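/- Let $\mathfrak g$ be a finite-dimensional complex reductive Lie algebra, $\mathfrak h\subseteq\mathfrak g$ a maximal torus, $\Phi\subseteq\mathfrak h^*$ the set of roots, $\Delta$ a set of simple roots, $\Phi^+$ the positive roots, $\mathfrak n^{\pm}=\bigoplus_{\beta\in\Phi^+}\mathfrak g_{\pm\beta}$, and $W$ the Weyl group. For $n\ge 1$ let $\mathfrak g_n=\mathfrak g\otimes\mathbb C[t]/(t^{n+1})$, write $x_i=x\otimes t^i$, $\mathfrak n^+_n=\mathfrak n^+\otimes\mathbb C[t]/(t^{n+1})$, $\mathfrak h_n^{\ge1}=\bigoplus_{i=1}^n\mathfrak h\otimes t^i$, and $U=U(\mathfrak g_n)$. Identify $(\mathfrak h_n^{\ge 1})^*$ with $(\mathfrak h^*)^{\oplus n}$ by restriction to the summands, $\mu=(\mu_1,\dots,\mu_n)$, and let $W$ act on it diagonally. Let $\mathcal O(\mathfrak g_n)$ be the full subcategory of $U$-modules $M$ that are finitely generated, on which $\mathfrak h\otimes 1$ acts semisimply, and on which $\mathfrak h_n^{\ge1}\oplus\mathfrak n^+_n$ acts locally finitely. For $\mu\in(\mathfrak h_n^{\ge1})^*$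 the Jordan block $\mathcal O^{(\mu)}(\mathfrak g_n)$ is the full subcategory of those $M\in\mathcal O(\mathfrak g_n)$ such that for every $m\in M$ and $h\in\mathfrak h_n^{\ge 1}$ we have $(h-\mu(h))^km=0$ for all $k\gg0$. Let $\alpha\in\Delta$. Choose $e_\alpha\in\mathfrak g_\alpha$, $f_\alpha\in\mathfrak g_{-\alpha}$ such that $h_\alpha:=[e_\alpha,f_\alpha]$ satisfies $\alpha(h_\alpha)=2$, and write $f_{\alpha,i}=f_\alpha\otimes t^i$, $h_{\alpha,i}=h_\alpha\otimes t^i$. Let $U_\alpha$ be the localisation of $U$ at the multiplicative set generated by $f_{\alpha,0},\dots,f_{\alpha,n}$, let $V_\alpha\subseteq U_\alpha$ be the sub-bimodule spanned by the elements $f_{\alpha,0}^{i_0}\cdots f_{\alpha,n}^{i_n}v$ with $v\in U$, $i_0,\dots,i_n\in\mathbb Z$ and $i_j\ge0$ for at least one $j$, and let $S_\alpha=U_\alpha/V_\alpha$, a $U$-$U$-bimodule. Let $\phi_\alpha$ be any automorphism of $\mathfrak g$ that restricts to the reflection $x\mapsto x-\alpha(x)h_\alpha$ on $\mathfrak h$,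 extended to $\mathfrak g_n$ by $\phi_\alpha(x_i)=\phi_\alpha(x)_i$. For a $U$-module $M$ let $\phi_\alpha^{\pm1}(M)$ be $M$ with $u\in U$ acting as $\phi_\alpha^{\pm1}(u)$, and let $\mathcal H(M)$ be the sum of the $\mathfrak h\otimes1$-weight spaces of $M$. Define functors $$T_\alpha M=\phi_\alpha(S_\alpha\otimes_U M),\qquad G_\alpha M=\mathcal H\bigl(\operatorname{Hom}_U(S_\alpha,\phi_\alpha^{-1}(M))\bigr),$$ where $U$ acts on $\operatorname{Hom}_U$ by $(u\cdot f)(s)=f(s\cdot u)$. (1) If $\mu\in(\mathfrak h_n^{\ge1})^*$ satisfies $\mu(h_{\alpha,n})\neq0$, then $T_\alpha$ and $G_\alpha$ restrict to functors $T_\alpha:\mathcal O^{(\mu)}(\mathfrak g_n)\to\mathcal O^{(s_\alpha(\mu))}(\mathfrak g_n)$ and $G_\alpha:\mathcal O^{(s_\alpha(\mu))}(\mathfrak g_n)\to\mathcal O^{(\mu)}(\mathfrak g_n)$, and these form a quasi-inverse pair of equivalences. (2) Consequently every Jordan block is equivalent to one whose centraliser is a standard Levi subalgebra: for every $\mu\in(\mathfrak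 h_n^{\ge1})^*$ there is $w\in W$ such that $\mathcal O^{(\mu)}(\mathfrak g_n)$ is equivalent to $\mathcal O^{(w(\mu))}(\mathfrak g_n)$ and the coadjoint centraliser $\mathfrak g^{w(\mu_n)}$ is a standard Levi subalgebra. Here $w(\mu_n)\in\mathfrak h^*$ is extended to $\mathfrak g$ by zero on $\mathfrak n^\pm$, and a standard Levi subalgebra is one of the form $\mathfrak h\oplus\bigoplus_{\beta\in\Phi\cap\mathbb ZI}\mathfrak g_\beta$ with $I\subseteq\Delta$. -/

import Mathlib

open CategoryTheory
open scoped TensorProduct Polynomial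

universe u

namespace TwistingFunctors

/-! ### Tensor product and Hom over a noncommutative ring -/

section Bimodule

/-- The relations `(s · r) ⊗ m - s ⊗ (r · m)` defining `S ⊗_U M` as a quotient of `S ⊗_ℤ M`, for a
`U`-`U`-bimodule `S` (the right action being encoded as an action of `Uᵐᵒᵖ`). -/
def tensorRel (U : Type u) [Ring U] (S : Type u) [AddCommGroup S] [Module U S] [Module Uᵐᵒᵖ S]
    (M : Type u) [AddCommGroup M] [Module U M] : Submodule U (S ⊗[ℤ] M) :=
  Submodule.span U {x | ∃ (s : S) (r : U) (m : M),
    x = (MulOpposite.op r • s) ⊗ₜ[ℤ] m - s ⊗ₜ[ℤ] (r • m)}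

/-- `S ⊗_U M`, a left `U`-module through the left action on `S`. -/
abbrev TensorOver (U : Type u) [Ring U] (S : Type u) [AddCommGroup S] [Module U S] [Module Uᵐᵒᵖ S]
    (M : Type u) [AddCommGroup M] [Module U M] : Type u :=
  (S ⊗[ℤ] M) ⧸ tensorRel U S M

variable (U : Type u) [Ring U] (S : Type u) [AddCommGroup S] [Module U S] [Module Uᵐᵒᵖ S]
  {M N : Type u} [AddCommGroup M] [Module U M] [AddCommGroup N] [Module U N]

theorem tensorRel_le_comap (f : M →ₗ[U] N) :
    tensorRel U S M ≤ (tensorRel U S N).comap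
      (TensorProduct.AlgebraTensorModule.lTensor U S (f.restrictScalars ℤ)) := by
  refine Submodule.span_le.2 ?_
  rintro _ ⟨s, r, m, rfl⟩
  refine Submodule.subset_span ⟨s, r, f m, ?_⟩
  simp

/-- `s ⊗ m ↦ s ⊗ f m`. -/
def tensorMap (f : M →ₗ[U] N) : TensorOver U S M →ₗ[U] TensorOver U S N :=
  Submodule.mapQ _ _ (TensorProduct.AlgebraTensorModule.lTensor U S (f.restrictScalars ℤ))
    (tensorRel_le_comap U S f)

/-- The functor `S ⊗_U -` on left `U`-modules. -/
def tensorFunctor : ModuleCat.{u} U ⥤ ModuleCat.{u} U where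
  obj M := ModuleCat.of U (TensorOver U S M)
  map f := ModuleCat.ofHom (tensorMap U S f.hom)
  map_id M := by
    refine ModuleCat.hom_ext (LinearMap.ext fun x => ?_)
    obtain ⟨y, rfl⟩ := Submodule.Quotient.mk_surjective _ x
    induction y with
    | zero => simp
    | add a b ha hb => simp_all
    | tmul s m => rfl
  map_comp f g := by
    refine ModuleCat.hom_ext (LinearMap.ext fun x => ?_)
    obtain ⟨y, rfl⟩ := Submodule.Quotient.mk_surjective _ x
    induction y with
    | zero => simp
    | add a b ha hb => simp_all
    | tmul s m => rfl

end Bimodule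

section Hom

variable (U : Type u) [Ring U] (S : Type u) [AddCommGroup S] [Module U S] [Module Uᵐᵒᵖ S]
  [SMulCommClass U Uᵐᵒᵖ S]

/-- Right multiplication by `r` on a bimodule, as a map of left modules. -/
def rightMul (r : U) : S →ₗ[U] S where
  toFun s := MulOpposite.op r • s
  map_add' := smul_add _
  map_smul' c s := (smul_comm c (MulOpposite.op r) s).symm

variable (M : Type u) [AddCommGroup M] [Module U M]

/-- `Hom_U(S, M)`, with the left `U`-action `(r • f) s = f (s · r)` below. -/
def HomOver : Type u := S →ₗ[U] M

instance : AddCommGroup (HomOver U S M) := inferInstanceAs (AddCommGroup (S →ₗ[U] M))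

variable {U S M} in
/-- An element of `Hom_U(S, M)` as a linear map. -/
def HomOver.toLin (f : HomOver U S M) : S →ₗ[U] M := f

instance : Module U (HomOver U S M) where
  smul r f := (f.toLin.comp (rightMul U S r) : S →ₗ[U] M)
  one_smul f := LinearMap.ext fun s => congrArg f.toLin
    (show MulOpposite.op (1 : U) • s = s by simp)
  mul_smul r r' f := LinearMap.ext fun s => congrArg f.toLin
    (show MulOpposite.op (r * r') • s = MulOpposite.op r' • MulOpposite.op r • s by
      rw [MulOpposite.op_mul, mul_smul])
  smul_zero _ := rfl
  smul_add _ _ _ := rfl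
  add_smul r r' f := LinearMap.ext fun s =>
    (congrArg f.toLin (show MulOpposite.op (r + r') • s
      = MulOpposite.op r • s + MulOpposite.op r' • s by rw [MulOpposite.op_add, add_smul])).trans
      (map_add f.toLin _ _)
  zero_smul f := LinearMap.ext fun s =>
    (congrArg f.toLin (show MulOpposite.op (0 : U) • s = 0 by simp)).trans (map_zero f.toLin)

/-- Postcomposition with `χ`. -/
def homMap {M N : Type u} [AddCommGroup M] [Module U M] [AddCommGroup N] [Module U N]
    (χ : M →ₗ[U] N) : HomOver U S M →ₗ[U] HomOver U S N where
  toFun f := χ.comp f.toLin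
  map_add' f f' := LinearMap.comp_add f.toLin f'.toLin χ
  map_smul' _ _ := LinearMap.ext fun _ => rfl

/-- The functor `Hom_U(S, -)` on left `U`-modules. -/
def homFunctor : ModuleCat.{u} U ⥤ ModuleCat.{u} U where
  obj M := ModuleCat.of U (HomOver U S M)
  map χ := ModuleCat.ofHom (homMap U S χ.hom)
  map_id _ := rfl
  map_comp _ _ := by
    ext f
    rfl

end Hom

/-! ### Adjoining inverses of finitely many elements of a ring -/

section Localization

variable {U : Type u} [Ring U] [Algebra ℂ U] {k : ℕ}

/-- The relations of the `U`-algebra generated by symbols `s i⁻¹`, subject to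
`s i * s i⁻¹ = 1 = s i⁻¹ * s i`: the elements of `U` are the generators `Sum.inl u`, and the symbols
`s i⁻¹` are the generators `Sum.inr i`. -/
inductive LocRel (s : Fin k → U) :
    FreeAlgebra ℂ (U ⊕ Fin k) → FreeAlgebra ℂ (U ⊕ Fin k) → Prop
  | add (x y : U) : LocRel s (FreeAlgebra.ι ℂ (Sum.inl (x + y)))
      (FreeAlgebra.ι ℂ (Sum.inl x) + FreeAlgebra.ι ℂ (Sum.inl y))
  | mul (x y : U) : LocRel s (FreeAlgebra.ι ℂ (Sum.inl (x * y)))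
      (FreeAlgebra.ι ℂ (Sum.inl x) * FreeAlgebra.ι ℂ (Sum.inl y))
  | scalar (c : ℂ) : LocRel s (FreeAlgebra.ι ℂ (Sum.inl (algebraMap ℂ U c)))
      (algebraMap ℂ (FreeAlgebra ℂ (U ⊕ Fin k)) c)
  | mul_inv (i : Fin k) : LocRel s
      (FreeAlgebra.ι ℂ (Sum.inl (s i)) * FreeAlgebra.ι ℂ (Sum.inr i)) 1
  | inv_mul (i : Fin k) : LocRel s
      (FreeAlgebra.ι ℂ (Sum.inr i) * FreeAlgebra.ι ℂ (Sum.inl (s i))) 1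

/-- The algebra `U[s i⁻¹ : i]`. -/
abbrev Loc (s : Fin k → U) : Type u := RingQuot (LocRel s)

/-- The canonical map `U → U[s i⁻¹ : i]`. -/
def toLoc (s : Fin k → U) : U →ₐ[ℂ] Loc s where
  toFun x := RingQuot.mkAlgHom ℂ (LocRel s) (FreeAlgebra.ι ℂ (Sum.inl x))
  map_one' := by
    have h := RingQuot.mkAlgHom_rel ℂ (LocRel.scalar (s := s) 1)
    simpa using h
  map_mul' x y := by rw [RingQuot.mkAlgHom_rel ℂ (LocRel.mul x y), map_mul]
  map_zero' := by
    have h := RingQuot.mkAlgHom_rel ℂ (LocRel.scalar (s := s) 0)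
    simpa using h
  map_add' x y := by rw [RingQuot.mkAlgHom_rel ℂ (LocRel.add x y), map_add]
  commutes' c := by
    rw [RingQuot.mkAlgHom_rel ℂ (LocRel.scalar (s := s) c), AlgHom.commutes]

/-- `s i` as a unit of `U[s i⁻¹ : i]`. -/
def locUnit (s : Fin k → U) (i : Fin k) : (Loc s)ˣ where
  val := toLoc s (s i)
  inv := RingQuot.mkAlgHom ℂ (LocRel s) (FreeAlgebra.ι ℂ (Sum.inr i))
  val_inv := by
    have h := RingQuot.mkAlgHom_rel ℂ (LocRel.mul_inv (s := s) i)
    rw [map_mul, map_one] at h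
    exact h
  inv_val := by
    have h := RingQuot.mkAlgHom_rel ℂ (LocRel.inv_mul (s := s) i)
    rw [map_mul, map_one] at h
    exact h

/-- The Laurent monomial `s 0 ^ (a 0) * s 1 ^ (a 1) * ⋯` in `U[s i⁻¹ : i]`. -/
def locMonomial (s : Fin k → U) (a : Fin k → ℤ) : Loc s :=
  (((List.finRange k).map fun i => locUnit s i ^ a i).prod : (Loc s)ˣ)

/-- The span of the elements `s 0 ^ (a 0) * s 1 ^ (a 1) * ⋯ * v` with `v ∈ U` and at least one
exponent `a j ≥ 0`. -/
def nonnegSpan (s : Fin k → U) : Submodule ℂ (Loc s) :=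
  Submodule.span ℂ {x | ∃ (a : Fin k → ℤ) (v : U), (∃ j, 0 ≤ a j) ∧
    x = locMonomial s a * toLoc s v}

/-- Every element of `X` is killed by a power of `ad s`. -/
def AdNilpotentOn (s : U) (X : Set U) : Prop :=
  ∀ x ∈ X, ∃ m : ℕ, (fun y : U => s * y - y * s)^[m] x = 0

theorem pow_mul_of_adNilpotent {R : Type u} [Ring R] (s : R) (m : ℕ) :
    ∀ (l : ℕ) (x : R), (fun y : R => s * y - y * s)^[m] x = 0 →
      ∃ y : R, s ^ (l + m) * x = y * s ^ l := by
  induction m with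
  | zero => intro l x hx; exact ⟨0, by simp_all⟩
  | succ m ih =>
    intro l
    induction l with
    | zero => intro x _; exact ⟨s ^ (0 + (m + 1)) * x, by simp⟩
    | succ l ihl =>
      intro x hx
      obtain ⟨y, hy⟩ := ihl x hx
      obtain ⟨z, hz⟩ := ih (l + 1) (s * x - x * s) (by simpa using hx)
      refine ⟨y + z, ?_⟩
      have h1 : s ^ (l + 1 + (m + 1)) * x
          = s ^ (l + (m + 1)) * x * s + s ^ (l + 1 + m) * (s * x - x * s) := by
        rw [show l + 1 + (m + 1) = (l + 1 + m) + 1 by ring,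
          show l + (m + 1) = l + 1 + m by ring, pow_succ]
        noncomm_ring
      rw [h1, hy, hz, pow_succ]
      noncomm_ring

/-- The left Ore condition for the powers of an element that is ad-nilpotent on generators. -/
theorem ore_of_adNilpotentOn (s : U) (X : Set U) (hX : Algebra.adjoin ℂ X = ⊤)
    (h : AdNilpotentOn s X) (x : U) : ∀ l : ℕ, ∃ (m : ℕ) (y : U), s ^ m * x = y * s ^ l := by
  have hx : x ∈ Algebra.adjoin ℂ X := hX ▸ Algebra.mem_top
  induction hx using Algebra.adjoin_induction with
  | mem x hx =>
    intro l
    obtain ⟨m, hm⟩ := h x hx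
    obtain ⟨y, hy⟩ := pow_mul_of_adNilpotent s m l x hm
    exact ⟨l + m, y, hy⟩
  | algebraMap c => exact fun l => ⟨l, algebraMap ℂ U c, (Algebra.commutes c _).symm⟩
  | add x y _ _ hx hy =>
    intro l
    obtain ⟨m, x', hx⟩ := hx l
    obtain ⟨m', y', hy⟩ := hy l
    refine ⟨m + m', s ^ m' * x' + s ^ m * y', ?_⟩
    rw [mul_add, add_mul, mul_assoc, mul_assoc, ← hx, ← hy, ← mul_assoc, ← mul_assoc, ← pow_add,
      ← pow_add, add_comm m' m]
  | mul x y _ _ hx hy =>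
    intro l
    obtain ⟨m, y', hy⟩ := hy l
    obtain ⟨m', x', hx⟩ := hx m
    exact ⟨m', x' * y', by rw [← mul_assoc, hx, mul_assoc, hy, mul_assoc]⟩

theorem toLoc_mul_locUnit_zpow (s : Fin k → U)
    (hs : ∀ i x (l : ℕ), ∃ (m : ℕ) (y : U), s i ^ m * x = y * s i ^ l) (i : Fin k) (x : U) (a : ℤ) :
    ∃ (b : ℤ) (y : U), (0 ≤ a → 0 ≤ b) ∧
      toLoc s x * ((locUnit s i ^ a : (Loc s)ˣ) : Loc s)
        = ((locUnit s i ^ b : (Loc s)ˣ) : Loc s) * toLoc s y := by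
  obtain ⟨l, rfl | rfl⟩ := a.eq_nat_or_neg
  · refine ⟨0, x * s i ^ l, fun _ => le_rfl, ?_⟩
    simp [locUnit]
  · obtain ⟨m, y, hy⟩ := hs i x l
    by_cases hl : l = 0
    · subst hl
      exact ⟨0, x, by simp, by simp⟩
    refine ⟨-m, y, fun h => by omega, ?_⟩
    rw [zpow_neg, zpow_neg, zpow_natCast, zpow_natCast, Units.eq_inv_mul_iff_mul_eq, ← mul_assoc,
      Units.mul_inv_eq_iff_eq_mul]
    have := congrArg (toLoc s) hy
    simpa [locUnit] using this

theorem toLoc_mul_list_prod (s : Fin k → U)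
    (hs : ∀ i x (l : ℕ), ∃ (m : ℕ) (y : U), s i ^ m * x = y * s i ^ l) (a : Fin k → ℤ)
    (L : List (Fin k)) (hL : L.Nodup) : ∀ x : U,
    ∃ (b : Fin k → ℤ) (y : U), (∀ j, 0 ≤ a j → 0 ≤ b j) ∧
      toLoc s x * (((L.map fun i => locUnit s i ^ a i).prod : (Loc s)ˣ) : Loc s)
        = (((L.map fun i => locUnit s i ^ b i).prod : (Loc s)ˣ) : Loc s) * toLoc s y := by
  induction L with
  | nil => exact fun x => ⟨a, x, fun _ h => h, by simp⟩
  | cons i L ih =>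
    intro x
    rw [List.nodup_cons] at hL
    obtain ⟨c, y, hc, hy⟩ := toLoc_mul_locUnit_zpow s hs i x (a i)
    obtain ⟨b, z, hb, hz⟩ := ih hL.2 y
    refine ⟨Function.update b i c, z, fun j hj => ?_, ?_⟩
    · by_cases hji : j = i
      · subst hji; simpa using hc hj
      · simpa [hji] using hb j hj
    · have hcongr : (L.map fun j => locUnit s j ^ Function.update b i c j)
          = L.map fun j => locUnit s j ^ b j := by
        refine List.map_congr_left fun j hj => ?_
        have : j ≠ i := fun h => hL.1 (h ▸ hj)
        simp [this]
      rw [List.map_cons, List.map_cons, List.prod_cons, List.prod_cons, hcongr, Units.val_mul,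
        Units.val_mul, ← mul_assoc, hy, mul_assoc, hz, mul_assoc, Function.update_self]

theorem toLoc_mul_mem_nonnegSpan (s : Fin k → U)
    (hs : ∀ i x (l : ℕ), ∃ (m : ℕ) (y : U), s i ^ m * x = y * s i ^ l) (x : U) {v : Loc s}
    (hv : v ∈ nonnegSpan s) : toLoc s x * v ∈ nonnegSpan s := by
  induction hv using Submodule.span_induction with
  | mem v hv =>
    obtain ⟨a, w, ⟨j, hj⟩, rfl⟩ := hv
    obtain ⟨b, y, hb, hy⟩ := toLoc_mul_list_prod s hs a _ (List.nodup_finRange k) x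
    refine Submodule.subset_span ⟨b, y * w, ⟨j, hb j hj⟩, ?_⟩
    rw [← mul_assoc, locMonomial, hy, map_mul, ← mul_assoc, locMonomial]
  | zero => simp
  | add v w _ _ hv hw => rw [mul_add]; exact add_mem hv hw
  | smul c v _ hv => rw [mul_smul_comm]; exact Submodule.smul_mem _ c hv

theorem mul_toLoc_mem_nonnegSpan (s : Fin k → U) (x : U) {v : Loc s}
    (hv : v ∈ nonnegSpan s) : v * toLoc s x ∈ nonnegSpan s := by
  induction hv using Submodule.span_induction with
  | mem v hv =>
    obtain ⟨a, w, hj, rfl⟩ := hv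
    exact Submodule.subset_span ⟨a, w * x, hj, by rw [map_mul, mul_assoc]⟩
  | zero => simp
  | add v w _ _ hv hw => rw [add_mul]; exact add_mem hv hw
  | smul c v _ hv => rw [smul_mul_assoc]; exact Submodule.smul_mem _ c hv

end Localization

section Quotient

/-- A finite family of elements of `U` the powers of each of which satisfy the left Ore condition.
The condition makes `nonnegSpan s` stable under left multiplication by `U`. -/
structure OreFamily (U : Type u) [Ring U] (k : ℕ) where
  /-- The elements of the family. -/
  s : Fin k → U
  /-- The Ore condition. -/
  ore : ∀ i x (l : ℕ), ∃ (m : ℕ) (y : U), s i ^ m * x = y * s i ^ l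

variable {U : Type u} [Ring U] [Algebra ℂ U] {k : ℕ} (F : OreFamily U k)

/-- The `U`-`U`-bimodule `U[s i⁻¹ : i] / nonnegSpan s`. -/
def LocQuot : Type u := Loc F.s ⧸ nonnegSpan F.s

instance : AddCommGroup (LocQuot F) := inferInstanceAs (AddCommGroup (Loc F.s ⧸ nonnegSpan F.s))

/-- The class of an element of `U[s i⁻¹ : i]`. -/
def LocQuot.mk (v : Loc F.s) : LocQuot F := (Submodule.Quotient.mk v : Loc F.s ⧸ nonnegSpan F.s)

theorem LocQuot.mk_surjective : Function.Surjective (LocQuot.mk F) :=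
  Submodule.Quotient.mk_surjective _

theorem LocQuot.mk_add (v w : Loc F.s) : mk F (v + w) = mk F v + mk F w := rfl

theorem LocQuot.mk_zero : mk F 0 = 0 := rfl

/-- The left action `x • [v] = [x * v]`. -/
instance : SMul U (LocQuot F) where
  smul x v := (Submodule.mapQ (nonnegSpan F.s) (nonnegSpan F.s)
    (LinearMap.mulLeft ℂ (toLoc F.s x)) fun _ hv => toLoc_mul_mem_nonnegSpan F.s F.ore x hv :
      (Loc F.s ⧸ nonnegSpan F.s) →ₗ[ℂ] (Loc F.s ⧸ nonnegSpan F.s)) v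

/-- The right action `[v] • x = [v * x]`. -/
instance : SMul Uᵐᵒᵖ (LocQuot F) where
  smul x v := (Submodule.mapQ (nonnegSpan F.s) (nonnegSpan F.s)
    (LinearMap.mulRight ℂ (toLoc F.s x.unop)) fun _ hv => mul_toLoc_mem_nonnegSpan F.s x.unop hv :
      (Loc F.s ⧸ nonnegSpan F.s) →ₗ[ℂ] (Loc F.s ⧸ nonnegSpan F.s)) v

theorem LocQuot.smul_mk (x : U) (v : Loc F.s) : x • mk F v = mk F (toLoc F.s x * v) := rfl

theorem LocQuot.op_smul_mk (x : Uᵐᵒᵖ) (v : Loc F.s) :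
    x • mk F v = mk F (v * toLoc F.s x.unop) := rfl

instance : Module U (LocQuot F) where
  one_smul v := by
    obtain ⟨v, rfl⟩ := LocQuot.mk_surjective F v
    simp [LocQuot.smul_mk]
  mul_smul x y v := by
    obtain ⟨v, rfl⟩ := LocQuot.mk_surjective F v
    simp [LocQuot.smul_mk, mul_assoc]
  smul_zero x := by rw [← LocQuot.mk_zero, LocQuot.smul_mk, mul_zero]
  smul_add x v w := by
    obtain ⟨v, rfl⟩ := LocQuot.mk_surjective F v
    obtain ⟨w, rfl⟩ := LocQuot.mk_surjective F w
    simp [LocQuot.smul_mk, ← LocQuot.mk_add, mul_add]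
  add_smul x y v := by
    obtain ⟨v, rfl⟩ := LocQuot.mk_surjective F v
    simp [LocQuot.smul_mk, ← LocQuot.mk_add, add_mul]
  zero_smul v := by
    obtain ⟨v, rfl⟩ := LocQuot.mk_surjective F v
    simp [LocQuot.smul_mk, LocQuot.mk_zero]

instance : Module Uᵐᵒᵖ (LocQuot F) where
  one_smul v := by
    obtain ⟨v, rfl⟩ := LocQuot.mk_surjective F v
    simp [LocQuot.op_smul_mk]
  mul_smul x y v := by
    obtain ⟨v, rfl⟩ := LocQuot.mk_surjective F v
    simp [LocQuot.op_smul_mk, mul_assoc]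
  smul_zero x := by rw [← LocQuot.mk_zero, LocQuot.op_smul_mk, zero_mul]
  smul_add x v w := by
    obtain ⟨v, rfl⟩ := LocQuot.mk_surjective F v
    obtain ⟨w, rfl⟩ := LocQuot.mk_surjective F w
    simp [LocQuot.op_smul_mk, ← LocQuot.mk_add, add_mul]
  add_smul x y v := by
    obtain ⟨v, rfl⟩ := LocQuot.mk_surjective F v
    simp [LocQuot.op_smul_mk, ← LocQuot.mk_add, mul_add]
  zero_smul v := by
    obtain ⟨v, rfl⟩ := LocQuot.mk_surjective F v
    simp [LocQuot.op_smul_mk, LocQuot.mk_zero]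

instance : SMulCommClass U Uᵐᵒᵖ (LocQuot F) where
  smul_comm x y v := by
    obtain ⟨v, rfl⟩ := LocQuot.mk_surjective F v
    simp [LocQuot.smul_mk, LocQuot.op_smul_mk, mul_assoc]

end Quotient

/-! ### Truncated current Lie algebras -/

section Current

/-- `ℂ[t]/(t^(n+1))`. -/
abbrev TruncPoly (n : ℕ) : Type := ℂ[X] ⧸ Ideal.span {(Polynomial.X : ℂ[X]) ^ (n + 1)}

/-- The class of `t ^ i` in `ℂ[t]/(t^(n+1))`. -/
noncomputable def tPow (n i : ℕ) : TruncPoly n := Ideal.Quotient.mk _ (Polynomial.X ^ i)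

variable (n : ℕ) (g : Type u) [LieRing g] [LieAlgebra ℂ g]

/-- The truncated current algebra `g_n = ℂ[t]/(t^(n+1)) ⊗ g`, with the bracket
`⁅a ⊗ x, b ⊗ y⁆ = (a * b) ⊗ ⁅x, y⁆`. -/
abbrev Current : Type u := TruncPoly n ⊗[ℂ] g

/-- The enveloping algebra `U(g_n)`. -/
abbrev Env : Type u := UniversalEnvelopingAlgebra ℂ (Current n g)

attribute [local instance] LieRing.ofAssociativeRing

variable {g}

/-- The element `x_i = x ⊗ t^i` of `U(g_n)`. -/
noncomputable def cur (i : ℕ) (x : g) : Env n g := UniversalEnvelopingAlgebra.ι ℂ (tPow n i ⊗ₜ[ℂ] x)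

/-- The endomorphism of `U(g_n)` with `x_i ↦ (φ x)_i`. -/
noncomputable def envMap (φ : g →ₗ⁅ℂ⁆ g) : Env n g →ₐ[ℂ] Env n g :=
  UniversalEnvelopingAlgebra.lift ℂ
    ((UniversalEnvelopingAlgebra.ι ℂ).comp
      (LieAlgebra.ExtendScalars.map (AlgHom.id ℂ (TruncPoly n)) φ))

/-- The module `M` with the action of `U(g_n)` twisted by `φ`: `u` acts as `φ u`. -/
noncomputable def twistFunctor (φ : g →ₗ⁅ℂ⁆ g) : ModuleCat.{u} (Env n g) ⥤ ModuleCat.{u} (Env n g) :=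
  ModuleCat.restrictScalars (envMap n φ).toRingHom

theorem adjoin_range_ι (L : Type u) [LieRing L] [LieAlgebra ℂ L] :
    Algebra.adjoin ℂ (Set.range (UniversalEnvelopingAlgebra.ι ℂ : L →ₗ⁅ℂ⁆ _)) = ⊤ := by
  set A := Algebra.adjoin ℂ (Set.range (UniversalEnvelopingAlgebra.ι ℂ : L →ₗ⁅ℂ⁆ _)) with hA
  let j : L →ₗ⁅ℂ⁆ A :=
    { toFun := fun x => ⟨UniversalEnvelopingAlgebra.ι ℂ x, Algebra.subset_adjoin ⟨x, rfl⟩⟩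
      map_add' := fun x y => Subtype.ext (map_add _ x y)
      map_smul' := fun c x => Subtype.ext (map_smul _ c x)
      map_lie' := fun {x y} => Subtype.ext (LieHom.map_lie _ x y) }
  have h : A.val.comp (UniversalEnvelopingAlgebra.lift ℂ j) = AlgHom.id ℂ _ := by
    refine UniversalEnvelopingAlgebra.hom_ext ℂ (LieHom.ext fun x => ?_)
    show A.val (UniversalEnvelopingAlgebra.lift ℂ j (UniversalEnvelopingAlgebra.ι ℂ x)) = _
    rw [UniversalEnvelopingAlgebra.lift_ι_apply]
    rfl
  refine eq_top_iff.2 fun x _ => ?_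
  have := congrArg (fun f => f x) h
  have hx : ((UniversalEnvelopingAlgebra.lift ℂ j x : A) : _) = x := this
  exact hx ▸ (UniversalEnvelopingAlgebra.lift ℂ j x).2

theorem ore_cur [FiniteDimensional ℂ g] (i : ℕ) {f : g} (hf : IsNilpotent (LieAlgebra.ad ℂ g f))
    (x : Env n g) (l : ℕ) : ∃ (m : ℕ) (y : Env n g), cur n i f ^ m * x = y * cur n i f ^ l := by
  refine ore_of_adNilpotentOn _ _ (adjoin_range_ι (Current n g)) ?_ x l
  obtain ⟨m, hm⟩ := hf
  have key : ∀ (m : ℕ) (y : Current n g),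
      (fun z : Env n g => cur n i f * z - z * cur n i f)^[m] (UniversalEnvelopingAlgebra.ι ℂ y)
        = UniversalEnvelopingAlgebra.ι ℂ
          (TensorProduct.map (LinearMap.mulLeft ℂ (tPow n i) ^ m) (LieAlgebra.ad ℂ g f ^ m) y) := by
    intro m
    induction m with
    | zero => intro y; simp [Module.End.one_eq_id]
    | succ m ih =>
      intro y
      have h1 : cur n i f * UniversalEnvelopingAlgebra.ι ℂ y
          - UniversalEnvelopingAlgebra.ι ℂ y * cur n i f
          = UniversalEnvelopingAlgebra.ι ℂ
            (TensorProduct.map (LinearMap.mulLeft ℂ (tPow n i)) (LieAlgebra.ad ℂ g f) y) := by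
        rw [cur, ← LieRing.of_associative_ring_bracket, ← LieHom.map_lie]
        congr 1
        induction y using TensorProduct.induction_on with
        | zero => simp
        | add a b ha hb => rw [lie_add, ha, hb, map_add]
        | tmul a z => simp
      rw [Function.iterate_succ_apply, h1, ih, ← LinearMap.comp_apply, ← TensorProduct.map_comp]
      rfl
  rintro _ ⟨y, rfl⟩
  refine ⟨m, ?_⟩
  rw [key, hm]
  simp

end Current

/-! ### Root data of a reductive Lie algebra -/

section Roots

variable {g : Type u} [LieRing g] [LieAlgebra ℂ g]

/-- A maximal torus of a reductive Lie algebra: a subalgebra consisting of ad-semisimple elements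
which is its own centraliser (in particular it is abelian). -/
structure IsMaximalTorus (H : LieSubalgebra ℂ g) : Prop where
  semisimple : ∀ h ∈ H, (LieAlgebra.ad ℂ g h).IsSemisimple
  mem_iff : ∀ x : g, x ∈ H ↔ ∀ h ∈ H, ⁅h, x⁆ = 0

variable (H : LieSubalgebra ℂ g)

/-- The space of all `x` with `⁅h, x⁆ = β h • x` for all `h ∈ H`. -/
def rootSpace (β : Module.Dual ℂ H) : Submodule ℂ g :=
  (LieModule.weightSpace g (β : H → ℂ)).toSubmodule

theorem mem_rootSpace {β : Module.Dual ℂ H} {x : g} :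
    x ∈ rootSpace H β ↔ ∀ h : H, ⁅(h : g), x⁆ = β h • x :=
  LieModule.mem_weightSpace _ _

/-- The set `Φ` of roots. -/
def roots : Set (Module.Dual ℂ H) := {β | β ≠ 0 ∧ rootSpace H β ≠ ⊥}

/-- `Δ` is a set of simple roots. -/
structure IsSimpleSystem (Δ : Set (Module.Dual ℂ H)) : Prop where
  subset_roots : Δ ⊆ roots H
  linearIndependent : LinearIndepOn ℂ id Δ
  pos_or_neg : ∀ β ∈ roots H, β ∈ AddSubmonoid.closure Δ ∨ -β ∈ AddSubmonoid.closure Δ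

/-- The positive roots `Φ⁺ = Φ ∩ ∑ ℤ≥0 α`. -/
def posRoots (Δ : Set (Module.Dual ℂ H)) : Set (Module.Dual ℂ H) :=
  {β | β ∈ roots H ∧ β ∈ AddSubmonoid.closure Δ}

/-- `n⁺`, the sum of the positive root spaces. -/
def nPos (Δ : Set (Module.Dual ℂ H)) : Submodule ℂ g := ⨆ β ∈ posRoots H Δ, rootSpace H β

/-- A triple `(e, h, f)` attached to the root `α`: `e ∈ g_α`, `f ∈ g_{-α}`, `h = ⁅e, f⁆ ∈ H`
and `α h = 2`. -/
structure RootTriple (α : Module.Dual ℂ H) where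
  /-- The raising element. -/
  e : g
  /-- The lowering element. -/
  f : g
  /-- The coroot. -/
  h : H
  e_mem : e ∈ rootSpace H α
  f_mem : f ∈ rootSpace H (-α)
  lie_e_f : ⁅e, f⁆ = (h : g)
  apply_h : α h = 2

variable {H}

/-- The reflection `ν ↦ ν - ν(h_α) α` of `H*`. -/
def dualReflection {α : Module.Dual ℂ H} (τ : RootTriple H α) :
    Module.Dual ℂ H ≃ₗ[ℂ] Module.Dual ℂ H :=
  Module.reflection (x := α) (f := Module.Dual.eval ℂ H τ.h) τ.apply_h

variable (H) in
/-- The Weyl group, acting on `H*`. -/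
def weylGroup : Subgroup (Module.Dual ℂ H ≃ₗ[ℂ] Module.Dual ℂ H) :=
  Subgroup.closure {r | ∃ β ∈ roots H, ∃ τ : RootTriple H β, r = dualReflection τ}

/-- `φ` is an automorphism of `g` which preserves `H` and acts on it as the reflection
`x ↦ x - α(x) h_α`. These are the automorphisms `Ad(x)` with `x` a representative of `s_α` in the
normaliser of `H` in the adjoint group. -/
def IsReflectionLift {α : Module.Dual ℂ H} (τ : RootTriple H α) (φ : g ≃ₗ⁅ℂ⁆ g) : Prop :=
  ∀ x : H, φ (x : g) = (x : g) - α x • (τ.h : g)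

theorem RootTriple.isNilpotent_ad [FiniteDimensional ℂ g] {α : Module.Dual ℂ H}
    (τ : RootTriple H α) : IsNilpotent (LieAlgebra.ad ℂ g τ.f) := by
  set F := LieAlgebra.ad ℂ g τ.f
  set D := LieAlgebra.ad ℂ g (τ.h : g)
  have hc : D * F - F * D = (-2 : ℂ) • F := by
    have h := (mem_rootSpace H).1 τ.f_mem τ.h
    rw [LinearMap.neg_apply, τ.apply_h] at h
    refine LinearMap.ext fun z => ?_
    show ⁅(τ.h : g), ⁅τ.f, z⁆⁆ - ⁅τ.f, ⁅(τ.h : g), z⁆⁆ = (-2 : ℂ) • ⁅τ.f, z⁆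
    rw [leibniz_lie (τ.h : g) τ.f z, h, smul_lie, add_sub_cancel_right]
  let E : Module.End ℂ (Module.End ℂ g) := LinearMap.mulLeft ℂ D - LinearMap.mulRight ℂ D
  have hE : ∀ m : ℕ, E (F ^ m) = (-2 * m : ℂ) • F ^ m := by
    intro m
    induction m with
    | zero => simp [E]
    | succ m ih =>
      have ih' : D * F ^ m - F ^ m * D = (-2 * m : ℂ) • F ^ m := ih
      show D * F ^ (m + 1) - F ^ (m + 1) * D = _
      have : D * F ^ (m + 1) - F ^ (m + 1) * D
          = (D * F ^ m - F ^ m * D) * F + F ^ m * (D * F - F * D) := by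
        rw [pow_succ]; noncomm_ring
      rw [this, ih', hc, smul_mul_assoc, mul_smul_comm, ← pow_succ, ← add_smul]
      congr 1
      push_cast
      ring
  by_contra hn
  have hne : ∀ m : ℕ, F ^ m ≠ 0 := fun m hm => hn ⟨m, hm⟩
  have hinj : Function.Injective fun m : ℕ => (-2 * m : ℂ) := by
    intro a b hab
    simpa using hab
  have hli := Module.End.eigenvectors_linearIndependent' E (fun m : ℕ => (-2 * m : ℂ)) hinj
    (fun m => F ^ m) fun m => ⟨Module.End.mem_eigenspace_iff.2 (hE m), hne m⟩
  exact Set.infinite_univ (Set.finite_univ_iff.2 hli.finite)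

theorem IsMaximalTorus.lie_eq_zero (hH : IsMaximalTorus H) (x y : H) : ⁅(x : g), (y : g)⁆ = 0 :=
  (hH.mem_iff y).1 y.2 x x.2

theorem IsMaximalTorus.rootSpace_zero (hH : IsMaximalTorus H) :
    rootSpace H 0 = H.toSubmodule := by
  ext x
  rw [mem_rootSpace, LieSubalgebra.mem_toSubmodule, hH.mem_iff]
  simp

theorem IsMaximalTorus.commute_ad (hH : IsMaximalTorus H) (x y : H) :
    Commute (LieAlgebra.ad ℂ g (x : g)) (LieAlgebra.ad ℂ g (y : g)) := by
  refine LinearMap.ext fun z => ?_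
  show ⁅(x : g), ⁅(y : g), z⁆⁆ = ⁅(y : g), ⁅(x : g), z⁆⁆
  rw [leibniz_lie (x : g) (y : g) z, hH.lie_eq_zero, zero_lie, zero_add]

/-- The simultaneous eigenspaces of a maximal torus span `g`. -/
theorem IsMaximalTorus.iSup_rootSpace [FiniteDimensional ℂ g] (hH : IsMaximalTorus H) :
    ⨆ β : Module.Dual ℂ H, rootSpace H β = ⊤ := by
  have htop := Module.End.iSup_iInf_maxGenEigenspace_eq_top_of_iSup_maxGenEigenspace_eq_top_of_commute
    (fun x : H => LieAlgebra.ad ℂ g (x : g)) (fun x y _ => hH.commute_ad x y)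
    (fun x => Module.End.iSup_maxGenEigenspace_eq_top _)
  rw [eq_top_iff, ← htop]
  refine iSup_le fun χ => ?_
  have hχ : ∀ v ∈ ⨅ x : H, (LieAlgebra.ad ℂ g (x : g)).maxGenEigenspace (χ x),
      ∀ x : H, ⁅(x : g), v⁆ = χ x • v := by
    intro v hv x
    have := (Submodule.mem_iInf _).1 hv x
    rw [(hH.semisimple x x.2).isFinitelySemisimple.maxGenEigenspace_eq_eigenspace] at this
    exact Module.End.mem_eigenspace_iff.1 this
  intro v hv
  by_cases hv0 : v = 0
  · rw [hv0]; exact zero_mem _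
  let β : Module.Dual ℂ H :=
    { toFun := χ
      map_add' := fun x y => by
        have := hχ v hv (x + y)
        rw [show ((x + y : H) : g) = x + y from rfl, add_lie, hχ v hv x, hχ v hv y, ← add_smul] at this
        exact (smul_left_injective ℂ hv0 this).symm
      map_smul' := fun c x => by
        have := hχ v hv (c • x)
        rw [show ((c • x : H) : g) = c • (x : g) from rfl, smul_lie, hχ v hv x, smul_smul] at this
        exact (smul_left_injective ℂ hv0 this).symm }
  exact Submodule.mem_iSup_of_mem β ((mem_rootSpace H).2 (hχ v hv))

/-- `g = H ⊕ (n⁻ ⊕ n⁺)`. -/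
theorem IsMaximalTorus.isCompl [FiniteDimensional ℂ g] (hH : IsMaximalTorus H) :
    IsCompl H.toSubmodule (⨆ β ∈ roots H, rootSpace H β) := by
  have hle : ∀ β : Module.Dual ℂ H, β ≠ 0 → rootSpace H β ≤ ⨆ β ∈ roots H, rootSpace H β := by
    intro β hβ
    by_cases h : rootSpace H β = ⊥
    · rw [h]; exact bot_le
    · exact le_iSup₂_of_le β ⟨hβ, h⟩ le_rfl
  constructor
  · have hind := Module.End.independent_iInf_maxGenEigenspace_of_forall_mapsTo
      (fun x : H => LieAlgebra.ad ℂ g (x : g)) fun x y c =>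
        Module.End.mapsTo_maxGenEigenspace_of_comm (hH.commute_ad y x) c
    have hsub : ∀ β : Module.Dual ℂ H, rootSpace H β ≤
        ⨅ x : H, (LieAlgebra.ad ℂ g (x : g)).maxGenEigenspace (β x) := by
      intro β v hv
      refine (Submodule.mem_iInf _).2 fun x => ?_
      exact Module.End.mem_maxGenEigenspace _ _ _ |>.2 ⟨1, by
        have := (mem_rootSpace H).1 hv x
        simp [this]⟩
    have h0 := hind (fun _ => 0)
    refine h0.mono ?_ (iSup₂_le fun β hβ => ?_)
    · rw [← hH.rootSpace_zero]; exact hsub 0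
    · refine (hsub β).trans (le_iSup₂_of_le (fun x => β x) (fun h => hβ.1 ?_) le_rfl)
      exact LinearMap.ext fun x => congrFun h x
  · rw [codisjoint_iff, eq_top_iff, ← hH.iSup_rootSpace]
    refine iSup_le fun β => ?_
    by_cases hβ : β = 0
    · rw [hβ, hH.rootSpace_zero]; exact le_sup_left
    · exact (hle β hβ).trans le_sup_right

/-- The extension of `ν ∈ H*` to `g` which vanishes on all root spaces, that is, on `n⁻` and
`n⁺`. -/
noncomputable def extendByZero [FiniteDimensional ℂ g] (hH : IsMaximalTorus H)
    (ν : Module.Dual ℂ H) : Module.Dual ℂ g :=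
  ν.comp (Submodule.projectionOnto _ _ hH.isCompl)

/-- The coadjoint centraliser `g^ν` of `ν ∈ H*`, extended by zero to `g`. -/
noncomputable def coadjointCentralizer [FiniteDimensional ℂ g] (hH : IsMaximalTorus H)
    (ν : Module.Dual ℂ H) : Submodule ℂ g where
  carrier := {x | ∀ y : g, extendByZero hH ν ⁅x, y⁆ = 0}
  zero_mem' y := by simp
  add_mem' hx hy z := by rw [add_lie, map_add, hx z, hy z, add_zero]
  smul_mem' c x hx z := by rw [smul_lie, map_smul, hx z, smul_zero]

variable (H) in
/-- `l` is a standard Levi subalgebra, i.e. the Levi factor containing `H` of a standard parabolic: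
for some set `I` of simple roots, it is the sum of `H` and of the root spaces for the roots in the
span of `I`. -/
def IsStandardLevi (Δ : Set (Module.Dual ℂ H)) (l : Submodule ℂ g) : Prop :=
  ∃ I ⊆ Δ, l = H.toSubmodule ⊔ ⨆ β ∈ roots H ∩ {β | β ∈ AddSubgroup.closure I}, rootSpace H β

end Roots

/-! ### Category O and its Jordan blocks -/

section CategoryO

attribute [local instance] LieRing.ofAssociativeRing

open scoped ModuleCat

variable {g : Type u} [LieRing g] [LieAlgebra ℂ g] (H : LieSubalgebra ℂ g) (n : ℕ)

/-- The weight space of weight `ν ∈ H*` for `H ⊗ 1 ⊆ g_n`. -/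
noncomputable def weightSpace (M : ModuleCat.{u} (Env n g)) (ν : Module.Dual ℂ H) : Submodule ℂ M where
  carrier := {m | ∀ h : H, cur n 0 (h : g) • m = ν h • m}
  zero_mem' h := by simp
  add_mem' hx hy h := by rw [smul_add, smul_add, hx h, hy h]
  smul_mem' c x hx h := by rw [smul_comm, hx h, smul_comm]

/-- The sum of the weight spaces of `M`. -/
noncomputable def weightSum (M : ModuleCat.{u} (Env n g)) : Submodule ℂ M := ⨆ ν, weightSpace H n M ν

variable {H n} in
theorem smul_mem_weightSum [FiniteDimensional ℂ g] (hH : IsMaximalTorus H)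
    (M : ModuleCat.{u} (Env n g)) (r : Env n g) {m : M} (hm : m ∈ weightSum H n M) :
    r • m ∈ weightSum H n M := by
  have hr : r ∈ Algebra.adjoin ℂ (Set.range (UniversalEnvelopingAlgebra.ι ℂ : Current n g → _)) :=
    adjoin_range_ι (Current n g) ▸ Algebra.mem_top
  induction hr using Algebra.adjoin_induction generalizing m with
  | algebraMap c =>
    rw [algebraMap_smul]
    exact Submodule.smul_mem _ c hm
  | add r r' _ _ h h' => rw [add_smul]; exact add_mem (h hm) (h' hm)
  | mul r r' _ _ h h' => rw [mul_smul]; exact h (h' hm)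
  | mem r hr =>
    obtain ⟨y, rfl⟩ := hr
    induction y using TensorProduct.induction_on with
    | zero => simp
    | add a b ha hb => rw [map_add, add_smul]; exact add_mem ha hb
    | tmul a x =>
      have hx : x ∈ ⨆ β : Module.Dual ℂ H, rootSpace H β := hH.iSup_rootSpace ▸ Submodule.mem_top
      induction hx using Submodule.iSup_induction' with
      | zero => simp
      | add x y _ _ hx hy =>
        rw [TensorProduct.tmul_add, map_add, add_smul]; exact add_mem hx hy
      | mem β x hx =>
        induction hm using Submodule.iSup_induction' with
        | zero => simp
        | add v w _ _ hv hw => rw [smul_add]; exact add_mem hv hw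
        | mem ν v hv =>
          refine Submodule.mem_iSup_of_mem (ν + β) fun h => ?_
          have h1 : cur n 0 (h : g) * UniversalEnvelopingAlgebra.ι ℂ (a ⊗ₜ[ℂ] x)
              = UniversalEnvelopingAlgebra.ι ℂ (a ⊗ₜ[ℂ] x) * cur n 0 (h : g)
                + β h • UniversalEnvelopingAlgebra.ι ℂ (a ⊗ₜ[ℂ] x) := by
            rw [← sub_eq_iff_eq_add', cur, ← LieRing.of_associative_ring_bracket, ← LieHom.map_lie,
              LieAlgebra.ExtendScalars.bracket_tmul, (mem_rootSpace H).1 hx h]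
            simp [tPow]
          rw [← mul_smul, h1, add_smul, mul_smul, hv h, smul_assoc, smul_comm, ← add_smul]
          rfl

/-- The sum of the weight spaces of `M`, as a `g_n`-submodule. -/
noncomputable def weightSubmodule [FiniteDimensional ℂ g] (hH : IsMaximalTorus H)
    (M : ModuleCat.{u} (Env n g)) : Submodule (Env n g) M where
  carrier := {m | m ∈ weightSum H n M}
  zero_mem' := (weightSum H n M).zero_mem
  add_mem' h h' := (weightSum H n M).add_mem h h'
  smul_mem' r _ h := smul_mem_weightSum hH M r h

theorem map_mem_weightSum {M N : ModuleCat.{u} (Env n g)} (f : M ⟶ N) {m : M}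
    (hm : m ∈ weightSum H n M) : f.hom m ∈ weightSum H n N := by
  induction hm using Submodule.iSup_induction' with
  | zero => rw [map_zero]; exact zero_mem _
  | add v w _ _ hv hw => rw [map_add]; exact add_mem hv hw
  | mem ν v hv =>
    refine Submodule.mem_iSup_of_mem ν fun h => ?_
    have hv' : cur n 0 (h : g) • v = algebraMap ℂ (Env n g) (ν h) • v := hv h
    show cur n 0 (h : g) • f.hom v = algebraMap ℂ (Env n g) (ν h) • f.hom v
    rw [← map_smul, hv', map_smul]

/-- The functor `ℋ`, sending `M` to the sum of its weight spaces. -/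
noncomputable def weightFunctor [FiniteDimensional ℂ g] (hH : IsMaximalTorus H) :
    ModuleCat.{u} (Env n g) ⥤ ModuleCat.{u} (Env n g) where
  obj M := ModuleCat.of (Env n g) (weightSubmodule H n hH M)
  map {_ N} f := ModuleCat.ofHom
    (f.hom.restrict fun m hm =>
      show f.hom m ∈ weightSum H n N from map_mem_weightSum H n f hm)
  map_id _ := rfl
  map_comp _ _ := rfl

variable (Δ : Set (Module.Dual ℂ H))

/-- The subspace `h_n^{≥1} ⊕ n⁺_n` of `g_n`. -/
noncomputable def posPart : Submodule ℂ (Current n g) :=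
  Submodule.span ℂ ({y | ∃ i, 1 ≤ i ∧ ∃ x ∈ H, y = tPow n i ⊗ₜ[ℂ] x} ∪
    {y | ∃ i, ∃ x ∈ nPos H Δ, y = tPow n i ⊗ₜ[ℂ] x})

/-- Membership in category `O(g_n)`. -/
structure CategoryO (M : ModuleCat.{u} (Env n g)) : Prop where
  /-- `M` is finitely generated. -/
  finite : Module.Finite (Env n g) M
  /-- `H ⊗ 1` acts semisimply: `M` is the sum of its weight spaces. -/
  semisimple : weightSum H n M = ⊤
  /-- `h_n^{≥1} ⊕ n⁺_n` acts locally finitely. -/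
  locallyFinite : ∀ m : M, ∃ W : Submodule ℂ M, m ∈ W ∧ FiniteDimensional ℂ W ∧
    ∀ y ∈ posPart H n Δ, ∀ w ∈ W, UniversalEnvelopingAlgebra.ι ℂ y • w ∈ W

variable {n} in
/-- An element `μ` of `(h_n^{≥1})* = (H*)^n` is given by its components `μ i`, `i : Fin n`, where
`μ i` is the restriction of `μ` to `H ⊗ t^(i+1)`. This is the last component `μ_n`, the restriction
of `μ` to `H ⊗ t^n`. -/
def topComponent (hn : 1 ≤ n) (μ : Fin n → Module.Dual ℂ H) : Module.Dual ℂ H :=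
  μ ⟨n - 1, by omega⟩

/-- The element `∑ i, x_i ⊗ t^(i+1)` of `h_n^{≥1}`, viewed in `U(g_n)`. -/
noncomputable def torusElement (x : Fin n → H) : Env n g := ∑ i : Fin n, cur n (i + 1) (x i : g)

variable {n} in
/-- The Jordan block `O^(μ)(g_n)`: the modules in `O(g_n)` which coincide with their generalised
eigenspace of eigenvalue `μ` for `h_n^{≥1}`. -/
def jordanBlock (μ : Fin n → Module.Dual ℂ H) : ObjectProperty (ModuleCat.{u} (Env n g)) := fun M =>
  CategoryO H n Δ M ∧ ∀ (m : M) (x : Fin n → H), ∃ K : ℕ, ∀ k ≥ K,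
    (torusElement H n x - algebraMap ℂ (Env n g) (∑ i, μ i (x i))) ^ k • m = 0

end CategoryO

/-! ### The twisting functors -/

section Twisting

variable {g : Type u} [LieRing g] [LieAlgebra ℂ g] [FiniteDimensional ℂ g] {H : LieSubalgebra ℂ g}
  {α : Module.Dual ℂ H} (n : ℕ) (τ : RootTriple H α)

/-- The elements `f_{α,0}, …, f_{α,n}` of `U(g_n)`. -/
noncomputable def loweringFamily : OreFamily (Env n g) (n + 1) where
  s i := cur n i τ.f
  ore i := ore_cur n i τ.isNilpotent_ad

/-- The bimodule `S_α = U_α / V_α`. Here `U_α` is `U = U(g_n)` with inverses of the `f_{α,i}`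
adjoined. As `U` is spanned by the ordered monomials having their factors `f_{α,i}` on the left,
`V_α = nonnegSpan` is the span of the monomials
`f_{α,0} ^ (a 0) * ⋯ * f_{α,n} ^ (a n) * v`, `a ∈ ℤ^(n+1)`, such that some `a j ≥ 0`, where `v` runs
over the ordered monomials without a factor `f_{α,i}`. -/
abbrev twistBimodule : Type u := LocQuot (loweringFamily n τ)

/-- `T_α M = φ(S_α ⊗_U M)`. -/
noncomputable def twistT (φ : g ≃ₗ⁅ℂ⁆ g) : ModuleCat.{u} (Env n g) ⥤ ModuleCat.{u} (Env n g) :=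
  tensorFunctor (Env n g) (twistBimodule n τ) ⋙ twistFunctor n φ.toLieHom

/-- `G_α M = ℋ(Hom_U(S_α, φ⁻¹(M)))`. -/
noncomputable def twistG (hH : IsMaximalTorus H) (φ : g ≃ₗ⁅ℂ⁆ g) :
    ModuleCat.{u} (Env n g) ⥤ ModuleCat.{u} (Env n g) :=
  twistFunctor n φ.symm.toLieHom ⋙ homFunctor (Env n g) (twistBimodule n τ) ⋙ weightFunctor H n hH

end Twisting

/-- The functor between full subcategories given by the restriction of `F`. -/
def restrictFunctor {C D : Type*} [Category* C] [Category* D] (F : C ⥤ D) {P : ObjectProperty C}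
    {Q : ObjectProperty D} (h : ∀ M, P M → Q (F.obj M)) : P.FullSubcategory ⥤ Q.FullSubcategory :=
  Q.lift (P.ι ⋙ F) fun M => h M.obj M.property

end TwistingFunctors

open TwistingFunctors

set_option linter.unusedSectionVars false

namespace TwistingFunctors

/-! ### Monomials in commuting families -/

section Monomials

/-! Write S = S_α, f_i = f_{α,i}, e_i = e_{α,i}, h_n = h_{α,n} and c = μ(h_n) ≠ 0. Statement (1) is
a Kashiwara-type equivalence for the current algebra of the sl₂ of α.

On a module M in the block of μ the weights are bounded above, so each e_i is locally nilpotent; and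
h_n is invertible, being c plus a locally nilpotent operator. Since [e_{n-a}, f_a] = h_n for all a,
the formula e^{j+1} f = f e^{j+1} + (j+1) h e^j shows that f_0, …, f_n is a regular sequence on M in
every order, also after passing to powers (`mem_rangeSum_of_pow_smul`). Dually, each e_j is
surjective on the common kernel of powers of the other e_i (`exists_e_smul_eq`). The pair e_0, f_n
is exceptional: [h_n, e_0] = 2 e_n need not vanish, so there the argument runs on the kernel of e_n.

The module S ⊗ M behaves like a top local cohomology: by regularity, f^(-d) ⊗ x = 0 exactly when x
lies in ∑ f_j^{d_j} M (`tens_sig_eq_zero_iff`). Hence the kernel of M → Hom(S, S ⊗ M) lies in every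
∑ f_j^k M and vanishes because weights are bounded, and weight vectors of Hom(S, S ⊗ M) come from M
because their values stabilise (`Upper.exists_unit_eq`). Conversely, let P be a weight module on
which the f_i are locally nilpotent and h_n is invertible. Coregularity, with e and f exchanged,
lifts a weight vector repeatedly through f_0 ⋯ f_n, so that it becomes a value of a homogeneous
homomorphism S → P (`Lower.exists_hom`). This makes the counit surjective; its kernel vanishes by
the result on the unit (`counit_bijective`).

It remains to see that the functors respect the blocks. Finite generation is transported because
sending N to the image of S ⊗ N identifies the submodules of M with those of S ⊗ M. Commutators with
elements of h_n^{≥1} raise the indices of the f_j and are therefore nilpotent on each monomial class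
of S, which controls generalised eigenvalues. Local finiteness is replaced by boundedness of weights
(`jordanBlock_iff`). For this bound, a weight vector of S ⊗ M is pushed by the f_i to one killed by
all of them, of the form (f_0 ⋯ f_n)^(-1) ⊗ x with x outside ∑ f_j M. The weight of such an x
differs from one of finitely many weights by a sum of positive roots other than α, and s_α preserves
the cone of these sums. A similar argument bounds the weights of homomorphisms.

For (2), order ℂ lexicographically. If μ_n is negative on a simple coroot then (1) applies, and the
reflection lowers the number of positive coroots on which μ_n is negative. Once no simple coroot is
negative, the roots whose coroots are killed by μ_n are those in the span of the simple ones with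
this property, so the centraliser is a standard Levi subalgebra. -/

theorem list_prod_map_mul {ι M : Type*} [Monoid M] (u v : ι → M) (h : ∀ i j, Commute (u i) (v j))
    (L : List ι) : (L.map fun i => u i * v i).prod = (L.map u).prod * (L.map v).prod := by
  induction L with
  | nil => simp
  | cons i L ih =>
    have hc : Commute (L.map u).prod (v i) :=
      Commute.list_prod_left _ _ fun x hx => by
        obtain ⟨j, -, rfl⟩ := List.mem_map.1 hx
        exact h j i
    simp only [List.map_cons, List.prod_cons, ih]
    rw [mul_assoc, ← mul_assoc (v i), ← hc.eq]
    simp only [mul_assoc]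

theorem list_prod_map_single {ι M : Type*} [DecidableEq ι] [Monoid M] (i : ι) (x : M) (u : ι → M)
    (hi : u i = x) (hu : ∀ j, j ≠ i → u j = 1) (L : List ι) (hL : L.Nodup) (h : i ∈ L) :
    (L.map u).prod = x := by
  induction L with
  | nil => simp at h
  | cons j L ih =>
    rw [List.nodup_cons] at hL
    rw [List.map_cons, List.prod_cons]
    rcases eq_or_ne j i with rfl | hji
    · have : (L.map u).prod = 1 := List.prod_eq_one fun y hy => by
        obtain ⟨l, hl, rfl⟩ := List.mem_map.1 hy
        exact hu l fun h => hL.1 (h ▸ hl)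
      rw [this, hi, mul_one]
    · rw [hu j hji, one_mul]
      exact ih hL.2 ((List.mem_cons.1 h).resolve_left hji.symm)

variable {U : Type u} [Ring U] {k : ℕ} (s : Fin k → U)

/-- The monomial `s 0 ^ (c 0) * s 1 ^ (c 1) * ⋯`. -/
def sMon (c : Fin k → ℕ) : U := ((List.finRange k).map fun i => s i ^ c i).prod

variable {s} (hs : ∀ i j, Commute (s i) (s j))
include hs

theorem sMon_add (c d : Fin k → ℕ) : sMon s (c + d) = sMon s c * sMon s d := by
  simp only [sMon, Pi.add_apply, pow_add]
  exact list_prod_map_mul _ _ (fun i j => (hs i j).pow_pow _ _) _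

omit hs in
theorem sMon_single (i : Fin k) (c : ℕ) : sMon s (Pi.single i c) = s i ^ c :=
  list_prod_map_single i _ _ (by simp) (fun j hj => by simp [hj]) _ (List.nodup_finRange k)
    (List.mem_finRange i)

omit hs in
theorem sMon_zero : sMon s 0 = 1 := by
  simp [sMon]

theorem sMon_commute (c d : Fin k → ℕ) : Commute (sMon s c) (sMon s d) := by
  rw [Commute, SemiconjBy, ← sMon_add hs, ← sMon_add hs, add_comm]

theorem sMon_pow (c : Fin k → ℕ) (m : ℕ) : sMon s c ^ m = sMon s (m • c) := by
  induction m with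
  | zero => simp [sMon_zero]
  | succ m ih => rw [pow_succ, ih, ← sMon_add hs, succ_nsmul]

theorem sMon_mul_eq_of_le {c d : Fin k → ℕ} (h : c ≤ d) :
    sMon s (d - c) * sMon s c = sMon s d := by
  rw [← sMon_add hs, tsub_add_cancel_of_le h]

theorem sMon_eq_mul_pow {c : Fin k → ℕ} {i : Fin k} {m : ℕ} (h : m ≤ c i) :
    sMon s c = sMon s (c - Pi.single i m) * s i ^ m := by
  rw [← sMon_single i m, sMon_mul_eq_of_le hs]
  intro j
  rcases eq_or_ne j i with rfl | hj
  · simpa using h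
  · simp [hj]

theorem sMon_comm_pow (c : Fin k → ℕ) (i : Fin k) (m : ℕ) :
    s i ^ m * sMon s c = sMon s c * s i ^ m := by
  rw [← sMon_single i m, (sMon_commute hs _ _).eq]

end Monomials

/-! ### Ore conditions -/

section Ore

variable {U : Type u} [Ring U] [Algebra ℂ U] {k : ℕ}

/-- Mirror image of `pow_mul_of_adNilpotent`. Moving one s to the left costs the commutator [s, x],
whose nilpotency order is smaller; this gives a double induction on m and l. -/
theorem mul_pow_of_adNilpotent {R : Type u} [Ring R] (s : R) (m : ℕ) :
    ∀ (l : ℕ) (x : R), (fun y : R => s * y - y * s)^[m] x = 0 →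
      ∃ y : R, x * s ^ (l + m) = s ^ l * y := by
  induction m with
  | zero => intro l x hx; exact ⟨0, by simp_all⟩
  | succ m ih =>
    intro l
    induction l with
    | zero => intro x _; exact ⟨x * s ^ (0 + (m + 1)), by simp⟩
    | succ l ihl =>
      intro x hx
      obtain ⟨y, hy⟩ := ihl x hx
      obtain ⟨z, hz⟩ := ih (l + 1) (s * x - x * s) (by simpa using hx)
      refine ⟨y - z, ?_⟩
      have h1 : x * s ^ (l + 1 + (m + 1))
          = s * (x * s ^ (l + (m + 1))) - (s * x - x * s) * s ^ (l + 1 + m) := by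
        rw [show l + 1 + (m + 1) = (l + 1 + m) + 1 by ring,
          show l + (m + 1) = l + 1 + m by ring, pow_succ']
        noncomm_ring
      rw [h1, hy, hz, mul_sub, ← mul_assoc, ← pow_succ']

/-- Leibniz rule: in each term of the (a + b)-th derivative of xy, either x is differentiated at
least a times or y at least b times. -/
theorem adNilpotent_mul {R : Type u} [Ring R] (s : R) :
    ∀ (N a b : ℕ) (x y : R), a + b = N → (fun y : R => s * y - y * s)^[a] x = 0 →
      (fun y : R => s * y - y * s)^[b] y = 0 → (fun y : R => s * y - y * s)^[N] (x * y) = 0 := by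
  set D : R → R := fun y => s * y - y * s with hD
  have hadd : ∀ (m : ℕ) (x y : R), D^[m] (x + y) = D^[m] x + D^[m] y := by
    intro m
    induction m with
    | zero => simp
    | succ m ih =>
      intro x y
      have : D (x + y) = D x + D y := by simp only [hD]; noncomm_ring
      simp only [Function.iterate_succ_apply, this, ih]
  have hz : ∀ m : ℕ, D^[m] 0 = 0 := by
    intro m
    induction m with
    | zero => simp
    | succ m ih => rw [Function.iterate_succ_apply, show D 0 = 0 by simp [hD], ih]
  intro N
  induction N with
  | zero =>
    intro a b x y h hx _
    obtain rfl : a = 0 := by omega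
    have : x = 0 := hx
    simp [this]
  | succ N ih =>
    intro a b x y h hx hy
    have hxy : D (x * y) = D x * y + x * D y := by simp only [hD]; noncomm_ring
    rw [Function.iterate_succ_apply, hxy, hadd]
    rcases a with _ | a
    · have : x = 0 := hx
      simp [this, show D 0 = 0 by simp [hD], hz]
    rcases b with _ | b
    · have : y = 0 := hy
      simp [this, show D 0 = 0 by simp [hD], hz]
    rw [ih a (b + 1) (D x) y (by omega) hx hy, ih (a + 1) b x (D y) (by omega) hx hy, add_zero]

/-- The elements killed by a power of ad s form a subalgebra, so generators suffice. -/
theorem adNilpotentOn_univ (s : U) (X : Set U) (hX : Algebra.adjoin ℂ X = ⊤)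
    (h : AdNilpotentOn s X) : AdNilpotentOn s Set.univ := by
  rintro x -
  have hx : x ∈ Algebra.adjoin ℂ X := hX ▸ Algebra.mem_top
  set D : U →+ U := AddMonoidHom.mulLeft s - AddMonoidHom.mulRight s with hD
  have hDf : (fun y : U => s * y - y * s) = D := rfl
  rw [hDf]
  have hmono : ∀ (m l : ℕ) (x : U), m ≤ l → D^[m] x = 0 → D^[l] x = 0 := by
    intro m l x hml hx
    obtain ⟨d, rfl⟩ := Nat.exists_eq_add_of_le' hml
    rw [Function.iterate_add_apply, hx, iterate_map_zero]
  induction hx using Algebra.adjoin_induction with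
  | mem x hx => exact h x hx
  | algebraMap c => exact ⟨1, by simp [hD, Algebra.commutes c s]⟩
  | add x y _ _ hx hy =>
    obtain ⟨m, hm⟩ := hx
    obtain ⟨l, hl⟩ := hy
    exact ⟨max m l, by rw [iterate_map_add, hmono _ _ _ (le_max_left _ _) hm,
      hmono _ _ _ (le_max_right _ _) hl, add_zero]⟩
  | mul x y _ _ hx hy =>
    obtain ⟨m, hm⟩ := hx
    obtain ⟨l, hl⟩ := hy
    exact ⟨m + l, adNilpotent_mul s _ m l x y rfl hm hl⟩

/-- If r s = 0 then (ad s)^m r = s^m r, which vanishes for large m. Such transfers of torsion from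
one side to the other replace any appeal to U being a domain. -/
theorem pow_mul_eq_zero_of_mul_pow_eq_zero {U : Type u} [Ring U] {s : U} (h : AdNilpotentOn s Set.univ) :
    ∀ (l : ℕ) (r : U), r * s ^ l = 0 → ∃ m, s ^ m * r = 0 := by
  have h1 : ∀ r : U, r * s = 0 → ∃ m, s ^ m * r = 0 := by
    intro r hr
    have key : ∀ m, (fun y : U => s * y - y * s)^[m] r = s ^ m * r := by
      intro m
      induction m with
      | zero => simp
      | succ m ih =>
        rw [Function.iterate_succ_apply', ih, mul_assoc, hr, mul_zero, sub_zero, pow_succ',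
          mul_assoc]
    obtain ⟨m, hm⟩ := h r trivial
    exact ⟨m, by rw [← key, hm]⟩
  intro l
  induction l with
  | zero => intro r hr; exact ⟨0, by simpa using hr⟩
  | succ l ih =>
    intro r hr
    obtain ⟨m, hm⟩ := h1 (r * s ^ l) (by rw [mul_assoc, ← pow_succ, hr])
    obtain ⟨p, hp⟩ := ih (s ^ m * r) (by rw [mul_assoc, hm])
    exact ⟨p + m, by rw [pow_add, mul_assoc, hp]⟩

/-- If s r = 0 then (ad s)^m r = (-1)^m r s^m. -/
theorem mul_pow_eq_zero_of_pow_mul_eq_zero {U : Type u} [Ring U] {s : U} (h : AdNilpotentOn s Set.univ) :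
    ∀ (l : ℕ) (r : U), s ^ l * r = 0 → ∃ m, r * s ^ m = 0 := by
  have h1 : ∀ r : U, s * r = 0 → ∃ m, r * s ^ m = 0 := by
    intro r hr
    have key : ∀ m, (fun y : U => s * y - y * s)^[m] r = (-1) ^ m * (r * s ^ m) := by
      intro m
      induction m with
      | zero => simp
      | succ m ih =>
        have h2 : s * ((-1) ^ m * (r * s ^ m)) = 0 := by
          rw [← mul_assoc, ((Commute.neg_one_right s).pow_right m).eq, mul_assoc, ← mul_assoc s, hr,
            zero_mul, mul_zero]
        rw [Function.iterate_succ_apply', ih, h2, zero_sub, pow_succ, pow_succ]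
        noncomm_ring
    obtain ⟨m, hm⟩ := h r trivial
    refine ⟨m, ?_⟩
    rw [key] at hm
    have := congrArg (fun x => (-1) ^ m * x) hm
    simpa [← mul_assoc, ← pow_add, ← two_mul, pow_mul] using this
  intro l
  induction l with
  | zero => intro r hr; exact ⟨0, by simpa using hr⟩
  | succ l ih =>
    intro r hr
    obtain ⟨m, hm⟩ := h1 (s ^ l * r) (by rw [← mul_assoc, ← pow_succ', hr])
    obtain ⟨p, hp⟩ := ih (r * s ^ m) (by rw [← mul_assoc, hm])
    exact ⟨m + p, by rw [pow_add, ← mul_assoc, hp]⟩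

/-- A finite family of commuting elements which are locally ad-nilpotent. -/
structure OreFamily.IsGood (F : OreFamily U k) : Prop where
  comm : ∀ i j, Commute (F.s i) (F.s j)
  ad : ∀ i, AdNilpotentOn (F.s i) Set.univ

variable {F : OreFamily U k} (hF : F.IsGood)
include hF

/-- The Ore condition for products, obtained by moving one factor across at a time. The monomials
with constant exponent suffice as denominators, since every monomial divides one of them. -/
theorem exists_sMon_mul_eq (c : Fin k → ℕ) (x : U) :
    ∃ (m : ℕ) (y : U), sMon F.s (fun _ => m) * x = y * sMon F.s c := by
  have h1 : ∀ (i : Fin k) (l : ℕ) (x : U), ∃ (m : ℕ) (y : U),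
      sMon F.s (fun _ => m) * x = y * F.s i ^ l := by
    intro i l x
    obtain ⟨m, y, hy⟩ := F.ore i x l
    refine ⟨m, sMon F.s ((fun _ => m) - Pi.single i m) * y, ?_⟩
    rw [sMon_eq_mul_pow hF.comm (c := fun _ => m) (i := i) le_rfl, mul_assoc, hy, ← mul_assoc]
  have h2 : ∀ (L : List (Fin k)) (x : U), ∃ (m : ℕ) (y : U),
      sMon F.s (fun _ => m) * x = y * (L.map fun i => F.s i ^ c i).prod := by
    intro L
    induction L with
    | nil => exact fun x => ⟨0, x, by simp [sMon]⟩
    | cons i L ih =>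
      intro x
      obtain ⟨m, y, hy⟩ := ih x
      obtain ⟨m', y', hy'⟩ := h1 i (c i) y
      refine ⟨m' + m, y', ?_⟩
      rw [List.map_cons, List.prod_cons, ← mul_assoc, ← hy', mul_assoc, ← hy, ← mul_assoc,
        ← sMon_add hF.comm]
      rfl
  exact h2 _ x

theorem exists_mul_sMon_eq (c : Fin k → ℕ) (x : U) :
    ∃ (m : ℕ) (y : U), x * sMon F.s (fun _ => m) = sMon F.s c * y := by
  have h1 : ∀ (i : Fin k) (l : ℕ) (x : U), ∃ (m : ℕ) (y : U),
      x * sMon F.s (fun _ => m) = F.s i ^ l * y := by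
    intro i l x
    obtain ⟨m, hm⟩ := hF.ad i x trivial
    obtain ⟨y, hy⟩ := mul_pow_of_adNilpotent _ m l x hm
    refine ⟨l + m, y * sMon F.s ((fun _ => l + m) - Pi.single i (l + m)), ?_⟩
    rw [sMon_eq_mul_pow hF.comm (c := fun _ => l + m) (i := i) le_rfl, ← sMon_comm_pow hF.comm,
      ← mul_assoc, hy, mul_assoc]
  have h2 : ∀ (L : List (Fin k)) (x : U), ∃ (m : ℕ) (y : U),
      x * sMon F.s (fun _ => m) = (L.map fun i => F.s i ^ c i).prod * y := by
    intro L
    induction L with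
    | nil => exact fun x => ⟨0, x, by simp [sMon]⟩
    | cons i L ih =>
      intro x
      obtain ⟨m, y, hy⟩ := h1 i (c i) x
      obtain ⟨m', y', hy'⟩ := ih y
      refine ⟨m + m', y', ?_⟩
      rw [List.map_cons, List.prod_cons, mul_assoc, ← hy', ← mul_assoc, ← hy, mul_assoc,
        ← sMon_add hF.comm]
      rfl
  exact h2 _ x

/-- Left torsion for the multiplicative set is right torsion: the one-element statement is applied
to the factors of the monomial in turn. -/
theorem exists_mul_sMon_eq_zero (c : Fin k → ℕ) (r : U) (h : sMon F.s c * r = 0) :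
    ∃ m : ℕ, r * sMon F.s (fun _ => m) = 0 := by
  have h2 : ∀ (L : List (Fin k)) (r : U), (L.map fun i => F.s i ^ c i).prod * r = 0 →
      ∃ m : ℕ, r * sMon F.s (fun _ => m) = 0 := by
    intro L
    induction L with
    | nil => exact fun r hr => ⟨0, by simp_all⟩
    | cons i L ih =>
      intro r hr
      rw [List.map_cons, List.prod_cons, mul_assoc] at hr
      obtain ⟨m, hm⟩ := mul_pow_eq_zero_of_pow_mul_eq_zero (hF.ad i) _ _ hr
      obtain ⟨m', hm'⟩ := ih (r * F.s i ^ m) (by rw [← mul_assoc, hm])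
      refine ⟨m + m', ?_⟩
      have : (fun _ => m + m' : Fin k → ℕ)
          = Pi.single i m + (((fun _ => m) - Pi.single i m) + fun _ => m') := by
        funext j
        rcases eq_or_ne j i with rfl | hj <;> simp [*]
      rw [this, sMon_add hF.comm, sMon_single, ← mul_assoc, sMon_add hF.comm,
        (sMon_commute hF.comm _ _).eq, ← mul_assoc, hm', zero_mul]
  exact h2 _ r h

theorem exists_sMon_mul_eq_zero (c : Fin k → ℕ) (r : U) (h : r * sMon F.s c = 0) :
    ∃ m : ℕ, sMon F.s (fun _ => m) * r = 0 := by
  have h2 : ∀ (L : List (Fin k)) (r : U), r * (L.map fun i => F.s i ^ c i).prod = 0 →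
      ∃ m : ℕ, sMon F.s (fun _ => m) * r = 0 := by
    intro L
    induction L with
    | nil => exact fun r hr => ⟨0, by simp_all⟩
    | cons i L ih =>
      intro r hr
      rw [List.map_cons, List.prod_cons, ← mul_assoc] at hr
      obtain ⟨m', hm'⟩ := ih (r * F.s i ^ c i) hr
      obtain ⟨m, hm⟩ := pow_mul_eq_zero_of_mul_pow_eq_zero (s := F.s i) (hF.ad i) _
        (sMon F.s (fun _ => m') * r) (by rw [mul_assoc, hm'])
      refine ⟨m + m', ?_⟩
      have : (fun _ => m + m' : Fin k → ℕ)
          = (((fun _ => m) - Pi.single i m) + Pi.single i m) + fun _ => m' := by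
        funext j
        rcases eq_or_ne j i with rfl | hj <;> simp [*]
      rw [this, sMon_add hF.comm, sMon_add hF.comm, sMon_single, mul_assoc, mul_assoc, hm, mul_zero]
  exact h2 _ r h

end Ore

/-! ### Fractions in the localisation -/

section Fractions

variable {U : Type u} [Ring U] [Algebra ℂ U] {k : ℕ}

theorem toLoc_sMon (s : Fin k → U) (c : Fin k → ℕ) :
    toLoc s (sMon s c) = locMonomial s (fun i => (c i : ℤ)) := by
  simp only [sMon, locMonomial, map_list_prod, List.map_map, zpow_natCast]
  have : ∀ L : List (Fin k), (L.map (toLoc s ∘ fun i => s i ^ c i)).prod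
      = (((L.map fun i => locUnit s i ^ c i).prod : (Loc s)ˣ) : Loc s) := by
    intro L
    induction L with
    | nil => simp
    | cons i L ih =>
      simp only [List.map_cons, List.prod_cons, ih, Units.val_mul, Function.comp, map_pow]
      rfl
  exact this _

theorem locMonomial_zero (s : Fin k → U) : locMonomial s 0 = 1 := by
  simp [locMonomial]

theorem locMonomial_single (s : Fin k → U) (i : Fin k) (z : ℤ) :
    locMonomial s (Pi.single i z) = ((locUnit s i ^ z : (Loc s)ˣ) : Loc s) := by
  rw [locMonomial, list_prod_map_single i (locUnit s i ^ z) _ (by simp)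
    (fun j hj => by simp [hj]) _ (List.nodup_finRange k) (List.mem_finRange i)]

theorem locUnit_commute {s : Fin k → U} (hs : ∀ i j, Commute (s i) (s j)) (i j : Fin k) :
    Commute (locUnit s i) (locUnit s j) :=
  Commute.units_of_val ((hs i j).map (toLoc s))

theorem locMonomial_add {s : Fin k → U} (hs : ∀ i j, Commute (s i) (s j)) (a b : Fin k → ℤ) :
    locMonomial s (a + b) = locMonomial s a * locMonomial s b := by
  rw [locMonomial, locMonomial, locMonomial, ← Units.val_mul]
  congr 1
  simp only [Pi.add_apply, zpow_add]
  exact list_prod_map_mul _ _ (fun i j => (locUnit_commute hs i j).zpow_zpow _ _) _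

theorem locMonomial_commute {s : Fin k → U} (hs : ∀ i j, Commute (s i) (s j)) (a b : Fin k → ℤ) :
    Commute (locMonomial s a) (locMonomial s b) := by
  rw [Commute, SemiconjBy, ← locMonomial_add hs, ← locMonomial_add hs, add_comm]

/-- The monomial with all exponents equal to `-m`. -/
def invMon (s : Fin k → U) (m : ℕ) : Loc s := locMonomial s (fun _ => -(m : ℤ))

theorem invMon_zero (s : Fin k → U) : invMon s 0 = 1 := by
  simp [invMon, locMonomial]

theorem invMon_mul_toLoc {s : Fin k → U} (hs : ∀ i j, Commute (s i) (s j)) {m l : ℕ}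
    (h : m ≤ l) : invMon s m = invMon s l * toLoc s (sMon s fun _ => l - m) := by
  rw [toLoc_sMon, invMon, invMon, ← locMonomial_add hs]
  congr 1
  funext i
  simp
  omega

theorem toLoc_mul_invMon {s : Fin k → U} (hs : ∀ i j, Commute (s i) (s j)) {m l : ℕ}
    (h : m ≤ l) : invMon s m = toLoc s (sMon s fun _ => l - m) * invMon s l := by
  rw [invMon_mul_toLoc hs h, toLoc_sMon, invMon, (locMonomial_commute hs _ _).eq]

theorem invMon_mul_self {s : Fin k → U} (hs : ∀ i j, Commute (s i) (s j)) (m : ℕ) :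
    invMon s m * toLoc s (sMon s fun _ => m) = 1 := by
  rw [← locMonomial_zero s, toLoc_sMon, invMon, ← locMonomial_add hs]
  congr 1
  funext i
  simp

theorem self_mul_invMon {s : Fin k → U} (hs : ∀ i j, Commute (s i) (s j)) (m : ℕ) :
    toLoc s (sMon s fun _ => m) * invMon s m = 1 := by
  rw [toLoc_sMon, invMon, (locMonomial_commute hs _ _).eq, ← toLoc_sMon]
  exact invMon_mul_self hs m

theorem locMonomial_eq_invMon_mul {s : Fin k → U} (hs : ∀ i j, Commute (s i) (s j))
    (a : Fin k → ℤ) (m : ℕ) (h : ∀ i, 0 ≤ a i + m) :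
    locMonomial s a = invMon s m * toLoc s (sMon s fun i => (a i + m).toNat) := by
  rw [toLoc_sMon, invMon, ← locMonomial_add hs]
  congr 1
  funext i
  have := h i
  simp only [Pi.add_apply]
  omega

theorem locMonomial_eq_mul_invMon {s : Fin k → U} (hs : ∀ i j, Commute (s i) (s j))
    (a : Fin k → ℤ) (m : ℕ) (h : ∀ i, 0 ≤ a i + m) :
    locMonomial s a = toLoc s (sMon s fun i => (a i + m).toNat) * invMon s m := by
  rw [locMonomial_eq_invMon_mul hs a m h, toLoc_sMon, invMon, (locMonomial_commute hs _ _).eq]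

theorem Loc.induction {s : Fin k → U} {p : Loc s → Prop} (hU : ∀ x, p (toLoc s x))
    (hinv : ∀ i, p ((locUnit s i)⁻¹ : (Loc s)ˣ)) (hadd : ∀ v w, p v → p w → p (v + w))
    (hmul : ∀ v w, p v → p w → p (v * w)) (v : Loc s) : p v := by
  obtain ⟨x, rfl⟩ := RingQuot.mkAlgHom_surjective ℂ (LocRel s) v
  induction x with
  | grade0 c =>
    have : RingQuot.mkAlgHom ℂ (LocRel s) (algebraMap ℂ _ c) = toLoc s (algebraMap ℂ U c) := by
      rw [AlgHom.commutes, AlgHom.commutes]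
    rw [this]
    exact hU _
  | grade1 x =>
    rcases x with x | i
    · exact hU x
    · exact hinv i
  | mul a b ha hb => rw [map_mul]; exact hmul _ _ ha hb
  | add a b ha hb => rw [map_add]; exact hadd _ _ ha hb

variable {F : OreFamily U k} (hF : F.IsGood)
include hF

theorem locUnit_inv_eq (i : Fin k) : (((locUnit F.s i)⁻¹ : (Loc F.s)ˣ) : Loc F.s)
    = invMon F.s 1 * toLoc F.s (sMon F.s fun j => if j = i then 0 else 1) := by
  have h := locMonomial_single F.s i (-1)
  rw [zpow_neg, zpow_one] at h
  rw [← h, toLoc_sMon, invMon, ← locMonomial_add hF.comm]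
  congr 1
  funext j
  rcases eq_or_ne j i with rfl | hj <;> simp [*]

/-- The localisation is built from generators and relations, so it is not clear a priori that its
elements are fractions. Closure of the fractions under sums uses common denominators, closure under
products uses the Ore condition. -/
theorem exists_invMon_mul (v : Loc F.s) : ∃ (m : ℕ) (x : U), v = invMon F.s m * toLoc F.s x := by
  induction v using Loc.induction with
  | hU x => exact ⟨0, x, by rw [invMon_zero, one_mul]⟩
  | hinv i => exact ⟨1, _, locUnit_inv_eq hF i⟩
  | hadd v w hv hw =>
    obtain ⟨m, x, rfl⟩ := hv
    obtain ⟨l, y, rfl⟩ := hw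
    refine ⟨max m l, sMon F.s (fun _ => max m l - m) * x + sMon F.s (fun _ => max m l - l) * y, ?_⟩
    rw [invMon_mul_toLoc hF.comm (le_max_left m l), invMon_mul_toLoc hF.comm (le_max_right m l)]
    simp only [map_add, map_mul, mul_add, mul_assoc]
  | hmul v w hv hw =>
    obtain ⟨m, x, rfl⟩ := hv
    obtain ⟨l, y, rfl⟩ := hw
    obtain ⟨p, z, hz⟩ := exists_sMon_mul_eq hF (fun _ => l) x
    refine ⟨m + p, z * y, ?_⟩
    have h1 : toLoc F.s x * invMon F.s l = invMon F.s p * toLoc F.s z := by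
      have := congrArg (fun t => invMon F.s p * toLoc F.s t * invMon F.s l) hz
      simp only [map_mul] at this
      rw [← mul_assoc, invMon_mul_self hF.comm, one_mul, mul_assoc (invMon F.s p),
        mul_assoc (toLoc F.s z), self_mul_invMon hF.comm, mul_one] at this
      exact this
    have h2 : invMon F.s (m + p) = invMon F.s m * invMon F.s p := by
      rw [invMon, invMon, invMon, ← locMonomial_add hF.comm]
      congr 1
      funext i
      simp
      ring
    rw [h2, map_mul, mul_assoc, ← mul_assoc (toLoc F.s x), h1]
    simp only [mul_assoc]

theorem toLoc_mul_invMon_eq (m : ℕ) (x : U) : ∃ (p : ℕ) (y : U),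
    invMon F.s m * toLoc F.s x = toLoc F.s y * invMon F.s p := by
  obtain ⟨p, y, hy⟩ := exists_mul_sMon_eq hF (fun _ => m) x
  refine ⟨p, y, ?_⟩
  have := congrArg (fun t => invMon F.s m * toLoc F.s t * invMon F.s p) hy
  simp only [map_mul] at this
  rw [← mul_assoc, ← mul_assoc, invMon_mul_self hF.comm, one_mul, mul_assoc (_ * _),
    self_mul_invMon hF.comm, mul_one] at this
  exact this

theorem exists_mul_invMon (v : Loc F.s) : ∃ (m : ℕ) (x : U), v = toLoc F.s x * invMon F.s m := by
  obtain ⟨m, x, rfl⟩ := exists_invMon_mul hF v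
  exact toLoc_mul_invMon_eq hF m x

/-- The elements of `nonnegSpan` in terms of right fractions. -/
theorem locMonomial_mul_toLoc_mem (a : Fin k → ℤ) (j : Fin k) (hj : 0 ≤ a j) (x : U) :
    ∃ (b : Fin k → ℤ) (y : U), 0 ≤ b j ∧
      locMonomial F.s a * toLoc F.s x = toLoc F.s y * locMonomial F.s b := by
  obtain ⟨m, hm⟩ : ∃ m : ℕ, ∀ i, 0 ≤ a i + m :=
    ⟨∑ i, (a i).natAbs, fun i => by
      have := Finset.single_le_sum (f := fun i => (a i).natAbs) (fun _ _ => Nat.zero_le _)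
        (Finset.mem_univ i)
      omega⟩
  have key : ∀ (c : Fin k → ℕ) (x : U), ∃ (p : Fin k → ℕ) (y : U), (c j = 0 → p j = 0) ∧
      x * sMon F.s p = sMon F.s c * y := by
    intro c
    have h2 : ∀ (L : List (Fin k)) (x : U), ∃ (p : Fin k → ℕ) (y : U), (c j = 0 → p j = 0) ∧
        x * sMon F.s p = (L.map fun i => F.s i ^ c i).prod * y := by
      intro L
      induction L with
      | nil => exact fun x => ⟨0, x, fun _ => rfl, by simp [sMon]⟩
      | cons i L ih =>
        intro x
        obtain ⟨m, hm⟩ := hF.ad i x trivial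
        obtain ⟨y, hy⟩ := mul_pow_of_adNilpotent _ m (c i) x hm
        obtain ⟨p, z, hp, hz⟩ := ih y
        by_cases hc : c i = 0
        -- A factor with exponent 0 is skipped instead of receiving the exponent m; otherwise p j
        -- could become nonzero although c j = 0.
        · obtain ⟨p, z, hp, hz⟩ := ih x
          exact ⟨p, z, hp, by simp [hc, hz]⟩
        refine ⟨Pi.single i (c i + m) + p, z, fun h => ?_, ?_⟩
        · have : j ≠ i := fun h' => hc (h' ▸ h)
          simp [this, hp h]
        · rw [sMon_add hF.comm, sMon_single, ← mul_assoc, hy, mul_assoc, hz, List.map_cons,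
            List.prod_cons, mul_assoc]
    exact h2 _
  -- The denominator leaves out the index j, which is possible as a j ≥ 0. This is what keeps the
  -- j-th exponent nonnegative on the other side.
  let c : Fin k → ℕ := fun i => if i = j then 0 else m
  let d : Fin k → ℕ := fun i => (a i + c i).toNat
  have hd : ∀ i, 0 ≤ a i + c i := by
    intro i
    by_cases h : i = j
    · subst h; simpa [c] using hj
    · simpa [c, h] using hm i
  obtain ⟨p, y, hp, hy⟩ := key c (sMon F.s d * x)
  refine ⟨fun i => -(p i : ℤ), y, by simp [hp (by simp [c])], ?_⟩
  have h1 : locMonomial F.s a = locMonomial F.s (fun i => -(c i : ℤ)) * toLoc F.s (sMon F.s d) := by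
    rw [toLoc_sMon, ← locMonomial_add hF.comm]
    congr 1
    funext i
    have := hd i
    simp only [Pi.add_apply, d]
    omega
  have h3 : ∀ e : Fin k → ℕ, locMonomial F.s (fun i => -(e i : ℤ)) * toLoc F.s (sMon F.s e) = 1 := by
    intro e
    rw [toLoc_sMon, ← locMonomial_add hF.comm, ← locMonomial_zero F.s]
    congr 1
    funext i
    simp
  have h4 : toLoc F.s (sMon F.s p) * locMonomial F.s (fun i => -(p i : ℤ)) = 1 := by
    rw [toLoc_sMon, (locMonomial_commute hF.comm _ _).eq, ← toLoc_sMon, h3]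
  have := congrArg (fun t => locMonomial F.s (fun i => -(c i : ℤ)) * toLoc F.s t *
    locMonomial F.s (fun i => -(p i : ℤ))) hy
  simp only [map_mul] at this
  rw [← mul_assoc, ← mul_assoc _ (toLoc F.s (sMon F.s c)), h3, one_mul, mul_assoc (_ * _), h4,
    mul_one, ← mul_assoc, ← h1] at this
  exact this

end Fractions

/-! ### Comparison with the Ore localisation -/

section OreLoc

variable {U : Type u} [Ring U] [Algebra ℂ U] {k : ℕ} {F : OreFamily U k}

/-- The powers of the product of the elements of the family. -/
def sPowers (F : OreFamily U k) : Submonoid U := Submonoid.powers (sMon F.s fun _ => 1)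

theorem mem_sPowers (hF : F.IsGood) {x : U} : x ∈ sPowers F ↔ ∃ m : ℕ, sMon F.s (fun _ => m) = x := by
  rw [sPowers, Submonoid.mem_powers_iff]
  simp [sMon_pow hF.comm, Pi.smul_def]

/-- The Ore condition for the powers of the product of the family. -/
@[reducible]
noncomputable def sPowersOreSet (hF : F.IsGood) : OreLocalization.OreSet (sPowers F) :=
  have h : ∀ (r : U) (s : sPowers F), ∃ (s' : sPowers F) (r' : U), (s' : U) * r = r' * s := by
    rintro r ⟨s, hs⟩
    obtain ⟨m, rfl⟩ := (mem_sPowers hF).1 hs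
    obtain ⟨p, y, hy⟩ := exists_sMon_mul_eq hF (fun _ => m) r
    exact ⟨⟨_, (mem_sPowers hF).2 ⟨p, rfl⟩⟩, y, hy⟩
  { ore_right_cancel := by
      rintro r₁ r₂ ⟨s, hs⟩ h
      obtain ⟨m, rfl⟩ := (mem_sPowers hF).1 hs
      obtain ⟨p, hp⟩ := exists_sMon_mul_eq_zero hF (fun _ => m) (r₁ - r₂) (by
        rw [sub_mul, sub_eq_zero]; exact h)
      exact ⟨⟨_, (mem_sPowers hF).2 ⟨p, rfl⟩⟩, by rwa [mul_sub, sub_eq_zero] at hp⟩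
    oreNum := fun r s => (h r s).choose_spec.choose
    oreDenom := fun r s => (h r s).choose
    ore_eq := fun r s => (h r s).choose_spec.choose_spec }

open OreLocalization in
/-- The comparison map from `U[s i⁻¹ : i]` to the Ore localisation. -/
theorem exists_locToOre (hF : F.IsGood) [OreSet (sPowers F)] :
    ∃ θ : Loc F.s →ₐ[ℂ] OreLocalization (sPowers F) U, ∀ x, θ (toLoc F.s x) = x /ₒ 1 := by
  let N : U →+* OreLocalization (sPowers F) U :=
    { (numeratorHom : U →* OreLocalization (sPowers F) U) with
      map_zero' := (OreLocalization.zero_def (S := sPowers F) (X := U)).symm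
      map_add' := fun x y => (add_oreDiv (s := (1 : sPowers F))).symm }
  -- A factor of a unit in a commuting product is a unit, so inverting the product of the family
  -- inverts each member.
  have hu : ∀ i, IsUnit (N (F.s i)) := by
    intro i
    have h1 : IsUnit (N (sMon F.s fun _ => 1)) :=
      numerator_isUnit (⟨_, Submonoid.mem_powers _⟩ : sPowers F)
    have h2 : sMon F.s (fun _ => 1) = sMon F.s ((fun _ => 1) - Pi.single i 1) * F.s i := by
      simpa using sMon_eq_mul_pow hF.comm (c := fun _ => 1) (i := i) (m := 1) le_rfl
    have h3 : Commute (N (sMon F.s ((fun _ => 1) - Pi.single i 1))) (N (F.s i)) := by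
      have := sMon_comm_pow hF.comm ((fun _ => 1) - Pi.single i 1) i 1
      rw [pow_one] at this
      exact (show Commute _ _ from this.symm).map N
    rw [h2, map_mul] at h1
    exact (h3.isUnit_mul_iff.1 h1).2
  let f : FreeAlgebra ℂ (U ⊕ Fin k) →ₐ[ℂ] OreLocalization (sPowers F) U :=
    FreeAlgebra.lift ℂ (Sum.elim N fun i => ((hu i).unit⁻¹ : _ˣ))
  refine ⟨RingQuot.liftAlgHom ℂ ⟨f, ?_⟩, fun x => ?_⟩
  · intro a b hab
    cases hab with
    | add x y => simp [f]
    | mul x y => simp [f]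
    | scalar c =>
      simp only [f, FreeAlgebra.lift_ι_apply, Sum.elim_inl, AlgHom.commutes]
      rfl
    | mul_inv i => simp [f]
    | inv_mul i => simp [f]
  · show RingQuot.liftAlgHom ℂ _ (RingQuot.mkAlgHom ℂ (LocRel F.s) _) = _
    rw [RingQuot.liftAlgHom_mkAlgHom_apply]
    simp [f]
    rfl

/-- Equality of fractions is explicit in the Ore localisation, so the kernel of U → U[s i⁻¹ : i] is
read off there. The left torsion found in this way is turned into right torsion. -/
theorem exists_mul_eq_zero_of_toLoc_eq_zero (hF : F.IsGood) {x : U} (h : toLoc F.s x = 0) :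
    ∃ m : ℕ, x * sMon F.s (fun _ => m) = 0 := by
  let _ := sPowersOreSet hF
  obtain ⟨θ, hθ⟩ := exists_locToOre hF
  have h1 := hθ x
  rw [h, map_zero, OreLocalization.zero_def, OreLocalization.oreDiv_eq_iff] at h1
  obtain ⟨u, v, huv, h2⟩ := h1
  obtain ⟨m, hm⟩ := (mem_sPowers hF).1 u.2
  have h3 : (u : U) * x = 0 := by
    simpa [Submonoid.smul_def] using huv
  rw [← hm] at h3
  exact exists_mul_sMon_eq_zero hF _ _ h3

end OreLoc

/-! ### Elements of the tensor product -/

section Tensor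

variable {U : Type u} [Ring U] {S : Type u} [AddCommGroup S] [Module U S] [Module Uᵐᵒᵖ S]
  {M N : Type u} [AddCommGroup M] [Module U M] [AddCommGroup N] [Module U N]

/-- The class of `s ⊗ m`. -/
def tens (s : S) (m : M) : TensorOver U S M := Submodule.Quotient.mk (s ⊗ₜ[ℤ] m)

theorem tens_add (s : S) (m m' : M) : (tens s (m + m') : TensorOver U S M) = tens s m + tens s m' := by
  rw [tens, TensorProduct.tmul_add]; rfl

theorem add_tens (s s' : S) (m : M) : (tens (s + s') m : TensorOver U S M) = tens s m + tens s' m := by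
  rw [tens, TensorProduct.add_tmul]; rfl

theorem zero_tens (m : M) : (tens 0 m : TensorOver U S M) = 0 := by
  rw [tens, TensorProduct.zero_tmul]; rfl

theorem tens_zero (s : S) : (tens s (0 : M) : TensorOver U S M) = 0 := by
  rw [tens, TensorProduct.tmul_zero]; rfl

theorem tens_sub (s : S) (m m' : M) : (tens s (m - m') : TensorOver U S M) = tens s m - tens s m' := by
  rw [tens, TensorProduct.tmul_sub]; rfl

theorem smul_tens (r : U) (s : S) (m : M) : r • (tens s m : TensorOver U S M) = tens (r • s) m := rfl

theorem tens_smul (r : U) (s : S) (m : M) :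
    (tens s (r • m) : TensorOver U S M) = tens (MulOpposite.op r • s) m := by
  refine ((Submodule.Quotient.eq _).2 ?_).symm
  exact Submodule.subset_span ⟨s, r, m, rfl⟩

theorem tensorMap_tens (f : M →ₗ[U] N) (s : S) (m : M) :
    tensorMap U S f (tens s m) = tens s (f m) := rfl

theorem TensorOver.induction {p : TensorOver U S M → Prop} (htens : ∀ s m, p (tens s m))
    (hadd : ∀ x y, p x → p y → p (x + y)) (x : TensorOver U S M) : p x := by
  obtain ⟨y, rfl⟩ := Submodule.Quotient.mk_surjective _ x
  induction y with
  | zero => simpa [zero_tens] using htens 0 0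
  | add a b ha hb => exact hadd _ _ ha hb
  | tmul s m => exact htens s m

theorem exists_tensLift [SMulCommClass U Uᵐᵒᵖ S] {A : Type*} [AddCommGroup A] (β : S →+ M →+ A)
    (hβ : ∀ (s : S) (r : U) (m : M), β (MulOpposite.op r • s) m = β s (r • m)) :
    ∃ B : TensorOver U S M →+ A, ∀ s m, B (tens s m) = β s m := by
  let B₀ : S ⊗[ℤ] M →+ A := TensorProduct.liftAddHom β (by
    intro c s m
    rw [map_zsmul, map_zsmul]; rfl)
  -- The relations are taken as a U-submodule while the target is only an abelian group, so
  -- vanishing is checked on all left multiples of the generators.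
  have h0 : ∀ z ∈ tensorRel U S M, ∀ u : U, B₀ (u • z) = 0 := by
    intro z hz
    induction hz using Submodule.span_induction with
    | mem z hz =>
      obtain ⟨s, r, m, rfl⟩ := hz
      intro u
      show B₀ (u • (_ - _)) = 0
      rw [smul_sub, TensorProduct.smul_tmul', TensorProduct.smul_tmul', map_sub, sub_eq_zero]
      show β _ _ = β _ _
      rw [smul_comm, hβ]
    | zero => simp
    | add x y _ _ hx hy => intro u; rw [smul_add, map_add, hx, hy, add_zero]
    | smul c x _ hx => intro u; rw [← mul_smul]; exact hx _
  refine ⟨QuotientAddGroup.lift (tensorRel U S M).toAddSubgroup B₀ fun z hz => by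
    simpa using h0 z hz 1, fun s m => ?_⟩
  rfl

end Tensor

/-! ### The bimodule `U[s i⁻¹ : i] / nonnegSpan s` -/

section LocQuotElements

variable {U : Type u} [Ring U] [Algebra ℂ U] {k : ℕ} {F : OreFamily U k}

variable (F) in
/-- The class of a Laurent monomial. -/
def sig (a : Fin k → ℤ) : LocQuot F := LocQuot.mk F (locMonomial F.s a)

theorem mk_eq_zero {v : Loc F.s} (hv : v ∈ nonnegSpan F.s) : LocQuot.mk F v = 0 :=
  (Submodule.Quotient.mk_eq_zero _).2 hv

theorem sig_eq_zero {a : Fin k → ℤ} (j : Fin k) (hj : 0 ≤ a j) : sig F a = 0 :=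
  mk_eq_zero (Submodule.subset_span ⟨a, 1, ⟨j, hj⟩, by simp⟩)

theorem sig_congr {a b : Fin k → ℤ} (h : ∀ i, a i = b i) : sig F a = sig F b := by
  rw [funext h]

variable (hF : F.IsGood)
include hF

theorem sMon_smul_sig (c : Fin k → ℕ) (a : Fin k → ℤ) :
    sMon F.s c • sig F a = sig F (fun i => a i + c i) := by
  rw [sig, LocQuot.smul_mk, toLoc_sMon, (locMonomial_commute hF.comm _ _).eq,
    ← locMonomial_add hF.comm]
  rfl

theorem op_sMon_smul_sig (c : Fin k → ℕ) (a : Fin k → ℤ) :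
    MulOpposite.op (sMon F.s c) • sig F a = sig F (fun i => a i + c i) := by
  rw [sig, LocQuot.op_smul_mk, MulOpposite.unop_op, toLoc_sMon, ← locMonomial_add hF.comm]
  rfl

theorem pow_smul_sig (i : Fin k) (p : ℕ) (a : Fin k → ℤ) :
    F.s i ^ p • sig F a = sig F (a + Pi.single i (p : ℤ)) := by
  rw [← sMon_single i p, sMon_smul_sig hF]
  refine sig_congr fun j => ?_
  rcases eq_or_ne j i with rfl | h <;> simp [*]

theorem op_pow_smul_sig (i : Fin k) (p : ℕ) (a : Fin k → ℤ) :
    MulOpposite.op (F.s i ^ p) • sig F a = sig F (a + Pi.single i (p : ℤ)) := by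
  rw [← sMon_single i p, op_sMon_smul_sig hF]
  refine sig_congr fun j => ?_
  rcases eq_or_ne j i with rfl | h <;> simp [*]

theorem exists_eq_op_smul_sig (x : LocQuot F) : ∃ N : ℕ, ∀ m ≥ N, ∃ u : U,
    x = MulOpposite.op u • sig F (fun _ => -(m : ℤ)) := by
  obtain ⟨v, rfl⟩ := LocQuot.mk_surjective F x
  obtain ⟨N, u, rfl⟩ := exists_invMon_mul hF v
  refine ⟨N, fun m hm => ⟨sMon F.s (fun _ => m - N) * u, ?_⟩⟩
  rw [sig, LocQuot.op_smul_mk, MulOpposite.unop_op, map_mul, ← mul_assoc,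
    invMon_mul_toLoc hF.comm hm]
  rfl

theorem exists_eq_smul_sig (x : LocQuot F) : ∃ N : ℕ, ∀ m ≥ N, ∃ u : U,
    x = u • sig F (fun _ => -(m : ℤ)) := by
  obtain ⟨v, rfl⟩ := LocQuot.mk_surjective F x
  obtain ⟨N, u, rfl⟩ := exists_mul_invMon hF v
  refine ⟨N, fun m hm => ⟨u * sMon F.s (fun _ => m - N), ?_⟩⟩
  rw [sig, LocQuot.smul_mk, map_mul, mul_assoc, toLoc_mul_invMon hF.comm hm]
  rfl

variable {M : Type u} [AddCommGroup M] [Module U M]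

theorem exists_eq_tens (z : TensorOver U (LocQuot F) M) : ∃ N : ℕ, ∀ m ≥ N, ∃ x : M,
    z = tens (sig F fun _ => -(m : ℤ)) x := by
  induction z using TensorOver.induction with
  | htens s x =>
    obtain ⟨N, hN⟩ := exists_eq_op_smul_sig hF s
    refine ⟨N, fun m hm => ?_⟩
    obtain ⟨u, rfl⟩ := hN m hm
    exact ⟨u • x, (tens_smul _ _ _).symm⟩
  | hadd x y hx hy =>
    obtain ⟨N, hN⟩ := hx
    obtain ⟨N', hN'⟩ := hy
    refine ⟨max N N', fun m hm => ?_⟩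
    obtain ⟨a, rfl⟩ := hN m (le_trans (le_max_left _ _) hm)
    obtain ⟨b, rfl⟩ := hN' m (le_trans (le_max_right _ _) hm)
    exact ⟨a + b, (tens_add _ _ _).symm⟩

open OreLocalization in
/-- If `s^(-c) ⊗ x = 0`, then a multiple of `x` lies in `∑ j, s j ^ K M`. -/
theorem exists_of_tens_sig_eq_zero (c : Fin k → ℕ) (x : M)
    (h : (tens (sig F fun i => -(c i : ℤ)) x : TensorOver U (LocQuot F) M) = 0) :
    ∃ K : ℕ, (∀ i, c i ≤ K) ∧ ∃ y : Fin k → M,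
      sMon F.s (fun i => K - c i) • x = ∑ j, F.s j ^ K • y j := by
  let _ := sPowersOreSet hF
  obtain ⟨θ, hθ⟩ := exists_locToOre hF
  let Mf := OreLocalization (sPowers F) M
  let inj : M →+ Mf :=
    { toFun := fun m => m /ₒ 1
      map_zero' := (OreLocalization.zero_def (S := sPowers F) (X := M)).symm
      map_add' := fun x y => (add_oreDiv (s := (1 : sPowers F))).symm }
  have hinj : ∀ (r : U) (m : M), θ (toLoc F.s r) • inj m = inj (r • m) := by
    intro r m
    rw [hθ]
    exact smul_div_one
  -- The tensor product is tested by mapping it to the localised module `Mf` modulo the subgroup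
  -- generated by the products of `nonnegSpan` with M.
  let VM : AddSubgroup Mf :=
    AddSubgroup.closure {w | ∃ v ∈ nonnegSpan F.s, ∃ m : M, w = θ v • inj m}
  -- Clearing denominators: if a j ≥ 0, then multiplying s^a by the K-th power of all s i leaves a
  -- monomial divisible by s j ^ K. The bound must hold for all large K so that sums can be treated
  -- with a common K.
  have hV : ∀ w ∈ VM, ∃ K₀ : ℕ, ∀ K ≥ K₀, ∃ y : Fin k → M,
      θ (toLoc F.s (sMon F.s fun _ => K)) • w = inj (∑ j, F.s j ^ K • y j) := by
    intro w hw
    induction hw using AddSubgroup.closure_induction with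
    | mem w hw =>
      obtain ⟨v, hv, m, rfl⟩ := hw
      induction hv using Submodule.span_induction generalizing m with
      | mem v hv =>
        obtain ⟨a, u, ⟨j, hj⟩, rfl⟩ := hv
        obtain ⟨K₀, hK₀⟩ : ∃ m : ℕ, ∀ i, 0 ≤ a i + m :=
          ⟨∑ i, (a i).natAbs, fun i => by
            have := Finset.single_le_sum (f := fun i => (a i).natAbs) (fun _ _ => Nat.zero_le _)
              (Finset.mem_univ i)
            omega⟩
        refine ⟨K₀, fun K hK => ?_⟩
        have hK' : ∀ i, 0 ≤ a i + K := fun i => by have := hK₀ i; omega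
        have hKj : K ≤ (a j + K).toNat := by omega
        refine ⟨Pi.single j ((sMon F.s ((fun i => (a i + K).toNat) - Pi.single j K) * u) • m), ?_⟩
        rw [← mul_smul, ← map_mul, ← mul_assoc, locMonomial_eq_invMon_mul hF.comm a K hK',
          ← mul_assoc, self_mul_invMon hF.comm, one_mul, ← map_mul, hinj,
          Finset.sum_eq_single j (fun i _ hi => by simp [hi]) (by simp), Pi.single_eq_same,
          ← mul_smul, ← mul_assoc, sMon_comm_pow hF.comm,
          ← sMon_eq_mul_pow hF.comm (c := fun i => (a i + K).toNat) hKj]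
      | zero => exact ⟨0, fun K _ => ⟨0, by simp⟩⟩
      | add v w _ _ hv hw =>
        obtain ⟨K₁, h₁⟩ := hv m
        obtain ⟨K₂, h₂⟩ := hw m
        refine ⟨max K₁ K₂, fun K hK => ?_⟩
        obtain ⟨y, hy⟩ := h₁ K (le_trans (le_max_left _ _) hK)
        obtain ⟨z, hz⟩ := h₂ K (le_trans (le_max_right _ _) hK)
        refine ⟨y + z, ?_⟩
        rw [map_add, add_smul, smul_add, hy, hz, ← map_add, ← Finset.sum_add_distrib]
        simp only [Pi.add_apply, smul_add]
      | smul c v _ hv =>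
        have : θ (c • v) • inj m = θ v • inj (algebraMap ℂ U c • m) := by
          rw [← hinj, ← mul_smul, ← map_mul, AlgHom.commutes, ← Algebra.commutes, Algebra.smul_def]
        rw [this]
        exact hv _
    | zero => exact ⟨0, fun K _ => ⟨0, by simp⟩⟩
    | add v w _ _ hv hw =>
      obtain ⟨K₁, h₁⟩ := hv
      obtain ⟨K₂, h₂⟩ := hw
      refine ⟨max K₁ K₂, fun K hK => ?_⟩
      obtain ⟨y, hy⟩ := h₁ K (le_trans (le_max_left _ _) hK)
      obtain ⟨z, hz⟩ := h₂ K (le_trans (le_max_right _ _) hK)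
      refine ⟨y + z, ?_⟩
      rw [smul_add, hy, hz, ← map_add, ← Finset.sum_add_distrib]
      simp only [Pi.add_apply, smul_add]
    | neg v _ hv =>
      obtain ⟨K₁, h₁⟩ := hv
      refine ⟨K₁, fun K hK => ?_⟩
      obtain ⟨y, hy⟩ := h₁ K hK
      exact ⟨-y, by rw [smul_neg, hy, ← map_neg, ← Finset.sum_neg_distrib]; simp⟩
  let β₀ : Loc F.s →+ M →+ Mf ⧸ VM := AddMonoidHom.mk' (fun v =>
    (QuotientAddGroup.mk' VM).comp ((DistribSMul.toAddMonoidHom Mf (θ v)).comp inj)) (by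
      intro v w
      refine AddMonoidHom.ext fun m => ?_
      show QuotientAddGroup.mk' VM (θ (v + w) • inj m) = _
      rw [map_add, add_smul, map_add]
      rfl)
  let β : LocQuot F →+ M →+ Mf ⧸ VM := QuotientAddGroup.lift (nonnegSpan F.s).toAddSubgroup β₀ (by
    intro v hv
    refine AddMonoidHom.ext fun m => ?_
    exact (QuotientAddGroup.eq_zero_iff _).2 (AddSubgroup.subset_closure ⟨v, hv, m, rfl⟩))
  have hβ : ∀ v m, β (LocQuot.mk F v) m = QuotientAddGroup.mk' VM (θ v • inj m) := fun _ _ => rfl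
  obtain ⟨B, hB⟩ := exists_tensLift β (by
    intro s r m
    obtain ⟨v, rfl⟩ := LocQuot.mk_surjective F s
    rw [LocQuot.op_smul_mk, hβ, hβ, map_mul, mul_smul, MulOpposite.unop_op, hinj])
  have h1 := hB (sig F fun i => -(c i : ℤ)) x
  rw [h, map_zero, sig, hβ] at h1
  obtain ⟨K₀, hK₀⟩ := hV _ ((QuotientAddGroup.eq_zero_iff _).1 h1.symm)
  set K := max K₀ (∑ i, c i) with hK
  have hcK : ∀ i, c i ≤ K := fun i => le_trans
    (Finset.single_le_sum (f := c) (fun _ _ => Nat.zero_le _) (Finset.mem_univ i)) (le_max_right _ _)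
  obtain ⟨y, hy⟩ := hK₀ K (le_max_left _ _)
  have h2 : toLoc F.s (sMon F.s fun _ => K) * locMonomial F.s (fun i => -(c i : ℤ))
      = toLoc F.s (sMon F.s fun i => K - c i) := by
    rw [toLoc_sMon, toLoc_sMon, ← locMonomial_add hF.comm]
    congr 1
    funext i
    have := hcK i
    simp only [Pi.add_apply]
    omega
  rw [← mul_smul, ← map_mul, h2, hinj] at hy
  obtain ⟨u, v, h3, h4⟩ := oreDiv_eq_iff.1 hy
  obtain ⟨p, hp⟩ := (mem_sPowers hF).1 u.2
  have h5 : (u : U) = v := by simpa using h4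
  have h6 : (u : U) • (∑ j, F.s j ^ K • y j) = (u : U) • (sMon F.s fun i => K - c i) • x := by
    rw [Submonoid.smul_def] at h3
    rw [h3, h5]
  -- The equation holds only after multiplication by the p-th power of all s i, by the definition of
  -- equality in `Mf`. One factor s j ^ p of it raises the exponent of s j from K to K + p.
  refine ⟨K + p, fun i => (hcK i).trans (Nat.le_add_right _ _),
    fun j => sMon F.s ((fun _ => p) - Pi.single j p) • y j, ?_⟩
  have h7 : (fun i => K + p - c i) = (fun _ => p) + fun i => K - c i := by
    funext i
    have := hcK i
    simp only [Pi.add_apply]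
    omega
  rw [h7, sMon_add hF.comm, hp, mul_smul, ← h6, ← hp, Finset.smul_sum]
  refine Finset.sum_congr rfl fun j _ => ?_
  rw [← mul_smul, ← mul_smul,
    sMon_eq_mul_pow hF.comm (c := fun _ => p) (i := j) (m := p) le_rfl, mul_assoc, ← pow_add,
    add_comm p K, sMon_comm_pow hF.comm]

/-- A homomorphism `S → P` is the same as a compatible system of elements of `P`, its values at the
classes of the monomials with constant exponent. -/
theorem exists_hom_of_system {P : Type u} [AddCommGroup P] [Module U P] (x : ℕ → P)
    (h₁ : ∀ l, sMon F.s (fun _ => 1) • x (l + 1) = x l) (h₂ : ∀ l j, F.s j ^ l • x l = 0) :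
    ∃ f : LocQuot F →ₗ[U] P, ∀ l : ℕ, f (sig F fun _ => -(l : ℤ)) = x l := by
  have h₁' : ∀ d m, sMon F.s (fun _ => d) • x (m + d) = x m := by
    intro d
    induction d with
    | zero => intro m; simp [sMon]
    | succ d ih =>
      intro m
      rw [show (fun _ => d + 1 : Fin k → ℕ) = (fun _ => d) + fun _ => 1 from rfl, sMon_add hF.comm,
        mul_smul, ← add_assoc, h₁, ih]
  -- The homomorphism has to send u s^(-m) to u • x m. Two expressions for one fraction agree in U
  -- up to right torsion, and the torsion factor is absorbed by replacing x (m + m') by a multiple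
  -- of a later x.
  have hwd : ∀ u m u' m', toLoc F.s u * invMon F.s m = toLoc F.s u' * invMon F.s m' →
      u • x m = u' • x m' := by
    intro u m u' m' h
    rw [toLoc_mul_invMon hF.comm (Nat.le_add_right m m'),
      toLoc_mul_invMon hF.comm (Nat.le_add_left m' m), ← mul_assoc, ← mul_assoc, ← map_mul,
      ← map_mul] at h
    have h3 := congrArg (fun t => t * toLoc F.s (sMon F.s fun _ => m + m')) h
    simp only [mul_assoc, invMon_mul_self hF.comm, mul_one] at h3
    rw [← sub_eq_zero, ← map_sub] at h3
    obtain ⟨p, hp⟩ := exists_mul_eq_zero_of_toLoc_eq_zero hF h3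
    have h4 : (u * sMon F.s (fun _ => m + m' - m) - u' * sMon F.s fun _ => m + m' - m') •
        x (m + m') = 0 := by
      rw [← h₁' p, ← mul_smul, hp, zero_smul]
    rw [sub_smul, sub_eq_zero, mul_smul, mul_smul, Nat.add_sub_cancel_left, Nat.add_sub_cancel,
      h₁', add_comm m m', h₁'] at h4
    exact h4
  choose m u hmu using exists_mul_invMon hF
  have hG : ∀ v p w, v = toLoc F.s w * invMon F.s p → u v • x (m v) = w • x p :=
    fun v p w h => hwd _ _ _ _ ((hmu v).symm.trans h)
  let G : Loc F.s →+ P := AddMonoidHom.mk' (fun v => u v • x (m v)) (by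
    intro v w
    rw [hG v (m v + m w) (u v * sMon F.s fun _ => m v + m w - m v) (by
        rw [map_mul, mul_assoc, ← toLoc_mul_invMon hF.comm (Nat.le_add_right _ _)]; exact hmu v),
      hG w (m v + m w) (u w * sMon F.s fun _ => m v + m w - m w) (by
        rw [map_mul, mul_assoc, ← toLoc_mul_invMon hF.comm (Nat.le_add_left _ _)]; exact hmu w),
      ← add_smul]
    refine hG _ _ _ ?_
    rw [map_add, add_mul, map_mul, mul_assoc, ← toLoc_mul_invMon hF.comm (Nat.le_add_right _ _),
      map_mul, mul_assoc, ← toLoc_mul_invMon hF.comm (Nat.le_add_left _ _), ← hmu, ← hmu])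
  have hGs : ∀ w v, G (toLoc F.s w * v) = w • G v := by
    intro w v
    show _ = w • u v • x (m v)
    rw [← mul_smul]
    refine hG _ _ _ ?_
    rw [map_mul, mul_assoc, ← hmu]
  -- In the form of a right fraction the monomial still has an exponent b j ≥ 0. Written over the
  -- denominator s^L it contains s j to a power at least L, which kills x L.
  have hG0 : ∀ v ∈ nonnegSpan F.s, G v = 0 := by
    intro v hv
    induction hv using Submodule.span_induction with
    | mem v hv =>
      obtain ⟨a, w, ⟨j, hj⟩, rfl⟩ := hv
      obtain ⟨b, y, hb, h⟩ := locMonomial_mul_toLoc_mem hF a j hj w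
      obtain ⟨L, hL⟩ : ∃ m : ℕ, ∀ i, 0 ≤ b i + m :=
        ⟨∑ i, (b i).natAbs, fun i => by
          have := Finset.single_le_sum (f := fun i => (b i).natAbs) (fun _ _ => Nat.zero_le _)
            (Finset.mem_univ i)
          omega⟩
      have hLj : L ≤ (b j + L).toNat := by omega
      rw [h, hGs, locMonomial_eq_mul_invMon hF.comm b L hL, hGs]
      have h5 : G (invMon F.s L) = x L := by
        exact (hG (invMon F.s L) L 1 (by simp)).trans (one_smul _ _)
      rw [h5, sMon_eq_mul_pow hF.comm (c := fun i => (b i + L).toNat) hLj, mul_smul, h₂, smul_zero,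
        smul_zero]
    | zero => exact map_zero G
    | add v w _ _ hv hw => rw [map_add, hv, hw, add_zero]
    | smul c v _ hv =>
      rw [Algebra.smul_def, ← AlgHom.commutes (toLoc F.s), hGs, hv, smul_zero]
  let G' : LocQuot F →+ P := QuotientAddGroup.lift (nonnegSpan F.s).toAddSubgroup G hG0
  have hG' : ∀ v, G' (LocQuot.mk F v) = G v := fun _ => rfl
  refine ⟨{ G' with map_smul' := fun r s => ?_ }, fun l => ?_⟩
  · obtain ⟨v, rfl⟩ := LocQuot.mk_surjective F s
    show G' (r • LocQuot.mk F v) = r • G' _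
    rw [LocQuot.smul_mk, hG', hG', hGs]
  · show G (invMon F.s l) = x l
    exact (hG (invMon F.s l) l 1 (by simp)).trans (one_smul _ _)

end LocQuotElements

/-! ### Regular and coregular families -/

section Regular

variable {U : Type u} [Ring U] {M : Type u} [AddCommGroup M] [Module U M] {ι : Type*}

variable (M) in
/-- The subgroup `∑ j ∈ S, G j M`. -/
def rangeSum (G : ι → U) (S : Finset ι) : AddSubgroup M where
  carrier := {x | ∃ y : ι → M, x = ∑ j ∈ S, G j • y j}
  zero_mem' := ⟨0, by simp⟩
  add_mem' := by
    rintro _ _ ⟨y, rfl⟩ ⟨z, rfl⟩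
    exact ⟨y + z, by simp [smul_add, Finset.sum_add_distrib]⟩
  neg_mem' := by
    rintro _ ⟨y, rfl⟩
    exact ⟨-y, by simp⟩

theorem mem_rangeSum {G : ι → U} {S : Finset ι} {x : M} :
    x ∈ rangeSum M G S ↔ ∃ y : ι → M, x = ∑ j ∈ S, G j • y j := Iff.rfl

theorem smul_mem_rangeSum_of_mem (G : ι → U) {S : Finset ι} {j : ι} (hj : j ∈ S) (x : M) :
    G j • x ∈ rangeSum M G S := by
  classical
  exact ⟨Pi.single j x, by
    rw [Finset.sum_eq_single j (fun i _ hi => by simp [hi]) (fun h => absurd hj h)]; simp⟩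

theorem smul_mem_rangeSum {G : ι → U} {S : Finset ι} {u : U} (hu : ∀ j ∈ S, Commute u (G j)) {x : M}
    (hx : x ∈ rangeSum M G S) : u • x ∈ rangeSum M G S := by
  obtain ⟨y, rfl⟩ := hx
  refine ⟨fun j => u • y j, ?_⟩
  rw [Finset.smul_sum]
  exact Finset.sum_congr rfl fun j hj => by rw [← mul_smul, ← mul_smul, (hu j hj).eq]

theorem rangeSum_congr {G G' : ι → U} {S : Finset ι} (h : ∀ j ∈ S, G j = G' j) :
    rangeSum M G S = rangeSum M G' S := by
  ext x
  simp only [mem_rangeSum]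
  exact exists_congr fun y => by rw [Finset.sum_congr rfl fun j hj => by rw [h j hj]]

/-- If each `G a` acts injectively modulo the images of later `G j`, then all relations between the
`G j` are trivial. -/
theorem mem_rangeSum_erase_of_sum_eq_zero [LinearOrder ι] {G : ι → U}
    (hreg : ∀ (a : ι) (S : Finset ι), (∀ j ∈ S, a < j) → ∀ x : M,
      G a • x ∈ rangeSum M G S → x ∈ rangeSum M G S)
    (hG : ∀ i j, Commute (G i) (G j)) (S : Finset ι) :
    ∀ x : ι → M, ∑ i ∈ S, G i • x i = 0 → ∀ j ∈ S, x j ∈ rangeSum M G (S.erase j) := by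
  induction S using Finset.induction_on_min with
  | empty => simp
  | insert a S ha ih =>
    intro x hx j hj
    have haS : a ∉ S := fun h => lt_irrefl _ (ha a h)
    rw [Finset.sum_insert haS] at hx
    -- Regularity applies to the smallest index a, since all other indices in the relation come
    -- later.
    have h1 : x a ∈ rangeSum M G S := hreg a S ha _ ⟨fun i => -x i, by
      rw [eq_neg_of_add_eq_zero_left hx]; simp⟩
    rcases Finset.mem_insert.1 hj with rfl | hjS
    · rwa [Finset.erase_insert haS]
    obtain ⟨v, hv⟩ := h1
    -- Inserting x a = ∑ G i v i yields a relation without the index a; the correction terms are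
    -- multiples of G a and are put back at the end.
    have h2 : ∑ i ∈ S, G i • (x i + G a • v i) = 0 := by
      rw [← hx, hv, Finset.smul_sum, ← Finset.sum_add_distrib]
      refine Finset.sum_congr rfl fun i _ => ?_
      rw [smul_add, ← mul_smul, ← mul_smul, (hG i a).eq, add_comm]
    obtain ⟨w, hw⟩ := ih _ h2 j hjS
    have hja : j ≠ a := fun h => haS (h ▸ hjS)
    have h3 : x j = (x j + G a • v j) - G a • v j := by abel
    rw [h3]
    refine sub_mem ?_ (smul_mem_rangeSum_of_mem G
      (Finset.mem_erase.2 ⟨hja.symm, Finset.mem_insert_self _ _⟩) _)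
    rw [hw]
    exact sum_mem fun i hi => smul_mem_rangeSum_of_mem G
      (Finset.erase_subset_erase _ (Finset.subset_insert _ _) hi) _

/-- The dual statement for surjectivity on the common kernels of later elements. -/
theorem exists_smul_eq_of_coregular [LinearOrder ι] {G : ι → U} {S₀ : Finset ι}
    (hco : ∀ a ∈ S₀, ∀ S ⊆ S₀, (∀ j ∈ S, a < j) → ∀ x : M, (∀ j ∈ S, G j • x = 0) →
      ∃ y, G a • y = x ∧ ∀ j ∈ S, G j • y = 0)
    (hG : ∀ i j, Commute (G i) (G j)) (S : Finset ι) (hS : S ⊆ S₀) :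
    ∀ j ∈ S, ∀ x : M, (∀ i ∈ S.erase j, G i • x = 0) →
      ∃ y, G j • y = x ∧ ∀ i ∈ S.erase j, G i • y = 0 := by
  have hcs : ∀ (i j : ι) (x : M), G i • G j • x = G j • G i • x := fun i j x => by
    rw [← mul_smul, ← mul_smul, (hG i j).eq]
  induction S using Finset.induction_on_min with
  | empty => simp
  | insert a S ha ih =>
    intro j hj x hx
    have haS : a ∉ S := fun h => lt_irrefl _ (ha a h)
    have haS₀ := hS (Finset.mem_insert_self a S)
    have hSS₀ := (Finset.subset_insert a S).trans hS
    rcases Finset.mem_insert.1 hj with rfl | hjS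
    · rw [Finset.erase_insert haS] at hx ⊢
      exact hco j haS₀ S hSS₀ ha x hx
    have hja : a ≠ j := fun h => haS (h ▸ hjS)
    rw [Finset.erase_insert_of_ne hja] at hx ⊢
    obtain ⟨y, hy, hy'⟩ := ih hSS₀ j hjS x fun i hi => hx i (Finset.mem_insert_of_mem hi)
    -- The preimage y may fail to be killed by G a. The defect G a y is killed by all G i with i in
    -- S, so it is removed by subtracting some z that these G i kill.
    obtain ⟨z, hz, hz'⟩ := hco a haS₀ S hSS₀ ha (G a • y) (fun i hi => by
      rw [hcs]
      rcases eq_or_ne i j with rfl | hij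
      · rw [hy, hx a (Finset.mem_insert_self _ _)]
      · rw [hy' i (Finset.mem_erase.2 ⟨hij, hi⟩), smul_zero])
    refine ⟨y - z, by rw [smul_sub, hy, hz' j hjS, sub_zero], fun i hi => ?_⟩
    rcases Finset.mem_insert.1 hi with rfl | hi
    · rw [smul_sub, hz, sub_self]
    · rw [smul_sub, hy' i hi, hz' i (Finset.mem_of_mem_erase hi), sub_zero]

end Regular

/-! ### Kashiwara-type lemmas for a pair of operators -/

section Kashiwara

variable {U : Type u} [Ring U] [Algebra ℂ U] {M : Type u} [AddCommGroup M] [Module U M]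

variable (M) in
/-- `x` acts locally nilpotently on `M`. -/
def LocNil (x : U) : Prop := ∀ m : M, ∃ k : ℕ, x ^ k • m = 0

/-- A subgroup of a module which is stable under scalars. -/
def ScalarStable (B : AddSubgroup M) : Prop := ∀ (z : ℂ), ∀ b ∈ B, algebraMap ℂ U z • b ∈ B

theorem mem_of_natCast_smul_mem {B : AddSubgroup M} (hB : ScalarStable (U := U) B) (j : ℕ) {y : M}
    (h : (j + 1) • y ∈ B) : y ∈ B := by
  have h1 := hB ((j + 1 : ℂ)⁻¹) _ h
  have h2 : algebraMap ℂ U ((j + 1 : ℂ)⁻¹) • (j + 1) • y = y := by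
    rw [← Nat.cast_smul_eq_nsmul U, ← mul_smul, ← map_natCast (algebraMap ℂ U), ← map_mul,
      Nat.cast_add, Nat.cast_one, inv_mul_cancel₀ (by exact_mod_cast Nat.succ_ne_zero j), map_one,
      one_smul]
  rwa [h2] at h1

variable {h : U} {c : ℂ}

/-- Write y = c⁻¹ (h y - (h - c) y) and induct on the power of h - c that kills y: invertibility of
h passes to quotients by stable subgroups. -/
theorem mem_of_smul_mem (hc : c ≠ 0) (hh : LocNil M (h - algebraMap ℂ U c)) {B : AddSubgroup M}
    (hB : ScalarStable (U := U) B) (hBh : ∀ b ∈ B, h • b ∈ B) {y : M} (hy : h • y ∈ B) : y ∈ B := by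
  obtain ⟨k, hk⟩ := hh y
  induction k generalizing y with
  | zero =>
    have : y = 0 := by simpa using hk
    exact this ▸ zero_mem _
  | succ k ih =>
    have h1 : (h - algebraMap ℂ U c) • y ∈ B := by
      refine ih ?_ (by rwa [← mul_smul, ← pow_succ])
      have : h • (h - algebraMap ℂ U c) • y = h • h • y - algebraMap ℂ U c • h • y := by
        rw [← mul_smul, mul_sub, ← Algebra.commutes c h, sub_smul, mul_smul, mul_smul]
      rw [this]
      exact sub_mem (hBh _ hy) (hB _ _ hy)
    have h2 := hB c⁻¹ _ (sub_mem hy h1)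
    have h3 : algebraMap ℂ U c⁻¹ • (h • y - (h - algebraMap ℂ U c) • y) = y := by
      rw [sub_smul, sub_sub_cancel, ← mul_smul, ← map_mul, inv_mul_cancel₀ hc, map_one, one_smul]
    rwa [h3] at h2

/-- If w' solves the equation for (h - c) y, then c⁻¹ (y - w') solves it for y. -/
theorem exists_smul_eq (hc : c ≠ 0) (hh : LocNil M (h - algebraMap ℂ U c)) {B : AddSubgroup M}
    (hB : ScalarStable (U := U) B) (hBh : ∀ b ∈ B, h • b ∈ B) {y : M} (hy : y ∈ B) :
    ∃ w ∈ B, h • w = y := by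
  obtain ⟨k, hk⟩ := hh y
  induction k generalizing y with
  | zero =>
    have : y = 0 := by simpa using hk
    exact ⟨0, zero_mem _, by simp [this]⟩
  | succ k ih =>
    have h1 : (h - algebraMap ℂ U c) • y ∈ B := by
      rw [sub_smul]; exact sub_mem (hBh _ hy) (hB _ _ hy)
    obtain ⟨w, hw, hw'⟩ := ih h1 (by rwa [← mul_smul, ← pow_succ])
    refine ⟨algebraMap ℂ U c⁻¹ • (y - w), hB _ _ (sub_mem hy hw), ?_⟩
    rw [← mul_smul, ← Algebra.commutes, mul_smul, smul_sub, hw', sub_smul, sub_sub_cancel,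
      ← mul_smul, ← map_mul, inv_mul_cancel₀ hc, map_one, one_smul]

variable {e f : U} (hef : e * f - f * e = h)
include hef

/-- The usual sl₂ formula, with h commuting with e. Commutation is asked on Y only, because it is
used for h = h_n and e = e_0, where [h_n, e_0] = 2 e_n acts as zero just on the kernel of e_n. -/
theorem pow_smul_smul {Y : AddSubgroup M} (hYe : ∀ y ∈ Y, e • y ∈ Y)
    (hY : ∀ y ∈ Y, h • e • y = e • h • y) {x : M} (hx : x ∈ Y) (j : ℕ) :
    e ^ (j + 1) • f • x = f • e ^ (j + 1) • x + (j + 1) • h • e ^ j • x := by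
  have hmem : ∀ j : ℕ, e ^ j • x ∈ Y := by
    intro j
    induction j with
    | zero => simpa using hx
    | succ j ih => rw [pow_succ', mul_smul]; exact hYe _ ih
  have hswap : ∀ y : M, e • f • y = f • e • y + h • y := fun y => by
    rw [← hef, sub_smul, mul_smul, mul_smul]; abel
  induction j with
  | zero => simp [hswap]
  | succ j ih =>
    rw [pow_succ', mul_smul, ih, smul_add, hswap, ← mul_smul e (e ^ (j + 1)), ← pow_succ',
      smul_comm e (j + 1), ← hY _ (hmem j), ← mul_smul e (e ^ j), ← pow_succ', add_assoc,
      succ_nsmul _ (j + 1), add_comm (h • _)]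

/-- Let `[e, f] = h` with `e` locally nilpotent, `h` invertible and commuting with `e`. Then `e * f`
is injective modulo each stable subgroup `B`. -/
theorem mem_of_smul_smul_mem (hc : c ≠ 0) (hh : LocNil M (h - algebraMap ℂ U c)) (he : LocNil M e)
    {B Y : AddSubgroup M} (hB : ScalarStable (U := U) B) (hBh : ∀ b ∈ B, h • b ∈ B)
    (hBe : ∀ b ∈ B, e • b ∈ B) (hBf : ∀ b ∈ B, f • b ∈ B) (hYe : ∀ y ∈ Y, e • y ∈ Y)
    (hY : ∀ y ∈ Y, h • e • y = e • h • y) {y : M} (hy : y ∈ Y) (hefy : e • f • y ∈ B) : y ∈ B := by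
  classical
  have hex : ∃ k, e ^ k • y ∈ B := by
    obtain ⟨k, hk⟩ := he y
    exact ⟨k, hk ▸ zero_mem _⟩
  have hmem : ∀ (j : ℕ) (b : M), b ∈ B → e ^ j • b ∈ B := by
    intro j
    induction j with
    | zero => intro b hb; simpa using hb
    | succ j ih => intro b hb; rw [pow_succ, mul_smul]; exact ih _ (hBe _ hb)
  rcases hk : Nat.find hex with _ | j
  · have := Nat.find_spec hex
    rw [hk] at this
    simpa using this
  · exfalso
    have h1 := Nat.find_spec hex
    rw [hk] at h1
    refine Nat.find_min hex (m := j) (by omega) ?_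
    -- For the least k = j + 1 with e^k y in B, the formula puts (j + 1) h e^j y into B. Both
    -- scalars and h can be cancelled modulo B, which contradicts minimality.
    refine mem_of_smul_mem hc hh hB hBh (mem_of_natCast_smul_mem (U := U) hB j ?_)
    rw [← add_sub_cancel_left (f • e ^ (j + 1) • y) ((j + 1) • h • e ^ j • y),
      ← pow_smul_smul hef hYe hY hy, pow_succ, mul_smul]
    exact sub_mem (hmem _ _ hefy) (hBf _ (by simpa [pow_succ, mul_smul] using h1))

/-- Under the same hypotheses, `e` is surjective on each stable subgroup. -/
theorem exists_smul_eq_of_locNil (hc : c ≠ 0) (hh : LocNil M (h - algebraMap ℂ U c))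
    (he : LocNil M e) {Z : AddSubgroup M} (hZ : ScalarStable (U := U) Z)
    (hZh : ∀ b ∈ Z, h • b ∈ Z) (hZe : ∀ b ∈ Z, e • b ∈ Z) (hZf : ∀ b ∈ Z, f • b ∈ Z)
    (hZc : ∀ y ∈ Z, h • e • y = e • h • y) {x : M} (hx : x ∈ Z) : ∃ y ∈ Z, e • y = x := by
  have hpow : ∀ (m : ℕ) (y : M), y ∈ Z → h • e ^ m • y = e ^ m • h • y ∧ e ^ m • y ∈ Z := by
    intro m
    induction m with
    | zero => intro y hy; simpa using hy
    | succ m ih =>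
      intro y hy
      rw [pow_succ', mul_smul, mul_smul, hZc _ (ih y hy).2, (ih y hy).1]
      exact ⟨rfl, hZe _ (ih y hy).2⟩
  have key : ∀ (m : ℕ) (x : M), x ∈ Z → e ^ m • x = 0 → ∃ y ∈ Z, e • y = x := by
    intro m
    induction m with
    | zero => intro x _ h0; exact ⟨0, zero_mem _, by simpa using h0.symm⟩
    | succ m ih =>
      intro x hx h0
      -- Induction on the power of e killing x. With h w = x and e^(m+1) w = 0 the formula gives e^m
      -- (e f w - (m + 1) x) = 0, so the inductive hypothesis makes (m + 1) x a value of e.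
      obtain ⟨w, ⟨hwZ, hw⟩, hwx⟩ := exists_smul_eq (U := U) hc hh
        (B := Z ⊓ (DistribSMul.toAddMonoidHom M (e ^ (m + 1))).ker)
        (fun z b hb => ⟨hZ z b hb.1, by
          have h2 : e ^ (m + 1) • b = 0 := hb.2
          show e ^ (m + 1) • algebraMap ℂ U z • b = 0
          rw [← mul_smul, ← Algebra.commutes, mul_smul, h2, smul_zero]⟩)
        (fun b hb => ⟨hZh b hb.1, by
          have h2 : e ^ (m + 1) • b = 0 := hb.2
          show e ^ (m + 1) • h • b = 0
          rw [← (hpow _ b hb.1).1, h2, smul_zero]⟩)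
        (y := x) ⟨hx, h0⟩
      have hw' : e ^ (m + 1) • w = 0 := hw
      obtain ⟨y, hy, hyx⟩ := ih (e • f • w - (m + 1) • x)
        (sub_mem (hZe _ (hZf _ hwZ)) (nsmul_mem hx _)) (by
          rw [smul_sub, ← mul_smul, ← pow_succ, pow_smul_smul hef hZe hZc hwZ, hw', smul_zero,
            zero_add, smul_comm (e ^ m) (m + 1), ← hwx, (hpow m w hwZ).1, sub_self])
      obtain ⟨v, hv, hvx⟩ : ∃ v ∈ Z, e • v = (m + 1) • x :=
        ⟨f • w - y, sub_mem (hZf _ hwZ) hy, by rw [smul_sub, hyx]; abel⟩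
      refine ⟨algebraMap ℂ U ((m + 1 : ℂ)⁻¹) • v, hZ _ _ hv, ?_⟩
      rw [← mul_smul, ← Algebra.commutes, mul_smul, hvx, ← Nat.cast_smul_eq_nsmul U, ← mul_smul,
        ← map_natCast (algebraMap ℂ U), ← map_mul, Nat.cast_add, Nat.cast_one,
        inv_mul_cancel₀ (by exact_mod_cast Nat.succ_ne_zero m), map_one, one_smul]
  obtain ⟨m, hm⟩ := he x
  exact key m x hx hm

end Kashiwara

/-! ### Modules over truncated current algebras of `sl₂` -/

/-- Elements `e i`, `f i`, `h i` of a ring satisfying the relations of `sl₂ ⊗ ℂ[t]/(t^(n+1))`. -/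
structure CurrentTriple (U : Type u) [Ring U] (n : ℕ) where
  e : ℕ → U
  f : ℕ → U
  h : ℕ → U
  e_f : ∀ i j, e i * f j - f j * e i = h (i + j)
  h_e : ∀ i j, h i * e j - e j * h i = 2 * e (i + j)
  h_f : ∀ i j, h i * f j - f j * h i = -(2 * f (i + j))
  e_comm : ∀ i j, Commute (e i) (e j)
  f_comm : ∀ i j, Commute (f i) (f j)
  e_zero : ∀ i, n < i → e i = 0
  f_zero : ∀ i, n < i → f i = 0
  h_zero : ∀ i, n < i → h i = 0

namespace CurrentTriple

variable {U : Type u} [Ring U] [Algebra ℂ U] {n : ℕ} (t : CurrentTriple U n)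

/-- The roles of `e` and `f` exchanged. -/
def swap : CurrentTriple U n where
  e := t.f
  f := t.e
  h i := -t.h i
  e_f i j := by rw [← neg_sub, t.e_f, add_comm]
  h_e i j := by
    rw [← neg_eq_iff_eq_neg.2 (t.h_f i j)]; noncomm_ring
  h_f i j := by
    have := t.h_e i j
    rw [← this]; noncomm_ring
  e_comm := t.f_comm
  f_comm := t.e_comm
  e_zero := t.f_zero
  f_zero := t.e_zero
  h_zero i hi := by rw [t.h_zero i hi, neg_zero]

theorem commute_e_f {i j : ℕ} (hij : n < i + j) : Commute (t.e i) (t.f j) :=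
  sub_eq_zero.1 (by rw [t.e_f, t.h_zero _ hij])

theorem commute_h_e {i j : ℕ} (hij : n < i + j) : Commute (t.h i) (t.e j) :=
  sub_eq_zero.1 (by rw [t.h_e, t.e_zero _ hij, mul_zero])

theorem commute_h_f {i j : ℕ} (hij : n < i + j) : Commute (t.h i) (t.f j) :=
  sub_eq_zero.1 (by rw [t.h_f, t.f_zero _ hij, mul_zero, neg_zero])

variable {M : Type u} [AddCommGroup M] [Module U M] {c : ℂ}

/-- The kernel of an element on a module. -/
def kerOf (M : Type u) [AddCommGroup M] [Module U M] (x : U) : AddSubgroup M :=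
  (DistribSMul.toAddMonoidHom M x).ker

omit [Algebra ℂ U] in
theorem mem_kerOf {x : U} {m : M} : m ∈ kerOf M x ↔ x • m = 0 := Iff.rfl

omit [Algebra ℂ U] in
theorem smul_mem_kerOf {x y : U} (hxy : Commute x y) {m : M} (hm : m ∈ kerOf M x) :
    y • m ∈ kerOf M x := by
  rw [mem_kerOf] at hm ⊢
  rw [← mul_smul, hxy.eq, mul_smul, hm, smul_zero]

theorem scalarStable_kerOf (x : U) : ScalarStable (U := U) (kerOf M x) := fun z _ hb =>
  smul_mem_kerOf (Algebra.commutes z x).symm hb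

theorem scalarStable_bot : ScalarStable (U := U) (⊥ : AddSubgroup M) := fun z b hb => by
  rw [AddSubgroup.mem_bot] at hb ⊢; rw [hb, smul_zero]

theorem scalarStable_rangeSum {ι : Type*} (G : ι → U) (S : Finset ι) :
    ScalarStable (U := U) (rangeSum M G S) := fun z _ hb =>
  smul_mem_rangeSum (fun j _ => Algebra.commutes z (G j)) hb

variable (hn : 1 ≤ n) (hc : c ≠ 0) (hh : LocNil M (t.h n - algebraMap ℂ U c))
  (he : ∀ i ≤ n, LocNil M (t.e i))
include hn hc hh he

/-- The pair e_0, f_n has bracket h_n, which commutes with e_0 on the kernel of e_n; on this kernel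
e_0 f_n is injective. -/
theorem eq_zero_of_e_f_last {x : M} (hx : t.e n • x = 0) (hfx : t.e 0 • t.f n • x = 0) : x = 0 := by
  have := mem_of_smul_smul_mem (e := t.e 0) (f := t.f n) (h := t.h n) (by simpa using t.e_f 0 n)
    hc hh (he 0 (Nat.zero_le _)) (B := ⊥) (Y := kerOf M (t.e n)) scalarStable_bot
    (fun b hb => by simp_all) (fun b hb => by simp_all) (fun b hb => by simp_all)
    (fun y hy => smul_mem_kerOf (t.e_comm n 0) hy) (fun y hy => by
      rw [← mul_smul, ← mul_smul, ← sub_eq_zero, ← sub_smul, t.h_e, mul_smul, add_zero,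
        mem_kerOf.1 hy, smul_zero]) (y := x) hx (by simp [hfx])
  simpa using this

/-- The elements e_n and f_n commute because 2n > n, so f_n also kills every e_n^k x. The last
nonzero such vector would lie in the kernel of e_n, contradicting injectivity of e_0 f_n there. -/
theorem f_last_injective {x : M} (hfx : t.f n • x = 0) : x = 0 := by
  obtain ⟨k, hk⟩ := he n le_rfl x
  induction k with
  | zero => simpa using hk
  | succ k ih =>
    refine ih (t.eq_zero_of_e_f_last hn hc hh he (by rwa [← mul_smul, ← pow_succ']) ?_)
    rw [← mul_smul (t.f n), ((t.commute_e_f (by omega)).pow_left k).eq.symm, mul_smul, hfx, smul_zero,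
      smul_zero]

/-- The exponentiated family `f i ^ l i`. -/
def fPow (l : Fin (n + 1) → ℕ) (i : Fin (n + 1)) : U := t.f i ^ l i

omit [Algebra ℂ U] hn hc hh he in
theorem fPow_commute (l l' : Fin (n + 1) → ℕ) (i j : Fin (n + 1)) :
    Commute (t.fPow l i) (t.fPow l' j) := (t.f_comm i j).pow_pow _ _

/-- The pair e_{n-a}, f_a has bracket h_n. For j > a all three operators commute with f_j since the
indices add up to more than n, and h_n commutes with e_{n-a} since a < n; thus the subgroup is
stable and the Kashiwara argument applies modulo it. -/
theorem mem_rangeSum_of_e_f {l : Fin (n + 1) → ℕ} {a : Fin (n + 1)} (han : a ≠ Fin.last n)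
    {S : Finset (Fin (n + 1))} (hS : ∀ j ∈ S, a < j) {x : M}
    (hx : t.e (n - a) • t.f a • x ∈ rangeSum M (t.fPow l) S) : x ∈ rangeSum M (t.fPow l) S := by
  have ha : (a : ℕ) < n := Fin.val_lt_last han
  refine mem_of_smul_smul_mem (e := t.e (n - a)) (f := t.f a) (h := t.h n)
    (by rw [t.e_f, Nat.sub_add_cancel ha.le]) hc hh (he _ (Nat.sub_le _ _)) (Y := ⊤)
    (scalarStable_rangeSum _ _) ?_ ?_ ?_ (fun _ _ => trivial) ?_ trivial hx
  · exact fun b hb => smul_mem_rangeSum (fun j hj =>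
      (t.commute_h_f (by have := hS j hj; rw [Fin.lt_def] at this; omega)).pow_right _) hb
  · exact fun b hb => smul_mem_rangeSum (fun j hj =>
      (t.commute_e_f (by have := hS j hj; rw [Fin.lt_def] at this; omega)).pow_right _) hb
  · exact fun b hb => smul_mem_rangeSum (fun j hj => (t.f_comm _ _).pow_right _) hb
  · intro y _
    rw [← mul_smul, ← mul_smul, (t.commute_h_e (by omega)).eq]

/-- For a < n, apply e_{n-a} and use injectivity of e_{n-a} f_a modulo the later images. For a = n
there are no later indices and f_n itself is injective. Powers follow by iteration. -/
theorem f_regular (l : Fin (n + 1) → ℕ) (a : Fin (n + 1)) (S : Finset (Fin (n + 1)))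
    (hS : ∀ j ∈ S, a < j) (x : M) (hx : t.fPow l a • x ∈ rangeSum M (t.fPow l) S) :
    x ∈ rangeSum M (t.fPow l) S := by
  have key : ∀ x : M, t.f a • x ∈ rangeSum M (t.fPow l) S → x ∈ rangeSum M (t.fPow l) S := by
    intro x hx
    rcases eq_or_ne a (Fin.last n) with rfl | han
    · obtain rfl : S = ∅ := Finset.eq_empty_of_forall_notMem fun j hj =>
        absurd (hS j hj) (Fin.le_last j).not_gt
      obtain ⟨y, hy⟩ := hx
      exact ⟨0, by simpa using t.f_last_injective hn hc hh he (by simpa using hy)⟩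
    · have ha : (a : ℕ) < n := Fin.val_lt_last han
      refine t.mem_rangeSum_of_e_f hn hc hh he han hS ?_
      exact smul_mem_rangeSum (fun j hj =>
        (t.commute_e_f (by have := hS j hj; rw [Fin.lt_def] at this; omega)).pow_right _) hx
  have : ∀ p : ℕ, ∀ x : M, t.f a ^ p • x ∈ rangeSum M (t.fPow l) S →
      x ∈ rangeSum M (t.fPow l) S := by
    intro p
    induction p with
    | zero => intro x hx; simpa using hx
    | succ p ih => intro x hx; exact ih x (key _ (by rwa [← mul_smul, ← pow_succ']))
  exact this _ x hx

/-- If `e i` acts locally nilpotently and `h n` invertibly, then `f 0, …, f n` is a regular sequence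
in each order, also after passing to powers. -/
theorem mem_rangeSum_of_pow_smul (l : Fin (n + 1) → ℕ) (j : Fin (n + 1)) (p : ℕ) {x : M}
    (hx : t.f j ^ p • x ∈ rangeSum M (t.fPow l) (Finset.univ.erase j)) :
    x ∈ rangeSum M (t.fPow l) (Finset.univ.erase j) := by
  obtain ⟨y, hy⟩ := hx
  have hl : ∀ i ∈ Finset.univ.erase j, t.fPow (Function.update l j p) i = t.fPow l i := by
    intro i hi
    simp [fPow, Function.update_of_ne (Finset.ne_of_mem_erase hi)]
  -- The membership is read as a relation whose j-th coefficient is x, with the exponent of f_j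
  -- changed to p.
  have h1 := mem_rangeSum_erase_of_sum_eq_zero (M := M) (G := t.fPow (Function.update l j p))
    (t.f_regular hn hc hh he _) (t.fPow_commute _ _) Finset.univ
    (Function.update (fun i => -y i) j x) (by
      rw [← Finset.add_sum_erase _ _ (Finset.mem_univ j), Function.update_self,
        show t.fPow (Function.update l j p) j = t.f j ^ p by simp [fPow], hy,
        ← Finset.sum_add_distrib]
      refine Finset.sum_eq_zero fun i hi => ?_
      rw [hl i hi, Function.update_of_ne (Finset.ne_of_mem_erase hi), smul_neg, add_neg_cancel])
    j (Finset.mem_univ j)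
  rwa [Function.update_self, rangeSum_congr hl] at h1

/-- The colon property of powers of a regular sequence, proved by cancelling one factor f_j at a
time. This lets exponents in S ⊗ M be compared after raising them to a common value. -/
theorem mem_rangeSum_of_sMon_smul (d : Fin (n + 1) → ℕ) : ∀ (l : Fin (n + 1) → ℕ), d ≤ l → ∀ x : M,
    sMon (fun i : Fin (n + 1) => t.f i) d • x ∈ rangeSum M (t.fPow l) Finset.univ →
      x ∈ rangeSum M (t.fPow (l - d)) Finset.univ := by
  have hcomm : ∀ i j : Fin (n + 1), Commute (t.f i) (t.f j) := fun i j => t.f_comm i j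
  induction hN : ∑ i, d i generalizing d with
  | zero =>
    intro l _ x hx
    have hd : d = 0 := funext fun i => (Finset.sum_eq_zero_iff.1 hN) i (Finset.mem_univ i)
    subst hd
    simpa [sMon_zero] using hx
  | succ N ih =>
    intro l hdl x hx
    obtain ⟨j, hj⟩ : ∃ j, d j ≠ 0 := by
      by_contra! h
      simp [h] at hN
    have hsd : sMon (fun i : Fin (n + 1) => t.f i) d
        = t.f j * sMon (fun i : Fin (n + 1) => t.f i) (d - Pi.single j 1) := by
      rw [sMon_eq_mul_pow hcomm (c := d) (i := j) (m := 1) (by omega), ← sMon_comm_pow hcomm, pow_one]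
    have hsum : ∑ i, (d - Pi.single j 1 : Fin (n + 1) → ℕ) i = N := by
      have h1 : d = (d - Pi.single j 1) + Pi.single j 1 := by
        funext i
        rcases eq_or_ne i j with rfl | hij
        · simp; omega
        · simp [hij]
      have h2 := congrArg (fun d : Fin (n + 1) → ℕ => ∑ i, d i) h1
      simp only [Pi.add_apply, Finset.sum_add_distrib, Finset.sum_pi_single', Finset.mem_univ,
        if_true, hN] at h2
      omega
    rw [hsd, mul_smul] at hx
    obtain ⟨y, hy⟩ := hx
    set z := sMon (fun i : Fin (n + 1) => t.f i) (d - Pi.single j 1) • x with hz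
    set l' := l - Pi.single j 1 with hl'
    have hlj : 1 ≤ l j := le_trans (Nat.one_le_iff_ne_zero.2 hj) (hdl j)
    have hlne : ∀ i ∈ Finset.univ.erase j, t.fPow l' i = t.fPow l i := fun i hi => by
      simp [fPow, hl', Finset.ne_of_mem_erase hi]
    have hlself : t.fPow l j = t.f j * t.fPow l' j := by
      simp only [fPow, hl', Pi.sub_apply, Pi.single_eq_same]
      rw [← pow_succ', Nat.sub_add_cancel hlj]
    -- If f_j z = ∑ f_i^{l_i} y_i, then f_j (z - f_j^{l_j - 1} y_j) lies in the sum over i ≠ j,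
    -- where f_j may be cancelled.
    have h1 : t.f j ^ 1 • (z - t.fPow l' j • y j) ∈
        rangeSum M (t.fPow l) (Finset.univ.erase j) := by
      refine ⟨y, ?_⟩
      rw [pow_one, smul_sub, ← mul_smul (t.f j) (t.fPow l' j), ← hlself, hy,
        ← Finset.add_sum_erase _ _ (Finset.mem_univ j), add_sub_cancel_left]
    have h2 := t.mem_rangeSum_of_pow_smul hn hc hh he l j 1 h1
    rw [← rangeSum_congr hlne] at h2
    have h3 : z ∈ rangeSum M (t.fPow l') Finset.univ := by
      rw [← sub_add_cancel z (t.fPow l' j • y j)]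
      refine add_mem ?_ (smul_mem_rangeSum_of_mem _ (Finset.mem_univ j) _)
      obtain ⟨w, hw⟩ := h2
      rw [hw]
      exact sum_mem fun i _ => smul_mem_rangeSum_of_mem _ (Finset.mem_univ i) _
    have hdl' : d - Pi.single j 1 ≤ l' := fun i => Nat.sub_le_sub_right (hdl i) _
    have h4 := ih _ hsum l' hdl' x h3
    have h5 : l' - (d - Pi.single j 1) = l - d := by
      funext i
      have := hdl i
      rcases eq_or_ne i j with rfl | hij
      · simp [hl']; omega
      · simp [hl', hij]
    rwa [h5] at h4

/-- A vector killed by all `e i` which lies in `∑ i, f i M` vanishes. -/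
theorem eq_zero_of_e_smul_eq_zero {x : M} (hx : ∀ i ≤ n, t.e i • x = 0)
    (hfx : x ∈ rangeSum M (fun i : Fin (n + 1) => t.f i) Finset.univ) : x = 0 := by
  have h1 : (fun i : Fin (n + 1) => t.f i) = t.fPow (fun _ => 1) := by funext i; simp [fPow]
  rw [h1] at hfx
  -- Remove the smallest index a of S. Applying e_{n-a} shows that y a lies in the sum over the
  -- later indices, hence so does x. The index n, when left alone, is treated with the pair e_0,
  -- f_n.
  have key : ∀ S : Finset (Fin (n + 1)), ∀ x : M, (∀ i ≤ n, t.e i • x = 0) →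
      x ∈ rangeSum M (t.fPow fun _ => 1) S → x = 0 := by
    intro S
    induction S using Finset.induction_on_min with
    | empty => rintro x _ ⟨y, hy⟩; simpa using hy
    | insert a S ha ih =>
      rintro x hx ⟨y, hy⟩
      have haS : a ∉ S := fun h => lt_irrefl _ (ha a h)
      rw [Finset.sum_insert haS] at hy
      rcases eq_or_ne a (Fin.last n) with rfl | han
      · obtain rfl : S = ∅ := Finset.eq_empty_of_forall_notMem fun j hj =>
          absurd (ha j hj) (Fin.le_last j).not_gt
        have hxy : x = t.f n • y (Fin.last n) := by simpa [fPow] using hy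
        have h2 : t.e n • y (Fin.last n) = 0 := by
          refine t.f_last_injective hn hc hh he ?_
          rw [← mul_smul, ← (t.commute_e_f (by omega)).eq, mul_smul, ← hxy, hx n le_rfl]
        rw [hxy, t.eq_zero_of_e_f_last hn hc hh he h2 (by rw [← hxy, hx 0 (Nat.zero_le _)]), smul_zero]
      · have ha' : (a : ℕ) < n := Fin.val_lt_last han
        set b := ∑ j ∈ S, t.fPow (fun _ => 1) j • y j with hb
        have hbm : b ∈ rangeSum M (t.fPow fun _ => 1) S := ⟨y, rfl⟩
        have hy' : x = t.f a • y a + b := by simpa [fPow] using hy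
        have h2 : t.e (n - a) • t.f a • y a ∈ rangeSum M (t.fPow fun _ => 1) S := by
          have : t.e (n - a) • t.f a • y a = -(t.e (n - a) • b) := by
            rw [eq_neg_iff_add_eq_zero, ← smul_add, ← hy', hx _ (Nat.sub_le _ _)]
          rw [this]
          exact neg_mem (smul_mem_rangeSum (fun j hj =>
            (t.commute_e_f (by have := ha j hj; rw [Fin.lt_def] at this; omega)).pow_right _) hbm)
        have h3 := t.mem_rangeSum_of_e_f hn hc hh he han ha h2
        refine ih x hx ?_
        rw [hy']
        exact add_mem (smul_mem_rangeSum (fun j _ => (t.f_comm _ _).pow_right _) h3) hbm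
  exact key _ x hx hfx

/-- The exponentiated family `e i ^ l i`. -/
def ePow (l : Fin (n + 1) → ℕ) (i : Fin (n + 1)) : U := t.e i ^ l i

omit [Algebra ℂ U] hn hc hh he in
theorem ePow_commute (l l' : Fin (n + 1) → ℕ) (i j : Fin (n + 1)) :
    Commute (t.ePow l i) (t.ePow l' j) := (t.e_comm i j).pow_pow _ _

/-- The common kernel of a family. -/
def kerFamily (M : Type u) [AddCommGroup M] [Module U M] (G : Fin (n + 1) → U)
    (S : Finset (Fin (n + 1))) : AddSubgroup M := ⨅ j ∈ S, kerOf M (G j)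

omit [Algebra ℂ U] hn hc hh he in
theorem mem_kerFamily {G : Fin (n + 1) → U} {S : Finset (Fin (n + 1))} {m : M} :
    m ∈ kerFamily M G S ↔ ∀ j ∈ S, G j • m = 0 := by
  simp only [kerFamily, AddSubgroup.mem_iInf, mem_kerOf]

omit hn hc hh he in
theorem scalarStable_kerFamily (G : Fin (n + 1) → U) (S : Finset (Fin (n + 1))) :
    ScalarStable (U := U) (kerFamily M G S) := fun z b hb =>
  mem_kerFamily.2 fun j hj => scalarStable_kerOf (G j) z b (mem_kerFamily.1 hb j hj)

omit [Algebra ℂ U] hn hc hh he in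
theorem smul_mem_kerFamily {G : Fin (n + 1) → U} {S : Finset (Fin (n + 1))} {x : U}
    (hx : ∀ j ∈ S, Commute (G j) x) {m : M} (hm : m ∈ kerFamily M G S) :
    x • m ∈ kerFamily M G S :=
  mem_kerFamily.2 fun j hj => smul_mem_kerOf (hx j hj) (mem_kerFamily.1 hm j hj)

omit [Algebra ℂ U] hn hc hh he in
theorem exists_pow_smul_eq {l : Fin (n + 1) → ℕ} {a : Fin (n + 1)} {S : Finset (Fin (n + 1))}
    (hS : ∀ x ∈ kerFamily M (t.ePow l) S, ∃ y ∈ kerFamily M (t.ePow l) S, t.e a • y = x) (p : ℕ) :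
    ∀ x ∈ kerFamily M (t.ePow l) S, ∃ y ∈ kerFamily M (t.ePow l) S, t.e a ^ p • y = x := by
  induction p with
  | zero => exact fun x hx => ⟨x, hx, by simp⟩
  | succ p ih =>
    intro x hx
    obtain ⟨y, hy, hyx⟩ := ih x hx
    obtain ⟨z, hz, hzy⟩ := hS y hy
    exact ⟨z, hz, by rw [pow_succ, mul_smul, hzy, hyx]⟩

/-- Dual to the regularity of the f_a: the pair e_a, f_{n-a} has bracket h_n, and for a > 0 all
three preserve the common kernel of powers of later e_j, while h_n commutes with e_a. -/
theorem e_coregular_of_ne_zero (l : Fin (n + 1) → ℕ) {a : Fin (n + 1)} (ha : a ≠ 0)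
    {S : Finset (Fin (n + 1))} (hS : ∀ j ∈ S, a < j) (x : M) (hx : x ∈ kerFamily M (t.ePow l) S) :
    ∃ y ∈ kerFamily M (t.ePow l) S, t.e a • y = x := by
  have ha' : 0 < (a : ℕ) := Nat.pos_of_ne_zero fun h => ha (Fin.ext h)
  have han : (a : ℕ) ≤ n := Nat.lt_succ_iff.1 a.2
  refine exists_smul_eq_of_locNil (e := t.e a) (f := t.f (n - a)) (h := t.h n)
    (by rw [t.e_f, Nat.add_sub_cancel' han]) hc hh (he _ han) (scalarStable_kerFamily _ _)
    ?_ ?_ ?_ ?_ hx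
  · exact fun b hb => smul_mem_kerFamily (fun j hj => ((t.commute_h_e (by
      have := hS j hj; rw [Fin.lt_def] at this; omega)).pow_right _).symm) hb
  · exact fun b hb => smul_mem_kerFamily (fun j hj => (t.e_comm _ _).pow_left _) hb
  · exact fun b hb => smul_mem_kerFamily (fun j hj => (t.commute_e_f (by
      have := hS j hj; rw [Fin.lt_def] at this; omega)).pow_left _) hb
  · intro y _
    rw [← mul_smul, ← mul_smul, (t.commute_h_e (by omega)).eq]

/-- For a = 0 the bracket [h_n, e_0] = 2 e_n obstructs the direct argument, which works on the
kernel of e_n only. The general case is reached by induction on the power of e_n that kills x. -/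
theorem e_coregular_zero (l : Fin (n + 1) → ℕ) {S : Finset (Fin (n + 1))} (hS : ∀ j ∈ S, 0 < j)
    (x : M) (hx : x ∈ kerFamily M (t.ePow l) S) : ∃ y ∈ kerFamily M (t.ePow l) S, t.e 0 • y = x := by
  classical
  set S₁ := S.erase (Fin.last n) with hS₁
  have hlast : (Fin.last n).val = n := rfl
  have hZ1 : ∀ {G : Fin (n + 1) → U} {b : M} (u : U), (∀ j, Commute (G j) u) →
      b ∈ kerFamily M G S₁ → u • b ∈ kerFamily M G S₁ :=
    fun u hu hb => smul_mem_kerFamily (fun j _ => hu j) hb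
  have key : ∀ (p : ℕ) (x : M), x ∈ kerFamily M (t.ePow l) S₁ → t.e n ^ p • x = 0 →
      ∃ y ∈ kerFamily M (t.ePow l) S₁, t.e 0 • y = x ∧ t.e n ^ p • y = 0 := by
    intro p
    induction p with
    | zero => intro x _ h0; exact ⟨0, zero_mem _, by simpa using h0.symm, by simp⟩
    | succ p ih =>
      intro x hx h0
      obtain ⟨y, hy, hyx, hy0⟩ := ih (t.e n • x)
        (hZ1 _ (fun j => (t.e_comm _ _).pow_left _) hx) (by rwa [← mul_smul, ← pow_succ])
      have hl : ∀ i ∈ S₁, t.ePow (Function.update l (Fin.last n) 1) i = t.ePow l i := by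
        intro i hi
        simp [ePow, Function.update_of_ne (Finset.ne_of_mem_erase hi)]
      have hnS₁ : Fin.last n ∉ S₁ := Finset.notMem_erase _ _
      -- Solve e_0 y = e_n x by induction, then lift y through e_n to y'. Only indices different
      -- from 0 occur here (n ≥ 1), so surjectivity of e_n on the common kernel is already
      -- available; its exponent is set to 1.
      obtain ⟨y', hy'y, hy'⟩ := exists_smul_eq_of_coregular (M := M)
        (G := t.ePow (Function.update l (Fin.last n) 1)) (S₀ := insert (Fin.last n) S₁)
        (fun a ha T _ hT x hx => by
          have ha0 : a ≠ 0 := by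
            rcases Finset.mem_insert.1 ha with rfl | ha
            · exact fun h => by have := congrArg Fin.val h; simp at this; omega
            · exact (hS a (Finset.mem_of_mem_erase ha)).ne'
          obtain ⟨y, hy, hyx⟩ := t.exists_pow_smul_eq (t.e_coregular_of_ne_zero hn hc hh he _ ha0 hT)
            _ x (mem_kerFamily.2 hx)
          exact ⟨y, hyx, mem_kerFamily.1 hy⟩)
        (t.ePow_commute _ _) _ subset_rfl (Fin.last n) (Finset.mem_insert_self _ _) y (by
          rw [Finset.erase_insert hnS₁]
          intro i hi
          rw [hl i hi]
          exact mem_kerFamily.1 hy i hi)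
      rw [Finset.erase_insert hnS₁] at hy'
      have hy'Z : y' ∈ kerFamily M (t.ePow l) S₁ :=
        mem_kerFamily.2 fun i hi => by rw [← hl i hi]; exact hy' i hi
      have hy'n : t.e n • y' = y := by simpa [ePow] using hy'y
      -- The remaining error x - e_0 y' is killed by e_n, so e_0 can be inverted on it.
      obtain ⟨z, ⟨hzZ, hzn⟩, hz⟩ := exists_smul_eq_of_locNil (e := t.e 0) (f := t.f n) (h := t.h n)
        (by simpa using t.e_f 0 n) hc hh (he 0 (Nat.zero_le _))
        (Z := kerFamily M (t.ePow l) S₁ ⊓ kerOf M (t.e n))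
        (fun z b hb => ⟨scalarStable_kerFamily _ _ z b hb.1, scalarStable_kerOf _ z b hb.2⟩)
        (fun b hb => ⟨smul_mem_kerFamily (fun j hj => ((t.commute_h_e (by
            have := hS j (Finset.mem_of_mem_erase hj); rw [Fin.lt_def] at this; simp at this
            omega)).pow_right _).symm) hb.1, smul_mem_kerOf (t.commute_h_e (by omega)).symm hb.2⟩)
        (fun b hb => ⟨hZ1 _ (fun j => (t.e_comm _ _).pow_left _) hb.1,
          smul_mem_kerOf (t.e_comm _ _) hb.2⟩)
        (fun b hb => ⟨smul_mem_kerFamily (fun j hj => (t.commute_e_f (by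
            have := hS j (Finset.mem_of_mem_erase hj); rw [Fin.lt_def] at this; simp at this
            omega)).pow_left _) hb.1, smul_mem_kerOf (t.commute_e_f (by omega)) hb.2⟩)
        (fun y hy => by
          rw [← mul_smul, ← mul_smul, ← sub_eq_zero, ← sub_smul, t.h_e, mul_smul, add_zero,
            mem_kerOf.1 hy.2, smul_zero])
        (x := x - t.e 0 • y') (AddSubgroup.mem_inf.2
          ⟨sub_mem hx (hZ1 _ (fun j => (t.e_comm _ _).pow_left _) hy'Z), by
          rw [mem_kerOf]
          rw [smul_sub, ← mul_smul _ (t.e 0), (t.e_comm n 0).eq, mul_smul, hy'n, hyx, sub_self]⟩)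
      have hzn' : t.e n • z = 0 := hzn
      refine ⟨y' + z, add_mem hy'Z hzZ, by rw [smul_add, hz]; abel, ?_⟩
      rw [smul_add, pow_succ, mul_smul, mul_smul, hy'n, hzn', hy0, smul_zero, add_zero]
  have hxS₁ : x ∈ kerFamily M (t.ePow l) S₁ :=
    mem_kerFamily.2 fun j hj => mem_kerFamily.1 hx j (Finset.mem_of_mem_erase hj)
  by_cases hnS : Fin.last n ∈ S
  · obtain ⟨y, hy, hyx, hyn⟩ := key (l (Fin.last n)) x hxS₁ (mem_kerFamily.1 hx _ hnS)
    refine ⟨y, mem_kerFamily.2 fun j hj => ?_, hyx⟩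
    rcases eq_or_ne j (Fin.last n) with rfl | hj'
    · exact hyn
    · exact mem_kerFamily.1 hy j (Finset.mem_erase.2 ⟨hj', hj⟩)
  · obtain ⟨p, hp⟩ := he n le_rfl x
    obtain ⟨y, hy, hyx, -⟩ := key p x hxS₁ hp
    rw [hS₁, Finset.erase_eq_of_notMem hnS] at hy
    exact ⟨y, hy, hyx⟩

/-- If `e i` acts locally nilpotently and `h n` invertibly, then each `e j` is surjective on the
common kernel of powers of the other `e i`. -/
theorem exists_e_smul_eq (l : Fin (n + 1) → ℕ) (j : Fin (n + 1)) {x : M}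
    (hx : ∀ i, i ≠ j → t.e i ^ l i • x = 0) :
    ∃ y : M, t.e j • y = x ∧ ∀ i, i ≠ j → t.e i ^ l i • y = 0 := by
  obtain ⟨y, hyx, hy⟩ := exists_smul_eq_of_coregular (M := M)
    (G := t.ePow (Function.update l j 1)) (S₀ := Finset.univ)
    (fun a _ T _ hT x hx => by
      have h1 : ∀ x ∈ kerFamily M (t.ePow (Function.update l j 1)) T,
          ∃ y ∈ kerFamily M (t.ePow (Function.update l j 1)) T, t.e a • y = x := by
        rcases eq_or_ne a 0 with rfl | ha
        · exact t.e_coregular_zero hn hc hh he _ hT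
        · exact t.e_coregular_of_ne_zero hn hc hh he _ ha hT
      obtain ⟨y, hy, hyx⟩ := t.exists_pow_smul_eq h1 _ x (mem_kerFamily.2 hx)
      exact ⟨y, hyx, mem_kerFamily.1 hy⟩)
    (t.ePow_commute _ _) _ subset_rfl j (Finset.mem_univ j) x (fun i hi => by
      have hij := Finset.ne_of_mem_erase hi
      simpa [ePow, Function.update_of_ne hij] using hx i hij)
  refine ⟨y, by simpa [ePow] using hyx, fun i hij => ?_⟩
  simpa [ePow, Function.update_of_ne hij] using hy i (Finset.mem_erase.2 ⟨hij, Finset.mem_univ _⟩)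

end CurrentTriple

/-! ### Elements of S ⊗ M when the f_i form a regular sequence -/

section TensSig

variable {U : Type u} [Ring U] [Algebra ℂ U]

theorem tens_sum {S M : Type u} [AddCommGroup S] [Module U S] [Module Uᵐᵒᵖ S] [AddCommGroup M]
    [Module U M] {ι : Type*} (s : S) (T : Finset ι) (x : ι → M) :
    (tens s (∑ i ∈ T, x i) : TensorOver U S M) = ∑ i ∈ T, tens s (x i) := by
  classical
  induction T using Finset.induction_on with
  | empty => simp [tens_zero]
  | insert a T ha ih => rw [Finset.sum_insert ha, Finset.sum_insert ha, tens_add, ih]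

variable {n : ℕ} (t : CurrentTriple U n) {F : OreFamily U (n + 1)} (hF : F.IsGood)
  (hFt : ∀ i, F.s i = t.f i) {M : Type u} [AddCommGroup M] [Module U M] {c : ℂ}

include hF hFt

theorem tens_sig_eq_zero_of_mem {d : Fin (n + 1) → ℕ} {x : M}
    (hx : x ∈ rangeSum M (t.fPow d) Finset.univ) :
    (tens (sig F fun i => -(d i : ℤ)) x : TensorOver U (LocQuot F) M) = 0 := by
  obtain ⟨y, rfl⟩ := hx
  rw [tens_sum]
  refine Finset.sum_eq_zero fun j _ => ?_
  rw [tens_smul, CurrentTriple.fPow, ← hFt, op_pow_smul_sig hF, sig_eq_zero j (by simp), zero_tens]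

variable (hn : 1 ≤ n) (hc : c ≠ 0) (hh : LocNil M (t.h n - algebraMap ℂ U c))
  (he : ∀ i ≤ n, LocNil M (t.e i))
include hn hc hh he

/-- Vanishing in S ⊗ M is known only after multiplication by a monomial; the colon property of
regular sequences removes that multiplication. -/
theorem tens_sig_eq_zero_iff {d : Fin (n + 1) → ℕ} {x : M} :
    (tens (sig F fun i => -(d i : ℤ)) x : TensorOver U (LocQuot F) M) = 0 ↔
      x ∈ rangeSum M (t.fPow d) Finset.univ := by
  refine ⟨fun h => ?_, tens_sig_eq_zero_of_mem t hF hFt⟩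
  obtain ⟨K, hK, y, hy⟩ := exists_of_tens_sig_eq_zero hF d x h
  have hs : F.s = fun i : Fin (n + 1) => t.f i := funext hFt
  rw [hs] at hy
  have := t.mem_rangeSum_of_sMon_smul hn hc hh he (fun i => K - d i) (fun _ => K)
    (fun i => Nat.sub_le _ _) x ⟨y, hy⟩
  have h1 : (fun _ => K : Fin (n + 1) → ℕ) - (fun i => K - d i) = d := by
    funext i
    have := hK i
    simp only [Pi.sub_apply]
    omega
  rwa [h1] at this

/-- Any element is f^(-N) ⊗ x for a large constant N, and each exponent is lowered to its minimal
value k i in turn. -/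
theorem exists_eq_tens_sig (k : Fin (n + 1) → ℕ) (z : TensorOver U (LocQuot F) M)
    (hz : ∀ i : Fin (n + 1), t.f i ^ k i • z = 0) :
    ∃ x : M, z = tens (sig F fun i => -(k i : ℤ)) x := by
  classical
  obtain ⟨N₀, hN₀⟩ := exists_eq_tens hF z
  set N := max N₀ (∑ i, k i) with hN
  have hkN : ∀ i, k i ≤ N := fun i => le_trans
    (Finset.single_le_sum (f := k) (fun _ _ => Nat.zero_le _) (Finset.mem_univ i)) (le_max_right _ _)
  have key : ∀ T : Finset (Fin (n + 1)),
      ∃ x : M, z = tens (sig F fun i => -((if i ∈ T then k i else N : ℕ) : ℤ)) x := by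
    intro T
    induction T using Finset.induction_on with
    | empty => simpa using hN₀ N (le_max_left _ _)
    | insert i T hi ih =>
      obtain ⟨x, hx⟩ := ih
      set d : Fin (n + 1) → ℕ := fun j => if j ∈ T then k j else N with hd
      have hdi : (if i ∈ T then k i else N) = N := if_neg hi
      set d' : Fin (n + 1) → ℕ := Function.update d i (N - k i) with hd'
      have h0 := hz i
      rw [hx, smul_tens, ← hFt, pow_smul_sig hF, sig_congr (b := fun j => -(d' j : ℤ)) (fun j => by
        rcases eq_or_ne j i with rfl | hj
        · have := hkN j
          simp only [Pi.add_apply, Pi.single_eq_same, hd', Function.update_self, hdi]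
          omega
        · simp [hd', hd, hj]), tens_sig_eq_zero_iff t hF hFt hn hc hh he] at h0
      obtain ⟨y, rfl⟩ := h0
      -- Vanishing of f_i^{k i} z writes x as ∑ f_j^{d' j} y j with d' i = N - k i. The terms with j
      -- ≠ i die since they make the j-th exponent zero, and the term j = i lowers the i-th exponent
      -- to k i.
      refine ⟨y i, ?_⟩
      rw [hx, tens_sum, Finset.sum_eq_single i]
      · rw [tens_smul, CurrentTriple.fPow, ← hFt, op_pow_smul_sig hF]
        congr 1
        refine sig_congr fun j => ?_
        rcases eq_or_ne j i with rfl | hj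
        · have := hkN j
          simp only [Pi.add_apply, Pi.single_eq_same, hd', Function.update_self, hdi,
            Finset.mem_insert_self, if_true]
          omega
        · simp [hj]
      · intro j _ hj
        rw [tens_smul, CurrentTriple.fPow, ← hFt, op_pow_smul_sig hF,
          sig_eq_zero j (by simp [hd', hd, hj]), zero_tens]
      · simp
  simpa using key Finset.univ

end TensSig

/-! ### Commutators with the bimodule -/

section Commutator

variable {U : Type u} [Ring U] [Algebra ℂ U] {k : ℕ} {F : OreFamily U k}

/-- The commutator `s ↦ y s - s y` on a bimodule. -/
def commutator (S : Type u) [AddCommGroup S] [Module U S] [Module Uᵐᵒᵖ S] (y : U) : S →+ S :=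
  DistribSMul.toAddMonoidHom S y - DistribSMul.toAddMonoidHom S (MulOpposite.op y)

theorem commutator_apply {S : Type u} [AddCommGroup S] [Module U S] [Module Uᵐᵒᵖ S] (y : U) (s : S) :
    commutator S y s = y • s - MulOpposite.op y • s := rfl

/-- The commutator of an element with a multiplicative family, determined on generators. -/
theorem mul_monomial_sub {R : Type*} [Ring R] [Algebra ℂ R] (m : (Fin k → ℤ) → R) (h0 : m 0 = 1)
    (hadd : ∀ a b, m (a + b) = m a * m b) (Y : R) (κ : Fin k → Fin k → ℂ)
    (hκ : ∀ j, Y * m (Pi.single j 1) - m (Pi.single j 1) * Y = ∑ l, κ j l • m (Pi.single l 1))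
    (a : Fin k → ℤ) :
    Y * m a - m a * Y = ∑ j, ∑ l, ((a j : ℂ) * κ j l) • m (a - Pi.single j 1 + Pi.single l 1) := by
  -- By the Leibniz rule the exponents for which the formula holds form a subgroup of ℤ^k, so it is
  -- enough to treat the standard basis vectors.
  let A : AddSubgroup (Fin k → ℤ) :=
    { carrier := {a | Y * m a - m a * Y =
        ∑ j, ∑ l, ((a j : ℂ) * κ j l) • m (a - Pi.single j 1 + Pi.single l 1)}
      zero_mem' := by simp [h0]
      add_mem' := by
        intro a b ha hb
        have h1 : Y * m (a + b) - m (a + b) * Y =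
            (Y * m a - m a * Y) * m b + m a * (Y * m b - m b * Y) := by
          rw [hadd]; noncomm_ring
        rw [Set.mem_ofPred_eq] at ha hb ⊢
        rw [h1, ha, hb]
        simp only [Finset.sum_mul, Finset.mul_sum, smul_mul_assoc, mul_smul_comm, ← hadd,
          ← Finset.sum_add_distrib]
        refine Finset.sum_congr rfl fun j _ => Finset.sum_congr rfl fun l _ => ?_
        rw [show a - Pi.single j 1 + Pi.single l 1 + b = a + b - Pi.single j 1 + Pi.single l 1 by abel,
          show a + (b - Pi.single j 1 + Pi.single l 1) = a + b - Pi.single j 1 + Pi.single l 1 by abel,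
          ← add_smul]
        congr 1
        push_cast [Pi.add_apply]
        ring
      neg_mem' := by
        intro a ha
        rw [Set.mem_ofPred_eq] at ha ⊢
        have h1 : m a * m (-a) = 1 := by rw [← hadd, add_neg_cancel, h0]
        have h2 : m (-a) * m a = 1 := by rw [← hadd, neg_add_cancel, h0]
        have h3 : Y * m (-a) - m (-a) * Y = -(m (-a) * (Y * m a - m a * Y) * m (-a)) := by
          rw [mul_sub, sub_mul, ← mul_assoc, ← mul_assoc, h2, one_mul, mul_assoc _ _ (m (-a)),
            h1, mul_one, neg_sub]
        rw [h3, ha]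
        simp only [Finset.sum_mul, Finset.mul_sum, smul_mul_assoc, mul_smul_comm, ← hadd,
          ← Finset.sum_neg_distrib]
        refine Finset.sum_congr rfl fun j _ => Finset.sum_congr rfl fun l _ => ?_
        rw [show -a + (a - Pi.single j 1 + Pi.single l 1) + -a = -a - Pi.single j 1 + Pi.single l 1 by
          abel, ← neg_smul]
        congr 1
        push_cast [Pi.neg_apply]
        ring }
  have hs : ∀ j, Pi.single j 1 ∈ A := by
    intro j
    show Y * _ - _ * Y = _
    rw [hκ]
    symm
    rw [Finset.sum_eq_single_of_mem j (Finset.mem_univ j) fun i _ hi => by simp [hi]]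
    refine Finset.sum_congr rfl fun l _ => ?_
    rw [Pi.single_eq_same, sub_self, zero_add, Int.cast_one, one_mul]
  have ha : a ∈ A := by
    rw [show a = ∑ j, a j • (Pi.single j 1 : Fin k → ℤ) by
      funext i
      simp [Finset.sum_apply, Pi.single_apply]]
    exact sum_mem fun j _ => zsmul_mem (hs j) _
  exact ha

variable (hF : F.IsGood)
include hF

theorem toLoc_mul_locMonomial_sub (y : U) (κ : Fin k → Fin k → ℂ)
    (hκ : ∀ j, y * F.s j - F.s j * y = ∑ l, algebraMap ℂ U (κ j l) * F.s l) (a : Fin k → ℤ) :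
    toLoc F.s y * locMonomial F.s a - locMonomial F.s a * toLoc F.s y =
      ∑ j, ∑ l, ((a j : ℂ) * κ j l) • locMonomial F.s (a - Pi.single j 1 + Pi.single l 1) := by
  have h1 : ∀ j, locMonomial F.s (Pi.single j 1) = toLoc F.s (F.s j) := fun j => by
    rw [locMonomial_single, zpow_one]; rfl
  refine mul_monomial_sub _ (locMonomial_zero _) (locMonomial_add hF.comm) _ κ (fun j => ?_) a
  rw [h1, ← map_mul, ← map_mul, ← map_sub, hκ, map_sum]
  refine Finset.sum_congr rfl fun l _ => ?_
  rw [h1, map_mul, AlgHom.commutes, ← Algebra.smul_def]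

theorem commutator_sig (y : U) (κ : Fin k → Fin k → ℂ)
    (hκ : ∀ j, y * F.s j - F.s j * y = ∑ l, algebraMap ℂ U (κ j l) * F.s l) (a : Fin k → ℤ) :
    commutator (LocQuot F) y (sig F a) =
      ∑ j, ∑ l, algebraMap ℂ U ((a j : ℂ) * κ j l) • sig F (a - Pi.single j 1 + Pi.single l 1) := by
  have h : ∀ {ι : Type} (T : Finset ι) (v : ι → Loc F.s),
      LocQuot.mk F (∑ i ∈ T, v i) = ∑ i ∈ T, LocQuot.mk F (v i) := fun T v =>
    map_sum (AddMonoidHom.mk' (LocQuot.mk F) (LocQuot.mk_add F)) v T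
  have h1 : commutator (LocQuot F) y (sig F a)
      = LocQuot.mk F (toLoc F.s y * locMonomial F.s a - locMonomial F.s a * toLoc F.s y) := rfl
  rw [h1, toLoc_mul_locMonomial_sub hF y κ hκ, h]
  refine Finset.sum_congr rfl fun j _ => ?_
  rw [h]
  refine Finset.sum_congr rfl fun l _ => ?_
  rw [sig, LocQuot.smul_mk, AlgHom.commutes, Algebra.smul_def]

/-- If `[y, s j]` involves only the `s l` with `l > j`, the commutator with `y` is nilpotent on the
classes of monomials. -/
theorem exists_commutator_iterate_sig_eq_zero (y : U) (κ : Fin k → Fin k → ℂ)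
    (hκ : ∀ j, y * F.s j - F.s j * y = ∑ l, algebraMap ℂ U (κ j l) * F.s l)
    (hκ0 : ∀ j l, l ≤ j → κ j l = 0) (a : Fin k → ℤ) :
    ∃ N : ℕ, (commutator (LocQuot F) y)^[N] (sig F a) = 0 := by
  have hsm : ∀ (z : ℂ) (N : ℕ) (s : LocQuot F),
      (commutator (LocQuot F) y)^[N] (algebraMap ℂ U z • s)
        = algebraMap ℂ U z • (commutator (LocQuot F) y)^[N] s := by
    intro z N
    induction N with
    | zero => exact fun _ => rfl
    | succ N ih =>
      intro s
      rw [Function.iterate_succ_apply, Function.iterate_succ_apply, ← ih, commutator_apply,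
        commutator_apply, smul_sub, ← mul_smul, ← Algebra.commutes, mul_smul,
        smul_comm (algebraMap ℂ U z) (MulOpposite.op y) s]
  let E : AddMonoid.End (LocQuot F) := commutator (LocQuot F) y
  have hpow : ∀ N : ℕ, ⇑(E ^ N) = (commutator (LocQuot F) y)^[N] := AddMonoid.End.coe_pow _ E
  -- The quantity ∑ j (-a j) decreases by l - j > 0 when s j is replaced by s l. Once it is negative
  -- some exponent is nonnegative, and the class is zero.
  have key : ∀ (N : ℕ) (a : Fin k → ℤ), ∑ j : Fin k, (j : ℤ) * (-a j) < N →
      (commutator (LocQuot F) y)^[N] (sig F a) = 0 := by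
    intro N
    induction N with
    | zero =>
      intro a ha
      obtain ⟨j, hj⟩ : ∃ j, 0 ≤ a j := by
        by_contra! h
        refine absurd ha (not_lt.2 (Finset.sum_nonneg fun j _ => ?_))
        exact mul_nonneg (by positivity) (by have := h j; omega)
      exact sig_eq_zero j hj
    | succ N ih =>
      intro a ha
      rw [Function.iterate_succ_apply, commutator_sig hF y κ hκ, ← hpow, map_sum]
      refine Finset.sum_eq_zero fun j _ => ?_
      rw [map_sum]
      refine Finset.sum_eq_zero fun l _ => ?_
      rw [hpow, hsm]
      by_cases hjl : l ≤ j
      · rw [hκ0 j l hjl, mul_zero, map_zero, zero_smul]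
      · rw [ih, smul_zero]
        have h2 : ∑ i : Fin k, (i : ℤ) * (-((a - Pi.single j 1 + Pi.single l 1 : Fin k → ℤ) i))
            = ∑ i : Fin k, (i : ℤ) * (-a i) + j - l := by
          have h3 : ∀ i : Fin k, (i : ℤ) * (-((a - Pi.single j 1 + Pi.single l 1 : Fin k → ℤ) i))
              = (i : ℤ) * (-a i) + (i : ℤ) * (Pi.single j 1 : Fin k → ℤ) i
                - (i : ℤ) * (Pi.single l 1 : Fin k → ℤ) i := by
            intro i
            simp only [Pi.add_apply, Pi.sub_apply]
            ring
          simp only [h3, Finset.sum_add_distrib, Finset.sum_sub_distrib]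
          simp [Pi.single_apply]
        rw [h2]
        have : (j : ℕ) < l := Fin.lt_def.1 (not_le.1 hjl)
        push_cast at ha
        omega
  obtain ⟨N, hN⟩ : ∃ N : ℕ, ∑ j : Fin k, (j : ℤ) * (-a j) < N :=
    ⟨(∑ j : Fin k, (j : ℤ) * (-a j)).toNat + 1, by omega⟩
  exact ⟨N, key N a hN⟩

-- An element y acts on s ⊗ m like a derivation, as [y, s] ⊗ m + s ⊗ y m; the scalar is put on the
-- second factor.
omit hF [Algebra ℂ U] in
theorem sub_smul_tens {S M : Type u} [AddCommGroup S] [Module U S] [Module Uᵐᵒᵖ S]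
    [AddCommGroup M] [Module U M] [Algebra ℂ U] (y : U) (z : ℂ)
    (hz : ∀ s : S, algebraMap ℂ U z • s = MulOpposite.op (algebraMap ℂ U z) • s) (s : S) (m : M) :
    (y - algebraMap ℂ U z) • (tens s m : TensorOver U S M)
      = tens (commutator S y s) m + tens s ((y - algebraMap ℂ U z) • m) := by
  rw [tens_smul, smul_tens, ← add_tens, commutator_apply]
  congr 1
  rw [MulOpposite.op_sub, sub_smul, sub_smul, hz]
  abel

omit hF in
theorem algebraMap_smul_locQuot (z : ℂ) (s : LocQuot F) :
    algebraMap ℂ U z • s = MulOpposite.op (algebraMap ℂ U z) • s := by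
  obtain ⟨v, rfl⟩ := LocQuot.mk_surjective F s
  rw [LocQuot.smul_mk, LocQuot.op_smul_mk, MulOpposite.unop_op, AlgHom.commutes, Algebra.commutes]

-- A power of exponent a + b distributes over the two factors, so one of them is hit often enough to
-- vanish.
omit hF in
theorem pow_smul_tens_eq_zero {M : Type u} [AddCommGroup M] [Module U M] (y : U) (z : ℂ) :
    ∀ (a b : ℕ) (s : LocQuot F) (m : M), (commutator (LocQuot F) y)^[a] s = 0 →
      (y - algebraMap ℂ U z) ^ b • m = 0 →
      (y - algebraMap ℂ U z) ^ (a + b) • (tens s m : TensorOver U (LocQuot F) M) = 0 := by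
  intro a b
  induction hN : a + b generalizing a b with
  | zero =>
    intro s m hs _
    obtain rfl : a = 0 := by omega
    rw [show s = 0 from hs, zero_tens, smul_zero]
  | succ N ih =>
    intro s m hs hm
    rw [pow_succ, mul_smul, sub_smul_tens y z (algebraMap_smul_locQuot z), smul_add]
    rcases Nat.eq_zero_or_pos a with rfl | ha
    · rw [show s = 0 from hs, map_zero, zero_tens, zero_tens, smul_zero, add_zero]
    rcases Nat.eq_zero_or_pos b with rfl | hb
    · rw [pow_zero, one_smul] at hm
      rw [hm, smul_zero, tens_zero, tens_zero, smul_zero, add_zero]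
    obtain ⟨a, rfl⟩ := Nat.exists_eq_succ_of_ne_zero ha.ne'
    obtain ⟨b, rfl⟩ := Nat.exists_eq_succ_of_ne_zero hb.ne'
    rw [ih a (b + 1) (by omega) _ _ (by rwa [← Function.iterate_succ_apply]) hm,
      ih (a + 1) b (by omega) _ _ hs (by rwa [← mul_smul, ← pow_succ]), add_zero]

/-- Generalised eigenspaces of `y` on `M` and on `S ⊗ M`. -/
theorem locNil_tensorOver {M : Type u} [AddCommGroup M] [Module U M] (y : U) (z : ℂ)
    (κ : Fin k → Fin k → ℂ)
    (hκ : ∀ j, y * F.s j - F.s j * y = ∑ l, algebraMap ℂ U (κ j l) * F.s l)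
    (hκ0 : ∀ j l, l ≤ j → κ j l = 0) (hM : LocNil M (y - algebraMap ℂ U z)) :
    LocNil (TensorOver U (LocQuot F) M) (y - algebraMap ℂ U z) := by
  intro x
  obtain ⟨N, hN⟩ := exists_eq_tens hF x
  obtain ⟨m, rfl⟩ := hN N le_rfl
  obtain ⟨a, ha⟩ := exists_commutator_iterate_sig_eq_zero hF y κ hκ hκ0 fun _ => -(N : ℤ)
  obtain ⟨b, hb⟩ := hM m
  exact ⟨a + b, pow_smul_tens_eq_zero y z a b _ _ ha hb⟩

/-- The action of `y - z` on `Hom(S, P)`, evaluated at a vector on which the commutator with `y` is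
nilpotent. -/
theorem exists_pow_smul_hom_apply_eq_zero {P : Type u} [AddCommGroup P] [Module U P] (y : U) (z : ℂ)
    (hP : LocNil P (y - algebraMap ℂ U z)) (f : HomOver U (LocQuot F) P) :
    ∀ (a : ℕ) (s : LocQuot F), (commutator (LocQuot F) y)^[a] s = 0 →
      ∃ K : ℕ, ∀ k ≥ K, ((y - algebraMap ℂ U z) ^ k • f).toLin s = 0 := by
  -- The right action on S turns into the action on P up to a commutator, on which the induction on
  -- a applies.
  have hstep : ∀ (f : HomOver U (LocQuot F) P) (s : LocQuot F),
      ((y - algebraMap ℂ U z) • f).toLin s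
        = (y - algebraMap ℂ U z) • f.toLin s - f.toLin (commutator (LocQuot F) y s) := by
    intro f s
    show f.toLin (MulOpposite.op (y - algebraMap ℂ U z) • s) = _
    rw [← map_smul, ← map_sub, commutator_apply, MulOpposite.op_sub, sub_smul, sub_smul,
      algebraMap_smul_locQuot]
    congr 1
    abel
  intro a
  induction a with
  | zero => intro s hs; exact ⟨0, fun k _ => by rw [show s = 0 from hs, map_zero]⟩
  | succ a ih =>
    intro s hs
    obtain ⟨K, hK⟩ := ih _ (by rwa [← Function.iterate_succ_apply])
    -- From the exponent K onwards the commutator term contributes nothing, so y - z simply acts on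
    -- the value in P.
    have h1 : ∀ j, ((y - algebraMap ℂ U z) ^ (K + j) • f).toLin s
        = (y - algebraMap ℂ U z) ^ j • ((y - algebraMap ℂ U z) ^ K • f).toLin s := by
      intro j
      induction j with
      | zero => simp
      | succ j ihj =>
        rw [← add_assoc, pow_succ', mul_smul, hstep, hK _ (Nat.le_add_right _ _), sub_zero, ihj,
          ← mul_smul, ← pow_succ']
    obtain ⟨b, hb⟩ := hP (((y - algebraMap ℂ U z) ^ K • f).toLin s)
    refine ⟨K + b, fun k hk => ?_⟩
    obtain ⟨j, rfl⟩ := Nat.exists_eq_add_of_le hk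
    rw [add_assoc, h1, add_comm b j, pow_add, mul_smul, hb, smul_zero]

end Commutator

/-! ### Weight vectors -/

section Weights

variable {U : Type u} [Ring U] [Algebra ℂ U] {H : Type*} [AddCommGroup H] [Module ℂ H] (η : H → U)
  {M N : Type u} [AddCommGroup M] [Module U M] [AddCommGroup N] [Module U N]

/-- `m` is a weight vector of weight `ν` for the operators `η x`. -/
def IsWt (ν : Module.Dual ℂ H) (m : M) : Prop := ∀ x, η x • m = algebraMap ℂ U (ν x) • m

/-- `u` has weight `β` for the commutators with `η x`. -/
def HasWt (β : Module.Dual ℂ H) (u : U) : Prop :=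
  ∀ x, η x * u - u * η x = algebraMap ℂ U (β x) * u

variable {η} {ν χ β γ : Module.Dual ℂ H} {m m' : M} {u v : U}

theorem IsWt.zero : IsWt η ν (0 : M) := fun x => by rw [smul_zero, smul_zero]

theorem IsWt.add (h : IsWt η ν m) (h' : IsWt η ν m') : IsWt η ν (m + m') := fun x => by
  rw [smul_add, smul_add, h, h']

theorem IsWt.neg (h : IsWt η ν m) : IsWt η ν (-m) := fun x => by rw [smul_neg, smul_neg, h]

theorem IsWt.sub (h : IsWt η ν m) (h' : IsWt η ν m') : IsWt η ν (m - m') := by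
  rw [sub_eq_add_neg]; exact h.add h'.neg

theorem IsWt.map (f : M →ₗ[U] N) (h : IsWt η ν m) : IsWt η ν (f m) := fun x => by
  rw [← map_smul, h, map_smul]

theorem IsWt.of_map {f : M →ₗ[U] N} (hf : Function.Injective f) (h : IsWt η ν (f m)) :
    IsWt η ν m := fun x => hf (by rw [map_smul, h, map_smul])

theorem IsWt.smul (hu : HasWt η β u) (h : IsWt η ν m) : IsWt η (ν + β) (u • m) := fun x => by
  rw [← mul_smul, sub_eq_iff_eq_add.1 (hu x), add_smul, mul_smul, mul_smul, h, LinearMap.add_apply,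
    map_add, add_smul, ← mul_smul u, ← Algebra.commutes, mul_smul, add_comm]

theorem HasWt.mul (hu : HasWt η β u) (hv : HasWt η γ v) : HasWt η (β + γ) (u * v) := fun x => by
  have h1 : η x * (u * v) - u * v * η x = (η x * u - u * η x) * v + u * (η x * v - v * η x) := by
    noncomm_ring
  rw [h1, hu, hv, LinearMap.add_apply, map_add, add_mul, mul_assoc, ← mul_assoc u,
    ← Algebra.commutes (γ x) u, mul_assoc]

theorem HasWt.one : HasWt η 0 (1 : U) := fun x => by simp

theorem HasWt.algebraMap (z : ℂ) : HasWt η 0 (algebraMap ℂ U z) := fun x => by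
  simp [Algebra.commutes]

theorem HasWt.pow (hu : HasWt η β u) (k : ℕ) : HasWt η (k • β) (u ^ k) := by
  induction k with
  | zero => simpa using HasWt.one
  | succ k ih => rw [pow_succ, succ_nsmul]; exact ih.mul hu

theorem HasWt.sub (hu : HasWt η β u) (hv : HasWt η β v) : HasWt η β (u - v) := fun x => by
  have h1 : η x * (u - v) - (u - v) * η x = (η x * u - u * η x) - (η x * v - v * η x) := by
    noncomm_ring
  rw [h1, hu, hv, mul_sub]

variable (η M) in
/-- `M` is generated, as an additive group, by weight vectors. -/
def IsWtModule : Prop := ∀ m : M, m ∈ AddSubgroup.closure {m : M | ∃ ν, IsWt η ν m}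

variable (η) in
/-- A subgroup stable under the scalars and the operators `η x`. -/
structure WtStable (K : AddSubgroup M) : Prop where
  scalar : ∀ z : ℂ, ∀ m ∈ K, algebraMap ℂ U z • m ∈ K
  smul : ∀ x, ∀ m ∈ K, η x • m ∈ K

/-- Two distinct weights differ at some x; applying η x - χ x eliminates the component of weight χ
and rescales the others, one of them by a nonzero factor. -/
theorem WtStable.mem_of_sum_mem {K : AddSubgroup M} (hK : WtStable η K)
    {v : Module.Dual ℂ H → M} (hv : ∀ ν, IsWt η ν (v ν)) (s : Finset (Module.Dual ℂ H)) :
    ∑ ν ∈ s, v ν ∈ K → ∀ ν ∈ s, v ν ∈ K := by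
  classical
  induction s using Finset.induction_on generalizing v with
  | empty => simp
  | insert χ s hχ ih =>
    intro h
    have h1 : ∀ ν ∈ s, v ν ∈ K := by
      intro ν hν
      obtain ⟨x, hx⟩ : ∃ x, ν x - χ x ≠ 0 := by
        by_contra! h'
        exact hχ ((LinearMap.ext fun x => sub_eq_zero.1 (h' x) : ν = χ) ▸ hν)
      have h2 : ∑ ν ∈ s, algebraMap ℂ U (ν x - χ x) • v ν ∈ K := by
        have h3 : ∑ ν ∈ s, algebraMap ℂ U (ν x - χ x) • v ν
            = η x • ∑ ν ∈ insert χ s, v ν - algebraMap ℂ U (χ x) • ∑ ν ∈ insert χ s, v ν := by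
          rw [Finset.smul_sum, Finset.smul_sum, ← Finset.sum_sub_distrib, Finset.sum_insert hχ, hv χ,
            sub_self, zero_add]
          exact Finset.sum_congr rfl fun ν _ => by rw [hv ν, map_sub, sub_smul]
        rw [h3]
        exact sub_mem (hK.smul _ _ h) (hK.scalar _ _ h)
      have h4 := ih (v := fun ν => algebraMap ℂ U (ν x - χ x) • v ν) (fun ν => by
        have := (hv ν).smul (HasWt.algebraMap (ν x - χ x)); rwa [add_zero] at this) h2 ν hν
      have h5 := hK.scalar (ν x - χ x)⁻¹ _ h4
      rwa [← mul_smul, ← map_mul, inv_mul_cancel₀ hx, map_one, one_smul] at h5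
    intro ν hν
    rcases Finset.mem_insert.1 hν with rfl | hν
    · rw [Finset.sum_insert hχ] at h
      exact (add_mem_cancel_right (sum_mem h1)).1 h
    · exact h1 ν hν

theorem wtStable_bot : WtStable η (⊥ : AddSubgroup M) where
  scalar z m hm := by rw [AddSubgroup.mem_bot] at hm ⊢; rw [hm, smul_zero]
  smul x m hm := by rw [AddSubgroup.mem_bot] at hm ⊢; rw [hm, smul_zero]

theorem IsWtModule.exists_finsupp (hM : IsWtModule η M) (m : M) :
    ∃ v : Module.Dual ℂ H →₀ M, (∀ ν, IsWt η ν (v ν)) ∧ m = v.sum fun _ x => x := by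
  classical
  refine AddSubgroup.closure_induction ?_ ?_ ?_ ?_ (hM m)
  · rintro m ⟨ν, hν⟩
    refine ⟨Finsupp.single ν m, fun χ => ?_, by simp⟩
    rcases eq_or_ne χ ν with rfl | h
    · simpa using hν
    · rw [Finsupp.single_eq_of_ne h]; exact IsWt.zero
  · exact ⟨0, fun _ => IsWt.zero, by simp⟩
  · rintro _ _ _ _ ⟨v, hv, rfl⟩ ⟨w, hw, rfl⟩
    refine ⟨v + w, fun ν => (hv ν).add (hw ν), ?_⟩
    rw [Finsupp.sum_add_index' (fun _ => rfl) fun _ _ _ => rfl]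
  · rintro _ _ ⟨v, hv, rfl⟩
    refine ⟨-v, fun ν => (hv ν).neg, ?_⟩
    rw [Finsupp.sum_neg_index fun _ => rfl, Finsupp.sum, Finsupp.sum, Finset.sum_neg_distrib]

theorem finsupp_eq_zero_of_isWt {v : Module.Dual ℂ H →₀ M} (hv : ∀ ν, IsWt η ν (v ν))
    (h : (v.sum fun _ x => x) = 0) : v = 0 := by
  ext ν
  by_cases hν : ν ∈ v.support
  · exact wtStable_bot.mem_of_sum_mem hv v.support h ν hν
  · simpa using hν

/-- The weight components of a vector. -/
noncomputable def IsWtModule.comp (hM : IsWtModule η M) : M →+ (Module.Dual ℂ H →₀ M) :=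
  AddMonoidHom.mk' (fun m => (hM.exists_finsupp m).choose) (by
    intro m m'
    rw [← sub_eq_zero]
    have h := fun m => (hM.exists_finsupp m).choose_spec
    refine finsupp_eq_zero_of_isWt
      (fun ν => ((h _).1 ν).sub (((h _).1 ν).add ((h _).1 ν))) ?_
    rw [Finsupp.sum_sub_index fun _ _ _ => rfl, Finsupp.sum_add_index' (fun _ => rfl)
      fun _ _ _ => rfl, ← (h _).2, ← (h _).2, ← (h _).2, sub_self])

theorem IsWtModule.isWt_comp (hM : IsWtModule η M) (m : M) (ν : Module.Dual ℂ H) :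
    IsWt η ν (hM.comp m ν) := (hM.exists_finsupp m).choose_spec.1 ν

theorem IsWtModule.sum_comp (hM : IsWtModule η M) (m : M) : ((hM.comp m).sum fun _ x => x) = m :=
  (hM.exists_finsupp m).choose_spec.2.symm

theorem IsWtModule.comp_eq (hM : IsWtModule η M) {m : M} {v : Module.Dual ℂ H →₀ M}
    (hv : ∀ ν, IsWt η ν (v ν)) (h : m = v.sum fun _ x => x) : hM.comp m = v := by
  rw [← sub_eq_zero]
  refine finsupp_eq_zero_of_isWt (fun ν => (hM.isWt_comp m ν).sub (hv ν)) ?_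
  rw [Finsupp.sum_sub_index fun _ _ _ => rfl, hM.sum_comp, ← h, sub_self]

theorem IsWtModule.comp_of_isWt (hM : IsWtModule η M) (h : IsWt η ν m) :
    hM.comp m = Finsupp.single ν m := by
  classical
  refine hM.comp_eq (fun χ => ?_) (by simp)
  rcases eq_or_ne χ ν with rfl | h'
  · simpa using h
  · rw [Finsupp.single_eq_of_ne h']; exact IsWt.zero

theorem IsWtModule.comp_self (hM : IsWtModule η M) (h : IsWt η ν m) : hM.comp m ν = m := by
  rw [hM.comp_of_isWt h, Finsupp.single_eq_same]

theorem IsWtModule.comp_ne (hM : IsWtModule η M) (h : IsWt η ν m) (hχ : χ ≠ ν) :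
    hM.comp m χ = 0 := by
  rw [hM.comp_of_isWt h, Finsupp.single_eq_of_ne hχ]

theorem IsWtModule.induction (hM : IsWtModule η M) {p : M → Prop} (hwt : ∀ ν m, IsWt η ν m → p m)
    (hadd : ∀ m m', p m → p m' → p (m + m')) (m : M) : p m := by
  rw [← hM.sum_comp m, Finsupp.sum]
  exact Finset.sum_induction _ p hadd (hwt 0 0 IsWt.zero) fun ν _ => hwt ν _ (hM.isWt_comp m ν)

/-- A homogeneous map commutes with taking weight components. -/
theorem IsWtModule.comp_map (hM : IsWtModule η M) (hN : IsWtModule η N) (T : M →+ N)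
    (e : Module.Dual ℂ H ≃ Module.Dual ℂ H) (hT : ∀ ν m, IsWt η ν m → IsWt η (e ν) (T m)) (m : M)
    (ν : Module.Dual ℂ H) : hN.comp (T m) (e ν) = T (hM.comp m ν) := by
  induction m using hM.induction with
  | hwt χ m hm =>
    rcases eq_or_ne ν χ with rfl | h
    · rw [hM.comp_self hm, hN.comp_self (hT _ _ hm)]
    · rw [hM.comp_ne hm h, hN.comp_ne (hT _ _ hm) (e.injective.ne h), map_zero]
  | hadd m m' h h' => rw [map_add, map_add, map_add, Finsupp.add_apply, Finsupp.add_apply, h, h',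
      map_add]

theorem IsWtModule.comp_smul (hM : IsWtModule η M) (hu : HasWt η β u) (m : M)
    (ν : Module.Dual ℂ H) : hM.comp (u • m) (ν + β) = u • hM.comp m ν :=
  hM.comp_map hM (DistribSMul.toAddMonoidHom M u) (Equiv.addRight β) (fun _ _ h => h.smul hu) m ν

theorem IsWtModule.comp_linearMap (hM : IsWtModule η M) (hN : IsWtModule η N) (f : M →ₗ[U] N) (m : M)
    (ν : Module.Dual ℂ H) : hN.comp (f m) ν = f (hM.comp m ν) :=
  hM.comp_map hN f.toAddMonoidHom (Equiv.refl _) (fun _ _ h => h.map f) m ν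

theorem WtStable.comp_mem {K : AddSubgroup M} (hK : WtStable η K) (hM : IsWtModule η M) (hm : m ∈ K)
    (ν : Module.Dual ℂ H) : hM.comp m ν ∈ K := by
  by_cases hν : ν ∈ (hM.comp m).support
  · refine hK.mem_of_sum_mem (hM.isWt_comp m) (hM.comp m).support ?_ ν hν
    have h : ∑ ν ∈ (hM.comp m).support, hM.comp m ν = m := hM.sum_comp m
    rwa [h]
  · rw [Finsupp.notMem_support_iff.1 hν]; exact zero_mem _

theorem wtStable_submodule (K : Submodule U M) : WtStable η K.toAddSubgroup where
  scalar _ _ hm := K.smul_mem _ hm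
  smul _ _ hm := K.smul_mem _ hm

theorem IsWtModule.submodule (hM : IsWtModule η M) (K : Submodule U M) : IsWtModule η K := by
  intro k
  have h1 : ∀ ν, hM.comp (k : M) ν ∈ K := fun ν =>
    (wtStable_submodule K).comp_mem hM (m := (k : M)) k.2 ν
  have h2 : k = ∑ ν ∈ (hM.comp (k : M)).support, (⟨_, h1 ν⟩ : K) := by
    refine Subtype.ext ?_
    rw [AddSubmonoidClass.coe_finsetSum]
    exact (hM.sum_comp (k : M)).symm
  rw [h2]
  exact sum_mem fun ν _ => AddSubgroup.subset_closure
    ⟨ν, IsWt.of_map (f := K.subtype) K.subtype_injective (hM.isWt_comp _ ν)⟩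

theorem IsWtModule.of_surjective (hM : IsWtModule η M) (f : M →ₗ[U] N)
    (hf : Function.Surjective f) : IsWtModule η N := by
  intro y
  obtain ⟨x, rfl⟩ := hf y
  induction x using hM.induction with
  | hwt ν m hm => exact AddSubgroup.subset_closure ⟨ν, hm.map f⟩
  | hadd m m' h h' => rw [map_add]; exact add_mem h h'

theorem IsWtModule.exists_lift (hM : IsWtModule η M) {f : M →ₗ[U] N}
    (hf : Function.Surjective f) {y : N} (hy : IsWt η ν y) : ∃ x, IsWt η ν x ∧ f x = y := by
  obtain ⟨x, rfl⟩ := hf y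
  exact ⟨hM.comp x ν, hM.isWt_comp x ν, by
    rw [← hM.comp_linearMap (hM.of_surjective f hf), (hM.of_surjective f hf).comp_self hy]⟩

/-- A weight vector in `∑ G_j M` is a sum of images of weight vectors. -/
theorem IsWtModule.exists_of_mem_rangeSum (hM : IsWtModule η M) {ι : Type*} {G : ι → U}
    {b : ι → Module.Dual ℂ H} (hG : ∀ j, HasWt η (b j) (G j)) {S : Finset ι} {x : M}
    (hx : IsWt η ν x) (hxS : x ∈ rangeSum M G S) :
    ∃ y : ι → M, x = ∑ j ∈ S, G j • y j ∧ ∀ j, IsWt η (ν - b j) (y j) := by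
  obtain ⟨y, hy⟩ := hxS
  refine ⟨fun j => hM.comp (y j) (ν - b j), ?_, fun j => hM.isWt_comp _ _⟩
  calc x = hM.comp x ν := (hM.comp_self hx).symm
    _ = ∑ j ∈ S, hM.comp (G j • y j) ν := by
      rw [hy, map_sum, Finsupp.finsetSum_apply]
    _ = _ := Finset.sum_congr rfl fun j _ => by
      rw [← hM.comp_smul (hG j), sub_add_cancel]

end Weights

/-- A current triple of root `α` for commuting operators `η x`. -/
structure WeightTriple (U : Type u) [Ring U] [Algebra ℂ U] (n : ℕ) (H : Type*) [AddCommGroup H]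
    [Module ℂ H] extends CurrentTriple U n where
  η : H → U
  α : Module.Dual ℂ H
  η_e : ∀ i, HasWt η α (e i)
  η_f : ∀ i, HasWt η (-α) (f i)
  η_h : ∀ i, HasWt η 0 (h i)
  η_η : ∀ x, HasWt η 0 (η x)

namespace WeightTriple

variable {U : Type u} [Ring U] [Algebra ℂ U] {n : ℕ} {H : Type*} [AddCommGroup H] [Module ℂ H]
  (t : WeightTriple U n H) {F : OreFamily U (n + 1)} {M P : Type u} [AddCommGroup M] [Module U M]
  [AddCommGroup P] [Module U P] {c : ℂ} {χ ν : Module.Dual ℂ H}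

/-- Weight modules with weights bounded in the direction of `α`, on which `h n` has the generalised
eigenvalue `c`. -/
structure Upper (M : Type u) [AddCommGroup M] [Module U M] (c : ℂ) : Prop where
  wt : IsWtModule t.η M
  bdd : ∀ χ, ∃ k₀ : ℕ, ∀ k ≥ k₀, ∀ m : M, IsWt t.η (χ + k • t.α) m → m = 0
  nil : LocNil M (t.h n - algebraMap ℂ U c)

/-- Weight modules on which the `f i` are locally nilpotent and `h n` has the generalised
eigenvalue `c`. -/
structure Lower (P : Type u) [AddCommGroup P] [Module U P] (c : ℂ) : Prop where
  wt : IsWtModule t.η P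
  f_nil : ∀ i ≤ n, LocNil P (t.f i)
  nil : LocNil P (t.h n - algebraMap ℂ U c)

variable {t}

/-- Powers of e_i raise weights along α, where they are bounded. -/
theorem Upper.e_nil (hM : t.Upper M c) (i : ℕ) : LocNil M (t.e i) := by
  intro m
  induction m using hM.wt.induction with
  | hwt χ m hm =>
    obtain ⟨k₀, hk₀⟩ := hM.bdd χ
    exact ⟨k₀, hk₀ k₀ le_rfl _ (hm.smul ((t.η_e i).pow k₀))⟩
  | hadd m m' h h' =>
    obtain ⟨a, ha⟩ := h
    obtain ⟨b, hb⟩ := h'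
    exact ⟨a + b, by rw [smul_add, add_comm a b, pow_add, mul_smul, ha, smul_zero, zero_add,
      ← pow_add, add_comm b a, pow_add, mul_smul, hb, smul_zero]⟩

theorem locNil_submodule {x : U} (h : LocNil M x) (K : Submodule U M) : LocNil K x := fun m => by
  obtain ⟨k, hk⟩ := h (m : M)
  exact ⟨k, Subtype.ext hk⟩

theorem locNil_of_surjective {x : U} (h : LocNil M x) (f : M →ₗ[U] P)
    (hf : Function.Surjective f) : LocNil P x := fun y => by
  obtain ⟨m, rfl⟩ := hf y
  obtain ⟨k, hk⟩ := h m
  exact ⟨k, by rw [← map_smul, hk, map_zero]⟩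

theorem Lower.submodule (hP : t.Lower P c) (K : Submodule U P) : t.Lower K c where
  wt := hP.wt.submodule K
  f_nil i hi := locNil_submodule (hP.f_nil i hi) K
  nil := locNil_submodule hP.nil K

theorem Upper.quotient (hM : t.Upper M c) (K : Submodule U M) : t.Upper (M ⧸ K) c where
  wt := hM.wt.of_surjective K.mkQ K.mkQ_surjective
  bdd χ := by
    obtain ⟨k₀, hk₀⟩ := hM.bdd χ
    refine ⟨k₀, fun k hk y hy => ?_⟩
    obtain ⟨x, hx, rfl⟩ := hM.wt.exists_lift K.mkQ_surjective hy
    rw [hk₀ k hk x hx, map_zero]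
  nil := locNil_of_surjective hM.nil K.mkQ K.mkQ_surjective

variable (hF : F.IsGood) (hFt : ∀ i, F.s i = t.f i) (hn : 1 ≤ n) (hc : c ≠ 0)
include hF hFt

/-- Each f_i has weight -α, so the monomial f^a has weight -(∑ a i) α for the commutator action. -/
theorem η_smul_sig (x : H) (a : Fin (n + 1) → ℤ) :
    t.η x • sig F a = MulOpposite.op (t.η x) • sig F a
      + algebraMap ℂ U (((-(∑ i, a i)) • t.α) x) • sig F a := by
  rw [← sub_eq_iff_eq_add', ← commutator_apply, commutator_sig hF (t.η x)
    (fun j l => if l = j then -t.α x else 0) (fun j => by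
      rw [hFt, t.η_f, LinearMap.neg_apply, Finset.sum_eq_single_of_mem j (Finset.mem_univ j)
        fun l _ hl => by rw [if_neg hl, map_zero, zero_mul], if_pos rfl, hFt])]
  have h1 : ∀ j : Fin (n + 1), ∑ l, algebraMap ℂ U ((a j : ℂ) * if l = j then -t.α x else 0) •
      sig F (a - Pi.single j 1 + Pi.single l 1) = algebraMap ℂ U ((a j : ℂ) * -t.α x) • sig F a := by
    intro j
    rw [Finset.sum_eq_single_of_mem j (Finset.mem_univ j)
      fun l _ hl => by rw [if_neg hl, mul_zero, map_zero, zero_smul], if_pos rfl, sub_add_cancel]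
  rw [Finset.sum_congr rfl fun j _ => h1 j, ← Finset.sum_smul, ← map_sum, ← Finset.sum_mul]
  congr 2
  rw [LinearMap.smul_apply, zsmul_eq_mul]
  push_cast
  ring

theorem isWt_tens {m : M} (hm : IsWt t.η χ m) (a : Fin (n + 1) → ℤ) :
    IsWt t.η (χ - (∑ i, a i) • t.α) (tens (sig F a) m : TensorOver U (LocQuot F) M) := by
  intro x
  rw [smul_tens, η_smul_sig hF hFt, add_tens, ← tens_smul, hm, tens_smul, ← smul_tens,
    ← algebraMap_smul_locQuot, ← smul_tens, ← add_smul, ← map_add, neg_smul, sub_eq_add_neg]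
  rfl

theorem isWtModule_tensorOver (hM : IsWtModule t.η M) :
    IsWtModule t.η (TensorOver U (LocQuot F) M) := by
  intro z
  obtain ⟨N, hN⟩ := exists_eq_tens hF z
  obtain ⟨m, rfl⟩ := hN N le_rfl
  clear hN
  induction m using hM.induction with
  | hwt ν m hm => exact AddSubgroup.subset_closure ⟨_, isWt_tens hF hFt hm _⟩
  | hadd m m' h h' => rw [tens_add]; exact add_mem h h'

theorem isWt_apply {f : HomOver U (LocQuot F) P} (hf : IsWt t.η χ f) (a : Fin (n + 1) → ℤ) :
    IsWt t.η (χ - (∑ i, a i) • t.α) (f.toLin (sig F a)) := by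
  intro x
  have h1 : f.toLin (MulOpposite.op (t.η x) • sig F a)
      = f.toLin (MulOpposite.op (algebraMap ℂ U (χ x)) • sig F a) :=
    congrArg (fun f => f.toLin (sig F a)) (hf x)
  rw [← map_smul, η_smul_sig hF hFt, map_add, h1, ← algebraMap_smul_locQuot, map_smul, map_smul,
    ← add_smul, ← map_add, neg_smul, sub_eq_add_neg]
  rfl

-- The classes with constant exponent -l, for arbitrarily large l, generate S as a left module.
omit hFt in
theorem hom_ext {f f' : HomOver U (LocQuot F) P} (l₀ : ℕ)
    (h : ∀ l ≥ l₀, f.toLin (sig F fun _ => -(l : ℤ)) = f'.toLin (sig F fun _ => -(l : ℤ))) :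
    f = f' := by
  refine LinearMap.ext fun s => ?_
  obtain ⟨N, hN⟩ := exists_eq_smul_sig hF s
  obtain ⟨u, rfl⟩ := hN (max N l₀) (le_max_left _ _)
  show f.toLin _ = f'.toLin _
  rw [map_smul, map_smul, h _ (le_max_right _ _)]

theorem isWt_hom {f : HomOver U (LocQuot F) P}
    (h : ∀ l : ℕ, IsWt t.η (χ + ((n + 1) * l) • t.α) (f.toLin (sig F fun _ => -(l : ℤ)))) :
    IsWt t.η χ f := by
  intro x
  refine hom_ext hF 0 fun l _ => ?_
  show f.toLin (MulOpposite.op (t.η x) • sig F fun _ => -(l : ℤ))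
    = f.toLin (MulOpposite.op (algebraMap ℂ U (χ x)) • sig F fun _ => -(l : ℤ))
  have h1 := η_smul_sig hF hFt x fun _ => -(l : ℤ)
  rw [← sub_eq_iff_eq_add] at h1
  rw [← h1, map_sub, map_smul, map_smul, h l x, ← algebraMap_smul_locQuot, map_smul, ← sub_smul,
    ← map_sub]
  congr 2
  simp only [LinearMap.add_apply, LinearMap.smul_apply, Finset.sum_const, Finset.card_univ,
    Fintype.card_fin, nsmul_eq_mul, zsmul_eq_mul]
  push_cast
  ring

/-- `f i ^ k` raises the exponent of a monomial. -/
theorem f_pow_smul_sig (i : Fin (n + 1)) (p : ℕ) (a : Fin (n + 1) → ℤ) :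
    t.f i ^ p • sig F a = sig F (a + Pi.single i (p : ℤ)) := by
  rw [← hFt, pow_smul_sig hF]

theorem f_pow_smul_const (i : Fin (n + 1)) (l : ℕ) : t.f i ^ l • sig F (fun _ => -(l : ℤ)) = 0 := by
  rw [f_pow_smul_sig hF hFt]
  exact sig_eq_zero i (by simp)

include hn

theorem Upper.tensorOver (hM : t.Upper M c) : t.Lower (TensorOver U (LocQuot F) M) c where
  wt := isWtModule_tensorOver hF hFt hM.wt
  f_nil i hi z := by
    obtain ⟨N, hN⟩ := exists_eq_tens hF z
    obtain ⟨m, rfl⟩ := hN N le_rfl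
    refine ⟨N, ?_⟩
    rw [smul_tens]
    have := f_pow_smul_const hF hFt ⟨i, Nat.lt_succ_of_le hi⟩ N
    rw [this, zero_tens]
  nil := by
    -- Here [h_n, f_j] = -2 f_{n+j}, which is nonzero only for j = 0. As n ≥ 1 the index strictly
    -- increases, as the nilpotency of the commutator requires.
    refine locNil_tensorOver hF (t.h n) c
      (fun j l => if (l : ℕ) = n + j then -2 else 0) (fun j => ?_) (fun j l hlj => ?_) hM.nil
    · rw [hFt, t.h_f]
      by_cases hj : n + (j : ℕ) < n + 1
      · rw [Finset.sum_eq_single_of_mem ⟨n + j, hj⟩ (Finset.mem_univ _) fun l _ hl => by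
          rw [if_neg fun h => hl (Fin.ext h), map_zero, zero_mul], if_pos rfl, hFt, map_neg, neg_mul,
          map_ofNat]
      · rw [t.f_zero _ (by omega), mul_zero, neg_zero]
        refine (Finset.sum_eq_zero fun l _ => ?_).symm
        rw [if_neg (by omega), map_zero, zero_mul]
    · have : (l : ℕ) ≤ j := hlj
      exact if_neg (by omega)

include hc

/-- The unit `M → Hom(S, S ⊗ M)` is injective. -/
theorem Upper.unit_injective (hM : t.Upper M c) {m : M}
    (h : ∀ s, (tens s m : TensorOver U (LocQuot F) M) = 0) : m = 0 := by
  have h1 : ∀ ν, hM.wt.comp m ν = 0 := by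
    intro ν
    obtain ⟨k₀, hk₀⟩ := hM.bdd ν
    obtain ⟨y, hy⟩ := (tens_sig_eq_zero_iff t.toCurrentTriple hF hFt hn hc hM.nil
      (fun i _ => hM.e_nil i) (d := fun _ => k₀)).1 (h (sig F fun _ => -(k₀ : ℤ)))
    rw [hy, map_sum, Finsupp.finsetSum_apply]
    refine Finset.sum_eq_zero fun j _ => ?_
    -- The component of weight ν of f_j^{k₀} y comes from the component of y of weight ν + k₀ α,
    -- which is zero by the choice of k₀.
    have h2 := hM.wt.comp_smul ((t.η_f j).pow k₀) (y j) (ν + k₀ • t.α)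
    rw [smul_neg, add_neg_cancel_right] at h2
    rw [CurrentTriple.fPow, h2, hk₀ k₀ le_rfl _ (hM.wt.isWt_comp _ _), smul_zero]
  rw [← hM.wt.sum_comp m, Finsupp.sum]
  exact Finset.sum_eq_zero fun ν _ => h1 ν

/-- Every weight vector of `Hom(S, S ⊗ M)` is in the image of the unit. -/
theorem Upper.exists_unit_eq (hM : t.Upper M c)
    {f : HomOver U (LocQuot F) (TensorOver U (LocQuot F) M)} (hf : IsWt t.η χ f) :
    ∃ m : M, IsWt t.η χ m ∧ ∀ s, f.toLin s = tens s m := by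
  have hP := hM.tensorOver hF hFt hn
  -- The value at f^(-l) is killed by each f_i^l, hence has the form f^(-l) ⊗ m. Passing to a weight
  -- component gives m the weight χ.
  have h1 : ∀ l : ℕ, ∃ m : M, IsWt t.η χ m ∧
      f.toLin (sig F fun _ => -(l : ℤ)) = tens (sig F fun _ => -(l : ℤ)) m := by
    intro l
    obtain ⟨m, hm⟩ := exists_eq_tens_sig t.toCurrentTriple hF hFt hn hc hM.nil
      (fun i _ => hM.e_nil i) (fun _ => l) (f.toLin (sig F fun _ => -(l : ℤ))) fun i => by
        rw [← map_smul, f_pow_smul_const hF hFt, map_zero]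
    refine ⟨hM.wt.comp m χ, hM.wt.isWt_comp _ _, ?_⟩
    let T : M →+ TensorOver U (LocQuot F) M := AddMonoidHom.mk' (tens (sig F fun _ => -(l : ℤ)))
      (tens_add _)
    have h2 := hM.wt.comp_map hP.wt T (Equiv.subRight ((∑ _i : Fin (n + 1), -(l : ℤ)) • t.α))
      (fun _ _ h => isWt_tens hF hFt h _) m χ
    have h3 := hP.wt.comp_self (isWt_apply hF hFt hf fun _ => -(l : ℤ))
    rw [hm] at h3 ⊢
    exact h3.symm.trans h2
  choose m hm hml using h1
  obtain ⟨k₀, hk₀⟩ := hM.bdd χ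
  -- Consecutive m l differ by an element of ∑ f_j^l M of weight χ, which would involve weight
  -- vectors of weight χ + l α; for l ≥ k₀ there are none.
  have hstep : ∀ l ≥ k₀, m (l + 1) = m l := by
    intro l hl
    rw [← sub_eq_zero]
    have h2 : sMon F.s (fun _ => 1) • (sig F fun _ => -((l + 1 : ℕ) : ℤ))
        = sig F fun _ => -(l : ℤ) := by
      rw [sMon_smul_sig hF]
      exact sig_congr fun i => by push_cast; ring
    have h3 : (tens (sig F fun _ => -(l : ℤ)) (m (l + 1) - m l) : TensorOver U (LocQuot F) M) = 0 := by
      rw [tens_sub, ← hml l, ← h2, ← smul_tens, ← hml, ← map_smul, sub_self]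
    rw [tens_sig_eq_zero_iff t.toCurrentTriple hF hFt hn hc hM.nil (fun i _ => hM.e_nil i)
      (d := fun _ => l)] at h3
    obtain ⟨y, hy, hyw⟩ := hM.wt.exists_of_mem_rangeSum (G := t.fPow fun _ => l) (b := fun _ => l • -t.α)
      (fun j => (t.η_f j).pow l) ((hm (l + 1)).sub (hm l)) h3
    rw [hy]
    refine Finset.sum_eq_zero fun j _ => ?_
    rw [hk₀ l hl (y j) (by have := hyw j; rwa [smul_neg, sub_neg_eq_add] at this), smul_zero]
  have hconst : ∀ l ≥ k₀, m l = m k₀ := by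
    intro l hl
    induction l, hl using Nat.le_induction with
    | base => rfl
    | succ l hl ih => rw [hstep l hl, ih]
  refine ⟨m k₀, hm k₀, fun s => ?_⟩
  obtain ⟨N, hN⟩ := exists_eq_smul_sig hF s
  obtain ⟨u, rfl⟩ := hN (max N k₀) (le_max_left _ _)
  rw [map_smul, hml, hconst _ (le_max_right _ _), smul_tens]

omit hF hFt in
/-- Homogeneous lifts along the product of the `f i`. -/
theorem Lower.exists_lift (hF : F.IsGood) (hFt : ∀ i, F.s i = t.f i) (hP : t.Lower P c) {p : P}
    (hp : IsWt t.η χ p) {l : ℕ} (hl : ∀ i : Fin (n + 1), t.f i ^ l • p = 0) :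
    ∃ p', IsWt t.η (χ + (n + 1) • t.α) p' ∧ (∀ i : Fin (n + 1), t.f i ^ (l + 1) • p' = 0) ∧
      sMon F.s (fun _ => 1) • p' = p := by
  classical
  have key : ∀ T : Finset (Fin (n + 1)), ∃ p', IsWt t.η (χ + T.card • t.α) p' ∧
      (∀ i : Fin (n + 1), t.f i ^ (l + if i ∈ T then 1 else 0) • p' = 0) ∧
      sMon F.s (fun i => if i ∈ T then 1 else 0) • p' = p := by
    intro T
    induction T using Finset.induction_on with
    | empty =>
      refine ⟨p, by simpa using hp, by simpa using hl, ?_⟩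
      have : (fun i : Fin (n + 1) => if i ∈ (∅ : Finset (Fin (n + 1))) then 1 else 0) = 0 := by
        funext i; simp
      rw [this, sMon_zero, one_smul]
    | insert j T hj ih =>
      obtain ⟨p', hp', hl', hpp⟩ := ih
      -- Exchanging e and f changes the sign of h_n, so the eigenvalue becomes -c. Coregularity then
      -- lifts p' through f_j while keeping the annihilating powers of the other f_i.
      have hh : LocNil P (t.toCurrentTriple.swap.h n - algebraMap ℂ U (-c)) := by
        intro x
        obtain ⟨k, hk⟩ := hP.nil x
        refine ⟨k, ?_⟩
        have : t.toCurrentTriple.swap.h n - algebraMap ℂ U (-c) = -(t.h n - algebraMap ℂ U c) := by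
          rw [map_neg]
          show -t.h n - _ = _
          abel
        rw [this, neg_pow, mul_smul, hk, smul_zero]
      obtain ⟨y, hyj, hy⟩ := t.toCurrentTriple.swap.exists_e_smul_eq hn (neg_ne_zero.2 hc) hh
        (fun i hi => hP.f_nil i hi) (fun i => l + if i ∈ T then 1 else 0) j (x := p')
        (fun i _ => hl' i)
      change t.f j • y = p' at hyj
      change ∀ i, i ≠ j → t.f i ^ (l + if i ∈ T then 1 else 0) • y = 0 at hy
      set ψ := χ + (insert j T).card • t.α with hψ
      have hψ' : ψ + -t.α = χ + T.card • t.α := by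
        rw [hψ, Finset.card_insert_of_notMem hj, succ_nsmul]; abel
      -- Taking the component of weight ψ keeps all equations since the f_i are homogeneous.
      have hyc : t.f j • hP.wt.comp y ψ = p' := by
        rw [← hP.wt.comp_smul (t.η_f j), hyj, hψ', hP.wt.comp_self hp']
      refine ⟨hP.wt.comp y ψ, hP.wt.isWt_comp _ _, fun i => ?_, ?_⟩
      · rcases eq_or_ne i j with rfl | hij
        · have := hl' i
          rw [if_neg hj, add_zero] at this
          rw [if_pos (Finset.mem_insert_self _ _), pow_succ, mul_smul, hyc, this]
        · have h1 : (i ∈ insert j T) = (i ∈ T) := by simp [hij]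
          simp only [h1]
          rw [← hP.wt.comp_smul ((t.η_f i).pow _), hy i hij, map_zero]
          rfl
      · have h1 : (fun i => if i ∈ insert j T then 1 else 0 : Fin (n + 1) → ℕ)
            = (fun i => if i ∈ T then 1 else 0) + Pi.single j 1 := by
          funext i
          rcases eq_or_ne i j with rfl | hij
          · simp [hj]
          · simp [hij]
        rw [h1, sMon_add hF.comm, sMon_single, pow_one, hFt, mul_smul, hyc, hpp]
  obtain ⟨p', h1, h2, h3⟩ := key Finset.univ
  exact ⟨p', by simpa using h1, by simpa using h2, by simpa using h3⟩

/-- Every weight vector is a value of a weight vector of `Hom(S, P)`. -/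
theorem Lower.exists_hom (hP : t.Lower P c) {p : P} (hp : IsWt t.η χ p) :
    ∃ (f : HomOver U (LocQuot F) P) (ν : Module.Dual ℂ H) (s : LocQuot F),
      IsWt t.η ν f ∧ f.toLin s = p := by
  obtain ⟨l, hl⟩ : ∃ l : ℕ, ∀ i : Fin (n + 1), t.f i ^ l • p = 0 := by
    choose l hl using fun i : Fin (n + 1) => hP.f_nil i (Nat.lt_succ_iff.1 i.2) p
    refine ⟨∑ i, l i, fun i => ?_⟩
    rw [← Finset.sum_erase_add _ _ (Finset.mem_univ i), pow_add, mul_smul, hl, smul_zero]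
  -- Infinitely many lifts through f_0 ⋯ f_n starting from p; each raises by one the power of every
  -- f_i needed to kill the vector.
  have hlift : ∀ (k : ℕ) (q : {q : P // IsWt t.η (χ + ((n + 1) * k) • t.α) q ∧
      ∀ i : Fin (n + 1), t.f i ^ (l + k) • q = 0}),
      ∃ q' : {q : P // IsWt t.η (χ + ((n + 1) * (k + 1)) • t.α) q ∧
        ∀ i : Fin (n + 1), t.f i ^ (l + (k + 1)) • q = 0},
      sMon F.s (fun _ => 1) • (q' : P) = q := by
    rintro k ⟨q, hq, hql⟩
    obtain ⟨q', h1, h2, h3⟩ := hP.exists_lift hn hc hF hFt hq hql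
    refine ⟨⟨q', ?_, h2⟩, h3⟩
    rw [mul_add, mul_one, add_smul, ← add_assoc]
    exact h1
  choose g hg using hlift
  let y : ∀ k : ℕ, {q : P // IsWt t.η (χ + ((n + 1) * k) • t.α) q ∧
      ∀ i : Fin (n + 1), t.f i ^ (l + k) • q = 0} := fun k =>
    Nat.rec (motive := fun k => {q : P // IsWt t.η (χ + ((n + 1) * k) • t.α) q ∧
      ∀ i : Fin (n + 1), t.f i ^ (l + k) • q = 0}) ⟨p, by simpa using hp, by simpa using hl⟩ g k
  have hy0 : (y 0).1 = p := rfl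
  have hy : ∀ k, sMon F.s (fun _ => 1) • (y (k + 1)).1 = (y k).1 := fun k => hg k (y k)
  have hyl : ∀ k, sMon F.s (fun _ => k) • (y k).1 = p := by
    intro k
    induction k with
    | zero => rw [show (fun _ => 0 : Fin (n + 1) → ℕ) = 0 from rfl, sMon_zero, one_smul, hy0]
    | succ k ih =>
      rw [show (fun _ => k + 1 : Fin (n + 1) → ℕ) = (fun _ => k) + fun _ => 1 from rfl,
        sMon_add hF.comm, mul_smul, hy, ih]
  have hsMon : ∀ k : ℕ, HasWt t.η ((k * (n + 1)) • -t.α) (sMon F.s fun _ => k) := by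
    intro k
    have : ∀ L : List (Fin (n + 1)),
        HasWt t.η ((k * L.length) • -t.α) ((L.map fun i => F.s i ^ k).prod) := by
      intro L
      induction L with
      | nil => simpa using HasWt.one
      | cons a L ih =>
        rw [List.map_cons, List.prod_cons, List.length_cons, mul_add, mul_one, add_comm, add_smul, hFt]
        exact ((t.η_f a).pow k).mul ih
    have h1 := this (List.finRange (n + 1))
    rwa [List.length_finRange] at h1
  -- The lifts y k are killed by f_j^{l+k} but perhaps not by f_j^k, so they are multiplied by (f_0
  -- ⋯ f_n)^l. This shifts the value p to the class with exponent -l.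
  obtain ⟨f, hf⟩ := exists_hom_of_system hF (fun k => sMon F.s (fun _ => l) • (y k).1)
    (fun k => by
      rw [← mul_smul, sMon_commute hF.comm, mul_smul, hy])
    (fun k j => by
      have h1 : F.s j ^ k * sMon F.s (fun _ => l)
          = sMon F.s ((fun _ => l) - Pi.single j l) * F.s j ^ (l + k) := by
        rw [sMon_eq_mul_pow hF.comm (c := fun _ => l) (i := j) (m := l) le_rfl,
          ← mul_assoc (F.s j ^ k), sMon_comm_pow hF.comm, mul_assoc, ← pow_add, add_comm k l]
      rw [← mul_smul, h1, mul_smul, hFt, (y k).2.2 j, smul_zero])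
  refine ⟨(f : LocQuot F →ₗ[U] P), χ + (l * (n + 1)) • -t.α, sig F fun _ => -(l : ℤ), ?_, ?_⟩
  · refine isWt_hom hF hFt fun k => ?_
    have h1 := (y k).2.1.smul (hsMon l)
    have h2 : f (sig F fun _ => -(k : ℤ)) = _ := hf k
    show IsWt t.η _ (f (sig F fun _ => -(k : ℤ)))
    rw [h2]
    rwa [add_right_comm]
  · show f _ = p
    rw [hf, hyl]

end WeightTriple

/-! ### Evaluation maps, and submodules of M versus submodules of S ⊗ M -/

section Counit

variable {U : Type u} [Ring U] {S : Type u} [AddCommGroup S] [Module U S] [Module Uᵐᵒᵖ S]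
  [SMulCommClass U Uᵐᵒᵖ S] {P : Type u} [AddCommGroup P] [Module U P]

/-- The evaluation `S ⊗ W → P` for a submodule `W` of `Hom(S, P)`. -/
theorem exists_counit (W : Submodule U (HomOver U S P)) :
    ∃ ε : TensorOver U S W →ₗ[U] P, ∀ (s : S) (f : W), ε (tens s f) = (f : HomOver U S P).toLin s := by
  let β : S →+ W →+ P := AddMonoidHom.mk' (fun s => AddMonoidHom.mk'
    (fun f => (f : HomOver U S P).toLin s) fun _ _ => rfl) fun s s' =>
      AddMonoidHom.ext fun f => map_add (f : HomOver U S P).toLin s s'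
  obtain ⟨B, hB⟩ := exists_tensLift β fun s r f =>
    show (f : HomOver U S P).toLin (MulOpposite.op r • s)
      = ((r • f : W) : HomOver U S P).toLin s by rw [Submodule.coe_smul]; rfl
  refine ⟨{ B with map_smul' := fun r z => ?_ }, hB⟩
  show B (r • z) = r • B z
  induction z using TensorOver.induction with
  | htens s f => rw [smul_tens, hB, hB]; exact map_smul (f : HomOver U S P).toLin r s
  | hadd x y hx hy => rw [smul_add, map_add, hx, hy, map_add, smul_add]

/-- The span of the `s ⊗ m` with `m ∈ N`. -/
def tensSpan (S : Type u) [AddCommGroup S] [Module U S] [Module Uᵐᵒᵖ S] {M : Type u} [AddCommGroup M]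
    [Module U M] (N : Submodule U M) : Submodule U (TensorOver U S M) :=
  Submodule.span U {z | ∃ s, ∃ m ∈ N, z = tens s m}

theorem tens_mem_tensSpan {M : Type u} [AddCommGroup M] [Module U M] {N : Submodule U M} (s : S)
    {m : M} (hm : m ∈ N) : tens s m ∈ tensSpan S N := Submodule.subset_span ⟨s, m, hm, rfl⟩

theorem tensSpan_mono {M : Type u} [AddCommGroup M] [Module U M] {N N' : Submodule U M}
    (h : N ≤ N') : tensSpan S N ≤ tensSpan S N' := by
  refine Submodule.span_mono ?_
  rintro _ ⟨s, m, hm, rfl⟩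
  exact ⟨s, m, h hm, rfl⟩

theorem tensSpan_top {M : Type u} [AddCommGroup M] [Module U M] :
    tensSpan S (⊤ : Submodule U M) = ⊤ := by
  refine eq_top_iff.2 fun z _ => ?_
  induction z using TensorOver.induction with
  | htens s m => exact tens_mem_tensSpan s trivial
  | hadd x y hx hy => exact add_mem (hx trivial) (hy trivial)

/-- The submodule of all `m` with `s ⊗ m ∈ K` for all `s`. -/
def tensColon {M : Type u} [AddCommGroup M] [Module U M] (K : Submodule U (TensorOver U S M)) :
    Submodule U M where
  carrier := {m | ∀ s : S, tens s m ∈ K}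
  zero_mem' s := by rw [tens_zero]; exact K.zero_mem
  add_mem' h h' s := by rw [tens_add]; exact K.add_mem (h s) (h' s)
  smul_mem' r m h s := by rw [tens_smul]; exact h _

theorem tensColon_mono {M : Type u} [AddCommGroup M] [Module U M]
    {K K' : Submodule U (TensorOver U S M)} (h : K ≤ K') : tensColon K ≤ tensColon K' :=
  fun _ hm s => h (hm s)

end Counit

/-! ### Bijectivity of the counit and transfer of finite generation -/

namespace WeightTriple

variable {U : Type u} [Ring U] [Algebra ℂ U] {n : ℕ} {H : Type*} [AddCommGroup H] [Module ℂ H]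
  {t : WeightTriple U n H} {F : OreFamily U (n + 1)} {M P : Type u} [AddCommGroup M] [Module U M]
  [AddCommGroup P] [Module U P] {c : ℂ} {χ ν : Module.Dual ℂ H}
  (hF : F.IsGood) (hFt : ∀ i, F.s i = t.f i) (hn : 1 ≤ n) (hc : c ≠ 0)
include hF hFt hn hc

/-- The evaluation `S ⊗ W → P`, where `W` is the sum of the weight spaces of `Hom(S, P)`, is
bijective. -/
theorem counit_bijective (hP : t.Lower P c) {W : Submodule U (HomOver U (LocQuot F) P)}
    (hW : ∀ χ f, IsWt t.η χ f → f ∈ W) (hWu : t.Upper W c)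
    {ε : TensorOver U (LocQuot F) W →ₗ[U] P}
    (hε : ∀ s (f : W), ε (tens s f) = (f : HomOver U (LocQuot F) P).toLin s) :
    Function.Bijective ε := by
  constructor
  · rw [← LinearMap.ker_eq_bot, eq_bot_iff]
    have hK : t.Lower ε.ker c := (hWu.tensorOver hF hFt hn).submodule _
    have h0 : ∀ z : ε.ker, z = 0 := by
      intro z
      induction z using hK.wt.induction with
      | hadd x y hx hy => rw [hx, hy, add_zero]
      | hwt χ z hz =>
        -- The kernel satisfies the hypotheses made on P, so each of its weight vectors is a value
        -- of a homogeneous homomorphism from S into it.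
        obtain ⟨f, ν, s, hf, rfl⟩ := hK.exists_hom hF hFt hn hc hz
        let f' : HomOver U (LocQuot F) (TensorOver U (LocQuot F) W) :=
          homMap U (LocQuot F) ε.ker.subtype f
        obtain ⟨w, -, hw⟩ := hWu.exists_unit_eq hF hFt hn hc
          (IsWt.map (homMap U (LocQuot F) ε.ker.subtype) hf)
        -- By the result on the unit this homomorphism is s ↦ s ⊗ w. It takes values in the kernel
        -- of evaluation, which says that w vanishes on all s.
        have h1 : w = 0 := Subtype.ext (LinearMap.ext fun s => by
          have h2 := (f.toLin s).2
          have h3 : ((f.toLin s : ε.ker) : TensorOver U (LocQuot F) W) = tens s w := hw s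
          rw [LinearMap.mem_ker, h3, hε] at h2
          exact h2)
        refine Subtype.ext ?_
        have h3 : ((f.toLin s : ε.ker) : TensorOver U (LocQuot F) W) = tens s w := hw s
        rw [h3, h1, tens_zero]
        rfl
    exact fun z hz => congrArg Subtype.val (h0 ⟨z, hz⟩)
  · intro p
    induction p using hP.wt.induction with
    | hadd x y hx hy =>
      obtain ⟨a, rfl⟩ := hx
      obtain ⟨b, rfl⟩ := hy
      exact ⟨a + b, map_add _ _ _⟩
    | hwt χ p hp =>
      obtain ⟨f, ν, s, hf, rfl⟩ := hP.exists_hom hF hFt hn hc hp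
      exact ⟨tens s (⟨f, hW ν f hf⟩ : W), hε _ _⟩

/-- Weight vectors of K are values of homomorphisms S → K. Inside S ⊗ M these have the form s ↦ s ⊗
w, and then w belongs to `tensColon K`. -/
theorem tensSpan_tensColon (hM : t.Upper M c) (K : Submodule U (TensorOver U (LocQuot F) M)) :
    tensSpan (LocQuot F) (tensColon K) = K := by
  refine le_antisymm (Submodule.span_le.2 ?_) fun z hz => ?_
  · rintro _ ⟨s, m, hm, rfl⟩
    exact hm s
  have hK : t.Lower K c := (hM.tensorOver hF hFt hn).submodule _
  have h0 : ∀ z : K, (z : TensorOver U (LocQuot F) M) ∈ tensSpan (LocQuot F) (tensColon K) := by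
    intro z
    induction z using hK.wt.induction with
    | hadd x y hx hy => exact add_mem hx hy
    | hwt χ z hz =>
      obtain ⟨f, ν, s, hf, rfl⟩ := hK.exists_hom hF hFt hn hc hz
      obtain ⟨w, -, hw⟩ := hM.exists_unit_eq hF hFt hn hc
        (IsWt.map (homMap U (LocQuot F) K.subtype) hf)
      have h3 : ∀ s, ((f.toLin s : K) : TensorOver U (LocQuot F) M) = tens s w := hw
      rw [h3]
      exact tens_mem_tensSpan s fun s => by rw [← h3]; exact (f.toLin s).2
  exact h0 ⟨z, hz⟩

/-- If all s ⊗ m lie in the image of S ⊗ N, then m maps to zero in S ⊗ (M / N) under every s;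
injectivity of the unit for M / N gives m ∈ N. -/
theorem tensColon_tensSpan (hM : t.Upper M c) (N : Submodule U M) :
    tensColon (tensSpan (LocQuot F) N) = N := by
  refine le_antisymm (fun m hm => ?_) fun m hm s => tens_mem_tensSpan s hm
  rw [← Submodule.Quotient.mk_eq_zero]
  refine (hM.quotient N).unit_injective hF hFt hn hc fun s => ?_
  have h1 : tensSpan (LocQuot F) N ≤ (tensorMap U (LocQuot F) N.mkQ).ker := by
    refine Submodule.span_le.2 ?_
    rintro _ ⟨s, m, hm, rfl⟩
    rw [SetLike.mem_coe, LinearMap.mem_ker, tensorMap_tens, Submodule.mkQ_apply,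
      (Submodule.Quotient.mk_eq_zero N).2 hm, tens_zero]
  exact h1 (hm s)

theorem eq_top_of_tensSpan_eq_top (hM : t.Upper M c) {N : Submodule U M}
    (h : tensSpan (LocQuot F) N = ⊤) : N = ⊤ := by
  rw [← tensColon_tensSpan hF hFt hn hc hM N, h]
  exact eq_top_iff.2 fun _ _ _ => trivial

/-- `S ⊗ M` is finitely generated if `M` is. -/
theorem finite_tensorOver (hM : t.Upper M c) [hfin : Module.Finite U M] :
    Module.Finite U (TensorOver U (LocQuot F) M) := by
  classical
  let N : Finset (TensorOver U (LocQuot F) M) → Submodule U M := fun T =>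
    tensColon (Submodule.span U (T : Set (TensorOver U (LocQuot F) M)))
  have hmono : Monotone N := fun T T' h => tensColon_mono (Submodule.span_mono h)
  -- The submodules of M attached to finite subsets of S ⊗ M are directed and exhaust M; as M is
  -- finitely generated, one of them is all of M.
  have htop : ⨆ T, N T = ⊤ := by
    refine eq_top_of_tensSpan_eq_top hF hFt hn hc hM (eq_top_iff.2 fun z _ => ?_)
    have h1 := tensSpan_tensColon hF hFt hn hc hM
      (Submodule.span U (({z} : Finset _) : Set (TensorOver U (LocQuot F) M)))
    refine tensSpan_mono (le_iSup N {z}) ?_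
    rw [h1]
    exact Submodule.subset_span (by simp)
  obtain ⟨T, hT⟩ : ∃ T, N T = ⊤ := by
    obtain ⟨G, hG⟩ := hfin.fg_top
    have h1 : ∀ m : M, ∃ T, m ∈ N T := fun m =>
      (Submodule.mem_iSup_of_directed N hmono.directed_le).1 (htop ▸ Submodule.mem_top)
    choose T hT using h1
    refine ⟨G.biUnion T, eq_top_iff.2 (hG ▸ Submodule.span_le.2 fun m hm => ?_)⟩
    exact hmono (Finset.subset_biUnion_of_mem T hm) (hT m)
  refine ⟨⟨T, ?_⟩⟩
  rw [← tensSpan_tensColon hF hFt hn hc hM (Submodule.span U _),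
    show tensColon (Submodule.span U (T : Set (TensorOver U (LocQuot F) M))) = ⊤ from hT,
    tensSpan_top]

/-- `M` is finitely generated if `S ⊗ M` is. -/
theorem finite_of_finite_tensorOver (hM : t.Upper M c)
    (hfin : Module.Finite U (TensorOver U (LocQuot F) M)) : Module.Finite U M := by
  classical
  let K : Finset M → Submodule U (TensorOver U (LocQuot F) M) := fun T =>
    tensSpan (LocQuot F) (Submodule.span U (T : Set M))
  have hmono : Monotone K := fun T T' h => tensSpan_mono (Submodule.span_mono h)
  have h1 : ∀ z, ∃ T, z ∈ K T := by
    intro z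
    induction z using TensorOver.induction with
    | htens s m => exact ⟨{m}, tens_mem_tensSpan s (Submodule.subset_span (by simp))⟩
    | hadd x y hx hy =>
      obtain ⟨T, hT⟩ := hx
      obtain ⟨T', hT'⟩ := hy
      exact ⟨T ∪ T', add_mem (hmono Finset.subset_union_left hT)
        (hmono Finset.subset_union_right hT')⟩
  choose T hT using h1
  obtain ⟨G, hG⟩ := hfin.fg_top
  have h2 : K (G.biUnion T) = ⊤ := eq_top_iff.2 (hG ▸ Submodule.span_le.2 fun m hm =>
    hmono (Finset.subset_biUnion_of_mem T hm) (hT m))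
  exact ⟨⟨G.biUnion T, eq_top_of_tensSpan_eq_top hF hFt hn hc hM h2⟩⟩

end WeightTriple

/-! ### Root spaces of a reductive Lie algebra -/

section Reductive

variable {g : Type u} [LieRing g] [LieAlgebra ℂ g]

theorem lie_mem_rootSpace {H : LieSubalgebra ℂ g} {β γ : Module.Dual ℂ H} {x y : g}
    (hx : x ∈ rootSpace H β) (hy : y ∈ rootSpace H γ) : ⁅x, y⁆ ∈ rootSpace H (β + γ) := by
  rw [mem_rootSpace] at hx hy ⊢
  intro h
  rw [leibniz_lie, hx, hy, smul_lie, lie_smul, LinearMap.add_apply, add_smul]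

variable [FiniteDimensional ℂ g]

theorem mem_center_iff {x : g} : x ∈ LieAlgebra.center ℂ g ↔ ∀ y : g, ⁅y, x⁆ = 0 :=
  LieModule.mem_maxTrivSubmodule ℂ g g x

/-- The quotient of a reductive Lie algebra by its centre is semisimple. -/
theorem hasTrivialRadical_of_surjective {L : Type*} [LieRing L] [LieAlgebra ℂ L]
    (hred : LieAlgebra.radical ℂ g = LieAlgebra.center ℂ g) (π : g →ₗ⁅ℂ⁆ L)
    (hπ : Function.Surjective π) (hker : ∀ x, π x = 0 → x ∈ LieAlgebra.center ℂ g)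
    (hcen : ∀ x ∈ LieAlgebra.center ℂ g, π x = 0) : LieAlgebra.HasTrivialRadical ℂ L := by
  rw [LieAlgebra.hasTrivialRadical_iff_no_abelian_ideals]
  intro A hA
  have hA' : ∀ a ∈ A, ∀ b ∈ A, ⁅a, b⁆ = 0 := fun a ha b hb =>
    congrArg Subtype.val (hA.trivial (⟨a, ha⟩ : A) (⟨b, hb⟩ : A))
  set I := A.comap π with hI
  -- The preimage I of an abelian ideal satisfies [I, I] ⊆ centre, so it is solvable, hence
  -- contained in the radical, which is the centre; its image is therefore zero.
  have h1 : LieAlgebra.derivedSeriesOfIdeal ℂ g 1 I ≤ LieAlgebra.center ℂ g := by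
    rw [LieAlgebra.derivedSeriesOfIdeal_succ, LieAlgebra.derivedSeriesOfIdeal_zero,
      LieSubmodule.lie_le_iff]
    intro x hx y hy
    refine hker _ ?_
    rw [LieHom.map_lie]
    exact hA' _ (LieIdeal.mem_comap.1 hx) _ (LieIdeal.mem_comap.1 hy)
  have h2 : LieAlgebra.derivedSeriesOfIdeal ℂ g 2 I = ⊥ := by
    rw [LieAlgebra.derivedSeriesOfIdeal_succ, eq_bot_iff, LieSubmodule.lie_le_iff]
    intro x _ y hy
    exact mem_center_iff.1 (h1 hy) x
  have h3 : LieAlgebra.IsSolvable I :=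
    LieAlgebra.IsSolvable.mk (R := ℂ) (k := 2) ((LieIdeal.derivedSeries_eq_bot_iff I 2).2 h2)
  have h4 : I ≤ LieAlgebra.center ℂ g := hred ▸ (LieAlgebra.LieIdeal.solvable_iff_le_radical ℂ g I).1 h3
  rw [eq_bot_iff]
  intro y hy
  obtain ⟨x, rfl⟩ := hπ y
  exact (LieSubmodule.mem_bot _).2 (hcen x (h4 (LieIdeal.mem_comap.2 hy)))

variable {H : LieSubalgebra ℂ g} (hH : IsMaximalTorus H)
include hH

theorem IsMaximalTorus.center_le {x : g} (hx : x ∈ LieAlgebra.center ℂ g) : x ∈ H :=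
  (hH.mem_iff x).2 fun h _ => mem_center_iff.1 hx h

/-- If x normalises H modulo the centre, then [h, x] lies in H, so (ad h)² x = 0. Semisimplicity of
ad h yields [h, x] = 0, and H is its own centraliser. -/
theorem IsMaximalTorus.isCartanSubalgebra_map {L : Type*} [LieRing L] [LieAlgebra ℂ L]
    (π : g →ₗ⁅ℂ⁆ L) (hπ : Function.Surjective π)
    (hker : ∀ x, π x = 0 → x ∈ LieAlgebra.center ℂ g) : (H.map π).IsCartanSubalgebra where
  nilpotent := by
    have : IsLieAbelian (H.map π) := ⟨by
      rintro ⟨_, x, hx, rfl⟩ ⟨_, y, hy, rfl⟩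
      refine Subtype.ext ?_
      show ⁅π x, π y⁆ = 0
      rw [← LieHom.map_lie, hH.lie_eq_zero ⟨x, hx⟩ ⟨y, hy⟩, map_zero]⟩
    infer_instance
  self_normalizing := by
    refine le_antisymm (fun y hy => ?_) (LieSubalgebra.le_normalizer _)
    obtain ⟨x, rfl⟩ := hπ y
    rw [LieSubalgebra.mem_normalizer_iff'] at hy
    refine ⟨x, (hH.mem_iff x).2 fun h hh => ?_, rfl⟩
    obtain ⟨k, hk, hkx⟩ := hy (π h) ⟨h, hh, rfl⟩
    have h1 : ⁅h, x⁆ ∈ H := by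
      have h2 : ⁅h, x⁆ - k ∈ LieAlgebra.center ℂ g := hker _ (by
        rw [map_sub, LieHom.map_lie, ← hkx, sub_eq_zero]; rfl)
      rw [← sub_add_cancel ⁅h, x⁆ k]
      exact add_mem (hH.center_le h2) hk
    have h2 : ((LieAlgebra.ad ℂ g h) ^ 2) x = 0 := by
      rw [pow_two]
      exact hH.lie_eq_zero ⟨h, hh⟩ ⟨_, h1⟩
    have h3 : x ∈ (LieAlgebra.ad ℂ g h).maxGenEigenspace 0 :=
      Module.End.mem_maxGenEigenspace _ _ _ |>.2 ⟨2, by simpa using h2⟩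
    rw [(hH.semisimple h hh).isFinitelySemisimple.maxGenEigenspace_eq_eigenspace] at h3
    simpa using Module.End.mem_eigenspace_iff.1 h3

variable (hred : LieAlgebra.radical ℂ g = LieAlgebra.center ℂ g)

theorem eq_zero_of_mem_center_of_mem_rootSpace {β : Module.Dual ℂ H} (hβ : β ≠ 0) {x : g}
    (hx : x ∈ rootSpace H β) (hc : x ∈ LieAlgebra.center ℂ g) : x = 0 := by
  obtain ⟨h, hh⟩ : ∃ h, β h ≠ 0 := by
    by_contra! h'
    exact hβ (LinearMap.ext h')
  have h1 := (mem_rootSpace H).1 hx h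
  rw [mem_center_iff.1 hc] at h1
  exact (smul_eq_zero.1 h1.symm).resolve_left hh

/-- A lift e of y is an eigenvector only up to the centre. Bracketing with some h₀ such that β h₀ =
1 leaves the image unchanged and kills the central error. -/
theorem exists_mem_rootSpace_of_map {L : Type*} [LieRing L] [LieAlgebra ℂ L]
    (π : g →ₗ⁅ℂ⁆ L) (hπ : Function.Surjective π)
    (hker : ∀ x, π x = 0 → x ∈ LieAlgebra.center ℂ g) {β : Module.Dual ℂ H} (hβ : β ≠ 0) {y : L}
    (hy : ∀ h : H, ⁅π h, y⁆ = β h • y) : ∃ x ∈ rootSpace H β, π x = y := by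
  obtain ⟨h₀, hh₀⟩ : ∃ h, β h = 1 := by
    obtain ⟨h, hh⟩ : ∃ h, β h ≠ 0 := by
      by_contra! h'
      exact hβ (LinearMap.ext h')
    exact ⟨(β h)⁻¹ • h, by rw [map_smul, smul_eq_mul, inv_mul_cancel₀ hh]⟩
  obtain ⟨e, rfl⟩ := hπ y
  refine ⟨⁅(h₀ : g), e⁆, (mem_rootSpace H).2 fun h => ?_, by
    rw [LieHom.map_lie, hy, hh₀, one_smul]⟩
  have h1 : ⁅(h : g), e⁆ - β h • e ∈ LieAlgebra.center ℂ g := hker _ (by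
    rw [map_sub, LieHom.map_lie, hy, map_smul, sub_self])
  have h2 := mem_center_iff.1 h1 h₀
  rw [lie_sub, lie_smul, sub_eq_zero] at h2
  rw [leibniz_lie, hH.lie_eq_zero, zero_lie, zero_add, h2]

include hred

/-- The quotient by the centre is semisimple with Cartan subalgebra the image of H, so the structure
theory of roots applies there. Root spaces for β ≠ 0 meet the centre trivially and lift back. -/
theorem rootSpace_facts_of_surjective {L' : Type*} [LieRing L'] [LieAlgebra ℂ L']
    (π : g →ₗ⁅ℂ⁆ L') (hπ : Function.Surjective π)
    (hπ0 : ∀ x, π x = 0 ↔ x ∈ LieAlgebra.center ℂ g) :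
    (∀ β ∈ roots H, Nonempty (RootTriple H β)) ∧
    (∀ β ∈ roots H, ∀ e ∈ rootSpace H β, ∀ x ∈ rootSpace H β, e ≠ 0 → ∃ c : ℂ, x = c • e) ∧
    (∀ β ∈ roots H, ∀ c : ℂ, c • β ∈ roots H → c = -1 ∨ c = 1) := by
  have hker := fun x => (hπ0 x).1
  have : FiniteDimensional ℂ L' := Module.Finite.of_surjective (π : g →ₗ[ℂ] L') hπ
  have hHT : LieAlgebra.HasTrivialRadical ℂ L' :=
    hasTrivialRadical_of_surjective hred π hπ hker fun x => (hπ0 x).2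
  have hcar : (H.map π).IsCartanSubalgebra := hH.isCartanSubalgebra_map π hπ hker
  let ρ : H →ₗ[ℂ] H.map π :=
    { toFun := fun h => ⟨π h, h, h.2, rfl⟩
      map_add' := fun x y => Subtype.ext (map_add π (x : g) y)
      map_smul' := fun c x => Subtype.ext (map_smul π c (x : g)) }
  have hρ : Function.Surjective ρ := by
    rintro ⟨_, x, hx, rfl⟩
    exact ⟨⟨x, hx⟩, rfl⟩
  obtain ⟨σ, hσ⟩ := LinearMap.exists_rightInverse_of_surjective ρ (LinearMap.range_eq_top.2 hρ)
  -- A root factors through the image of H, since the kernel of H → L' is central and acts by zero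
  -- on root vectors.
  have hσρ : ∀ β ∈ roots H, ∀ h, β (σ (ρ h)) = β h := by
    intro β hβ h
    obtain ⟨x, hx, hx0⟩ := Submodule.exists_mem_ne_zero_of_ne_bot hβ.2
    have h1 : ρ (σ (ρ h) - h) = 0 := by
      rw [map_sub, sub_eq_zero]
      exact LinearMap.congr_fun hσ (ρ h)
    have h2 : ((σ (ρ h) - h : H) : g) ∈ LieAlgebra.center ℂ g := hker _ (congrArg Subtype.val h1)
    have h3 := (mem_rootSpace H).1 hx (σ (ρ h) - h)
    rw [← lie_skew, mem_center_iff.1 h2, neg_zero] at h3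
    have h4 := (smul_eq_zero.1 h3.symm).resolve_right hx0
    rwa [map_sub, sub_eq_zero] at h4
  have hwt : ∀ β ∈ roots H, ∀ x ∈ rootSpace H β,
      π x ∈ LieModule.weightSpace L' (fun y : H.map π => β (σ y)) := by
    intro β hβ x hx
    rw [LieModule.mem_weightSpace]
    intro y
    obtain ⟨h, rfl⟩ := hρ y
    show ⁅π h, π x⁆ = _
    rw [← LieHom.map_lie, (mem_rootSpace H).1 hx, hσρ β hβ, map_smul]
  have hπne : ∀ β ∈ roots H, ∀ x ∈ rootSpace H β, x ≠ 0 → π x ≠ 0 := fun β hβ x hx hx0 h =>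
    hx0 (eq_zero_of_mem_center_of_mem_rootSpace hH hβ.1 hx (hker _ h))
  have hne : ∀ β ∈ roots H,
      LieModule.genWeightSpace L' (fun y : H.map π => β (σ y)) ≠ ⊥ := by
    intro β hβ h
    obtain ⟨x, hx, hx0⟩ := Submodule.exists_mem_ne_zero_of_ne_bot hβ.2
    have := LieModule.weightSpace_le_genWeightSpace _ _ (hwt β hβ x hx)
    rw [h] at this
    exact hπne β hβ x hx hx0 ((LieSubmodule.mem_bot _).1 this)
  let wt : ∀ β ∈ roots H, LieModule.Weight ℂ (H.map π) L' := fun β hβ => ⟨_, hne β hβ⟩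
  have hwtρ : ∀ β hβ h, wt β hβ (ρ h) = β h := fun β hβ h => hσρ β hβ h
  have hnz : ∀ β hβ, (wt β hβ).IsNonZero := by
    intro β hβ h
    refine hβ.1 (LinearMap.ext fun x => ?_)
    rw [← hwtρ β hβ, LieModule.Weight.IsZero.eq h]
    rfl
  refine ⟨fun β hβ => ?_, fun β hβ e he x hx he0 => ?_, fun β hβ c hc => ?_⟩
  · obtain ⟨h', e', f', ht, he', hf'⟩ :=
      LieAlgebra.IsKilling.exists_isSl2Triple_of_weight_isNonZero (hnz β hβ)
    have hlie : ∀ y ∈ LieAlgebra.rootSpace (H.map π) (wt β hβ), ∀ h : H, ⁅π h, y⁆ = β h • y := by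
      intro y hy h
      have := LieAlgebra.IsKilling.lie_eq_smul_of_mem_rootSpace hy (ρ h)
      rw [hwtρ β hβ] at this
      exact this
    have hlie' : ∀ y ∈ LieAlgebra.rootSpace (H.map π) (-wt β hβ), ∀ h : H,
        ⁅π h, y⁆ = (-β) h • y := by
      intro y hy h
      have := LieAlgebra.IsKilling.lie_eq_smul_of_mem_rootSpace hy (ρ h)
      rw [Pi.neg_apply, hwtρ β hβ] at this
      exact this
    obtain ⟨e, he, rfl⟩ := exists_mem_rootSpace_of_map hH π hπ hker hβ.1 (hlie e' he')
    obtain ⟨f, hf, rfl⟩ := exists_mem_rootSpace_of_map hH π hπ hker (neg_ne_zero.2 hβ.1)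
      (hlie' f' hf')
    have h1 : ⁅e, f⁆ ∈ H := by
      have := lie_mem_rootSpace he hf
      rwa [add_neg_cancel, hH.rootSpace_zero] at this
    refine ⟨⟨e, f, ⟨_, h1⟩, he, hf, rfl, ?_⟩⟩
    have h2 := (mem_rootSpace H).1 he ⟨_, h1⟩
    have h3 := congrArg π h2
    rw [LieHom.map_lie, LieHom.map_lie, ht.lie_e_f, ht.lie_h_e_nsmul, map_smul,
      ← Nat.cast_smul_eq_nsmul ℂ] at h3
    exact (smul_left_injective ℂ ht.e_ne_zero h3).symm
  · have h1 := LieAlgebra.IsKilling.finrank_rootSpace_eq_one (wt β hβ) (hnz β hβ)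
    have hm : ∀ x ∈ rootSpace H β, π x ∈ LieAlgebra.rootSpace (H.map π) (wt β hβ) := fun x hx =>
      LieModule.weightSpace_le_genWeightSpace _ _ (hwt β hβ x hx)
    obtain ⟨c, hc⟩ := (finrank_eq_one_iff_of_nonzero'
      (⟨π e, hm e he⟩ : LieAlgebra.rootSpace (H.map π) (wt β hβ))
      (fun h => hπne β hβ e he he0 (congrArg Subtype.val h))).1 h1 ⟨π x, hm x hx⟩
    refine ⟨c, ?_⟩
    rw [← sub_eq_zero]
    refine eq_zero_of_mem_center_of_mem_rootSpace hH hβ.1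
      (sub_mem hx (Submodule.smul_mem _ c he)) (hker _ ?_)
    rw [map_sub, map_smul, sub_eq_zero]
    exact (congrArg Subtype.val hc).symm
  · have h1 := LieAlgebra.IsKilling.eq_neg_or_eq_of_eq_smul (wt β hβ) (wt _ hc) (hnz _ hc) c rfl
    obtain ⟨h, hh⟩ : ∃ h, β h ≠ 0 := by
      by_contra! h'
      exact hβ.1 (LinearMap.ext h')
    refine h1.imp (fun h2 => ?_) fun h2 => ?_
    · have h3 := congrArg (fun w : LieModule.Weight ℂ (H.map π) L' => w (ρ h)) h2
      simp only [LieModule.Weight.coe_neg, Pi.neg_apply] at h3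
      rw [hwtρ _ hc, hwtρ β hβ, LinearMap.smul_apply, smul_eq_mul] at h3
      exact mul_right_cancel₀ hh (by rw [h3]; ring)
    · have h3 : wt (c • β) hc (ρ h) = wt β hβ (ρ h) := by rw [h2]
      rw [hwtρ _ hc, hwtρ β hβ, LinearMap.smul_apply, smul_eq_mul] at h3
      exact mul_right_cancel₀ hh (by rw [h3]; ring)

attribute [local instance] LieRing.ofAssociativeRing in
/-- Each root of a reductive Lie algebra has a root triple and a one-dimensional root space, and its
only multiples which are roots are itself and its negative. -/
theorem rootSpace_facts :
    (∀ β ∈ roots H, Nonempty (RootTriple H β)) ∧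
    (∀ β ∈ roots H, ∀ e ∈ rootSpace H β, ∀ x ∈ rootSpace H β, e ≠ 0 → ∃ c : ℂ, x = c • e) ∧
    (∀ β ∈ roots H, ∀ c : ℂ, c • β ∈ roots H → c = -1 ∨ c = 1) := by
  refine rootSpace_facts_of_surjective hH hred (LieAlgebra.ad ℂ g).rangeRestrict
    (LieHom.surjective_rangeRestrict _) fun x => ?_
  rw [← LieAlgebra.self_module_ker_eq_center, ← LieAlgebra.ad_ker_eq_self_module_ker,
    LieHom.mem_ker]
  exact Subtype.ext_iff

end Reductive

/-! ### Exponentials of nilpotent inner derivations -/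

section Exp

variable {g : Type u} [LieRing g] [LieAlgebra ℂ g]

open Finset in
/-- For an ad-nilpotent element `x`, there is an automorphism of `g` given by `exp (ad x)`. -/
theorem exists_exp_ad {x : g} (hx : IsNilpotent (LieAlgebra.ad ℂ g x)) :
    ∃ φ : g ≃ₗ⁅ℂ⁆ g, ∀ y : g, ⁅x, ⁅x, ⁅x, y⁆⁆⁆ = 0 →
      φ y = y + ⁅x, y⁆ + (2 : ℂ)⁻¹ • ⁅x, ⁅x, y⁆⁆ := by
  -- The exponential of a nilpotent derivation is taken over ℚ, so g is viewed as a Lie algebra over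
  -- ℚ by restriction of scalars.
  let _ : Module ℚ g := Module.compHom g (algebraMap ℚ ℂ)
  have hq : ∀ (q : ℚ) (y : g), q • y = (q : ℂ) • y := fun _ _ => rfl
  let _ : LieAlgebra ℚ g := { lie_smul := fun q y z => by rw [hq, hq, lie_smul] }
  -- The inner derivation attached to a is y ↦ [y, a]; the sign makes D equal to ad x.
  let D : LieDerivation ℂ g g := LieDerivation.inner ℂ g g (-x)
  have hD : ∀ y, D y = ⁅x, y⁆ := fun y => by
    show ⁅y, -x⁆ = _
    rw [lie_neg, lie_skew]
  have hD' : D.toLinearMap = LieAlgebra.ad ℂ g x := LinearMap.ext hD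
  have hDn : IsNilpotent D.toLinearMap := by rw [hD']; exact hx
  refine ⟨LieDerivation.exp D hDn, fun y hy => ?_⟩
  have h1 := IsNilpotent.exp_smul_eq_sum (a := D.toLinearMap) (m := y) (k := 3) (by
    rw [hD', pow_succ, pow_two]
    exact hy) hDn
  rw [LieDerivation.exp_map_apply]
  refine h1.trans ?_
  rw [hD', sum_range_succ, sum_range_succ, sum_range_succ, sum_range_zero, zero_add, pow_two]
  show (_ : ℚ) • y + (_ : ℚ) • ⁅x, y⁆ + (_ : ℚ) • ⁅x, ⁅x, y⁆⁆ = _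
  rw [hq, hq, hq]
  norm_num

end Exp

/-! ### Root triples, reflections and their lifts to automorphisms -/

section Reflections

variable {g : Type u} [LieRing g] [LieAlgebra ℂ g] {H : LieSubalgebra ℂ g}
  {α β γ : Module.Dual ℂ H}

namespace RootTriple

/-- The root triple of the negative root. -/
def swap (τ : RootTriple H α) : RootTriple H (-α) where
  e := τ.f
  f := τ.e
  h := -τ.h
  e_mem := τ.f_mem
  f_mem := by rw [neg_neg]; exact τ.e_mem
  lie_e_f := by rw [← lie_skew, τ.lie_e_f]; rfl
  apply_h := by rw [LinearMap.neg_apply, map_neg, neg_neg, τ.apply_h]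

theorem h_ne_zero (τ : RootTriple H α) : (τ.h : g) ≠ 0 := by
  intro h
  have h1 : τ.h = 0 := Subtype.ext h
  have := τ.apply_h
  rw [h1, map_zero] at this
  norm_num at this

theorem e_ne_zero (τ : RootTriple H α) : τ.e ≠ 0 := fun h => τ.h_ne_zero (by
  rw [← τ.lie_e_f, h, zero_lie])

theorem f_ne_zero (τ : RootTriple H α) : τ.f ≠ 0 := τ.swap.e_ne_zero

theorem root_ne_zero (τ : RootTriple H α) : α ≠ 0 := by
  rintro rfl
  have := τ.apply_h
  norm_num at this

theorem mem_roots (τ : RootTriple H α) : α ∈ roots H :=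
  ⟨τ.root_ne_zero, fun h => τ.e_ne_zero (by have := τ.e_mem; rwa [h, Submodule.mem_bot] at this)⟩

theorem lie_h_e (τ : RootTriple H α) : ⁅(τ.h : g), τ.e⁆ = (2 : ℂ) • τ.e := by
  rw [(mem_rootSpace H).1 τ.e_mem, τ.apply_h]

theorem lie_h_f (τ : RootTriple H α) : ⁅(τ.h : g), τ.f⁆ = (-2 : ℂ) • τ.f := by
  rw [(mem_rootSpace H).1 τ.f_mem, LinearMap.neg_apply, τ.apply_h]

theorem isSl2Triple (τ : RootTriple H α) : IsSl2Triple (τ.h : g) τ.e τ.f where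
  h_ne_zero := τ.h_ne_zero
  lie_e_f := τ.lie_e_f
  lie_h_e_nsmul := by rw [τ.lie_h_e, ← Nat.cast_smul_eq_nsmul ℂ]; norm_num
  lie_h_f_nsmul := by rw [τ.lie_h_f, ← Nat.cast_smul_eq_nsmul ℂ, ← neg_smul]; norm_num

/-- The image of a root triple under an automorphism of `g` which permutes root spaces. -/
def map (τ : RootTriple H β) (φ : g ≃ₗ⁅ℂ⁆ g) (s : H → H) (hs : ∀ h : H, φ h = s h)
    (he : φ τ.e ∈ rootSpace H γ) (hf : φ τ.f ∈ rootSpace H (-γ)) (hγ : γ (s τ.h) = 2) :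
    RootTriple H γ where
  e := φ τ.e
  f := φ τ.f
  h := s τ.h
  e_mem := he
  f_mem := hf
  lie_e_f := by rw [← LieEquiv.map_lie, τ.lie_e_f, hs]
  apply_h := hγ

end RootTriple

theorem dualReflection_apply (τ : RootTriple H α) (ν : Module.Dual ℂ H) :
    dualReflection τ ν = ν - ν τ.h • α := Module.reflection_apply _ _

theorem dualReflection_apply_apply (τ : RootTriple H α) (ν : Module.Dual ℂ H) (x : H) :
    dualReflection τ ν x = ν (x - α x • τ.h) := by
  rw [dualReflection_apply, LinearMap.sub_apply, LinearMap.smul_apply, map_sub, map_smul,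
    smul_eq_mul, smul_eq_mul, mul_comm]

theorem dualReflection_self (τ : RootTriple H α) : dualReflection τ α = -α := by
  rw [dualReflection_apply, τ.apply_h, two_smul]; abel

theorem dualReflection_dualReflection (τ : RootTriple H α) (ν : Module.Dual ℂ H) :
    dualReflection τ (dualReflection τ ν) = ν :=
  Module.involutive_reflection (x := α) (f := Module.Dual.eval ℂ H τ.h) τ.apply_h ν

/-- The reflection `x ↦ x - α(x) h_α` of `H`. -/
def torusReflection (τ : RootTriple H α) (x : H) : H := x - α x • τ.h

theorem torusReflection_torusReflection (τ : RootTriple H α) (x : H) :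
    torusReflection τ (torusReflection τ x) = x := by
  rw [torusReflection, torusReflection, map_sub, map_smul, τ.apply_h, smul_eq_mul]
  module

namespace IsReflectionLift

variable {τ : RootTriple H α} {φ : g ≃ₗ⁅ℂ⁆ g} (hφ : IsReflectionLift τ φ)
include hφ

theorem apply (x : H) : φ (x : g) = (torusReflection τ x : H) := hφ x

theorem symm : IsReflectionLift τ φ.symm := by
  intro x
  have h1 : φ (torusReflection τ x : H) = (x : g) := by
    rw [hφ.apply, torusReflection_torusReflection]
  show φ.symm (x : g) = (torusReflection τ x : H)
  rw [← h1, LieEquiv.symm_apply_apply]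

theorem map_mem_rootSpace {x : g} (hx : x ∈ rootSpace H β) :
    φ x ∈ rootSpace H (dualReflection τ β) := by
  rw [mem_rootSpace]
  intro h
  have h1 : (h : g) = φ (torusReflection τ h : H) := by
    rw [hφ.apply, torusReflection_torusReflection]
  rw [h1, ← LieEquiv.map_lie, (mem_rootSpace H).1 hx, dualReflection_apply_apply, map_smul]
  rfl

theorem dualReflection_mem_roots (hβ : β ∈ roots H) : dualReflection τ β ∈ roots H := by
  refine ⟨(LinearEquiv.map_ne_zero_iff _).2 hβ.1, fun h => ?_⟩
  obtain ⟨x, hx, hx0⟩ := Submodule.exists_mem_ne_zero_of_ne_bot hβ.2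
  have := hφ.map_mem_rootSpace hx
  rw [h, Submodule.mem_bot] at this
  exact hx0 (φ.injective (this.trans (map_zero φ).symm))

/-- The image of a root triple. -/
def mapTriple (σ : RootTriple H β) : RootTriple H (dualReflection τ β) :=
  σ.map φ (torusReflection τ) hφ.apply (hφ.map_mem_rootSpace σ.e_mem)
    (by rw [← map_neg]; exact hφ.map_mem_rootSpace σ.f_mem)
    (by
      rw [dualReflection_apply_apply]
      exact (congrArg β (torusReflection_torusReflection τ σ.h)).trans σ.apply_h)

theorem mapTriple_h (σ : RootTriple H β) : (hφ.mapTriple σ).h = torusReflection τ σ.h := rfl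

end IsReflectionLift

variable [FiniteDimensional ℂ g]

/-- The lift is the classical exp(ad e) exp(-ad f) exp(ad e). On H and on e the exponential series
involved stop at the quadratic term. -/
theorem exists_isReflectionLift (τ : RootTriple H α) : ∃ φ : g ≃ₗ⁅ℂ⁆ g, IsReflectionLift τ φ := by
  have hfn := τ.isNilpotent_ad
  have hen : IsNilpotent (LieAlgebra.ad ℂ g τ.e) := τ.swap.isNilpotent_ad
  obtain ⟨φ, hφ⟩ := exists_exp_ad hen
  obtain ⟨ψ, hψ⟩ := exists_exp_ad (x := -τ.f) (by rw [map_neg]; exact hfn.neg)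
  have hex : ∀ x : H, ⁅τ.e, (x : g)⁆ = -(α x • τ.e) := fun x => by
    rw [← lie_skew, (mem_rootSpace H).1 τ.e_mem]
  have hfx : ∀ x : H, ⁅-τ.f, (x : g)⁆ = -(α x • τ.f) := fun x => by
    rw [neg_lie, lie_skew, (mem_rootSpace H).1 τ.f_mem, LinearMap.neg_apply, neg_smul]
  have h1 : ∀ x : H, φ (x : g) = (x : g) - α x • τ.e := fun x => by
    have h2 : ⁅τ.e, ⁅τ.e, (x : g)⁆⁆ = 0 := by rw [hex, lie_neg, lie_smul, lie_self, smul_zero, neg_zero]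
    rw [hφ _ (by rw [h2, lie_zero]), h2, hex, smul_zero, add_zero, sub_eq_add_neg]
  have h2 : φ τ.e = τ.e := by
    rw [hφ _ (by rw [lie_self, lie_zero, lie_zero]), lie_self, lie_zero, smul_zero, add_zero, add_zero]
  have h3 : ∀ x : H, ψ (x : g) = (x : g) - α x • τ.f := fun x => by
    have h2 : ⁅-τ.f, ⁅-τ.f, (x : g)⁆⁆ = 0 := by
      rw [hfx, lie_neg, lie_smul, neg_lie, lie_self, neg_zero, smul_zero, neg_zero]
    rw [hψ _ (by rw [h2, lie_zero]), h2, hfx, smul_zero, add_zero, sub_eq_add_neg]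
  have h4 : ψ τ.e = τ.e + (τ.h : g) - τ.f := by
    have h5 : ⁅-τ.f, τ.e⁆ = (τ.h : g) := by rw [neg_lie, lie_skew, τ.lie_e_f]
    rw [hψ _ (by
      rw [h5, hfx, lie_neg, lie_smul, neg_lie, lie_self, neg_zero, smul_zero, neg_zero]), h5, hfx,
      τ.apply_h]
    module
  refine ⟨(φ.trans ψ).trans φ, fun x => ?_⟩
  show φ (ψ (φ (x : g))) = _
  have h6 : ψ (φ (x : g)) = (x : g) - α x • (τ.e + τ.h) := by
    rw [h1, map_sub, map_smul, h3, h4]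
    module
  rw [h6, map_sub, map_smul, map_add, h1, h1, h2, τ.apply_h]
  module

/-- The numbers `β(h_α)` are integers. -/
theorem exists_int_apply_h (τ : RootTriple H α) (hβ : β ∈ roots H ∨ β = 0) :
    ∃ z : ℤ, β τ.h = z := by
  rcases hβ with hβ | rfl
  swap
  · exact ⟨0, by simp⟩
  obtain ⟨x, hx, hx0⟩ := Submodule.exists_mem_ne_zero_of_ne_bot hβ.2
  have hhx : ⁅(τ.h : g), x⁆ = β τ.h • x := (mem_rootSpace H).1 hx _
  have t := τ.isSl2Triple
  obtain ⟨m, hm⟩ := τ.swap.isNilpotent_ad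
  change LieAlgebra.ad ℂ g τ.e ^ m = 0 at hm
  -- The last nonzero e^k x is a primitive vector for the sl₂ of α, and its weight β(h_α) + 2k is a
  -- natural number.
  obtain ⟨k, hk, hk'⟩ := Nat.exists_not_and_succ_of_not_zero_of_exists
    (p := fun k => (LieModule.toEnd ℂ g g τ.e ^ k) x = 0) (by simpa using hx0)
    ⟨m, by
      show (LieAlgebra.ad ℂ g τ.e ^ m) x = 0
      rw [hm]; rfl⟩
  have hp : t.HasPrimitiveVectorWith ((LieModule.toEnd ℂ g g τ.e ^ k) x) (β τ.h + 2 * k : ℂ) :=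
    { ne_zero := hk
      lie_h := t.lie_h_pow_toEnd_e hhx k
      lie_e := by rwa [IsSl2Triple.lie_e_pow_toEnd_e k] }
  obtain ⟨N, hN⟩ := hp.exists_nat
  exact ⟨N - 2 * k, by push_cast; rw [← hN]; ring⟩

end Reflections

/-! ### Finiteness of roots, uniqueness of coroots, simple reflections -/

section RootCombinatorics

variable {g : Type u} [LieRing g] [LieAlgebra ℂ g] [FiniteDimensional ℂ g] {H : LieSubalgebra ℂ g}

theorem IsMaximalTorus.iSupIndep_rootSpace (hH : IsMaximalTorus H) : iSupIndep (rootSpace H) := by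
  have hind := Module.End.independent_iInf_maxGenEigenspace_of_forall_mapsTo
    (fun x : H => LieAlgebra.ad ℂ g (x : g)) fun x y c =>
      Module.End.mapsTo_maxGenEigenspace_of_comm (hH.commute_ad y x) c
  refine (hind.comp (f := fun (β : Module.Dual ℂ H) (x : H) => β x)
    fun β γ h => LinearMap.ext (congrFun h)).mono fun β v hv => ?_
  refine (Submodule.mem_iInf _).2 fun x => ?_
  exact Module.End.mem_maxGenEigenspace _ _ _ |>.2 ⟨1, by
    have := (mem_rootSpace H).1 hv x
    simp [this]⟩

theorem IsMaximalTorus.finite_roots (hH : IsMaximalTorus H) : (roots H).Finite :=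
  (WellFoundedGT.finite_ne_bot_of_iSupIndep hH.iSupIndep_rootSpace).subset fun _ h => h.2

variable {Δ : Set (Module.Dual ℂ H)} {α β γ : Module.Dual ℂ H}

omit [FiniteDimensional ℂ g] in
theorem IsSimpleSystem.exists_functional (hΔ : IsSimpleSystem H Δ) (f : Module.Dual ℂ H → ℂ) :
    ∃ L : Module.Dual ℂ H →ₗ[ℂ] ℂ, ∀ δ ∈ Δ, L δ = f δ := by
  have hli : LinearIndependent ℂ (fun δ : Δ => (δ : Module.Dual ℂ H)) := hΔ.linearIndependent
  obtain ⟨L, hL⟩ := LinearMap.exists_extend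
    ((Module.Basis.span hli).constr ℂ fun δ : Δ => f (δ : Module.Dual ℂ H))
  refine ⟨L, fun δ hδ => ?_⟩
  have h1 := (Module.Basis.span hli).constr_basis ℂ (fun δ : Δ => f (δ : Module.Dual ℂ H)) ⟨δ, hδ⟩
  rw [← hL] at h1
  rwa [LinearMap.comp_apply, Submodule.subtype_apply, Module.Basis.span_apply] at h1

/-- A functional which is `0` or `1` on simple roots takes natural values on their sums. -/
theorem exists_nat_of_mem_closure {S : Set (Module.Dual ℂ H)} {L : Module.Dual ℂ H →ₗ[ℂ] ℂ}
    (hL : ∀ δ ∈ S, ∃ k : ℕ, L δ = k) {x : Module.Dual ℂ H} (hx : x ∈ AddSubmonoid.closure S) :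
    ∃ k : ℕ, L x = k := by
  induction hx using AddSubmonoid.closure_induction with
  | mem x hx => exact hL x hx
  | zero => exact ⟨0, by simp⟩
  | add x y _ _ hx hy =>
    obtain ⟨k, hk⟩ := hx
    obtain ⟨l, hl⟩ := hy
    exact ⟨k + l, by rw [map_add, hk, hl]; push_cast; rfl⟩

theorem eq_zero_or_exists_nat_of_mem_closure {S : Set (Module.Dual ℂ H)}
    {L : Module.Dual ℂ H →ₗ[ℂ] ℂ} (hL : ∀ δ ∈ S, L δ = 1) {x : Module.Dual ℂ H}
    (hx : x ∈ AddSubmonoid.closure S) : x = 0 ∨ ∃ k : ℕ, L x = (k + 1 : ℕ) := by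
  induction hx using AddSubmonoid.closure_induction with
  | mem x hx => exact Or.inr ⟨0, by rw [hL x hx]; norm_num⟩
  | zero => exact Or.inl rfl
  | add x y _ _ hx hy =>
    rcases hx with rfl | ⟨k, hk⟩
    · rwa [zero_add]
    rcases hy with rfl | ⟨l, hl⟩
    · rw [add_zero]; exact Or.inr ⟨k, hk⟩
    · exact Or.inr ⟨k + 1 + l, by rw [map_add, hk, hl]; push_cast; ring⟩

theorem RootTriple.neg_mem_roots (τ : RootTriple H β) : -β ∈ roots H := τ.swap.mem_roots

variable (hH : IsMaximalTorus H) (hred : LieAlgebra.radical ℂ g = LieAlgebra.center ℂ g)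
  (hΔ : IsSimpleSystem H Δ)
include hH hred

theorem exists_rootTriple (hβ : β ∈ roots H) : Nonempty (RootTriple H β) :=
  (rootSpace_facts hH hred).1 β hβ

theorem RootTriple.exists_eq_smul_e (τ : RootTriple H β) {x : g} (hx : x ∈ rootSpace H β) :
    ∃ c : ℂ, x = c • τ.e :=
  (rootSpace_facts hH hred).2.1 β τ.mem_roots _ τ.e_mem _ hx τ.e_ne_zero

theorem RootTriple.exists_eq_smul_f (τ : RootTriple H β) {x : g} (hx : x ∈ rootSpace H (-β)) :
    ∃ c : ℂ, x = c • τ.f :=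
  τ.swap.exists_eq_smul_e hH hred hx

/-- Root spaces are lines, so two coroots are proportional, and both take the value 2 at β. -/
theorem RootTriple.h_unique (τ σ : RootTriple H β) : τ.h = σ.h := by
  obtain ⟨a, ha⟩ := σ.exists_eq_smul_e hH hred τ.e_mem
  obtain ⟨b, hb⟩ := σ.exists_eq_smul_f hH hred τ.f_mem
  have h1 : τ.h = (a * b) • σ.h := Subtype.ext (by
    rw [← τ.lie_e_f, ha, hb, smul_lie, lie_smul, σ.lie_e_f, smul_smul]
    rfl)
  have h2 := τ.apply_h
  rw [h1, map_smul, σ.apply_h, smul_eq_mul] at h2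
  rw [h1, show a * b = 1 from mul_right_cancel₀ two_ne_zero (by rw [h2, one_mul]), one_smul]

theorem eq_of_smul_mem_roots (hβ : β ∈ roots H) {c : ℂ} (hc : c • β ∈ roots H) : c = -1 ∨ c = 1 :=
  (rootSpace_facts hH hred).2.2 β hβ c hc

include hΔ

/-- The reflection in a simple root permutes the other positive roots. -/
theorem IsSimpleSystem.dualReflection_mem (hα : α ∈ Δ) (τ : RootTriple H α)
    (hβ : β ∈ posRoots H Δ) (hβα : β ≠ α) :
    dualReflection τ β ∈ posRoots H Δ ∧ dualReflection τ β ≠ α := by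
  classical
  obtain ⟨φ, hφ⟩ := exists_isReflectionLift τ
  -- This functional measures the part of a root outside α. The reflection changes only the
  -- coefficient of α, so it preserves the value of L.
  obtain ⟨L, hL⟩ := hΔ.exists_functional fun δ => if δ = α then 0 else 1
  have hΔ' : Δ = {α} ∪ Δ \ {α} := by rw [Set.union_sdiff_self, Set.singleton_union, Set.insert_eq_of_mem hα]
  have hb := hβ.2
  rw [hΔ', AddSubmonoid.closure_union, AddSubmonoid.mem_sup] at hb
  obtain ⟨y, hy, z, hz, hyz⟩ := hb
  obtain ⟨k, rfl⟩ := AddSubmonoid.mem_closure_singleton.1 hy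
  have hLα : L α = 0 := by rw [hL α hα, if_pos rfl]
  -- A positive root with no part outside α is a multiple of α, hence equal to α, which is excluded.
  -- So L β > 0, and β stays positive after reflection.
  have hLβ : ∃ m : ℕ, L β = (m + 1 : ℕ) := by
    rcases eq_zero_or_exists_nat_of_mem_closure (L := L)
      (fun δ hδ => by rw [hL δ hδ.1, if_neg (show ¬ δ = α from hδ.2)]) hz with rfl | ⟨m, hm⟩
    · exfalso
      rw [add_zero] at hyz
      have h1 : (k : ℂ) • α ∈ roots H := by rw [Nat.cast_smul_eq_nsmul, hyz]; exact hβ.1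
      rcases eq_of_smul_mem_roots hH hred (hΔ.subset_roots hα) h1 with h | h
      · have := congrArg Complex.re h
        simp at this
        linarith [(Nat.cast_nonneg k : (0 : ℝ) ≤ k)]
      · exact hβα (by rw [← hyz, ← Nat.cast_smul_eq_nsmul ℂ, h, one_smul])
    · exact ⟨m, by rw [← hyz, map_add, map_nsmul, hLα, smul_zero, zero_add, hm]⟩
  obtain ⟨m, hm⟩ := hLβ
  have hLs : L (dualReflection τ β) = (m + 1 : ℕ) := by
    rw [dualReflection_apply, map_sub, map_smul, hLα, smul_zero, sub_zero, hm]
  have hs := hφ.dualReflection_mem_roots hβ.1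
  refine ⟨⟨hs, (hΔ.pos_or_neg _ hs).resolve_right fun hneg => ?_⟩, fun h => ?_⟩
  · obtain ⟨l, hl⟩ := exists_nat_of_mem_closure (L := L) (fun δ hδ => by
      rw [hL δ hδ]
      by_cases h : δ = α
      · exact ⟨0, by rw [if_pos h]; norm_num⟩
      · exact ⟨1, by rw [if_neg h]; norm_num⟩) hneg
    rw [map_neg, hLs] at hl
    have h2 : ((m + 1 : ℕ) : ℂ) + l = 0 := by rw [← hl, add_neg_cancel]
    norm_cast at h2
    omega
  · rw [h, hLα] at hLs
    norm_cast at hLs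

end RootCombinatorics

/-! ### The canonical form and dominance -/

section Dominance

/-- Positivity for the lexicographic order of `ℂ = ℝ²`. -/
def LexPos (z : ℂ) : Prop := 0 < z.re ∨ z.re = 0 ∧ 0 < z.im

theorem LexPos.add {z w : ℂ} (hz : LexPos z) (hw : LexPos w) : LexPos (z + w) := by
  rcases hz with hz | ⟨hz, hz'⟩ <;> rcases hw with hw | ⟨hw, hw'⟩
  · exact Or.inl (by rw [Complex.add_re]; linarith)
  · exact Or.inl (by rw [Complex.add_re]; linarith)
  · exact Or.inl (by rw [Complex.add_re]; linarith)
  · exact Or.inr ⟨by rw [Complex.add_re]; linarith, by rw [Complex.add_im]; linarith⟩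

theorem LexPos.smul {z : ℂ} (hz : LexPos z) {r : ℝ} (hr : 0 < r) : LexPos (r * z) := by
  rcases hz with hz | ⟨hz, hz'⟩
  · exact Or.inl (by simpa using mul_pos hr hz)
  · exact Or.inr ⟨by simp [hz], by simpa using mul_pos hr hz'⟩

theorem LexPos.ne_zero {z : ℂ} (hz : LexPos z) : z ≠ 0 := by
  rintro rfl
  rcases hz with hz | ⟨hz, hz'⟩
  · simp at hz
  · simp at hz'

theorem lexPos_or (z : ℂ) : LexPos z ∨ z = 0 ∨ LexPos (-z) := by
  rcases lt_trichotomy z.re 0 with h | h | h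
  · exact Or.inr (Or.inr (Or.inl (by simpa using h)))
  · rcases lt_trichotomy z.im 0 with h' | h' | h'
    · exact Or.inr (Or.inr (Or.inr ⟨by simpa using h, by simpa using h'⟩))
    · exact Or.inr (Or.inl (Complex.ext h h'))
    · exact Or.inl (Or.inr ⟨h, h'⟩)
  · exact Or.inl (Or.inl h)

theorem LexPos.not_neg {z : ℂ} (hz : LexPos z) : ¬LexPos (-z) := fun h =>
  (hz.add h).ne_zero (add_neg_cancel z)

variable {g : Type u} [LieRing g] [LieAlgebra ℂ g] [FiniteDimensional ℂ g] {H : LieSubalgebra ℂ g}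

open Classical in
/-- The coroot `h_β` of a root. -/
noncomputable def coroot (β : Module.Dual ℂ H) : H :=
  if h : Nonempty (RootTriple H β) then h.some.h else 0

variable {Δ : Set (Module.Dual ℂ H)} {α β γ ν : Module.Dual ℂ H}
  (hH : IsMaximalTorus H) (hred : LieAlgebra.radical ℂ g = LieAlgebra.center ℂ g)
  (hΔ : IsSimpleSystem H Δ)
include hH hred

theorem RootTriple.coroot_eq (τ : RootTriple H β) : coroot β = τ.h := by
  have h : Nonempty (RootTriple H β) := ⟨τ⟩
  rw [coroot, dif_pos h]
  exact h.some.h_unique hH hred τ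

theorem coroot_neg (hβ : β ∈ roots H) : coroot (-β) = -coroot β := by
  obtain ⟨τ⟩ := exists_rootTriple hH hred hβ
  rw [τ.coroot_eq hH hred, τ.swap.coroot_eq hH hred]
  rfl

theorem coroot_dualReflection (τ : RootTriple H α) (hβ : β ∈ roots H) :
    coroot (dualReflection τ β) = torusReflection τ (coroot β) := by
  obtain ⟨φ, hφ⟩ := exists_isReflectionLift τ
  obtain ⟨σ⟩ := exists_rootTriple hH hred hβ
  rw [(hφ.mapTriple σ).coroot_eq hH hred, σ.coroot_eq hH hred, hφ.mapTriple_h]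

omit hred in
variable (H) in
/-- The map `H* → H` given by the canonical form. -/
noncomputable def canonicalMap : Module.Dual ℂ H →ₗ[ℂ] H :=
  ∑ γ ∈ hH.finite_roots.toFinset, (Module.Dual.eval ℂ H (coroot γ)).smulRight (coroot γ)

omit hred in
theorem canonicalMap_apply (β : Module.Dual ℂ H) :
    canonicalMap H hH β = ∑ γ ∈ hH.finite_roots.toFinset, β (coroot γ) • coroot γ := by
  rw [canonicalMap, LinearMap.sum_apply]
  rfl

/-- The canonical form is positive on roots. -/
theorem exists_apply_canonicalMap (hβ : β ∈ roots H) :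
    ∃ r : ℝ, 0 < r ∧ β (canonicalMap H hH β) = r := by
  have h1 : ∀ γ ∈ roots H, ∃ z : ℤ, β (coroot γ) = z := by
    intro γ hγ
    obtain ⟨τ⟩ := exists_rootTriple hH hred hγ
    rw [τ.coroot_eq hH hred]
    exact exists_int_apply_h τ (Or.inl hβ)
  obtain ⟨τ⟩ := exists_rootTriple hH hred hβ
  have h2 : β (coroot β) = 2 := by rw [τ.coroot_eq hH hred, τ.apply_h]
  refine ⟨∑ γ ∈ hH.finite_roots.toFinset, (β (coroot γ)).re ^ 2, ?_, ?_⟩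
  · refine lt_of_lt_of_le ?_ (Finset.single_le_sum (f := fun γ => (β (coroot γ)).re ^ 2)
      (fun _ _ => sq_nonneg _) (hH.finite_roots.mem_toFinset.2 hβ))
    simp [h2]
  · rw [canonicalMap_apply, map_sum]
    push_cast
    refine Finset.sum_congr rfl fun γ hγ => ?_
    obtain ⟨z, hz⟩ := h1 γ (hH.finite_roots.mem_toFinset.1 hγ)
    rw [map_smul, hz, smul_eq_mul, pow_two]
    simp

/-- The reflection in β permutes the coroots, so it sends the image of β under the canonical form to
its negative; its (-1)-eigenspace is spanned by the coroot. -/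
theorem two_smul_canonicalMap (hβ : β ∈ roots H) :
    (2 : ℂ) • canonicalMap H hH β = β (canonicalMap H hH β) • coroot β := by
  obtain ⟨τ⟩ := exists_rootTriple hH hred hβ
  obtain ⟨φ, hφ⟩ := exists_isReflectionLift τ
  have hs : torusReflection τ (canonicalMap H hH β) = -canonicalMap H hH β := by
    have h1 : torusReflection τ (canonicalMap H hH β)
        = ∑ γ ∈ hH.finite_roots.toFinset, β (coroot γ) • torusReflection τ (coroot γ) := by
      rw [canonicalMap_apply]
      simp only [torusReflection, map_sum, Finset.sum_smul, ← Finset.sum_sub_distrib, smul_sub,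
        map_smul, smul_eq_mul, mul_smul]
    rw [h1, canonicalMap_apply, ← Finset.sum_neg_distrib]
    refine Finset.sum_nbij' (dualReflection τ) (dualReflection τ) ?_ ?_ ?_ ?_ ?_
    · exact fun γ hγ => hH.finite_roots.mem_toFinset.2
        (hφ.dualReflection_mem_roots (hH.finite_roots.mem_toFinset.1 hγ))
    · exact fun γ hγ => hH.finite_roots.mem_toFinset.2
        (hφ.dualReflection_mem_roots (hH.finite_roots.mem_toFinset.1 hγ))
    · exact fun γ _ => dualReflection_dualReflection τ γ
    · exact fun γ _ => dualReflection_dualReflection τ γ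
    · intro γ hγ
      rw [coroot_dualReflection hH hred τ (hH.finite_roots.mem_toFinset.1 hγ), ← neg_smul]
      congr 1
      have h2 : β (torusReflection τ (coroot γ)) = dualReflection τ β (coroot γ) :=
        (dualReflection_apply_apply τ β _).symm
      rw [h2, dualReflection_self, LinearMap.neg_apply, neg_neg]
  rw [torusReflection, ← τ.coroot_eq hH hred, sub_eq_iff_eq_add, eq_neg_add_iff_add_eq] at hs
  rw [two_smul, hs]

/-- Coroots are not additive in β, whereas the canonical map is linear. Up to a positive real factor
they agree on roots, so signs of ν on coroots can be compared additively. -/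
theorem apply_canonicalMap (hβ : β ∈ roots H) :
    ∃ r : ℝ, 0 < r ∧ ∀ ν : Module.Dual ℂ H, ν (canonicalMap H hH β) = r * ν (coroot β) := by
  obtain ⟨r, hr, h⟩ := exists_apply_canonicalMap hH hred hβ
  refine ⟨r / 2, by positivity, fun ν => ?_⟩
  have h1 := congrArg ν (two_smul_canonicalMap hH hred hβ)
  rw [map_smul, map_smul, smul_eq_mul, smul_eq_mul, h] at h1
  push_cast
  linear_combination h1 / 2

include hΔ

/-- For dominant `ν`, the roots orthogonal to `ν` are those in the span of the simple roots
orthogonal to `ν`. -/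
theorem IsSimpleSystem.apply_coroot_eq_zero_iff
    (hν : ∀ α ∈ Δ, LexPos (ν (coroot α)) ∨ ν (coroot α) = 0) (hβ : β ∈ roots H) :
    ν (coroot β) = 0 ↔ β ∈ AddSubgroup.closure {α | α ∈ Δ ∧ ν (coroot α) = 0} := by
  have hB : ∀ β ∈ roots H, ν (canonicalMap H hH β) = 0 ↔ ν (coroot β) = 0 := by
    intro β hβ
    obtain ⟨r, hr, h⟩ := apply_canonicalMap hH hred hβ
    rw [h, mul_eq_zero, or_iff_right (by exact_mod_cast hr.ne')]
  -- A sum of lexicographically nonnegative numbers vanishes only if each summand does, so x can be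
  -- killed only when it is built from simple roots that are killed.
  have hpos : ∀ x ∈ AddSubmonoid.closure Δ, (LexPos (ν (canonicalMap H hH x)) ∨
      ν (canonicalMap H hH x) = 0) ∧ (ν (canonicalMap H hH x) = 0 →
        x ∈ AddSubgroup.closure {α | α ∈ Δ ∧ ν (coroot α) = 0}) := by
    intro x hx
    induction hx using AddSubmonoid.closure_induction with
    | mem α hα =>
      have hα' := hΔ.subset_roots hα
      refine ⟨?_, fun h => AddSubgroup.subset_closure ⟨hα, (hB α hα').1 h⟩⟩
      rw [hB α hα']
      refine (hν α hα).imp_left fun h => ?_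
      obtain ⟨r, hr, h'⟩ := apply_canonicalMap hH hred hα'
      rw [h']
      exact h.smul hr
    | zero => exact ⟨Or.inr (by simp), fun _ => zero_mem _⟩
    | add x y _ _ hx hy =>
      rw [map_add, map_add]
      rcases hx.1 with h1 | h1 <;> rcases hy.1 with h2 | h2
      · exact ⟨Or.inl (h1.add h2), fun h => absurd h (h1.add h2).ne_zero⟩
      · rw [h2, add_zero]
        exact ⟨Or.inl h1, fun h => absurd h h1.ne_zero⟩
      · rw [h1, zero_add]
        exact ⟨Or.inl h2, fun h => absurd h h2.ne_zero⟩
      · rw [h1, h2, add_zero]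
        exact ⟨Or.inr rfl, fun _ => add_mem (hx.2 h1) (hy.2 h2)⟩
  constructor
  · intro h
    rcases hΔ.pos_or_neg β hβ with hβ' | hβ'
    · exact (hpos β hβ').2 ((hB β hβ).2 h)
    · have h1 := (hpos _ hβ').2 (by rw [map_neg, map_neg, (hB β hβ).2 h, neg_zero])
      rw [← neg_neg β]
      exact neg_mem h1
  · intro h
    rw [← hB β hβ]
    clear hβ
    induction h using AddSubgroup.closure_induction with
    | mem α hα => exact (hB α (hΔ.subset_roots hα.1)).2 hα.2
    | zero => simp
    | add x y _ _ hx hy => rw [map_add, map_add, hx, hy, add_zero]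
    | neg x _ hx => rw [map_neg, map_neg, hx, neg_zero]

/-- The number of positive coroots on which `ν` is negative. -/
noncomputable def negCount (Δ : Set (Module.Dual ℂ H)) (ν : Module.Dual ℂ H) : ℕ :=
  {β | β ∈ posRoots H Δ ∧ LexPos (-ν (coroot β))}.ncard

/-- Reflection in α carries the positive roots counted for the reflected ν injectively to those
counted for ν. The root α itself is counted for ν but missed by this map. -/
theorem negCount_dualReflection_lt (hα : α ∈ Δ) (τ : RootTriple H α)
    (hν : LexPos (-ν (coroot α))) : negCount Δ (dualReflection τ ν) < negCount Δ ν := by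
  have hfin : {β | β ∈ posRoots H Δ ∧ LexPos (-ν (coroot β))}.Finite :=
    hH.finite_roots.subset fun β hβ => hβ.1.1
  have happ : ∀ β ∈ roots H, dualReflection τ ν (coroot β) = ν (coroot (dualReflection τ β)) := by
    intro β hβ
    rw [coroot_dualReflection hH hred τ hβ, dualReflection_apply_apply]
    rfl
  have hαp : α ∈ posRoots H Δ := ⟨hΔ.subset_roots hα, AddSubmonoid.subset_closure hα⟩
  have hsub : dualReflection τ '' {β | β ∈ posRoots H Δ ∧ LexPos (-dualReflection τ ν (coroot β))} ⊂
      {β | β ∈ posRoots H Δ ∧ LexPos (-ν (coroot β))} := by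
    rw [Set.ssubset_iff_of_subset]
    · refine ⟨α, ⟨hαp, hν⟩, ?_⟩
      rintro ⟨β, ⟨hβ, hβ'⟩, hβα⟩
      have h1 : β = -α := by
        rw [← dualReflection_dualReflection τ β, hβα, dualReflection_self]
      obtain ⟨L, hL⟩ := hΔ.exists_functional fun _ => 1
      obtain ⟨k, hk⟩ := exists_nat_of_mem_closure (L := L)
        (fun δ hδ => ⟨1, by rw [hL δ hδ]; norm_num⟩) hβ.2
      rw [h1, map_neg, hL α hα] at hk
      have := congrArg Complex.re hk
      simp at this
      linarith [(Nat.cast_nonneg k : (0 : ℝ) ≤ k)]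
    · rintro _ ⟨β, ⟨hβ, hβ'⟩, rfl⟩
      rw [happ β hβ.1] at hβ'
      have hβα : β ≠ α := by
        rintro rfl
        rw [dualReflection_self, coroot_neg hH hred hβ.1, map_neg, neg_neg] at hβ'
        exact hβ'.not_neg hν
      exact ⟨(hΔ.dualReflection_mem hH hred hα τ hβ hβα).1, hβ'⟩
  rw [negCount, ← Set.ncard_image_of_injective _ (dualReflection τ).injective]
  exact Set.ncard_lt_ncard hsub hfin

end Dominance

/-! ### Coadjoint centralisers -/

section Centralizer

variable {g : Type u} [LieRing g] [LieAlgebra ℂ g] [FiniteDimensional ℂ g] {H : LieSubalgebra ℂ g}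
  {Δ : Set (Module.Dual ℂ H)} {β : Module.Dual ℂ H} (hH : IsMaximalTorus H)

theorem extendByZero_coe (ν : Module.Dual ℂ H) (x : H) : extendByZero hH ν x = ν x :=
  congrArg ν (Submodule.projectionOnto_apply_left hH.isCompl x)

theorem extendByZero_of_mem (ν : Module.Dual ℂ H) (hβ : β ≠ 0) {x : g} (hx : x ∈ rootSpace H β) :
    extendByZero hH ν x = 0 := by
  have hx' : x ∈ ⨆ β ∈ roots H, rootSpace H β := by
    by_cases h : rootSpace H β = ⊥
    · rw [h, Submodule.mem_bot] at hx
      rw [hx]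
      exact zero_mem _
    · exact (le_iSup₂_of_le (f := fun β (_ : β ∈ roots H) => rootSpace H β) β ⟨hβ, h⟩ le_rfl) hx
  rw [extendByZero, LinearMap.comp_apply]
  exact (congrArg ν ((Submodule.projectionOnto_apply_eq_zero_iff hH.isCompl).2 hx')).trans
    (map_zero ν)

variable (hred : LieAlgebra.radical ℂ g = LieAlgebra.center ℂ g)
include hred

/-- The coadjoint centraliser of `ν` is spanned by the torus and the root spaces for the roots whose
coroots are killed by `ν`. -/
theorem coadjointCentralizer_eq (ν : Module.Dual ℂ H) :
    coadjointCentralizer hH ν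
      = H.toSubmodule ⊔ ⨆ β ∈ roots H ∩ {β | ν (coroot β) = 0}, rootSpace H β := by
  classical
  refine le_antisymm (fun x hx => ?_) (sup_le (fun x hx y => ?_) (iSup₂_le fun β hβ x hx y => ?_))
  · have hxt : x ∈ ⨆ β : Module.Dual ℂ H, rootSpace H β := hH.iSup_rootSpace ▸ Submodule.mem_top
    obtain ⟨v, hv, rfl⟩ := (Submodule.mem_iSup_iff_exists_finsupp _ _).1 hxt
    refine Submodule.finsuppSum_mem _ _ _ _ fun β hβ0 => ?_
    by_cases hβ : β = 0
    · refine Submodule.mem_sup_left ?_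
      rw [← hH.rootSpace_zero, ← hβ]
      exact hv β
    have hβr : β ∈ roots H := ⟨hβ, fun h => hβ0 ((Submodule.mem_bot ℂ).1 (h ▸ hv β))⟩
    refine Submodule.mem_sup_right (le_iSup₂_of_le (f := fun β
      (_ : β ∈ roots H ∩ {β | ν (coroot β) = 0}) => rootSpace H β) β ⟨hβr, ?_⟩ le_rfl (hv β))
    obtain ⟨τ⟩ := exists_rootTriple hH hred hβr
    obtain ⟨a, ha⟩ := τ.exists_eq_smul_e hH hred (hv β)
    -- Pairing with the root vector f of -β isolates the component in g_β: the bracket of f with any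
    -- other component lies in a nonzero weight space, where the extension of ν vanishes.
    have h1 := hx τ.f
    rw [Finsupp.sum, sum_lie, map_sum, Finset.sum_eq_single β] at h1
    · rw [ha, smul_lie, τ.lie_e_f, map_smul, extendByZero_coe, smul_eq_zero] at h1
      rcases h1 with h1 | h1
      · exact absurd (by rw [ha, h1, zero_smul]) hβ0
      · show ν (coroot β) = 0
        rw [τ.coroot_eq hH hred, h1]
    · intro γ _ hγ
      refine extendByZero_of_mem hH ν (β := γ + -β) ?_ (lie_mem_rootSpace (hv γ) τ.f_mem)
      rwa [← sub_eq_add_neg, sub_ne_zero]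
    · intro h
      rw [Finsupp.notMem_support_iff] at h
      exact absurd h hβ0
  · have hy : y ∈ ⨆ β : Module.Dual ℂ H, rootSpace H β := hH.iSup_rootSpace ▸ Submodule.mem_top
    induction hy using Submodule.iSup_induction' with
    | zero => rw [lie_zero, map_zero]
    | add a b _ _ ha hb => rw [lie_add, map_add, ha, hb, add_zero]
    | mem γ y hy =>
      rw [(mem_rootSpace H).1 hy ⟨x, hx⟩, map_smul]
      by_cases hγ : γ = 0
      · rw [hγ, LinearMap.zero_apply, zero_smul]
      · rw [extendByZero_of_mem hH ν hγ hy, smul_zero]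
  · have hy : y ∈ ⨆ β : Module.Dual ℂ H, rootSpace H β := hH.iSup_rootSpace ▸ Submodule.mem_top
    induction hy using Submodule.iSup_induction' with
    | zero => rw [lie_zero, map_zero]
    | add a b _ _ ha hb => rw [lie_add, map_add, ha, hb, add_zero]
    | mem γ y hy =>
      by_cases hγ : β + γ = 0
      · obtain rfl : γ = -β := (neg_eq_of_add_eq_zero_right hγ).symm
        obtain ⟨τ⟩ := exists_rootTriple hH hred hβ.1
        obtain ⟨a, rfl⟩ := τ.exists_eq_smul_e hH hred hx
        obtain ⟨b, rfl⟩ := τ.exists_eq_smul_f hH hred hy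
        have hν : ν (coroot β) = 0 := hβ.2
        rw [smul_lie, lie_smul, τ.lie_e_f, map_smul, map_smul, extendByZero_coe,
          ← τ.coroot_eq hH hred, hν, smul_zero, smul_zero]
      · exact extendByZero_of_mem hH ν hγ (lie_mem_rootSpace hx hy)

/-- The coadjoint centraliser of a dominant element is a standard Levi subalgebra. -/
theorem isStandardLevi_coadjointCentralizer (hΔ : IsSimpleSystem H Δ) {ν : Module.Dual ℂ H}
    (hν : ∀ α ∈ Δ, ¬LexPos (-ν (coroot α))) : IsStandardLevi H Δ (coadjointCentralizer hH ν) := by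
  refine ⟨{α | α ∈ Δ ∧ ν (coroot α) = 0}, fun α hα => hα.1, ?_⟩
  rw [coadjointCentralizer_eq hH hred]
  congr 1
  have : roots H ∩ {β | ν (coroot β) = 0}
      = roots H ∩ {β | β ∈ AddSubgroup.closure {α | α ∈ Δ ∧ ν (coroot α) = 0}} := by
    ext β
    refine and_congr_right fun hβ => ?_
    exact hΔ.apply_coroot_eq_zero_iff hH hred (fun α hα => (lexPos_or _).imp_right
      fun h => h.resolve_right (hν α hα)) hβ
  rw [this]

end Centralizer

/-! ### The current algebra of a root triple -/

section CurrentElements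

attribute [local instance] LieRing.ofAssociativeRing

variable {g : Type u} [LieRing g] [LieAlgebra ℂ g] (n : ℕ)

theorem tPow_mul_tPow (i j : ℕ) : tPow n i * tPow n j = tPow n (i + j) :=
  (map_mul _ _ _).symm.trans (congrArg _ (pow_add _ _ _).symm)

theorem tPow_eq_zero {i : ℕ} (hi : n < i) : tPow n i = 0 := by
  rw [tPow, Ideal.Quotient.eq_zero_iff_mem, Ideal.mem_span_singleton]
  exact pow_dvd_pow _ hi

theorem cur_eq_zero {i : ℕ} (hi : n < i) (x : g) : cur n i x = 0 := by
  rw [cur, tPow_eq_zero n hi, TensorProduct.zero_tmul, map_zero]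

theorem cur_zero (i : ℕ) : cur n i (0 : g) = 0 := by
  rw [cur, TensorProduct.tmul_zero, map_zero]

theorem cur_smul (i : ℕ) (c : ℂ) (x : g) : cur n i (c • x) = algebraMap ℂ (Env n g) c * cur n i x := by
  rw [cur, TensorProduct.tmul_smul, map_smul, Algebra.smul_def, cur]

theorem cur_neg (i : ℕ) (x : g) : cur n i (-x) = -cur n i x := by
  rw [cur, TensorProduct.tmul_neg, map_neg, cur]

theorem cur_lie (i j : ℕ) (x y : g) :
    cur n i x * cur n j y - cur n j y * cur n i x = cur n (i + j) ⁅x, y⁆ := by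
  rw [cur, cur, cur, ← LieRing.of_associative_ring_bracket, ← LieHom.map_lie,
    LieAlgebra.ExtendScalars.bracket_tmul, tPow_mul_tPow]

theorem cur_commute (i j : ℕ) {x y : g} (h : ⁅x, y⁆ = 0) : Commute (cur n i x) (cur n j y) :=
  sub_eq_zero.1 (by rw [cur_lie, h, cur_zero])

theorem envMap_cur (φ : g →ₗ⁅ℂ⁆ g) (i : ℕ) (x : g) : envMap n φ (cur n i x) = cur n i (φ x) := by
  rw [envMap, cur]
  refine (UniversalEnvelopingAlgebra.lift_ι_apply ℂ _ _).trans ?_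
  rfl

/-- An additive property of elements of the current algebra may be checked on the elements
`x ⊗ t^i` with `x` in a root space. -/
theorem current_induction [FiniteDimensional ℂ g] {H : LieSubalgebra ℂ g} (hH : IsMaximalTorus H)
    {p : Current n g → Prop} (hadd : ∀ y z, p y → p z → p (y + z))
    (hp : ∀ (i : ℕ) (β : Module.Dual ℂ H), ∀ x ∈ rootSpace H β, p (tPow n i ⊗ₜ[ℂ] x))
    (y : Current n g) : p y := by
  have h0 : p 0 := by
    have := hp 0 0 0 (zero_mem _)
    rwa [TensorProduct.tmul_zero] at this
  induction y using TensorProduct.induction_on with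
  | zero => exact h0
  | add y z hy hz => exact hadd _ _ hy hz
  | tmul a x =>
    have hx : x ∈ ⨆ β : Module.Dual ℂ H, rootSpace H β := hH.iSup_rootSpace ▸ Submodule.mem_top
    induction hx using Submodule.iSup_induction' with
    | zero => rwa [TensorProduct.tmul_zero]
    | add x y _ _ hx hy => rw [TensorProduct.tmul_add]; exact hadd _ _ hx hy
    | mem β x hx =>
      obtain ⟨q, rfl⟩ := Ideal.Quotient.mk_surjective a
      induction q using Polynomial.induction_on' with
      | add q r hq hr => rw [map_add, TensorProduct.add_tmul]; exact hadd _ _ hq hr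
      | monomial i c =>
        have : (Ideal.Quotient.mk (Ideal.span {(Polynomial.X : ℂ[X]) ^ (n + 1)})
            (Polynomial.monomial i c)) ⊗ₜ[ℂ] x = tPow n i ⊗ₜ[ℂ] (c • x) := by
          rw [TensorProduct.tmul_smul, TensorProduct.smul_tmul', tPow,
            ← Polynomial.C_mul_X_pow_eq_monomial, ← Polynomial.smul_eq_C_mul]
          rfl
        rw [this]
        exact hp i β _ ((rootSpace H β).smul_mem c hx)

variable {n} in
theorem adNilpotentOn_cur (i : ℕ) {f : g} (hf : IsNilpotent (LieAlgebra.ad ℂ g f)) :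
    AdNilpotentOn (cur n i f) Set.univ := by
  refine adNilpotentOn_univ _ _ (adjoin_range_ι (Current n g)) ?_
  obtain ⟨m, hm⟩ := hf
  have key : ∀ (m : ℕ) (y : Current n g),
      (fun z : Env n g => cur n i f * z - z * cur n i f)^[m] (UniversalEnvelopingAlgebra.ι ℂ y)
        = UniversalEnvelopingAlgebra.ι ℂ
          (TensorProduct.map (LinearMap.mulLeft ℂ (tPow n i) ^ m) (LieAlgebra.ad ℂ g f ^ m) y) := by
    intro m
    induction m with
    | zero => intro y; simp [Module.End.one_eq_id]
    | succ m ih =>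
      intro y
      have h1 : cur n i f * UniversalEnvelopingAlgebra.ι ℂ y
          - UniversalEnvelopingAlgebra.ι ℂ y * cur n i f
          = UniversalEnvelopingAlgebra.ι ℂ
            (TensorProduct.map (LinearMap.mulLeft ℂ (tPow n i)) (LieAlgebra.ad ℂ g f) y) := by
        rw [cur, ← LieRing.of_associative_ring_bracket, ← LieHom.map_lie]
        congr 1
        induction y using TensorProduct.induction_on with
        | zero => simp
        | add a b ha hb => rw [lie_add, ha, hb, map_add]
        | tmul a z => simp
      rw [Function.iterate_succ_apply, h1, ih, ← LinearMap.comp_apply, ← TensorProduct.map_comp]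
      rfl
  rintro _ ⟨y, rfl⟩
  refine ⟨m, ?_⟩
  rw [key, hm]
  simp

end CurrentElements

/-! ### The weight triple of a root -/

section Triple

variable {g : Type u} [LieRing g] [LieAlgebra ℂ g] {H : LieSubalgebra ℂ g} (n : ℕ)

variable (H) in
/-- The action of `H ⊗ 1`. -/
noncomputable def torus (x : H) : Env n g := cur n 0 (x : g)

theorem hasWt_cur (i : ℕ) {β : Module.Dual ℂ H} {x : g} (hx : x ∈ rootSpace H β) :
    HasWt (torus H n) β (cur n i x) := fun h => by
  rw [torus, cur_lie, (mem_rootSpace H).1 hx h, cur_smul, zero_add]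

variable [FiniteDimensional ℂ g] (hH : IsMaximalTorus H) {α : Module.Dual ℂ H} (τ : RootTriple H α)
include hH

theorem mem_rootSpace_zero (x : H) : (x : g) ∈ rootSpace H 0 := by
  rw [hH.rootSpace_zero]
  exact x.2

/-- The current algebra of the `sl₂` of a root. -/
noncomputable def RootTriple.weightTriple : WeightTriple (Env n g) n H where
  e i := cur n i τ.e
  f i := cur n i τ.f
  h i := cur n i τ.h
  e_f i j := by rw [cur_lie, τ.lie_e_f]
  h_e i j := by rw [cur_lie, τ.lie_h_e, cur_smul, map_ofNat]
  h_f i j := by rw [cur_lie, τ.lie_h_f, neg_smul, cur_neg, cur_smul, map_ofNat]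
  e_comm i j := cur_commute n i j (lie_self _)
  f_comm i j := cur_commute n i j (lie_self _)
  e_zero i hi := cur_eq_zero n hi _
  f_zero i hi := cur_eq_zero n hi _
  h_zero i hi := cur_eq_zero n hi _
  η := torus H n
  α := α
  η_e i := hasWt_cur n i τ.e_mem
  η_f i := hasWt_cur n i τ.f_mem
  η_h i := hasWt_cur n i (mem_rootSpace_zero hH τ.h)
  η_η x := hasWt_cur n 0 (mem_rootSpace_zero hH x)

omit hH in
theorem isGood_loweringFamily : (loweringFamily n τ).IsGood where
  comm i j := cur_commute n i j (lie_self _)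
  ad i := adNilpotentOn_cur i τ.isNilpotent_ad

end Triple

/-! ### Subgroups generated under the action of a set of operators -/

section GenBy

variable {U : Type u} [Ring U] {M : Type u} [AddCommGroup M] [Module U M]

/-- The smallest subgroup containing `Y` and stable under the operators in `p`. -/
def genBy (p : Set U) (Y : Set M) : AddSubgroup M :=
  AddSubgroup.closure {m | ∃ u ∈ Submonoid.closure p, ∃ w ∈ Y, m = u • w}

variable {p V : Set U} {Y : Set M} {m : M} {v : U}

theorem subset_genBy {m : M} (hm : m ∈ Y) : m ∈ genBy p Y :=
  AddSubgroup.subset_closure ⟨1, one_mem _, m, hm, (one_smul U m).symm⟩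

theorem smul_mem_genBy (hv : v ∈ p) (hm : m ∈ genBy p Y) : v • m ∈ genBy p Y := by
  induction hm using AddSubgroup.closure_induction with
  | mem m hm =>
    obtain ⟨u, hu, w, hw, rfl⟩ := hm
    exact AddSubgroup.subset_closure ⟨v * u, mul_mem (Submonoid.subset_closure hv) hu, w, hw,
      (mul_smul _ _ _).symm⟩
  | zero => rw [smul_zero]; exact zero_mem _
  | add a b _ _ ha hb => rw [smul_add]; exact add_mem ha hb
  | neg a _ ha => rw [smul_neg]; exact neg_mem ha

theorem genBy_induction {q : M → Prop} (hq : ∀ w ∈ Y, q w) (hsmul : ∀ v ∈ p, ∀ m, q m → q (v • m))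
    (h0 : q 0) (hadd : ∀ a b, q a → q b → q (a + b)) (hneg : ∀ a, q a → q (-a))
    (hm : m ∈ genBy p Y) : q m := by
  induction hm using AddSubgroup.closure_induction with
  | mem m hm =>
    obtain ⟨u, hu, w, hw, rfl⟩ := hm
    induction hu using Submonoid.closure_induction_left with
    | one => rw [one_smul]; exact hq w hw
    | mul_left x hx y _ hy => rw [mul_smul]; exact hsmul x hx _ hy
  | zero => exact h0
  | add a b _ _ ha hb => exact hadd a b ha hb
  | neg a _ ha => exact hneg a ha

/-- If a set `V` of operators is stable under commutators with `p` and maps `Y` into the subgroup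
generated by `Y` under `p`, then this subgroup is stable under `V`. -/
theorem smul_mem_genBy_of_commutator (hVp : ∀ v ∈ V, ∀ x ∈ p, v * x - x * v ∈ V)
    (hY : ∀ v ∈ V, ∀ w ∈ Y, v • w ∈ genBy p Y) (hv : v ∈ V) (hm : m ∈ genBy p Y) :
    v • m ∈ genBy p Y := by
  revert v
  refine genBy_induction (q := fun m => ∀ {v}, v ∈ V → v • m ∈ genBy p Y) ?_ ?_ ?_ ?_ ?_ hm
  · exact fun w hw v hv => hY v hv w hw
  · intro x hx m ih v hv
    have h : v • x • m = x • v • m + (v * x - x * v) • m := by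
      rw [sub_smul, mul_smul, mul_smul]
      abel
    rw [h]
    exact add_mem (smul_mem_genBy hx (ih hv)) (ih (hVp v hv x hx))
  · intro v _
    rw [smul_zero]
    exact zero_mem _
  · intro a b ha hb v hv
    rw [smul_add]
    exact add_mem (ha hv) (hb hv)
  · intro a ha v hv
    rw [smul_neg]
    exact neg_mem (ha hv)

variable [Algebra ℂ U] {H : Type*} [AddCommGroup H] [Module ℂ H] {η : H → U}
  {S : Set (Module.Dual ℂ H)} {χ γ : Module.Dual ℂ H}

/-- The subgroup generated by the weight vectors with weight in `S`. -/
def wtSpan (η : H → U) (M : Type u) [AddCommGroup M] [Module U M] (S : Set (Module.Dual ℂ H)) : AddSubgroup M :=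
  AddSubgroup.closure {m : M | ∃ χ ∈ S, IsWt η χ m}

theorem smul_mem_wtSpan {u : U} (hu : HasWt η γ u) (hS : ∀ χ ∈ S, χ + γ ∈ S)
    (hm : m ∈ wtSpan η M S) : u • m ∈ wtSpan η M S := by
  induction hm using AddSubgroup.closure_induction with
  | mem m hm =>
    obtain ⟨χ, hχ, hm⟩ := hm
    exact AddSubgroup.subset_closure ⟨χ + γ, hS χ hχ, hm.smul hu⟩
  | zero => rw [smul_zero]; exact zero_mem _
  | add a b _ _ ha hb => rw [smul_add]; exact add_mem ha hb
  | neg a _ ha => rw [smul_neg]; exact neg_mem ha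

theorem comp_eq_zero_of_mem_wtSpan (hM : IsWtModule η M) (hm : m ∈ wtSpan η M S) (hχ : χ ∉ S) :
    hM.comp m χ = 0 := by
  induction hm using AddSubgroup.closure_induction with
  | mem m hm =>
    obtain ⟨ν, hν, hm⟩ := hm
    exact hM.comp_ne hm fun h => hχ (h ▸ hν)
  | zero => rw [map_zero, Finsupp.zero_apply]
  | add a b _ _ ha hb => rw [map_add, Finsupp.add_apply, ha, hb, add_zero]
  | neg a _ ha => rw [map_neg, Finsupp.neg_apply, ha, neg_zero]

end GenBy

/-! ### Bounds for weights -/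

section Bounds

variable {g : Type u} [LieRing g] [LieAlgebra ℂ g] [FiniteDimensional ℂ g] {H : LieSubalgebra ℂ g}
  (n : ℕ) (Δ : Set (Module.Dual ℂ H))

/-- The weights of `M` lie in finitely many cones `χ₀ - ℕΔ`. -/
def BddWts (M : Type u) [AddCommGroup M] [Module (Env n g) M] : Prop :=
  ∃ F : Set (Module.Dual ℂ H), F.Finite ∧ ∀ χ (m : M), IsWt (torus H n) χ m → m ≠ 0 →
    ∃ χ₀ ∈ F, χ₀ - χ ∈ AddSubmonoid.closure Δ

variable {n Δ} {M : Type u} [AddCommGroup M] [Module (Env n g) M]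

/-- The scalars and the elements `x ⊗ t^i` with `x` of weight in `-Γ`. -/
def lowerSet (n : ℕ) (Γ : AddSubmonoid (Module.Dual ℂ H)) : Set (Env n g) :=
  {v | (∃ c : ℂ, v = algebraMap ℂ _ c) ∨ ∃ (i : ℕ) (γ : Module.Dual ℂ H), -γ ∈ Γ ∧
    ∃ x ∈ rootSpace H γ, v = cur n i x}

theorem commutator_mem_lowerSet {Γ : AddSubmonoid (Module.Dual ℂ H)} {u v : Env n g}
    (hu : u ∈ lowerSet n Γ) (hv : v ∈ lowerSet n Γ) : u * v - v * u ∈ lowerSet n Γ := by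
  have h0 : (0 : Env n g) ∈ lowerSet n Γ := Or.inl ⟨0, (map_zero _).symm⟩
  rcases hu with ⟨c, rfl⟩ | ⟨i, γ, hγ, x, hx, rfl⟩
  · rwa [Algebra.commutes, sub_self]
  rcases hv with ⟨c, rfl⟩ | ⟨j, δ, hδ, y, hy, rfl⟩
  · rwa [Algebra.commutes, sub_self]
  exact Or.inr ⟨i + j, γ + δ, by rw [neg_add]; exact add_mem hγ hδ, _, lie_mem_rootSpace hx hy,
    cur_lie n i j x y⟩

/-- The set of weights below `F`. -/
def below (F : Set (Module.Dual ℂ H)) (Γ : AddSubmonoid (Module.Dual ℂ H)) :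
    Set (Module.Dual ℂ H) := {χ | ∃ χ₀ ∈ F, χ₀ - χ ∈ Γ}

theorem genBy_lowerSet_le {Γ : AddSubmonoid (Module.Dual ℂ H)} {F : Set (Module.Dual ℂ H)}
    {W : Set M} (hWF : ∀ w ∈ W, w ∈ wtSpan (torus H n) M F) :
    genBy (lowerSet n Γ) W ≤ wtSpan (torus H n) M (below F Γ) := by
  intro m hm
  refine genBy_induction (fun w hw => ?_) ?_ (zero_mem _) (fun a b => add_mem)
    (fun a => neg_mem) hm
  · refine AddSubgroup.closure_mono ?_ (hWF w hw)
    rintro m ⟨χ, hχ, hm⟩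
    exact ⟨χ, ⟨χ, hχ, by rw [sub_self]; exact zero_mem _⟩, hm⟩
  · rintro v (⟨c, rfl⟩ | ⟨i, γ, hγ, x, hx, rfl⟩) m hm
    · exact smul_mem_wtSpan (HasWt.algebraMap c) (fun χ hχ => by rwa [add_zero]) hm
    · refine smul_mem_wtSpan (hasWt_cur n i hx) ?_ hm
      rintro χ ⟨χ₀, h₀, hχ⟩
      exact ⟨χ₀, h₀, by rw [← sub_sub, sub_eq_add_neg]; exact add_mem hχ hγ⟩

variable (hH : IsMaximalTorus H) (hred : LieAlgebra.radical ℂ g = LieAlgebra.center ℂ g)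
  (hΔ : IsSimpleSystem H Δ) {F : Set (Module.Dual ℂ H)} {W : Set M}
  (hW : ∀ y ∈ posPart H n Δ, ∀ w ∈ W, UniversalEnvelopingAlgebra.ι ℂ y • w ∈ W)
  (hspan : Submodule.span (Env n g) W = ⊤)
include hH hΔ hW hspan

attribute [local instance] LieRing.ofAssociativeRing in
/-- A module is generated under `n⁻_n ⊕ H` by any set of generators stable under the action of
`h_n^{≥1} ⊕ n⁺_n`. -/
theorem genBy_lowerSet_eq_top : genBy (lowerSet n (AddSubmonoid.closure Δ)) W = ⊤ := by
  set p : Set (Env n g) := lowerSet n (AddSubmonoid.closure Δ) with hp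
  set V : Set (Env n g) := Set.range (UniversalEnvelopingAlgebra.ι ℂ : Current n g → _) with hV
  have hY : ∀ v ∈ V, ∀ w ∈ W, v • w ∈ genBy p W := by
    rintro _ ⟨y, rfl⟩ w hw
    refine current_induction n hH (p := fun y => UniversalEnvelopingAlgebra.ι ℂ y • w ∈ genBy p W)
      (fun y z hy hz => ?_) (fun i β x hx => ?_) y
    · rw [map_add, add_smul]
      exact add_mem hy hz
    by_cases hβ0 : β = 0
    · exact smul_mem_genBy (Or.inr ⟨i, β, by rw [hβ0, neg_zero]; exact zero_mem _, x, hx, rfl⟩)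
        (subset_genBy hw)
    by_cases hβ : rootSpace H β = ⊥
    · rw [hβ, Submodule.mem_bot] at hx
      rw [hx, TensorProduct.tmul_zero, map_zero, zero_smul]
      exact zero_mem _
    rcases hΔ.pos_or_neg β ⟨hβ0, hβ⟩ with h | h
    · refine subset_genBy (hW _ (Submodule.subset_span (Or.inr ⟨i, x, ?_, rfl⟩)) w hw)
      exact (le_iSup₂_of_le (f := fun β (_ : β ∈ posRoots H Δ) => rootSpace H β) β
        ⟨⟨hβ0, hβ⟩, h⟩ le_rfl) hx
    · exact smul_mem_genBy (Or.inr ⟨i, β, h, x, hx, rfl⟩) (subset_genBy hw)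
  have hVp : ∀ v ∈ V, ∀ x ∈ p, v * x - x * v ∈ V := by
    rintro _ ⟨y, rfl⟩ v (⟨c, rfl⟩ | ⟨i, γ, hγ, x, hx, rfl⟩)
    · exact ⟨0, by rw [map_zero, Algebra.commutes, sub_self]⟩
    · exact ⟨⁅y, tPow n i ⊗ₜ[ℂ] x⁆, by
        rw [LieHom.map_lie, LieRing.of_associative_ring_bracket, cur]⟩
  have hU : ∀ (r : Env n g) (m : M), m ∈ genBy p W → r • m ∈ genBy p W := by
    intro r
    have hr : r ∈ Algebra.adjoin ℂ V := adjoin_range_ι (Current n g) ▸ Algebra.mem_top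
    induction hr using Algebra.adjoin_induction with
    | mem v hv => exact fun m hm => smul_mem_genBy_of_commutator hVp hY hv hm
    | algebraMap c => exact fun m hm => smul_mem_genBy (Or.inl ⟨c, rfl⟩) hm
    | add r r' _ _ h h' => intro m hm; rw [add_smul]; exact add_mem (h m hm) (h' m hm)
    | mul r r' _ _ h h' => intro m hm; rw [mul_smul]; exact h _ (h' m hm)
  rw [eq_top_iff]
  intro m _
  have hm : m ∈ Submodule.span (Env n g) W := hspan ▸ Submodule.mem_top
  induction hm using Submodule.span_induction with
  | mem w hw => exact subset_genBy hw
  | zero => exact zero_mem _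
  | add a b _ _ ha hb => exact add_mem (ha trivial) (hb trivial)
  | smul r a _ ha => exact hU r a (ha trivial)

/-- The weights of a module lie below those of a set of generators stable under the action of
`h_n^{≥1} ⊕ n⁺_n`. -/
theorem mem_below_of_generators (hM : IsWtModule (torus H n) M)
    (hWF : ∀ w ∈ W, w ∈ wtSpan (torus H n) M F) {χ : Module.Dual ℂ H} {m : M}
    (hm : IsWt (torus H n) χ m) (hm0 : m ≠ 0) : χ ∈ below F (AddSubmonoid.closure Δ) := by
  by_contra hχ
  refine hm0 ?_
  rw [← hM.comp_self hm]
  refine comp_eq_zero_of_mem_wtSpan hM (genBy_lowerSet_le hWF ?_) hχ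
  rw [genBy_lowerSet_eq_top hH hΔ hW hspan]
  trivial

include hred in
/-- Outside the image of the `f_{α,i}`, the weights of a module differ from those of a set of
generators stable under the action of `h_n^{≥1} ⊕ n⁺_n` by sums of positive roots other than
`α`. -/
theorem mem_below_or_mem_rangeSum_of_generators {α : Module.Dual ℂ H} (hα : α ∈ Δ)
    (τ : RootTriple H α) (hM : IsWtModule (torus H n) M)
    (hWF : ∀ w ∈ W, w ∈ wtSpan (torus H n) M F) {χ : Module.Dual ℂ H} {m : M}
    (hm : IsWt (torus H n) χ m) :
    χ ∈ below F (AddSubmonoid.closure (posRoots H Δ \ {α})) ∨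
      m ∈ rangeSum M (fun i : Fin (n + 1) => cur n i τ.f) Finset.univ := by
  set R := rangeSum M (fun i : Fin (n + 1) => cur n i τ.f) Finset.univ with hR
  set Γ := AddSubmonoid.closure (posRoots H Δ \ {α}) with hΓ
  set C : Set M := ((genBy (lowerSet n Γ) W : AddSubgroup M) : Set M) with hC
  set q : Set (Env n g) := {v | ∃ (i : ℕ), ∃ x ∈ rootSpace H (-α), v = cur n i x} with hq
  have hmemR : ∀ i, ∀ x ∈ rootSpace H (-α), ∀ m : M, cur n i x • m ∈ R := by
    intro i x hx m
    by_cases hi : n < i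
    · rw [cur_eq_zero n hi, zero_smul]
      exact zero_mem _
    obtain ⟨c, rfl⟩ := τ.exists_eq_smul_f hH hred hx
    refine ⟨Pi.single ⟨i, by omega⟩ (algebraMap ℂ (Env n g) c • m), ?_⟩
    rw [Finset.sum_eq_single ⟨i, by omega⟩]
    · rw [Pi.single_eq_same, cur_smul, Algebra.commutes, mul_smul]
    · intro j _ hj
      rw [Pi.single_eq_of_ne hj, smul_zero]
    · exact fun h => absurd (Finset.mem_univ _) h
  -- M is generated under n⁻_n ⊕ h_n by W. Commutators with f_{α,i} remain in this subalgebra, so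
  -- the f_{α,i} can be moved to the left of all other factors.
  have hE : genBy q C = ⊤ := by
    rw [eq_top_iff, ← genBy_lowerSet_eq_top hH hΔ hW hspan]
    intro m hm
    refine genBy_induction (fun w hw => subset_genBy (subset_genBy hw)) (fun v hv m hm => ?_)
      (zero_mem _) (fun a b => add_mem) (fun a => neg_mem) hm
    refine smul_mem_genBy_of_commutator (V := lowerSet n (AddSubmonoid.closure Δ)) ?_ ?_ hv hm
    · rintro v hv _ ⟨i, x, hx, rfl⟩
      exact commutator_mem_lowerSet hv (Or.inr ⟨i, -α, by rw [neg_neg]; exact AddSubmonoid.subset_closure hα, x, hx, rfl⟩)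
    · rintro v (⟨c, rfl⟩ | ⟨i, γ, hγ, x, hx, rfl⟩) w hw
      · exact subset_genBy (smul_mem_genBy (Or.inl ⟨c, rfl⟩) hw)
      by_cases hγα : γ = -α
      · exact smul_mem_genBy ⟨i, x, hγα ▸ hx, rfl⟩ (subset_genBy hw)
      by_cases hγ0 : γ = 0
      · exact subset_genBy (smul_mem_genBy
          (Or.inr ⟨i, γ, by rw [hγ0, neg_zero]; exact zero_mem _, x, hx, rfl⟩) hw)
      by_cases hγr : rootSpace H γ = ⊥
      · rw [hγr, Submodule.mem_bot] at hx
        rw [hx, cur_zero, zero_smul]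
        exact zero_mem _
      · obtain ⟨σ⟩ := exists_rootTriple hH hred (β := γ) ⟨hγ0, hγr⟩
        refine subset_genBy (smul_mem_genBy (Or.inr ⟨i, γ, AddSubmonoid.subset_closure
          ⟨⟨σ.neg_mem_roots, hγ⟩, fun h => hγα ?_⟩, x, hx, rfl⟩) hw)
        rw [← Set.mem_singleton_iff.1 h, neg_neg]
  -- Consequently M is the sum of the images of the f_{α,i} and of C. The weights of C differ from
  -- those in F by positive roots other than α only.
  have hm' : ∀ m : M, ∃ r ∈ R, ∃ c ∈ genBy (lowerSet n Γ) W, m = r + c := by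
    intro m
    have hm : m ∈ genBy q C := hE ▸ AddSubgroup.mem_top m
    refine genBy_induction (q := fun m => ∃ r ∈ R, ∃ c ∈ genBy (lowerSet n Γ) W, m = r + c)
      (fun w hw => ⟨0, zero_mem _, w, hw, (zero_add w).symm⟩) ?_
      ⟨0, zero_mem _, 0, zero_mem _, (add_zero _).symm⟩ ?_ ?_ hm
    · rintro _ ⟨i, x, hx, rfl⟩ m _
      exact ⟨_, hmemR i x hx m, 0, zero_mem _, (add_zero _).symm⟩
    · rintro _ _ ⟨r, hr, c, hc, rfl⟩ ⟨r', hr', c', hc', rfl⟩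
      exact ⟨r + r', add_mem hr hr', c + c', add_mem hc hc', by abel⟩
    · rintro _ ⟨r, hr, c, hc, rfl⟩
      exact ⟨-r, neg_mem hr, -c, neg_mem hc, by abel⟩
  refine or_iff_not_imp_left.2 fun hχ => ?_
  obtain ⟨r, hr, c, hc, rfl⟩ := hm' m
  have hst : WtStable (torus H n) R := by
    constructor
    · rintro z _ ⟨y, rfl⟩
      refine ⟨fun j => algebraMap ℂ (Env n g) z • y j, ?_⟩
      rw [Finset.smul_sum]
      exact Finset.sum_congr rfl fun j _ => by rw [← mul_smul, Algebra.commutes, mul_smul]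
    · rintro x _ ⟨y, rfl⟩
      rw [Finset.smul_sum]
      refine sum_mem fun j _ => ?_
      have : torus H n x * cur n j τ.f
          = cur n j τ.f * torus H n x + algebraMap ℂ (Env n g) ((-α) x) * cur n j τ.f := by
        rw [← hasWt_cur n j τ.f_mem x]
        abel
      rw [← mul_smul, this, add_smul, mul_smul, Algebra.commutes, mul_smul]
      exact add_mem (hmemR _ _ τ.f_mem _) (hmemR _ _ τ.f_mem _)
  have h1 := hM.comp_self hm
  rw [map_add, Finsupp.add_apply,
    comp_eq_zero_of_mem_wtSpan hM (genBy_lowerSet_le hWF hc) hχ, add_zero] at h1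
  rw [← h1]
  exact hst.comp_mem hM hr χ

end Bounds

/-! ### Local finiteness -/

section LocallyFinite

/-- A vector lies in a finite-dimensional subspace stable under finitely many commuting operators
each of which is locally nilpotent up to a scalar. -/
theorem exists_fg_stable_of_locNil {V : Type*} [AddCommGroup V] [Module ℂ V] {ι : Type*}
    (T : ι → Module.End ℂ V) (hT : ∀ i j, Commute (T i) (T j)) (c : ι → ℂ)
    (hc : ∀ i v, ∃ k : ℕ, ((T i - algebraMap ℂ _ (c i)) ^ k) v = 0) (K : Submodule ℂ V)
    (hK : ∀ i, K.map (T i) ≤ K) (s : Finset ι) {v : V} (hv : v ∈ K) :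
    ∃ W : Submodule ℂ V, v ∈ W ∧ W ≤ K ∧ W.FG ∧ ∀ i ∈ s, W.map (T i) ≤ W := by
  classical
  induction s using Finset.induction_on with
  | empty =>
    exact ⟨ℂ ∙ v, Submodule.mem_span_singleton_self v, (Submodule.span_singleton_le_iff_mem v K).2 hv,
      Submodule.fg_span_singleton v, by simp⟩
  | insert a s ha ih =>
    obtain ⟨W, hvW, hWK, hfg, hW⟩ := ih
    set D := T a - algebraMap ℂ _ (c a) with hD
    have hKD : K.map D ≤ K := by
      rintro _ ⟨x, hx, rfl⟩
      rw [hD, LinearMap.sub_apply, Module.algebraMap_end_apply]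
      exact sub_mem (hK a ⟨x, hx, rfl⟩) (K.smul_mem _ hx)
    -- On the finitely generated W some power of D = T a - c a vanishes, so the sum of the D^k W is
    -- again finitely generated. It is stable under T a and, as the operators commute, under the
    -- previous ones.
    obtain ⟨N, hN⟩ : ∃ N, ∀ k ≥ N, W.map (D ^ k) = ⊥ := by
      obtain ⟨t, rfl⟩ := hfg
      choose k hk using hc a
      refine ⟨t.sup k, fun l hl => ?_⟩
      rw [Submodule.map_span, Submodule.span_eq_bot]
      rintro _ ⟨x, hx, rfl⟩
      rw [← Nat.sub_add_cancel ((Finset.le_sup (f := k) hx).trans hl), pow_add, Module.End.mul_apply,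
        hk x, map_zero]
    refine ⟨⨆ k : ℕ, W.map (D ^ k), ?_, iSup_le fun k => ?_, ?_, ?_⟩
    · exact Submodule.mem_iSup_of_mem 0 ⟨v, hvW, rfl⟩
    · induction k with
      | zero => rw [pow_zero, Module.End.one_eq_id, Submodule.map_id]; exact hWK
      | succ k ih =>
        rw [pow_succ', Module.End.mul_eq_comp, Submodule.map_comp]
        exact (Submodule.map_mono ih).trans hKD
    · have : ⨆ k : ℕ, W.map (D ^ k) = ⨆ k ∈ Finset.range N, W.map (D ^ k) := by
        refine le_antisymm (iSup_le fun k => ?_) (iSup₂_le fun k _ => le_iSup (fun k => W.map (D ^ k)) k)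
        by_cases hk : k < N
        · exact le_iSup₂_of_le (f := fun k (_ : k ∈ Finset.range N) => W.map (D ^ k)) k
            (Finset.mem_range.2 hk) le_rfl
        · rw [hN k (not_lt.1 hk)]
          exact bot_le
      rw [this]
      exact Submodule.fg_biSup _ _ fun k _ => hfg.map _
    · have hDst : (⨆ k : ℕ, W.map (D ^ k)).map D ≤ ⨆ k : ℕ, W.map (D ^ k) := by
        rw [Submodule.map_iSup]
        refine iSup_le fun k => ?_
        rw [← Submodule.map_comp, ← Module.End.mul_eq_comp, ← pow_succ']
        exact le_iSup (fun k => W.map (D ^ k)) (k + 1)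
      intro i hi
      rcases Finset.mem_insert.1 hi with rfl | hi
      · rintro _ ⟨x, hx, rfl⟩
        have : T i x = D x + c i • x := by
          rw [hD, LinearMap.sub_apply, Module.algebraMap_end_apply, sub_add_cancel]
        rw [this]
        exact add_mem (hDst ⟨x, hx, rfl⟩) (Submodule.smul_mem _ _ hx)
      · rw [Submodule.map_iSup]
        refine iSup_mono fun k => ?_
        have hcomm : Commute (T i) (D ^ k) :=
          ((hT i a).sub_right (Algebra.commutes' _ _).symm).pow_right k
        rw [← Submodule.map_comp, ← Module.End.mul_eq_comp, hcomm.eq, Module.End.mul_eq_comp,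
          Submodule.map_comp]
        exact Submodule.map_mono (hW i hi)

end LocallyFinite

/-! ### Category O in terms of weights -/

section CategoryO

attribute [local instance] LieRing.ofAssociativeRing

open scoped ModuleCat

variable {g : Type u} [LieRing g] [LieAlgebra ℂ g] {H : LieSubalgebra ℂ g} {n : ℕ}
  {Δ : Set (Module.Dual ℂ H)} {M : ModuleCat.{u} (Env n g)}

theorem mem_weightSpace_iff {χ : Module.Dual ℂ H} {m : M} :
    m ∈ weightSpace H n M χ ↔ IsWt (torus H n) χ m := Iff.rfl

theorem mem_weightSum_iff {m : M} :
    m ∈ weightSum H n M ↔ m ∈ AddSubgroup.closure {m : M | ∃ ν, IsWt (torus H n) ν m} := by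
  constructor <;> intro hm
  · induction hm using Submodule.iSup_induction' with
    | zero => exact zero_mem _
    | add x y _ _ hx hy => exact add_mem hx hy
    | mem ν x hx => exact AddSubgroup.subset_closure ⟨ν, hx⟩
  · induction hm using AddSubgroup.closure_induction with
    | zero => exact zero_mem _
    | add x y _ _ hx hy => exact add_mem hx hy
    | neg x _ hx => exact neg_mem hx
    | mem x hx => exact Submodule.mem_iSup_of_mem hx.choose hx.choose_spec

theorem weightSum_eq_top_iff : weightSum H n M = ⊤ ↔ IsWtModule (torus H n) M := by
  rw [Submodule.eq_top_iff']
  exact forall_congr' fun m => mem_weightSum_iff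

theorem IsWtModule.mem_wtSpan_support (hM : IsWtModule (torus H n) M) (m : M) :
    m ∈ wtSpan (torus H n) M ((hM.comp m).support : Set (Module.Dual ℂ H)) := by
  have h : ∑ χ ∈ (hM.comp m).support, hM.comp m χ
      ∈ wtSpan (torus H n) M ((hM.comp m).support : Set (Module.Dual ℂ H)) :=
    sum_mem fun χ hχ => AddSubgroup.subset_closure ⟨χ, hχ, hM.isWt_comp m χ⟩
  have h' : ∑ χ ∈ (hM.comp m).support, hM.comp m χ = m := hM.sum_comp m
  rwa [h'] at h

theorem smul_mem_wtSpan_scalar {F : Set (Module.Dual ℂ H)} (c : ℂ) {m : M}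
    (hm : m ∈ wtSpan (torus H n) M F) : c • m ∈ wtSpan (torus H n) M F :=
  smul_mem_wtSpan (HasWt.algebraMap c) (fun χ hχ => by rwa [add_zero]) hm

/-- The modules in category O have a set of generators with finitely many weights which is stable
under `h_n^{≥1} ⊕ n⁺_n`. -/
theorem CategoryO.exists_generators (hM : CategoryO H n Δ M) :
    ∃ (W : Set M) (F : Set (Module.Dual ℂ H)), F.Finite ∧
      (∀ y ∈ posPart H n Δ, ∀ w ∈ W, UniversalEnvelopingAlgebra.ι ℂ y • w ∈ W) ∧
      Submodule.span (Env n g) W = ⊤ ∧ ∀ w ∈ W, w ∈ wtSpan (torus H n) M F := by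
  classical
  have hwt := weightSum_eq_top_iff.1 hM.semisimple
  obtain ⟨S, hS⟩ := hM.finite.1
  choose W hW hfin hst using hM.locallyFinite
  have hF : ∀ m, ∃ F : Set (Module.Dual ℂ H), F.Finite ∧ ∀ w ∈ W m, w ∈ wtSpan (torus H n) M F := by
    intro m
    obtain ⟨t, ht⟩ := (Submodule.fg_iff_finiteDimensional _).2 (hfin m)
    refine ⟨⋃ x ∈ t, ((hwt.comp x).support : Set _),
      Set.Finite.biUnion t.finite_toSet fun x _ => (hwt.comp x).support.finite_toSet, fun w hw => ?_⟩
    rw [← ht] at hw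
    induction hw using Submodule.span_induction with
    | mem x hx =>
      refine AddSubgroup.closure_mono ?_ (hwt.mem_wtSpan_support x)
      rintro y ⟨χ, hχ, hy⟩
      exact ⟨χ, Set.mem_biUnion hx hχ, hy⟩
    | zero => exact zero_mem _
    | add x y _ _ hx hy => exact add_mem hx hy
    | smul c x _ hx => exact smul_mem_wtSpan_scalar c hx
  choose F hFfin hF using hF
  refine ⟨⋃ m ∈ S, (W m : Set M), ⋃ m ∈ S, F m,
    Set.Finite.biUnion S.finite_toSet fun x _ => hFfin x, ?_, ?_, ?_⟩
  · intro y hy w hw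
    obtain ⟨m, hm, hw⟩ := Set.mem_iUnion₂.1 hw
    exact Set.mem_iUnion₂.2 ⟨m, hm, hst m y hy w hw⟩
  · rw [eq_top_iff, ← hS]
    exact Submodule.span_mono fun m hm => Set.mem_iUnion₂.2 ⟨m, hm, hW m⟩
  · intro w hw
    obtain ⟨m, hm, hw⟩ := Set.mem_iUnion₂.1 hw
    refine AddSubgroup.closure_mono ?_ (hF m w hw)
    rintro y ⟨χ, hχ, hy⟩
    exact ⟨χ, Set.mem_iUnion₂.2 ⟨m, hm, hχ⟩, hy⟩

variable [FiniteDimensional ℂ g]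

theorem CategoryO.bddWts (hM : CategoryO H n Δ M) (hH : IsMaximalTorus H)
    (hΔ : IsSimpleSystem H Δ) : BddWts n Δ M := by
  obtain ⟨W, F, hF, hW, hspan, hWF⟩ := hM.exists_generators
  exact ⟨F, hF, fun χ m hm hm0 => mem_below_of_generators hH hΔ hW hspan
    (weightSum_eq_top_iff.1 hM.semisimple) hWF hm hm0⟩

/-- The vectors lying in a finite-dimensional subspace stable under `h_n^{≥1} ⊕ n⁺_n`. -/
def locallyFinitePart (Δ : Set (Module.Dual ℂ H)) (M : ModuleCat.{u} (Env n g)) :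
    Submodule ℂ M where
  carrier := {m | ∃ W : Submodule ℂ M, m ∈ W ∧ W.FG ∧
    ∀ y ∈ posPart H n Δ, ∀ w ∈ W, UniversalEnvelopingAlgebra.ι ℂ y • w ∈ W}
  zero_mem' := ⟨⊥, zero_mem _, Submodule.fg_bot, fun y _ w hw => by
    rw [Submodule.mem_bot] at hw ⊢
    rw [hw, smul_zero]⟩
  add_mem' := by
    rintro a b ⟨W, ha, hW, hst⟩ ⟨W', hb, hW', hst'⟩
    refine ⟨W ⊔ W', Submodule.add_mem_sup ha hb, hW.sup hW', fun y hy w hw => ?_⟩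
    obtain ⟨x, hx, z, hz, rfl⟩ := Submodule.mem_sup.1 hw
    rw [smul_add]
    exact Submodule.add_mem_sup (hst y hy x hx) (hst' y hy z hz)
  smul_mem' := by
    rintro c a ⟨W, ha, hW, hst⟩
    exact ⟨W, W.smul_mem c ha, hW, hst⟩

theorem exists_stable_of_le_locallyFinitePart {X : Submodule ℂ M} (hX : X.FG)
    (h : X ≤ locallyFinitePart Δ M) : ∃ W : Submodule ℂ M, X ≤ W ∧ W.FG ∧
      ∀ y ∈ posPart H n Δ, ∀ w ∈ W, UniversalEnvelopingAlgebra.ι ℂ y • w ∈ W := by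
  obtain ⟨t, rfl⟩ := hX
  have h' : ∀ x : M, ∃ W : Submodule ℂ M, (x ∈ t → x ∈ W) ∧ W.FG ∧
      ∀ y ∈ posPart H n Δ, ∀ w ∈ W, UniversalEnvelopingAlgebra.ι ℂ y • w ∈ W := by
    intro x
    by_cases hx : x ∈ t
    · obtain ⟨W, h1, h2⟩ := h (Submodule.subset_span hx)
      exact ⟨W, fun _ => h1, h2⟩
    · obtain ⟨W, -, h2⟩ := (locallyFinitePart Δ M).zero_mem
      exact ⟨W, fun h => absurd h hx, h2⟩
  choose W hxW hfg hst using h'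
  refine ⟨⨆ x ∈ t, W x, Submodule.span_le.2 fun x hx => ?_, Submodule.fg_biSup _ _ fun x _ => hfg x,
    fun y hy w hw => ?_⟩
  · exact (le_iSup₂_of_le (f := fun x (_ : x ∈ t) => W x) x hx le_rfl) (hxW x hx)
  · have : ⨆ x ∈ t, W x ≤ (⨆ x ∈ t, W x).comap
        (Algebra.lsmul ℂ ℂ M (UniversalEnvelopingAlgebra.ι ℂ y)) := iSup₂_le fun x hx w hw =>
      (le_iSup₂_of_le (f := fun x (_ : x ∈ t) => W x) x hx le_rfl) (hst x y hy w hw)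
    exact this hw

/-- Weight modules with bounded weights on which the elements of `h_n^{≥1}` act locally nilpotently
up to scalars are locally finite over `h_n^{≥1} ⊕ n⁺_n`. -/
theorem locallyFinitePart_eq_top (hH : IsMaximalTorus H) (hΔ : IsSimpleSystem H Δ)
    (hwt : IsWtModule (torus H n) M) (hbdd : BddWts n Δ M)
    (hnil : ∀ i, 1 ≤ i → i ≤ n → ∀ x : H, ∃ c : ℂ, LocNil M (cur n i (x : g) - algebraMap ℂ _ c)) :
    locallyFinitePart Δ M = ⊤ := by
  classical
  obtain ⟨L, hL⟩ := hΔ.exists_functional fun _ => 1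
  have hLnat : ∀ γ ∈ AddSubmonoid.closure Δ, ∃ k : ℕ, L γ = k := fun γ hγ =>
    exists_nat_of_mem_closure (fun δ hδ => ⟨1, by rw [hL δ hδ, Nat.cast_one]⟩) hγ
  have hLpos : ∀ β ∈ posRoots H Δ, ∃ k : ℕ, L β = (k + 1 : ℕ) := fun β hβ =>
    (eq_zero_or_exists_nat_of_mem_closure (fun δ hδ => hL δ hδ) hβ.2).resolve_left hβ.1.1
  let act : Current n g →ₗ[ℂ] M →ₗ[ℂ] M :=
    (Algebra.lsmul ℂ ℂ M).toLinearMap ∘ₗ 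
      ((UniversalEnvelopingAlgebra.ι ℂ : Current n g →ₗ⁅ℂ⁆ Env n g) : Current n g →ₗ[ℂ] Env n g)
  -- Induction on the height to which weights above χ can occur. For N = 0 even χ itself is not a
  -- weight.
  have main : ∀ (N : ℕ) (χ : Module.Dual ℂ H),
      (∀ γ ∈ AddSubmonoid.closure Δ, ∀ k : ℕ, N ≤ k → L γ = k → ∀ m : M,
        IsWt (torus H n) (χ + γ) m → m = 0) →
      weightSpace H n M χ ≤ locallyFinitePart Δ M := by
    intro N
    induction N with
    | zero =>
      intro χ h m hm
      rw [h 0 (zero_mem _) 0 le_rfl (by simp) m (by rw [add_zero]; exact hm)]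
      exact zero_mem _
    | succ N ih =>
      intro χ h m hm
      let b := Module.finBasis ℂ H
      let T : Fin n × Fin (Module.finrank ℂ H) → Module.End ℂ M := fun p =>
        Algebra.lsmul ℂ ℂ M (cur n (p.1 + 1) (b p.2 : g))
      have hc : ∀ p : Fin n × Fin (Module.finrank ℂ H), ∃ c : ℂ,
          LocNil M (cur n (p.1 + 1) (b p.2 : g) - algebraMap ℂ _ c) := fun p =>
        hnil _ (by omega) (by omega) _
      choose c hc using hc
      obtain ⟨E, hmE, hEχ, hEfg, hE⟩ := exists_fg_stable_of_locNil T
        (fun p q => (cur_commute n _ _ (hH.lie_eq_zero _ _)).map (Algebra.lsmul ℂ ℂ M)) c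
        (fun p v => by
          obtain ⟨k, hk⟩ := hc p v
          refine ⟨k, ?_⟩
          have : T p - algebraMap ℂ _ (c p)
              = Algebra.lsmul ℂ ℂ M (cur n (p.1 + 1) (b p.2 : g) - algebraMap ℂ _ (c p)) := by
            rw [map_sub, AlgHom.commutes]
          rw [this, ← map_pow]
          exact hk)
        (weightSpace H n M χ) (by
          rintro p _ ⟨v, hv, rfl⟩
          have := IsWt.smul (hasWt_cur n (p.1 + 1) (mem_rootSpace_zero hH (b p.2)))
            (mem_weightSpace_iff.1 hv)
          rw [add_zero] at this
          exact this) Finset.univ hm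
      -- E is a finite-dimensional part of the weight space, stable under h_n^{≥1}. The subspace
      -- n⁺_n E has strictly higher weights, hence by induction lies in a finite-dimensional stable
      -- W, and E + W is then stable.
      let nn : Submodule ℂ (Current n g) :=
        ⨆ i ∈ Finset.range (n + 1), (nPos H Δ).map (TensorProduct.mk ℂ (TruncPoly n) g (tPow n i))
      have hnn : nn.FG := Submodule.fg_biSup _ _ fun i _ =>
        ((Submodule.fg_iff_finiteDimensional _).2 inferInstance).map _
      have hXle : Submodule.map₂ act nn E ≤ locallyFinitePart Δ M := by
        refine Submodule.map₂_le.2 fun y hy e he => ?_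
        have : nn ≤ (locallyFinitePart Δ M).comap (act.flip e) := by
          refine iSup₂_le fun i _ => Submodule.map_le_iff_le_comap.2 (iSup₂_le fun β hβ x hx => ?_)
          obtain ⟨l, hl⟩ := hLpos β hβ
          refine ih (χ + β) (fun γ hγ k hk hLγ m hm => ?_)
            (IsWt.smul (hasWt_cur n i hx) (mem_weightSpace_iff.1 (hEχ he)))
          refine h (β + γ) (add_mem hβ.2 hγ) (l + 1 + k) (by omega) ?_ m (by rwa [← add_assoc])
          rw [map_add, hl, hLγ]
          push_cast
          ring
        exact this hy
      obtain ⟨W, hXW, hWfg, hWst⟩ := exists_stable_of_le_locallyFinitePart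
        (hnn.map₂ act hEfg) hXle
      refine ⟨E ⊔ W, Submodule.mem_sup_left hmE, hEfg.sup hWfg, fun y hy w hw => ?_⟩
      obtain ⟨e, he, w, hw', rfl⟩ := Submodule.mem_sup.1 hw
      rw [smul_add]
      refine add_mem ?_ (Submodule.mem_sup_right (hWst y hy w hw'))
      have hle : posPart H n Δ ≤ (E ⊔ W).comap (act.flip e) := by
        refine Submodule.span_le.2 ?_
        rintro _ (⟨i, hi, x, hx, rfl⟩ | ⟨i, x, hx, rfl⟩)
        · show cur n i x • e ∈ E ⊔ W
          by_cases hin : n < i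
          · rw [cur_eq_zero n hin, zero_smul]
            exact zero_mem _
          refine Submodule.mem_sup_left ?_
          have hx' : (x : g) = ∑ j, b.repr ⟨x, hx⟩ j • (b j : g) := by
            have := congrArg (H.toSubmodule.subtype) (b.sum_repr ⟨x, hx⟩)
            rw [map_sum] at this
            exact this.symm
          have h1 : cur n i x • e = ∑ j, b.repr ⟨x, hx⟩ j • cur n i (b j : g) • e := by
            rw [congrArg (cur n i) hx', cur, TensorProduct.tmul_sum, map_sum, Finset.sum_smul]
            refine Finset.sum_congr rfl fun j _ => ?_
            rw [TensorProduct.tmul_smul, map_smul, smul_assoc, cur]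
          rw [h1]
          refine sum_mem fun j _ => E.smul_mem _ ?_
          have := hE (⟨i - 1, by omega⟩, j) (Finset.mem_univ _) ⟨e, he, rfl⟩
          have h2 : cur n (i - 1 + 1) (b j : g) • e ∈ E := this
          rwa [Nat.sub_add_cancel hi] at h2
        · show cur n i x • e ∈ E ⊔ W
          by_cases hin : n < i
          · rw [cur_eq_zero n hin, zero_smul]
            exact zero_mem _
          refine Submodule.mem_sup_right (hXW (Submodule.apply_mem_map₂ act ?_ he))
          exact (le_iSup₂_of_le (f := fun i (_ : i ∈ Finset.range (n + 1)) =>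
            (nPos H Δ).map (TensorProduct.mk ℂ (TruncPoly n) g (tPow n i))) i
            (Finset.mem_range.2 (by omega)) le_rfl) ⟨x, hx, rfl⟩
      exact hle hy
  rw [eq_top_iff, ← weightSum_eq_top_iff.2 hwt]
  refine iSup_le fun χ => ?_
  obtain ⟨F, hF, hbdd⟩ := hbdd
  -- Only finitely many tops χ₀ occur, so the heights of weights above χ are bounded.
  have hbound : ∃ N : ℕ, ∀ χ₀ ∈ F, ∀ k : ℕ, L (χ₀ - χ) = k → k < N := by
    have hf : (Set.Finite {k : ℕ | ∃ χ₀ ∈ F, L (χ₀ - χ) = k}) := by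
      have := (hF.image fun χ₀ => L (χ₀ - χ)).preimage (f := fun k : ℕ => (k : ℂ))
        Nat.cast_injective.injOn
      refine this.subset ?_
      rintro k ⟨χ₀, h, hk⟩
      exact ⟨χ₀, h, hk⟩
    obtain ⟨N, hN⟩ := hf.bddAbove
    exact ⟨N + 1, fun χ₀ h k hk => Nat.lt_succ_of_le (hN ⟨χ₀, h, hk⟩)⟩
  obtain ⟨N, hN⟩ := hbound
  refine main N χ fun γ hγ k hk hLγ m hm => ?_
  by_contra hm0
  obtain ⟨χ₀, h₀, h⟩ := hbdd _ m hm hm0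
  obtain ⟨l, hl⟩ := hLnat _ h
  have := hN χ₀ h₀ (l + k) (by
    rw [Nat.cast_add, ← hl, ← hLγ, ← map_add]
    congr 1
    abel)
  omega

end CategoryO

/-! ### Jordan blocks -/

section Blocks

variable {g : Type u} [LieRing g] [LieAlgebra ℂ g] {H : LieSubalgebra ℂ g} {n : ℕ}

theorem torusElement_single (i : Fin n) (x : H) :
    torusElement H n (Pi.single i x) = cur n (i + 1) (x : g) := by
  rw [torusElement, Finset.sum_eq_single i, Pi.single_eq_same]
  · intro j _ hj
    rw [Pi.single_eq_of_ne hj]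
    exact cur_zero n _
  · exact fun h => absurd (Finset.mem_univ _) h

theorem sum_apply_single (μ : Fin n → Module.Dual ℂ H) (i : Fin n) (x : H) :
    ∑ j, μ j ((Pi.single i x : Fin n → H) j) = μ i x := by
  rw [Finset.sum_eq_single i, Pi.single_eq_same]
  · intro j _ hj
    rw [Pi.single_eq_of_ne hj, map_zero]
  · exact fun h => absurd (Finset.mem_univ _) h

/-- The elements of `h_n^{≥1}` act with generalised eigenvalue `μ`. -/
def HasTorusEigenvalue (μ : Fin n → Module.Dual ℂ H) (M : Type u) [AddCommGroup M]
    [Module (Env n g) M] : Prop :=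
  ∀ x : Fin n → H, LocNil M (torusElement H n x - algebraMap ℂ _ (∑ i, μ i (x i)))

theorem HasTorusEigenvalue.locNil_cur {μ : Fin n → Module.Dual ℂ H} {M : Type u} [AddCommGroup M]
    [Module (Env n g) M] (h : HasTorusEigenvalue μ M) (i : Fin n) (x : H) :
    LocNil M (cur n (i + 1) (x : g) - algebraMap ℂ _ (μ i x)) := by
  have := h (Pi.single i x)
  rwa [torusElement_single, sum_apply_single] at this

theorem HasTorusEigenvalue.locNil_top {μ : Fin n → Module.Dual ℂ H} {M : Type u} [AddCommGroup M]
    [Module (Env n g) M] (h : HasTorusEigenvalue μ M) (hn : 1 ≤ n) (x : H) :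
    LocNil M (cur n n (x : g) - algebraMap ℂ _ (topComponent H hn μ x)) := by
  have := h.locNil_cur ⟨n - 1, by omega⟩ x
  rwa [show ((⟨n - 1, by omega⟩ : Fin n) : ℕ) + 1 = n by simp; omega] at this

variable [FiniteDimensional ℂ g] {Δ : Set (Module.Dual ℂ H)}

open scoped ModuleCat in
-- Bounded weights and local finiteness of h_n^{≥1} ⊕ n⁺_n are interchangeable here. Weight bounds
-- can be followed through the twisting functors, where finite-dimensional stable subspaces are hard
-- to trace.
theorem jordanBlock_iff (hH : IsMaximalTorus H) (hΔ : IsSimpleSystem H Δ)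
    {μ : Fin n → Module.Dual ℂ H} {M : ModuleCat.{u} (Env n g)} :
    jordanBlock H Δ μ M ↔ Module.Finite (Env n g) M ∧ IsWtModule (torus H n) M ∧ BddWts n Δ M ∧
      HasTorusEigenvalue μ M := by
  constructor
  · rintro ⟨hO, hμ⟩
    refine ⟨hO.finite, weightSum_eq_top_iff.1 hO.semisimple, hO.bddWts hH hΔ, fun x m => ?_⟩
    obtain ⟨K, hK⟩ := hμ m x
    exact ⟨K, hK K le_rfl⟩
  · rintro ⟨hfin, hwt, hbdd, hμ⟩
    refine ⟨⟨hfin, weightSum_eq_top_iff.2 hwt, fun m => ?_⟩, fun m x => ?_⟩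
    · have htop := locallyFinitePart_eq_top hH hΔ hwt hbdd fun i h1 hi x => by
        have := hμ.locNil_cur ⟨i - 1, by omega⟩ x
        refine ⟨μ ⟨i - 1, by omega⟩ x, ?_⟩
        rwa [show ((⟨i - 1, by omega⟩ : Fin n) : ℕ) + 1 = i by simp; omega] at this
      obtain ⟨W, hm, hW, hst⟩ : m ∈ locallyFinitePart Δ M := htop ▸ Submodule.mem_top
      exact ⟨W, hm, (Submodule.fg_iff_finiteDimensional _).1 hW, hst⟩
    · obtain ⟨K, hK⟩ := hμ x m
      refine ⟨K, fun k hk => ?_⟩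
      obtain ⟨l, rfl⟩ := Nat.exists_eq_add_of_le' hk
      rw [pow_add _ l K, mul_smul, hK, smul_zero]

/-- There are only finitely many weights of the form `χ + kα` below a finite set. -/
theorem exists_bound_of_finite (hΔ : IsSimpleSystem H Δ) {α : Module.Dual ℂ H} (hα : α ∈ Δ)
    {F : Set (Module.Dual ℂ H)} (hF : F.Finite) (χ : Module.Dual ℂ H) :
    ∃ N : ℕ, ∀ k : ℕ, χ + k • α ∈ below F (AddSubmonoid.closure Δ) → k < N := by
  obtain ⟨L, hL⟩ := hΔ.exists_functional fun _ => 1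
  have hf : (Set.Finite {k : ℕ | ∃ χ₀ ∈ F, L (χ₀ - χ) = k}) := by
    refine ((hF.image fun χ₀ => L (χ₀ - χ)).preimage (f := fun k : ℕ => (k : ℂ))
      Nat.cast_injective.injOn).subset ?_
    rintro k ⟨χ₀, h, hk⟩
    exact ⟨χ₀, h, hk⟩
  obtain ⟨N, hN⟩ := hf.bddAbove
  refine ⟨N + 1, ?_⟩
  rintro k ⟨χ₀, h₀, h⟩
  obtain ⟨l, hl⟩ := exists_nat_of_mem_closure (L := L)
    (fun δ hδ => ⟨1, by rw [hL δ hδ, Nat.cast_one]⟩) h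
  have : l + k ≤ N := hN ⟨χ₀, h₀, by
    rw [← sub_sub, map_sub, map_nsmul, hL α hα, nsmul_one] at hl
    rw [Nat.cast_add, ← hl, sub_add_cancel]⟩
  omega

theorem upper_of_bddWts (hH : IsMaximalTorus H) (hΔ : IsSimpleSystem H Δ) {α : Module.Dual ℂ H}
    (hα : α ∈ Δ) (τ : RootTriple H α) (hn : 1 ≤ n) {μ : Fin n → Module.Dual ℂ H} {M : Type u}
    [AddCommGroup M] [Module (Env n g) M] (hwt : IsWtModule (torus H n) M) (hbdd : BddWts n Δ M)
    (hμ : HasTorusEigenvalue μ M) :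
    (τ.weightTriple n hH).Upper M (topComponent H hn μ τ.h) where
  wt := hwt
  bdd χ := by
    obtain ⟨F, hF, h⟩ := hbdd
    obtain ⟨N, hN⟩ := exists_bound_of_finite hΔ hα hF χ
    refine ⟨N, fun k hk m hm => ?_⟩
    by_contra hm0
    exact absurd (hN k (h _ m hm hm0)) (not_lt.2 hk)
  nil := hμ.locNil_top hn τ.h

/-- The bound uses the cone of positive roots other than α because, unlike the full positive cone,
it is preserved by s_α and so survives the twist by φ. -/
theorem CategoryO.exists_socle_bound {M : ModuleCat.{u} (Env n g)} (hM : CategoryO H n Δ M)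
    (hH : IsMaximalTorus H) (hred : LieAlgebra.radical ℂ g = LieAlgebra.center ℂ g)
    (hΔ : IsSimpleSystem H Δ) {α : Module.Dual ℂ H} (hα : α ∈ Δ) (τ : RootTriple H α) :
    ∃ F : Set (Module.Dual ℂ H), F.Finite ∧ ∀ χ (m : M), IsWt (torus H n) χ m →
      χ ∈ below F (AddSubmonoid.closure (posRoots H Δ \ {α})) ∨
      m ∈ rangeSum M (fun i : Fin (n + 1) => cur n i τ.f) Finset.univ := by
  obtain ⟨W, F, hF, hW, hspan, hWF⟩ := hM.exists_generators
  exact ⟨F, hF, fun χ m hm => mem_below_or_mem_rangeSum_of_generators hH hred hΔ hW hspan hα τ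
    (weightSum_eq_top_iff.1 hM.semisimple) hWF hm⟩

/-- The reflection in a simple root `α` preserves the cone spanned by the positive roots other than
`α`. -/
theorem image_below (hH : IsMaximalTorus H)
    (hred : LieAlgebra.radical ℂ g = LieAlgebra.center ℂ g) (hΔ : IsSimpleSystem H Δ)
    {α : Module.Dual ℂ H} (hα : α ∈ Δ) (τ : RootTriple H α) {F : Set (Module.Dual ℂ H)}
    {χ : Module.Dual ℂ H} (hχ : χ ∈ below F (AddSubmonoid.closure (posRoots H Δ \ {α}))) :
    dualReflection τ χ ∈ below (dualReflection τ '' F)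
      (AddSubmonoid.closure (posRoots H Δ \ {α})) := by
  obtain ⟨χ₀, h₀, h⟩ := hχ
  refine ⟨_, ⟨χ₀, h₀, rfl⟩, ?_⟩
  rw [← map_sub]
  generalize χ₀ - χ = γ at h
  induction h using AddSubmonoid.closure_induction with
  | mem β hβ =>
    have := hΔ.dualReflection_mem hH hred hα τ hβ.1 hβ.2
    exact AddSubmonoid.subset_closure ⟨this.1, this.2⟩
  | zero => rw [map_zero]; exact zero_mem _
  | add x y _ _ hx hy => rw [map_add]; exact add_mem hx hy

/-- The direction -α lies in the full cone, so passing to it absorbs the powers of f_{α,i} used to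
reach a vector killed by all of them. -/
theorem below_sub_nsmul {α χ : Module.Dual ℂ H} (hα : α ∈ Δ) {F : Set (Module.Dual ℂ H)}
    (hχ : χ ∈ below F (AddSubmonoid.closure (posRoots H Δ \ {α}))) (k : ℕ) :
    χ - k • α ∈ below F (AddSubmonoid.closure Δ) := by
  obtain ⟨χ₀, h₀, h⟩ := hχ
  refine ⟨χ₀, h₀, ?_⟩
  rw [sub_sub_eq_add_sub, add_sub_right_comm]
  exact add_mem ((AddSubmonoid.closure_le.2 fun β hβ => hβ.1.2) h)
    (nsmul_mem (AddSubmonoid.subset_closure hα) k)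

end Blocks

/-! ### Twists of modules by a lift of a reflection -/

section Twist

variable {g : Type u} [LieRing g] [LieAlgebra ℂ g] {H : LieSubalgebra ℂ g} {n : ℕ}
  {α : Module.Dual ℂ H} {τ : RootTriple H α}

/-- The identity map from a twisted module to the module. -/
def untwist (φ : g →ₗ⁅ℂ⁆ g) (N : ModuleCat.{u} (Env n g)) : (twistFunctor n φ).obj N ≃+ N :=
  AddEquiv.refl N

theorem untwist_smul {φ : g →ₗ⁅ℂ⁆ g} {N : ModuleCat.{u} (Env n g)} (r : Env n g)
    (x : (twistFunctor n φ).obj N) : untwist φ N (r • x) = envMap n φ r • untwist φ N x := rfl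

theorem locNil_twist_iff {φ : g →ₗ⁅ℂ⁆ g} {N : ModuleCat.{u} (Env n g)} {r : Env n g} :
    LocNil ((twistFunctor n φ).obj N) r ↔ LocNil N (envMap n φ r) := by
  refine (untwist φ N).toEquiv.forall_congr fun {m} => exists_congr fun k => ?_
  rw [← map_pow]
  exact Iff.rfl

attribute [local instance] LieRing.ofAssociativeRing in
theorem envMap_comp_symm (φ : g ≃ₗ⁅ℂ⁆ g) (r : Env n g) :
    envMap n φ.toLieHom (envMap n φ.symm.toLieHom r) = r := by
  have : (envMap n φ.toLieHom).comp (envMap n φ.symm.toLieHom) = AlgHom.id ℂ (Env n g) := by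
    refine UniversalEnvelopingAlgebra.hom_ext ℂ (LieHom.ext fun y => ?_)
    show envMap n φ.toLieHom (envMap n φ.symm.toLieHom (UniversalEnvelopingAlgebra.ι ℂ y))
      = UniversalEnvelopingAlgebra.ι ℂ y
    induction y using TensorProduct.induction_on with
    | zero => simp
    | add a b ha hb => simp only [map_add, ha, hb]
    | tmul a x =>
      rw [envMap, envMap, UniversalEnvelopingAlgebra.lift_ι_apply]
      refine (UniversalEnvelopingAlgebra.lift_ι_apply ℂ _ _).trans ?_
      show UniversalEnvelopingAlgebra.ι ℂ (a ⊗ₜ[ℂ] φ (φ.symm x)) = _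
      rw [LieEquiv.apply_symm_apply]
  exact congrArg (fun f => f r) this

theorem finite_twist (φ : g ≃ₗ⁅ℂ⁆ g) {N : ModuleCat.{u} (Env n g)}
    (hN : Module.Finite (Env n g) N) :
    Module.Finite (Env n g) ((twistFunctor n φ.toLieHom).obj N) := by
  obtain ⟨S, hS⟩ := hN.1
  refine ⟨⟨S.map (untwist φ.toLieHom N).symm.toEquiv.toEmbedding, ?_⟩⟩
  rw [Finset.coe_map, eq_top_iff]
  intro x _
  obtain ⟨y, rfl⟩ := (untwist φ.toLieHom N).symm.surjective x
  have hy : y ∈ Submodule.span (Env n g) (S : Set N) := hS ▸ Submodule.mem_top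
  induction hy using Submodule.span_induction with
  | mem w hw => exact Submodule.subset_span ⟨w, hw, rfl⟩
  | zero => rw [map_zero]; exact zero_mem _
  | add a b _ _ ha hb => rw [map_add]; exact add_mem (ha trivial) (hb trivial)
  | smul r a _ ha =>
    have h := Submodule.smul_mem _ (envMap n φ.symm.toLieHom r) (ha trivial)
    have h' : envMap n φ.symm.toLieHom r • (untwist φ.toLieHom N).symm a
        = (untwist φ.toLieHom N).symm (r • a) := by
      rw [AddEquiv.eq_symm_apply, untwist_smul, envMap_comp_symm, AddEquiv.apply_symm_apply]
    rwa [h'] at h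

variable {φ : g ≃ₗ⁅ℂ⁆ g} (hφ : IsReflectionLift τ φ) {N : ModuleCat.{u} (Env n g)}
include hφ

theorem IsReflectionLift.envMap_cur_coe (i : ℕ) (x : H) :
    envMap n φ.toLieHom (cur n i (x : g)) = cur n i ((torusReflection τ x : H) : g) := by
  rw [envMap_cur]
  exact congrArg (cur n i) (hφ.apply x)

theorem IsReflectionLift.isWt_twist_iff {χ : Module.Dual ℂ H}
    {x : (twistFunctor n φ.toLieHom).obj N} :
    IsWt (torus H n) χ x ↔ IsWt (torus H n) (dualReflection τ χ) (untwist φ.toLieHom N x) := by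
  have h : ∀ y : H, torus H n y • x = algebraMap ℂ (Env n g) (χ y) • x ↔
      torus H n (torusReflection τ y) • untwist φ.toLieHom N x
        = algebraMap ℂ (Env n g) (χ y) • untwist φ.toLieHom N x := by
    intro y
    rw [← (untwist φ.toLieHom N).injective.eq_iff, untwist_smul, untwist_smul, torus,
      hφ.envMap_cur_coe, AlgHom.commutes]
    rfl
  constructor
  · intro hx y
    have := (h (torusReflection τ y)).1 (hx _)
    rw [torusReflection_torusReflection] at this
    rw [this, dualReflection_apply_apply]
    rfl
  · intro hx y
    refine (h y).2 ?_
    rw [hx, dualReflection_apply_apply]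
    exact congrArg (fun z => algebraMap ℂ (Env n g) (χ z) • untwist φ.toLieHom N x)
      (torusReflection_torusReflection τ y)

theorem IsReflectionLift.isWtModule_twist (hN : IsWtModule (torus H n) N) :
    IsWtModule (torus H n) ((twistFunctor n φ.toLieHom).obj N) := fun m => by
  obtain ⟨y, rfl⟩ := (untwist φ.toLieHom N).symm.surjective m
  refine hN.induction (p := fun y => (untwist φ.toLieHom N).symm y ∈ _) (fun χ x hx => ?_)
    (fun a b ha hb => ?_) y
  · refine AddSubgroup.subset_closure ⟨dualReflection τ χ, hφ.isWt_twist_iff.2 ?_⟩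
    rwa [dualReflection_dualReflection, AddEquiv.apply_symm_apply]
  · rw [map_add]
    exact add_mem ha hb

theorem IsReflectionLift.hasTorusEigenvalue_twist {μ : Fin n → Module.Dual ℂ H}
    (hN : HasTorusEigenvalue μ N) :
    HasTorusEigenvalue (fun i => dualReflection τ (μ i)) ((twistFunctor n φ.toLieHom).obj N) := by
  intro x
  rw [locNil_twist_iff]
  have := hN fun i => torusReflection τ (x i)
  convert this using 1
  rw [map_sub, AlgHom.commutes, torusElement, map_sum, torusElement]
  congr 1
  · exact Finset.sum_congr rfl fun i _ => hφ.envMap_cur_coe _ _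
  · exact congrArg _ (Finset.sum_congr rfl fun i _ => dualReflection_apply_apply τ _ _)

end Twist

/-! ### Socles of twisted modules -/

section Socle

namespace WeightTriple

variable {U : Type u} [Ring U] [Algebra ℂ U] {n : ℕ} {H : Type*} [AddCommGroup H] [Module ℂ H]
  {t : WeightTriple U n H} {F : OreFamily U (n + 1)} {M P : Type u} [AddCommGroup M] [Module U M]
  [AddCommGroup P] [Module U P] {c : ℂ} {χ : Module.Dual ℂ H}

/-- Apply the last nonvanishing power of f_0, then of f_1, and so on; since the f_i commute, earlier
annihilations persist. -/
theorem Lower.exists_f_smul_eq_zero (hP : t.Lower P c) {z : P} (hz : IsWt t.η χ z) (hz0 : z ≠ 0) :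
    ∃ (y : P) (k : ℕ), y ≠ 0 ∧ IsWt t.η (χ - k • t.α) y ∧ ∀ i ≤ n, t.f i • y = 0 := by
  have key : ∀ m ≤ n + 1, ∃ (y : P) (k : ℕ), y ≠ 0 ∧ IsWt t.η (χ - k • t.α) y ∧
      ∀ i < m, t.f i • y = 0 := by
    intro m
    induction m with
    | zero => exact fun _ => ⟨z, 0, hz0, by rwa [zero_smul, sub_zero], fun i hi => by omega⟩
    | succ m ih =>
      intro hm
      obtain ⟨y, k, hy0, hy, hi⟩ := ih (by omega)
      classical
      have hnil := hP.f_nil m (by omega) y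
      obtain ⟨l, hl⟩ : ∃ l, Nat.find hnil = l + 1 := by
        refine Nat.exists_eq_succ_of_ne_zero fun h => hy0 ?_
        have := Nat.find_spec hnil
        rwa [h, pow_zero, one_smul] at this
      refine ⟨t.f m ^ l • y, k + l, Nat.find_min hnil (by omega), ?_, fun i him => ?_⟩
      · have := hy.smul ((t.η_f m).pow l)
        rwa [smul_neg, ← sub_eq_add_neg, sub_sub, ← add_smul] at this
      · rcases Nat.lt_succ_iff_lt_or_eq.1 him with h | rfl
        · rw [← mul_smul, ((t.f_comm i m).pow_right l).eq, mul_smul, hi i h, smul_zero]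
        · rw [← mul_smul, ← pow_succ', ← hl]
          exact Nat.find_spec hnil
  obtain ⟨y, k, hy0, hy, h⟩ := key (n + 1) le_rfl
  exact ⟨y, k, hy0, hy, fun i hi => h i (by omega)⟩

variable (hF : F.IsGood) (hFt : ∀ i, F.s i = t.f i)
include hF hFt

/-- A nonzero vector killed by all f_i has the form (f_0 ⋯ f_n)^(-1) ⊗ x, and being nonzero means
that x is outside ∑ f_i M. The weight drops by the powers of f_i used, and by n + 1 more for the
inverse monomial. -/
theorem Upper.exists_notMem_rangeSum (hn : 1 ≤ n) (hc : c ≠ 0) (hM : t.Upper M c)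
    {z : TensorOver U (LocQuot F) M} (hz : IsWt t.η χ z) (hz0 : z ≠ 0) :
    ∃ (x : M) (k : ℕ), IsWt t.η (χ - k • t.α) x ∧
      x ∉ rangeSum M (fun i : Fin (n + 1) => t.f i) Finset.univ := by
  obtain ⟨y, k, hy0, hy, hfy⟩ := (hM.tensorOver hF hFt hn).exists_f_smul_eq_zero hz hz0
  obtain ⟨x, rfl⟩ := exists_eq_tens_sig t.toCurrentTriple hF hFt hn hc hM.nil
    (fun i _ => hM.e_nil i) (fun _ => 1) y fun i => by
      rw [pow_one]
      exact hfy i (by omega)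
  let T : M →+ TensorOver U (LocQuot F) M :=
    AddMonoidHom.mk' (tens (sig F fun _ => -((1 : ℕ) : ℤ))) (tens_add _)
  let ν : Module.Dual ℂ H := χ - (k + (n + 1)) • t.α
  have hcomp := hM.wt.comp_map (isWtModule_tensorOver hF hFt hM.wt) T
    (Equiv.addRight ((n + 1) • t.α)) (fun ν m hm => by
      have := isWt_tens hF hFt hm fun _ => -((1 : ℕ) : ℤ)
      simp only [Finset.sum_const, Finset.card_univ, Fintype.card_fin, Nat.cast_one, smul_neg,
        neg_smul, sub_neg_eq_add, nsmul_eq_mul, mul_one] at this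
      rw [natCast_zsmul] at this
      exact this) x ν
  have he : Equiv.addRight ((n + 1) • t.α) ν = χ - k • t.α := by
    show χ - (k + (n + 1)) • t.α + (n + 1) • t.α = χ - k • t.α
    rw [add_smul]
    abel
  rw [he, show T x = tens (sig F fun _ => -((1 : ℕ) : ℤ)) x from rfl,
    IsWtModule.comp_self _ hy] at hcomp
  refine ⟨hM.wt.comp x ν, k + (n + 1), hM.wt.isWt_comp x ν, fun hmem => hy0 ?_⟩
  rw [hcomp]
  refine (tens_sig_eq_zero_iff t.toCurrentTriple hF hFt hn hc hM.nil (fun i _ => hM.e_nil i)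
    (d := fun _ => 1)).2 ?_
  have : t.fPow (fun _ => 1) = fun i : Fin (n + 1) => t.f i := funext fun i => pow_one _
  rwa [this]

/-- Choose d with the smallest sum such that the value is nonzero; multiplication by f_i lowers this
sum. -/
theorem exists_apply_sig_ne_zero {f : HomOver U (LocQuot F) P} (hf : f ≠ 0) :
    ∃ d : Fin (n + 1) → ℕ, f.toLin (sig F fun i => -(d i : ℤ)) ≠ 0 ∧
      ∀ i : Fin (n + 1), t.f i • f.toLin (sig F fun i => -(d i : ℤ)) = 0 := by
  classical
  have hex : ∃ N : ℕ, ∃ d : Fin (n + 1) → ℕ, ∑ i, d i = N ∧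
      f.toLin (sig F fun i => -(d i : ℤ)) ≠ 0 := by
    by_contra! h
    exact hf (hom_ext hF 0 fun l _ => h _ (fun _ => l) rfl)
  obtain ⟨d, hd, hne⟩ := Nat.find_spec hex
  refine ⟨d, hne, fun i => ?_⟩
  by_contra hi
  have hdi : d i ≠ 0 := fun h => hne (by
    rw [sig_eq_zero i (by rw [h]; simp), map_zero])
  have h1 : t.f i • sig F (fun i => -(d i : ℤ))
      = sig F fun j => -((d - Pi.single i 1 : Fin (n + 1) → ℕ) j : ℤ) := by
    have := f_pow_smul_sig hF hFt i 1 fun i => -(d i : ℤ)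
    rw [pow_one] at this
    rw [this]
    refine sig_congr fun j => ?_
    by_cases hj : j = i
    · subst hj
      simp only [Pi.add_apply, Pi.sub_apply, Pi.single_eq_same]
      omega
    · simp [Pi.single_eq_of_ne hj]
  rw [← map_smul, h1] at hi
  refine Nat.find_min hex ?_ ⟨_, rfl, hi⟩
  rw [← hd]
  refine Finset.sum_lt_sum (fun j _ => Nat.sub_le _ _) ⟨i, Finset.mem_univ i, ?_⟩
  simp only [Pi.sub_apply, Pi.single_eq_same]
  omega

/-- If the homomorphisms of a given weight are determined by finitely many of their values, then
elements acting locally nilpotently on the target act locally nilpotently on them. -/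
theorem exists_pow_smul_hom_eq_zero {y : U} {z : ℂ} (hy : HasWt t.η 0 y)
    {κ : Fin (n + 1) → Fin (n + 1) → ℂ}
    (hκ : ∀ j, y * F.s j - F.s j * y = ∑ l, algebraMap ℂ U (κ j l) * F.s l)
    (hκ0 : ∀ j l, l ≤ j → κ j l = 0) (hP : LocNil P (y - algebraMap ℂ U z)) {N : ℕ}
    (hN : ∀ f : HomOver U (LocQuot F) P, IsWt t.η χ f →
      (∀ d : Fin (n + 1) → ℕ, ∑ i, d i < N → f.toLin (sig F fun i => -(d i : ℤ)) = 0) → f = 0)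
    {f : HomOver U (LocQuot F) P} (hf : IsWt t.η χ f) :
    ∃ k : ℕ, (y - algebraMap ℂ U z) ^ k • f = 0 := by
  classical
  have h : ∀ d : Fin (n + 1) → ℕ, ∃ K : ℕ, ∀ k ≥ K,
      ((y - algebraMap ℂ U z) ^ k • f).toLin (sig F fun i => -(d i : ℤ)) = 0 := by
    intro d
    obtain ⟨a, ha⟩ := exists_commutator_iterate_sig_eq_zero hF y κ hκ hκ0 fun i => -(d i : ℤ)
    exact exists_pow_smul_hom_apply_eq_zero hF y z hP f a _ ha
  choose K hK using h
  -- Only finitely many d have sum below N, and they all lie in the box with entries below N, so one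
  -- exponent works for all the values that matter.
  refine ⟨(Fintype.piFinset fun _ : Fin (n + 1) => Finset.range N).sup K, hN _ ?_ fun d hd => ?_⟩
  · have := hf.smul ((hy.sub (HasWt.algebraMap z)).pow
      ((Fintype.piFinset fun _ : Fin (n + 1) => Finset.range N).sup K))
    rwa [smul_zero, add_zero] at this
  · refine hK d _ (Finset.le_sup (f := K) (Fintype.mem_piFinset.2 fun i => Finset.mem_range.2 ?_))
    exact (Finset.single_le_sum (f := d) (fun _ _ => Nat.zero_le _) (Finset.mem_univ i)).trans_lt hd

end WeightTriple

end Socle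

/-! ### The twisting functors on Jordan blocks -/

section Blocks

variable {g : Type u} [LieRing g] [LieAlgebra ℂ g] {H : LieSubalgebra ℂ g} {n : ℕ}
  {α : Module.Dual ℂ H}

/-- The coefficients of the commutators of elements of `h_n^{≥1}` with the `f_{α,j}`. -/
def torusCoeff (α : Module.Dual ℂ H) (x : Fin n → H) (j l : Fin (n + 1)) : ℂ :=
  ∑ i : Fin n, if (l : ℕ) = i + 1 + j then -α (x i) else 0

theorem torusCoeff_eq_zero (x : Fin n → H) {j l : Fin (n + 1)} (h : l ≤ j) :
    torusCoeff α x j l = 0 := by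
  refine Finset.sum_eq_zero fun i _ => if_neg ?_
  have : (l : ℕ) ≤ j := h
  omega

theorem torusElement_commutator (τ : RootTriple H α) (x : Fin n → H) (j : Fin (n + 1)) :
    torusElement H n x * cur n j τ.f - cur n j τ.f * torusElement H n x
      = ∑ l : Fin (n + 1), algebraMap ℂ (Env n g) (torusCoeff α x j l) * cur n l τ.f := by
  have h1 : ∀ i : Fin n, cur n (i + 1) (x i : g) * cur n j τ.f - cur n j τ.f * cur n (i + 1) (x i : g)
      = ∑ l : Fin (n + 1), algebraMap ℂ (Env n g) (if (l : ℕ) = i + 1 + j then -α (x i) else 0)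
        * cur n l τ.f := by
    intro i
    have h2 : ⁅(x i : g), τ.f⁆ = (-α (x i)) • τ.f := (mem_rootSpace H).1 τ.f_mem (x i)
    rw [cur_lie, h2, cur_smul]
    by_cases h : (i : ℕ) + 1 + j ≤ n
    · rw [Finset.sum_eq_single ⟨i + 1 + j, by omega⟩, if_pos rfl]
      · intro l _ hl
        rw [if_neg fun h => hl (Fin.ext h), map_zero, zero_mul]
      · exact fun h => absurd (Finset.mem_univ _) h
    · rw [cur_eq_zero n (by omega), mul_zero]
      refine (Finset.sum_eq_zero fun l _ => ?_).symm
      rw [if_neg (by omega), map_zero, zero_mul]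
  rw [torusElement, Finset.sum_mul, Finset.mul_sum, ← Finset.sum_sub_distrib,
    Finset.sum_congr rfl fun i _ => h1 i, Finset.sum_comm]
  refine Finset.sum_congr rfl fun l _ => ?_
  rw [torusCoeff, map_sum, Finset.sum_mul]

theorem hasWt_torusElement (hH : IsMaximalTorus H) (x : Fin n → H) :
    HasWt (torus H n) 0 (torusElement H n x) := fun y => by
  rw [torusElement, Finset.mul_sum, Finset.sum_mul, ← Finset.sum_sub_distrib, LinearMap.zero_apply,
    map_zero, zero_mul]
  exact Finset.sum_eq_zero fun i _ => by rw [torus, cur_lie, hH.lie_eq_zero, cur_zero]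

variable [FiniteDimensional ℂ g] {Δ : Set (Module.Dual ℂ H)} (hH : IsMaximalTorus H)
  (hred : LieAlgebra.radical ℂ g = LieAlgebra.center ℂ g) (hΔ : IsSimpleSystem H Δ) (hn : 1 ≤ n)
  (hα : α ∈ Δ) (τ : RootTriple H α) {φ : g ≃ₗ⁅ℂ⁆ g} (hφ : IsReflectionLift τ φ)
  {μ : Fin n → Module.Dual ℂ H} (hμ : topComponent H hn μ τ.h ≠ 0)

theorem topComponent_reflection :
    topComponent H hn (fun i => dualReflection τ (μ i)) τ.h = -topComponent H hn μ τ.h := by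
  show dualReflection τ (topComponent H hn μ) τ.h = _
  rw [dualReflection_apply_apply, τ.apply_h, two_smul, sub_add_cancel_left, map_neg]

include hH hred hΔ hα hφ hμ

/-- Only the weight bound needs more than transport through S ⊗ M and the twist: it rests on the
vectors outside the images of the f_{α,i}. -/
theorem jordanBlock_twistT {M : ModuleCat.{u} (Env n g)} (hM : jordanBlock H Δ μ M) :
    jordanBlock H Δ (fun i => dualReflection τ (μ i)) ((twistT n τ φ).obj M) := by
  obtain ⟨hfin, hwt, hbdd, hnil⟩ := (jordanBlock_iff hH hΔ).1 hM
  have hF := isGood_loweringFamily n τ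
  have hFt : ∀ i, (loweringFamily n τ).s i = (τ.weightTriple n hH).f i := fun _ => rfl
  have hU := upper_of_bddWts hH hΔ hα τ hn hwt hbdd hnil
  refine (jordanBlock_iff hH hΔ).2 ?_
  let Q : ModuleCat.{u} (Env n g) :=
    ModuleCat.of (Env n g) (TensorOver (Env n g) (twistBimodule n τ) M)
  show Module.Finite (Env n g) ((twistFunctor n φ.toLieHom).obj Q) ∧
    IsWtModule (torus H n) ((twistFunctor n φ.toLieHom).obj Q) ∧
    BddWts n Δ ((twistFunctor n φ.toLieHom).obj Q) ∧
    HasTorusEigenvalue _ ((twistFunctor n φ.toLieHom).obj Q)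
  have hQfin : Module.Finite (Env n g) Q := WeightTriple.finite_tensorOver hF hFt hn hμ hU
  have hQwt : IsWtModule (torus H n) Q :=
    WeightTriple.isWtModule_tensorOver (t := τ.weightTriple n hH) hF hFt hwt
  have hQnil : HasTorusEigenvalue μ Q := fun x => locNil_tensorOver hF _ _ _
    (torusElement_commutator τ x) (fun j l h => torusCoeff_eq_zero x h) (hnil x)
  refine ⟨finite_twist φ hQfin, hφ.isWtModule_twist hQwt, ?_, hφ.hasTorusEigenvalue_twist hQnil⟩
  obtain ⟨F, hFfin, hsoc⟩ := hM.1.exists_socle_bound hH hred hΔ hα τ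
  refine ⟨dualReflection τ '' F, hFfin.image _, fun χ z hz hz0 => ?_⟩
  obtain ⟨x, k, hx, hxr⟩ := hU.exists_notMem_rangeSum hF hFt hn hμ
    (hφ.isWt_twist_iff.1 hz) ((AddEquiv.map_ne_zero_iff (untwist φ.toLieHom Q)).2 hz0)
  -- The vector x has weight s_α(χ) - kα; reflecting it gives χ + kα, and the surplus kα is then
  -- subtracted inside the full cone.
  have h := image_below hH hred hΔ hα τ ((hsoc _ x hx).resolve_right hxr)
  have h' := below_sub_nsmul hα h k
  have hα' : (τ.weightTriple n hH).α = α := rfl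
  rw [map_sub, dualReflection_dualReflection, map_nsmul, hα', dualReflection_self, smul_neg,
    sub_neg_eq_add, add_sub_cancel_right] at h'
  exact h'

/-- The inverse of φ sends f_α to a multiple of e_α, which is locally nilpotent on N by the bound on
its weights, and it turns the eigenvalue s_α(μ) back into μ. -/
theorem lower_twist {N : ModuleCat.{u} (Env n g)}
    (hN : jordanBlock H Δ (fun i => dualReflection τ (μ i)) N) :
    (τ.weightTriple n hH).Lower ((twistFunctor n φ.symm.toLieHom).obj N)
      (topComponent H hn μ τ.h) := by
  obtain ⟨hfin, hwt, hbdd, hnil⟩ := (jordanBlock_iff hH hΔ).1 hN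
  have hU := upper_of_bddWts hH hΔ hα τ hn hwt hbdd hnil
  refine ⟨hφ.symm.isWtModule_twist hwt, fun i _ => ?_, ?_⟩
  · rw [locNil_twist_iff]
    show LocNil N (envMap n φ.symm.toLieHom (cur n i τ.f))
    have hf := hφ.symm.map_mem_rootSpace τ.f_mem
    rw [map_neg, dualReflection_self, neg_neg] at hf
    obtain ⟨c, hc⟩ := τ.exists_eq_smul_e hH hred hf
    rw [envMap_cur]
    have : cur n i (φ.symm.toLieHom τ.f) = algebraMap ℂ _ c * cur n i τ.e := by
      rw [← cur_smul, ← hc]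
      rfl
    rw [this]
    intro m
    obtain ⟨k, hk⟩ := hU.e_nil i m
    refine ⟨k, ?_⟩
    rw [(show Commute (algebraMap ℂ _ c) (cur n i τ.e) from Algebra.commutes c _).mul_pow, mul_smul]
    exact (congrArg _ hk).trans (smul_zero _)
  · have := (hφ.symm.hasTorusEigenvalue_twist hnil).locNil_top hn τ.h
    simp only [dualReflection_dualReflection] at this
    exact this

/-- The weights of homomorphisms from `S_α` are bounded. -/
theorem exists_hom_bound {N : ModuleCat.{u} (Env n g)}
    (hN : jordanBlock H Δ (fun i => dualReflection τ (μ i)) N) :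
    ∃ F : Set (Module.Dual ℂ H), F.Finite ∧ ∀ χ
      (f : HomOver (Env n g) (twistBimodule n τ) ((twistFunctor n φ.symm.toLieHom).obj N)),
      IsWt (torus H n) χ f → f ≠ 0 → ∃ d : Fin (n + 1) → ℕ,
        f.toLin (sig (loweringFamily n τ) fun i => -(d i : ℤ)) ≠ 0 ∧
        χ + (∑ i, d i) • α ∈ below F (AddSubmonoid.closure (posRoots H Δ \ {α})) := by
  obtain ⟨hfin, hwt, hbdd, hnil⟩ := (jordanBlock_iff hH hΔ).1 hN
  have hF := isGood_loweringFamily n τ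
  have hFt : ∀ i, (loweringFamily n τ).s i = (τ.weightTriple n hH).f i := fun _ => rfl
  have hU := upper_of_bddWts hH hΔ hα τ hn hwt hbdd hnil
  rw [topComponent_reflection] at hU
  obtain ⟨F, hFfin, hsoc⟩ := hN.1.exists_socle_bound hH hred hΔ hα τ
  refine ⟨dualReflection τ '' F, hFfin.image _, fun χ f hf hf0 => ?_⟩
  obtain ⟨d, hd, hfd⟩ := WeightTriple.exists_apply_sig_ne_zero (t := τ.weightTriple n hH) hF hFt hf0
  refine ⟨d, hd, ?_⟩
  set p := f.toLin (sig (loweringFamily n τ) fun i => -(d i : ℤ)) with hp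
  have hpwt : IsWt (torus H n) (χ + (∑ i, d i) • α) p := by
    have := WeightTriple.isWt_apply (t := τ.weightTriple n hH) hF hFt hf fun i => -(d i : ℤ)
    rw [Finset.sum_neg_distrib, neg_smul, sub_neg_eq_add, ← Nat.cast_sum, natCast_zsmul] at this
    exact this
  set q := untwist φ.symm.toLieHom N p with hq
  have hqwt := hφ.symm.isWt_twist_iff.1 hpwt
  have hq0 : q ≠ 0 := (AddEquiv.map_ne_zero_iff (untwist φ.symm.toLieHom N)).2 hd
  have hf' := hφ.symm.map_mem_rootSpace τ.f_mem
  rw [map_neg, dualReflection_self, neg_neg] at hf'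
  obtain ⟨c, hc⟩ := τ.exists_eq_smul_e hH hred hf'
  have hc0 : c ≠ 0 := by
    rintro rfl
    rw [zero_smul] at hc
    exact τ.f_ne_zero (φ.symm.injective (hc.trans (map_zero φ.symm).symm))
  -- The value p is killed by all f_{α,i} for the twisted action, which means that q is killed by
  -- all e_{α,i} in N.
  have heq : ∀ i ≤ n, cur n i τ.e • q = 0 := by
    intro i hi
    have h1 : cur n i τ.f • p = 0 := hfd ⟨i, by omega⟩
    have h2 : envMap n φ.symm.toLieHom (cur n i τ.f) • q = 0 := by
      rw [hq, ← untwist_smul, h1, map_zero]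
    have h3 : cur n i (φ.symm.toLieHom τ.f) = algebraMap ℂ _ c * cur n i τ.e := by
      rw [← cur_smul, ← hc]
      rfl
    rw [envMap_cur, h3, mul_smul] at h2
    have h4 := congrArg (fun m => algebraMap ℂ (Env n g) c⁻¹ • m) h2
    simp only [smul_zero] at h4
    rwa [← mul_smul, ← map_mul, inv_mul_cancel₀ hc0, map_one, one_smul] at h4
  -- A nonzero vector killed by all e_{α,i} is not in ∑ f_{α,i} N. On N the eigenvalue of h_{α,n} is
  -- the negative of the one for μ, hence still nonzero.
  have hqr : q ∉ rangeSum N (fun i : Fin (n + 1) => cur n i τ.f) Finset.univ := fun h => hq0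
    ((τ.weightTriple n hH).eq_zero_of_e_smul_eq_zero hn (neg_ne_zero.2 hμ) hU.nil
      (fun i _ => hU.e_nil i) heq h)
  have h := image_below hH hred hΔ hα τ ((hsoc _ q hqwt).resolve_right hqr)
  rwa [dualReflection_dualReflection] at h

end Blocks

/-! ### The submodule spanned by the weight vectors -/

section WeightSubmodule

variable {g : Type u} [LieRing g] [LieAlgebra ℂ g] [FiniteDimensional ℂ g] {H : LieSubalgebra ℂ g}
  {n : ℕ} (hH : IsMaximalTorus H) {X : ModuleCat.{u} (Env n g)}

theorem isWt_subtype_iff {X : Type u} [AddCommGroup X] [Module (Env n g) X]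
    {K : Submodule (Env n g) X} {χ : Module.Dual ℂ H} {x : K} :
    IsWt (torus H n) χ x ↔ IsWt (torus H n) χ (x : X) :=
  ⟨fun h => h.map K.subtype, fun h => IsWt.of_map (f := K.subtype) K.subtype_injective h⟩

open scoped ModuleCat in
theorem mem_weightSubmodule_of_isWt {χ : Module.Dual ℂ H} {x : X} (hx : IsWt (torus H n) χ x) :
    x ∈ weightSubmodule H n hH X :=
  Submodule.mem_iSup_of_mem (p := weightSpace H n X) χ hx

theorem isWtModule_weightSubmodule : IsWtModule (torus H n) (weightSubmodule H n hH X) := by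
  intro w
  have h : AddSubgroup.closure {x : X | ∃ ν, IsWt (torus H n) ν x}
      ≤ (AddSubgroup.closure {w : weightSubmodule H n hH X | ∃ ν, IsWt (torus H n) ν w}).map
        (weightSubmodule H n hH X).subtype.toAddMonoidHom := by
    refine (AddSubgroup.closure_le _).2 ?_
    rintro x ⟨ν, hx⟩
    exact ⟨⟨x, mem_weightSubmodule_of_isWt hH hx⟩,
      AddSubgroup.subset_closure ⟨ν, isWt_subtype_iff.2 hx⟩, rfl⟩
  obtain ⟨w', hw', hww'⟩ := h (mem_weightSum_iff.1 w.2)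
  rwa [← Subtype.ext hww']

end WeightSubmodule

/-! ### The functor G_α on Jordan blocks -/

section Blocks

variable {g : Type u} [LieRing g] [LieAlgebra ℂ g] {H : LieSubalgebra ℂ g} {n : ℕ}
  {α : Module.Dual ℂ H} [FiniteDimensional ℂ g] {Δ : Set (Module.Dual ℂ H)}
  (hH : IsMaximalTorus H) (hred : LieAlgebra.radical ℂ g = LieAlgebra.center ℂ g)
  (hΔ : IsSimpleSystem H Δ) (hn : 1 ≤ n) (hα : α ∈ Δ) (τ : RootTriple H α) {φ : g ≃ₗ⁅ℂ⁆ g}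
  (hφ : IsReflectionLift τ φ) {μ : Fin n → Module.Dual ℂ H}
  (hμ : topComponent H hn μ τ.h ≠ 0)

/-- `Hom_U(S_α, φ⁻¹(N))`. -/
noncomputable abbrev homTwist (τ : RootTriple H α) (φ : g ≃ₗ⁅ℂ⁆ g) (N : ModuleCat.{u} (Env n g)) :
    ModuleCat.{u} (Env n g) :=
  ModuleCat.of (Env n g)
    (HomOver (Env n g) (twistBimodule n τ) ((twistFunctor n φ.symm.toLieHom).obj N))

include hred hΔ hα hφ hμ

/-- Both claims follow from the bound on χ + |d| α for the exponents d at which a homomorphism of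
weight χ has a nonzero socle value. For fixed χ it leaves finitely many d, so finitely many values
determine the homomorphism. -/
theorem bddWts_and_hasTorusEigenvalue_hom {N : ModuleCat.{u} (Env n g)}
    (hN : jordanBlock H Δ (fun i => dualReflection τ (μ i)) N) :
    BddWts n Δ (weightSubmodule H n hH (homTwist τ φ N)) ∧
      HasTorusEigenvalue μ (weightSubmodule H n hH (homTwist τ φ N)) := by
  have hF := isGood_loweringFamily n τ
  have hFt : ∀ i, (loweringFamily n τ).s i = (τ.weightTriple n hH).f i := fun _ => rfl
  obtain ⟨F, hFfin, hbound⟩ := exists_hom_bound hH hred hΔ hn hα τ hφ hμ hN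
  refine ⟨⟨F, hFfin, fun χ f hf hf0 => ?_⟩, fun x => ?_⟩
  · obtain ⟨d, -, hd⟩ := hbound χ f (isWt_subtype_iff.1 hf) fun h => hf0 (Subtype.ext h)
    have := below_sub_nsmul hα hd (∑ i, d i)
    rwa [add_sub_cancel_right] at this
  · intro w
    refine (isWtModule_weightSubmodule hH).induction
      (p := fun w => ∃ k, (torusElement H n x - algebraMap ℂ _ (∑ i, μ i (x i))) ^ k • w = 0)
      (fun χ f hf => ?_) (fun a b ha hb => ?_) w
    · obtain ⟨K, hK⟩ := exists_bound_of_finite hΔ hα hFfin χ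
      have hP : LocNil ((twistFunctor n φ.symm.toLieHom).obj N)
          (torusElement H n x - algebraMap ℂ _ (∑ i, μ i (x i))) := by
        have := hφ.symm.hasTorusEigenvalue_twist ((jordanBlock_iff hH hΔ).1 hN).2.2.2 x
        simpa only [dualReflection_dualReflection] using this
      obtain ⟨k, hk⟩ := WeightTriple.exists_pow_smul_hom_eq_zero (t := τ.weightTriple n hH)
        (χ := χ) (f := (f : homTwist τ φ N)) hF hFt (hasWt_torusElement hH x)
        (torusElement_commutator τ x) (fun j l h => torusCoeff_eq_zero x h) hP (N := K)
        (fun f' hf' h => by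
          by_contra hf0
          obtain ⟨d, hd0, hd⟩ := hbound χ f' hf' hf0
          refine hd0 (h d (hK _ ?_))
          have := below_sub_nsmul hα hd 0
          rwa [zero_smul, sub_zero] at this) (isWt_subtype_iff.1 hf)
      exact ⟨k, Subtype.ext hk⟩
    · obtain ⟨k, hk⟩ := ha
      obtain ⟨l, hl⟩ := hb
      refine ⟨k + l, ?_⟩
      rw [smul_add, pow_add _ k l, mul_smul, mul_smul, hl, smul_zero, add_zero, ← mul_smul, ← pow_add,
        add_comm k l, pow_add _ l k, mul_smul, hk, smul_zero]

theorem upper_hom {N : ModuleCat.{u} (Env n g)}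
    (hN : jordanBlock H Δ (fun i => dualReflection τ (μ i)) N) :
    (τ.weightTriple n hH).Upper (weightSubmodule H n hH (homTwist τ φ N))
      (topComponent H hn μ τ.h) :=
  have h := bddWts_and_hasTorusEigenvalue_hom hH hred hΔ hn hα τ hφ hμ hN
  upper_of_bddWts hH hΔ hα τ hn (isWtModule_weightSubmodule hH) h.1 h.2

theorem counit_bijective_hom {N : ModuleCat.{u} (Env n g)}
    (hN : jordanBlock H Δ (fun i => dualReflection τ (μ i)) N)
    {ε : TensorOver (Env n g) (twistBimodule n τ) (weightSubmodule H n hH (homTwist τ φ N))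
      →ₗ[Env n g] (twistFunctor n φ.symm.toLieHom).obj N}
    (hε : ∀ s (f : weightSubmodule H n hH (homTwist τ φ N)),
      ε (tens s f) = HomOver.toLin (f : homTwist τ φ N) s) : Function.Bijective ε :=
  WeightTriple.counit_bijective (t := τ.weightTriple n hH) (isGood_loweringFamily n τ)
    (fun _ => rfl) hn hμ (lower_twist hH hred hΔ hn hα τ hφ hμ hN)
    (W := weightSubmodule H n hH (homTwist τ φ N))
    (fun _ _ hf => mem_weightSubmodule_of_isWt hH hf)
    (upper_hom hH hred hΔ hn hα τ hφ hμ hN) hε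

/-- Finite generation is reflected by S ⊗ -, and S ⊗ W is isomorphic by the counit to the twist of
N, which is finitely generated. -/
theorem jordanBlock_twistG {N : ModuleCat.{u} (Env n g)}
    (hN : jordanBlock H Δ (fun i => dualReflection τ (μ i)) N) :
    jordanBlock H Δ μ ((twistG n τ hH φ).obj N) := by
  have h := bddWts_and_hasTorusEigenvalue_hom hH hred hΔ hn hα τ hφ hμ hN
  have hU := upper_hom hH hred hΔ hn hα τ hφ hμ hN
  refine (jordanBlock_iff hH hΔ).2 ⟨?_, isWtModule_weightSubmodule hH, h⟩
  obtain ⟨ε, hε⟩ := exists_counit (weightSubmodule H n hH (homTwist τ φ N))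
  have hb := counit_bijective_hom hH hred hΔ hn hα τ hφ hμ hN hε
  have hP := finite_twist (n := n) φ.symm hN.1.finite
  exact WeightTriple.finite_of_finite_tensorOver (isGood_loweringFamily n τ) (fun _ => rfl) hn hμ hU
    (Module.Finite.equiv (LinearEquiv.ofBijective ε hb).symm)

end Blocks

/-! ### The unit and the counit -/

section Unit

variable (U : Type u) [Ring U] (S : Type u) [AddCommGroup S] [Module U S] [Module Uᵐᵒᵖ S]
  [SMulCommClass U Uᵐᵒᵖ S] (M : Type u) [AddCommGroup M] [Module U M]

/-- The map `m ↦ (s ↦ s ⊗ m)`. -/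
def unitHom : M →ₗ[U] HomOver U S (TensorOver U S M) where
  toFun m := ({ toFun := fun s => tens s m
                map_add' := fun s s' => add_tens s s' m
                map_smul' := fun _ _ => rfl } : S →ₗ[U] TensorOver U S M)
  map_add' m m' := LinearMap.ext fun s => tens_add s m m'
  map_smul' r m := LinearMap.ext fun s => tens_smul r s m

end Unit

section Untwist

variable {g : Type u} [LieRing g] [LieAlgebra ℂ g] {n : ℕ}

/-- Twisting by an automorphism and by its inverse gives back the module. -/
noncomputable def doubleTwist (φ ψ : g →ₗ⁅ℂ⁆ g) (h : ∀ r : Env n g, envMap n φ (envMap n ψ r) = r)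
    (Q : ModuleCat.{u} (Env n g)) :
    (twistFunctor n ψ).obj ((twistFunctor n φ).obj Q) ≃ₗ[Env n g] Q where
  __ := (untwist ψ ((twistFunctor n φ).obj Q)).trans (untwist φ Q)
  map_smul' r x := by
    show untwist φ Q (untwist ψ ((twistFunctor n φ).obj Q) (r • x)) = _
    rw [untwist_smul, untwist_smul, h]
    rfl

theorem envMap_symm_comp (φ : g ≃ₗ⁅ℂ⁆ g) (r : Env n g) :
    envMap n φ.symm.toLieHom (envMap n φ.toLieHom r) = r :=
  envMap_comp_symm φ.symm r

end Untwist

/-! ### Unit and counit as natural isomorphisms -/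

section Equivalence

variable {g : Type u} [LieRing g] [LieAlgebra ℂ g] {H : LieSubalgebra ℂ g} {n : ℕ}
  {α : Module.Dual ℂ H} [FiniteDimensional ℂ g] {Δ : Set (Module.Dual ℂ H)}
  (hH : IsMaximalTorus H) (hred : LieAlgebra.radical ℂ g = LieAlgebra.center ℂ g)
  (hΔ : IsSimpleSystem H Δ) (hn : 1 ≤ n) (hα : α ∈ Δ) (τ : RootTriple H α) {φ : g ≃ₗ⁅ℂ⁆ g}
  (hφ : IsReflectionLift τ φ) {μ : Fin n → Module.Dual ℂ H}
  (hμ : topComponent H hn μ τ.h ≠ 0)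

/-- `S_α ⊗_U M`. -/
noncomputable abbrev tensTwist (τ : RootTriple H α) (M : ModuleCat.{u} (Env n g)) :
    ModuleCat.{u} (Env n g) :=
  ModuleCat.of (Env n g) (TensorOver (Env n g) (twistBimodule n τ) M)

/-- `φ⁻¹(φ(S_α ⊗_U M)) = S_α ⊗_U M`. -/
noncomputable def twistTEquiv (τ : RootTriple H α) (φ : g ≃ₗ⁅ℂ⁆ g) (M : ModuleCat.{u} (Env n g)) :
    (twistFunctor n φ.symm.toLieHom).obj ((twistT n τ φ).obj M) ≃ₗ[Env n g] tensTwist τ M :=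
  doubleTwist φ.toLieHom φ.symm.toLieHom (envMap_comp_symm φ) (tensTwist τ M)

/-- The unit as a map to `Hom_U(S_α, φ⁻¹(T_α M))`. -/
noncomputable def twistUnit (τ : RootTriple H α) (φ : g ≃ₗ⁅ℂ⁆ g) (M : ModuleCat.{u} (Env n g)) :
    M →ₗ[Env n g] homTwist τ φ ((twistT n τ φ).obj M) :=
  (homMap (Env n g) (twistBimodule n τ) (twistTEquiv τ φ M).symm.toLinearMap).comp
    (unitHom (Env n g) (twistBimodule n τ) M)

theorem twistUnit_toLin (M : ModuleCat.{u} (Env n g)) (m : M) (s : twistBimodule n τ) :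
    HomOver.toLin (twistUnit τ φ M m) s = (twistTEquiv τ φ M).symm (tens s m) := rfl

include hred hΔ hα hφ hμ

/-- The unit is an isomorphism on the modules in the Jordan block. -/
theorem exists_unitEquiv {M : ModuleCat.{u} (Env n g)} (hM : jordanBlock H Δ μ M) :
    ∃ e : M ≃ₗ[Env n g] weightSubmodule H n hH (homTwist τ φ ((twistT n τ φ).obj M)),
      ∀ m, (e m : homTwist τ φ ((twistT n τ φ).obj M)) = twistUnit τ φ M m := by
  obtain ⟨hfin, hwt, hbdd, hnil⟩ := (jordanBlock_iff hH hΔ).1 hM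
  have hF := isGood_loweringFamily n τ
  have hFt : ∀ i, (loweringFamily n τ).s i = (τ.weightTriple n hH).f i := fun _ => rfl
  have hU := upper_of_bddWts hH hΔ hα τ hn hwt hbdd hnil
  have hmem : ∀ m, twistUnit τ φ M m
      ∈ weightSubmodule H n hH (homTwist τ φ ((twistT n τ φ).obj M)) := by
    intro m
    refine hwt.induction (p := fun m => twistUnit τ φ M m
      ∈ weightSubmodule H n hH (homTwist τ φ ((twistT n τ φ).obj M))) (fun χ m hm => ?_)
      (fun a b ha hb => ?_) m
    · exact mem_weightSubmodule_of_isWt hH (hm.map _)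
    · rw [map_add]
      exact add_mem ha hb
  refine ⟨LinearEquiv.ofBijective ((twistUnit τ φ M).codRestrict
    (weightSubmodule H n hH (homTwist τ φ ((twistT n τ φ).obj M))) hmem) ⟨?_, ?_⟩, fun m => rfl⟩
  · rw [injective_iff_map_eq_zero]
    intro m hm
    refine hU.unit_injective hF hFt hn hμ fun s => ?_
    have h1 : twistUnit τ φ M m = 0 := congrArg Subtype.val hm
    have h2 := twistUnit_toLin τ M m s (φ := φ)
    rw [h1] at h2
    exact ((twistTEquiv τ φ M).symm.map_eq_zero_iff).1 h2.symm
  · intro w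
    refine (isWtModule_weightSubmodule hH).induction (p := fun w => ∃ m,
      (twistUnit τ φ M).codRestrict _ hmem m = w) (fun χ f hf => ?_) (fun a b ha hb => ?_) w
    · have hf' := (isWt_subtype_iff.1 hf).map
        (homMap (Env n g) (twistBimodule n τ) (twistTEquiv τ φ M).toLinearMap)
      obtain ⟨m, -, hm⟩ := hU.exists_unit_eq hF hFt hn hμ hf'
      refine ⟨m, Subtype.ext (LinearMap.ext fun s => (twistTEquiv τ φ M).injective ?_)⟩
      refine Eq.trans ?_ (hm s).symm
      exact (twistTEquiv τ φ M).apply_symm_apply _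
    · obtain ⟨m, rfl⟩ := ha
      obtain ⟨m', rfl⟩ := hb
      exact ⟨m + m', map_add _ m m'⟩

theorem nonempty_unit_iso
    (hT : ∀ M, jordanBlock H Δ μ M →
      jordanBlock H Δ (fun i => dualReflection τ (μ i)) ((twistT n τ φ).obj M))
    (hG : ∀ N, jordanBlock H Δ (fun i => dualReflection τ (μ i)) N →
      jordanBlock H Δ μ ((twistG n τ hH φ).obj N)) :
    Nonempty (restrictFunctor (twistT n τ φ) hT ⋙ restrictFunctor (twistG n τ hH φ) hG ≅ 𝟭 _) := by
  choose e he using fun (M : ModuleCat.{u} (Env n g)) (hM : jordanBlock H Δ μ M) =>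
    exists_unitEquiv hH hred hΔ hn hα τ hφ hμ hM
  let i (M : (jordanBlock H Δ μ).FullSubcategory) :
      M.obj ≅ (twistG n τ hH φ).obj ((twistT n τ φ).obj M.obj) := (e M.obj M.property).toModuleIso
  refine ⟨(NatIso.ofComponents (F := 𝟭 _)
    (G := restrictFunctor (twistT n τ φ) hT ⋙ restrictFunctor (twistG n τ hH φ) hG) (fun M => ObjectProperty.isoMk _ (i M)) ?_).symm⟩
  intro M M' f
  refine ObjectProperty.hom_ext _ (ModuleCat.hom_ext (LinearMap.ext fun m => ?_))
  refine Subtype.ext ?_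
  refine (he M'.obj M'.property (f.hom.hom m)).trans ?_
  refine Eq.trans ?_ (congrArg (homMap (Env n g) (twistBimodule n τ)
    ((twistFunctor n φ.symm.toLieHom).map ((twistT n τ φ).map f.hom)).hom)
      (he M.obj M.property m)).symm
  rfl

/-- The counit is an isomorphism on the modules in the Jordan block. -/
theorem exists_counitIso {N : ModuleCat.{u} (Env n g)}
    (hN : jordanBlock H Δ (fun i => dualReflection τ (μ i)) N) :
    ∃ e : (tensorFunctor (Env n g) (twistBimodule n τ)).obj ((twistG n τ hH φ).obj N)
        ≅ (twistFunctor n φ.symm.toLieHom).obj N,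
      ∀ (s : twistBimodule n τ) (f : weightSubmodule H n hH (homTwist τ φ N)),
        e.hom.hom (tens s f) = HomOver.toLin (f : homTwist τ φ N) s := by
  obtain ⟨ε, hε⟩ := exists_counit (weightSubmodule H n hH (homTwist τ φ N))
  have hb := counit_bijective_hom hH hred hΔ hn hα τ hφ hμ hN hε
  exact ⟨(LinearEquiv.ofBijective ε hb).toModuleIso, hε⟩

omit hH hred hΔ hα hφ hμ in
/-- Twisting by `φ⁻¹` and by `φ` gives the identity functor. -/
noncomputable def twistFunctorIso (n : ℕ) (φ : g ≃ₗ⁅ℂ⁆ g) :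
    twistFunctor n φ.symm.toLieHom ⋙ twistFunctor n φ.toLieHom ≅ 𝟭 _ :=
  NatIso.ofComponents (fun N =>
    (doubleTwist φ.symm.toLieHom φ.toLieHom (envMap_symm_comp φ) N).toModuleIso) fun _ => rfl

theorem nonempty_counit_iso
    (hT : ∀ M, jordanBlock H Δ μ M →
      jordanBlock H Δ (fun i => dualReflection τ (μ i)) ((twistT n τ φ).obj M))
    (hG : ∀ N, jordanBlock H Δ (fun i => dualReflection τ (μ i)) N →
      jordanBlock H Δ μ ((twistG n τ hH φ).obj N)) :
    Nonempty (restrictFunctor (twistG n τ hH φ) hG ⋙ restrictFunctor (twistT n τ φ) hT ≅ 𝟭 _) := by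
  choose e he using fun (N : ModuleCat.{u} (Env n g))
    (hN : jordanBlock H Δ (fun i => dualReflection τ (μ i)) N) =>
    exists_counitIso hH hred hΔ hn hα τ hφ hμ hN
  have hnat : ∀ (N N' : ModuleCat.{u} (Env n g)) hN hN' (f : N ⟶ N'),
      (tensorFunctor (Env n g) (twistBimodule n τ)).map ((twistG n τ hH φ).map f) ≫ (e N' hN').hom
        = (e N hN).hom ≫ (twistFunctor n φ.symm.toLieHom).map f := by
    intro N N' hN hN' f
    refine ModuleCat.hom_ext (LinearMap.ext fun z => ?_)
    obtain ⟨l, hl⟩ := exists_eq_tens (isGood_loweringFamily n τ) z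
    obtain ⟨w, rfl⟩ := hl l le_rfl
    refine (he N' hN' _ _).trans ?_
    exact (congrArg f.hom (he N hN _ w)).symm
  let i (N : (jordanBlock H Δ fun i => dualReflection τ (μ i)).FullSubcategory) :
      (twistT n τ φ).obj ((twistG n τ hH φ).obj N.obj) ≅ N.obj :=
    (twistFunctor n φ.toLieHom).mapIso (e N.obj N.property) ≪≫ (twistFunctorIso n φ).app N.obj
  refine ⟨NatIso.ofComponents (G := 𝟭 _)
    (F := restrictFunctor (twistG n τ hH φ) hG ⋙ restrictFunctor (twistT n τ φ) hT)
    (fun N => ObjectProperty.isoMk _ (i N)) ?_⟩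
  intro N N' f
  refine ObjectProperty.hom_ext _ ?_
  show (twistFunctor n φ.toLieHom).map ((tensorFunctor (Env n g) (twistBimodule n τ)).map
      ((twistG n τ hH φ).map f.hom)) ≫ (twistFunctor n φ.toLieHom).map (e N'.obj N'.property).hom ≫
        (twistFunctorIso n φ).hom.app N'.obj
    = ((twistFunctor n φ.toLieHom).map (e N.obj N.property).hom ≫
        (twistFunctorIso n φ).hom.app N.obj) ≫ f.hom
  rw [← Functor.map_comp_assoc, hnat _ _ N.property N'.property, Functor.map_comp_assoc,
    Category.assoc]
  congr 1

end Equivalence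

/-! ### Equivalences of Jordan blocks -/

section Reduction

variable {g : Type u} [LieRing g] [LieAlgebra ℂ g] [FiniteDimensional ℂ g]
  (hred : LieAlgebra.radical ℂ g = LieAlgebra.center ℂ g) {H : LieSubalgebra ℂ g}
  (hH : IsMaximalTorus H) {Δ : Set (Module.Dual ℂ H)} (hΔ : IsSimpleSystem H Δ) {n : ℕ} (hn : 1 ≤ n)
include hred hH hΔ

theorem twisting_equivalence {α : Module.Dual ℂ H} (hα : α ∈ Δ) (τ : RootTriple H α)
    {φ : g ≃ₗ⁅ℂ⁆ g} (hφ : IsReflectionLift τ φ) {μ : Fin n → Module.Dual ℂ H}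
    (hμ : topComponent H hn μ τ.h ≠ 0) :
    ∃ (hT : ∀ M, jordanBlock H Δ μ M →
        jordanBlock H Δ (fun i => dualReflection τ (μ i)) ((twistT n τ φ).obj M))
      (hG : ∀ N, jordanBlock H Δ (fun i => dualReflection τ (μ i)) N →
        jordanBlock H Δ μ ((twistG n τ hH φ).obj N)),
      Nonempty (restrictFunctor (twistT n τ φ) hT ⋙ restrictFunctor (twistG n τ hH φ) hG ≅ 𝟭 _) ∧
      Nonempty (restrictFunctor (twistG n τ hH φ) hG ⋙ restrictFunctor (twistT n τ φ) hT ≅ 𝟭 _) :=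
  ⟨fun _ hM => jordanBlock_twistT hH hred hΔ hn hα τ hφ hμ hM,
    fun _ hN => jordanBlock_twistG hH hred hΔ hn hα τ hφ hμ hN,
    nonempty_unit_iso hH hred hΔ hn hα τ hφ hμ _ _,
    nonempty_counit_iso hH hred hΔ hn hα τ hφ hμ _ _⟩

/-- Every Jordan block is equivalent to one whose top component is dominant. -/
theorem exists_dominant_equivalence (N : ℕ) : ∀ μ : Fin n → Module.Dual ℂ H,
    negCount Δ (topComponent H hn μ) = N → ∃ w ∈ weylGroup H,
      (∀ α ∈ Δ, ¬LexPos (-(topComponent H hn fun i => w (μ i)) (coroot α))) ∧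
      Nonempty ((jordanBlock H Δ μ).FullSubcategory ≌
        (jordanBlock H Δ fun i => w (μ i)).FullSubcategory) := by
  induction N using Nat.strong_induction_on with
  | _ N ih =>
    intro μ hN
    by_cases hdom : ∀ α ∈ Δ, ¬LexPos (-(topComponent H hn μ) (coroot α))
    · exact ⟨1, one_mem _, hdom, ⟨CategoryTheory.Equivalence.refl⟩⟩
    · push Not at hdom
      obtain ⟨α, hα, hpos⟩ := hdom
      obtain ⟨τ⟩ := exists_rootTriple hH hred (hΔ.subset_roots hα)
      obtain ⟨φ, hφ⟩ := exists_isReflectionLift τ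
      -- Lexicographic negativity at a simple coroot contains the nonvanishing that the twisting
      -- equivalence requires.
      have hμ : topComponent H hn μ τ.h ≠ 0 := by
        rw [← τ.coroot_eq hH hred]
        exact neg_ne_zero.1 hpos.ne_zero
      obtain ⟨hT, hG, ⟨i⟩, ⟨j⟩⟩ := twisting_equivalence hred hH hΔ hn hα τ hφ hμ
      have hlt : negCount Δ (topComponent H hn fun i => dualReflection τ (μ i)) < N := by
        rw [← hN]
        exact negCount_dualReflection_lt hH hred hΔ hα τ hpos
      obtain ⟨w, hw, hwdom, ⟨e⟩⟩ := ih _ hlt _ rfl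
      exact ⟨w * dualReflection τ, mul_mem hw (Subgroup.subset_closure
        ⟨α, hΔ.subset_roots hα, τ, rfl⟩), hwdom,
        ⟨(CategoryTheory.Equivalence.mk (restrictFunctor (twistT n τ φ) hT)
          (restrictFunctor (twistG n τ hH φ) hG) i.symm j).trans e⟩⟩

end Reduction

end TwistingFunctors

theorem mainTheorem3 {g : Type u} [LieRing g] [LieAlgebra ℂ g] [FiniteDimensional ℂ g]
    (hred : LieAlgebra.radical ℂ g = LieAlgebra.center ℂ g)
    (H : LieSubalgebra ℂ g) (hH : IsMaximalTorus H)
    (Δ : Set (Module.Dual ℂ H)) (hΔ : IsSimpleSystem H Δ) (n : ℕ) (hn : 1 ≤ n) :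
    (∀ α ∈ Δ, ∀ (τ : RootTriple H α) (φ : g ≃ₗ⁅ℂ⁆ g), IsReflectionLift τ φ →
      ∀ μ : Fin n → Module.Dual ℂ H, topComponent H hn μ τ.h ≠ 0 →
        ∃ (hT : ∀ M, jordanBlock H Δ μ M →
              jordanBlock H Δ (fun i => dualReflection τ (μ i)) ((twistT n τ φ).obj M))
          (hG : ∀ N, jordanBlock H Δ (fun i => dualReflection τ (μ i)) N →
              jordanBlock H Δ μ ((twistG n τ hH φ).obj N)),
          Nonempty (restrictFunctor (twistT n τ φ) hT ⋙ restrictFunctor (twistG n τ hH φ) hG ≅ 𝟭 _) ∧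
          Nonempty (restrictFunctor (twistG n τ hH φ) hG ⋙ restrictFunctor (twistT n τ φ) hT ≅ 𝟭 _)) ∧
    (∀ μ : Fin n → Module.Dual ℂ H, ∃ w ∈ weylGroup H,
      IsStandardLevi H Δ (coadjointCentralizer hH (topComponent H hn fun i => w (μ i))) ∧
      Nonempty ((jordanBlock H Δ μ).FullSubcategory ≌
        (jordanBlock H Δ fun i => w (μ i)).FullSubcategory)) := by
  refine ⟨fun α hα τ φ hφ μ hμ => twisting_equivalence hred hH hΔ hn hα τ hφ hμ, fun μ => ?_⟩
  obtain ⟨w, hw, hdom, he⟩ := exists_dominant_equivalence hred hH hΔ hn _ μ rfl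
  exact ⟨w, hw, isStandardLevi_coadjointCentralizer hH hred hΔ hdom, he⟩
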